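/- Let $X$ be a smooth closed oriented $n$-manifold and let $a,c\in\operatorname{Diff}^+(X)$ have a shared fixed point $x\in X$. Suppose that $(b_t)_{t\in[0,1]}$ is a smooth isotopy from $b_0=[a,c]=aca^{-1}c^{-1}$ to $b_1=\mathrm{id}_X$ through diffeomorphisms of $X$ with $b_t(x)=x$ and $d(b_t)_x=\mathrm{id}_{T_xX}$ for all $t$. Suppose also that the maximal subspace of $T_xX$ on which all generalized eigenvalues of $da_x$ and of $dc_x$ are negative real numbers has odd dimension. (1) Let $\phi:O\to\mathbb R^n$ be any smooth coordinates, onto $\mathbb R^n$, on an open subset $O$ of the connected component of $x$; let $B_1\subset\mathbb R^n$ be the open unit ball and $X^\circ:=X\setminus\phi^{-1}(B_1)$. Let $\operatorname{Diff}^+(X^\circ,\partial)$ be the group of orientation-preserving diffeomorphisms of $X^\circ$ that are the identity in a neighbourhood of $\partial X^\circ$. Then there exist $a^\circ,c^\circ\in\operatorname{Diff}^+(X^\circ,\partial)$ whose commutator $[a^\circ,c^\circ]$ represents the smooth mapping class rel boundary of the boundary Dehn twist on $X^\circ$, i.e. is smoothly isotopic through elements of $\operatorname{Diff}^+(X^\circ,\partial)$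 to a diffeomorphism that is $(t,\omega)\mapsto(t,\alpha(t)\omega)$ on the collar $\phi^{-1}(\{1\le|v|\le2\})\cong[0,1]\times S^{n-1}$ and the identity elsewhere, where $\alpha$ is a smooth loop in $SO(n)$ at the identity, constant near its endpoints, whose class generates $\pi_1(SO(n))$. (2) The mapping torus $X_{a,c}\to T^2$ of $a$ and $c$ (the $X$-bundle obtained from the mapping tori of $a$ and of $c$ over the two circles of the $1$-skeleton $S^1\vee S^1$ of $T^2$ by extending over the $2$-cell by means of the isotopy $b_t$) is a smooth orientable $X$-bundle over $T^2$, with closed total space, and this total space is not spin. -/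

import Mathlib

open Set Topology Bundle
open scoped Manifold ContDiff

universe u

noncomputable section

/-! ### Orientations -/

/-- An orientation of a smooth manifold `M` modelled on `V`: an atlas of smooth charts whose
transition maps have positive Jacobian determinant. -/
structure OrientedAtlas (V : Type) [NormedAddCommGroup V] [NormedSpace ℝ V]
    (M : Type u) [TopologicalSpace M] [ChartedSpace V M] where
  charts : Set (OpenPartialHomeomorph M V)
  charts_subset : charts ⊆ IsManifold.maximalAtlas 𝓘(ℝ, V) ∞ M
  covers : ∀ y : M, ∃ φ ∈ charts, y ∈ φ.source
  compatible : ∀ φ ∈ charts, ∀ ψ ∈ charts, ∀ y ∈ φ.source ∩ ψ.source,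
    0 < (fderiv ℝ (ψ ∘ φ.symm) (φ y)).det

section General

variable {V : Type} [NormedAddCommGroup V] [NormedSpace ℝ V]
  {M : Type u} [TopologicalSpace M] [ChartedSpace V M]

/-- A (smooth) self-map of an oriented manifold preserves the orientation if it has positive
Jacobian determinant in oriented charts. -/
def IsOrientationPreserving (o : OrientedAtlas V M) (f : M → M) : Prop :=
  ∀ φ ∈ o.charts, ∀ ψ ∈ o.charts, ∀ y ∈ φ.source, f y ∈ ψ.source →
    0 < (fderiv ℝ (ψ ∘ f ∘ φ.symm) (φ y)).det

/-! ### Spin structures -/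

/-- The bundle of positively oriented frames of the tangent bundle, as a subspace of the
`m`-fold power of the tangent bundle (`m = dim M ≥ 1`): a point is a tuple of tangent vectors
`v₁, …, vₘ` at one point `y` which oriented charts send to a positive basis of `V`.  (Whether the
reference basis of `V` used here is replaced by one of the opposite orientation is immaterial:
this replaces the frame bundle by a homeomorphic one over `M`.) -/
def OrientedFrameBundle [FiniteDimensional ℝ V] [IsManifold 𝓘(ℝ, V) ∞ M]
    (o : OrientedAtlas V M) : Set (Fin (Module.finrank ℝ V) → TangentBundle 𝓘(ℝ, V) M) :=
  {w | ∃ (y : M) (v : Fin (Module.finrank ℝ V) → TangentSpace 𝓘(ℝ, V) y),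
    (∀ i, w i = ⟨y, v i⟩) ∧
    ∀ φ ∈ o.charts, y ∈ φ.source →
      0 < (Module.finBasis ℝ V).det (fun i => (mfderiv 𝓘(ℝ, V) 𝓘(ℝ, V) φ y (v i) : V))}

/-- The oriented manifold `M`, of dimension at least `2`, admits a spin structure: its oriented
frame bundle has a two-sheeted covering whose restriction to each fibre of the frame bundle is a
nontrivial covering, i.e. has no continuous section. -/
def HasSpinStructure [FiniteDimensional ℝ V] [IsManifold 𝓘(ℝ, V) ∞ M]
    (o : OrientedAtlas V M) : Prop :=
  ∃ (P : Type u) (_ : TopologicalSpace P) (p : P → OrientedFrameBundle o),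
    IsCoveringMap p ∧ (∀ w, (p ⁻¹' {w}).ncard = 2) ∧
    ∀ y : M, ¬ ∃ σ : {w : OrientedFrameBundle o // ∀ i, (w.1 i).proj = y} → P,
      Continuous σ ∧ ∀ w, p (σ w) = w.1

variable (V M) in
/-- The manifold `M` is spin: it is orientable and, for some orientation, admits a spin
structure. -/
def IsSpin [FiniteDimensional ℝ V] [IsManifold 𝓘(ℝ, V) ∞ M] : Prop :=
  ∃ o : OrientedAtlas V M, HasSpinStructure o

/-! ### Smooth oriented fibre bundles -/

/-- `q : E → B` is a smooth orientable bundle with fibre the oriented manifold `M`: it is smooth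
and has a family of smooth local trivialisations over a cover of `B` whose coordinate changes
preserve the orientation of the fibre. -/
def IsOrientableSmoothBundle (o : OrientedAtlas V M)
    {VB HB : Type} [NormedAddCommGroup VB] [NormedSpace ℝ VB] [TopologicalSpace HB]
    (IB : ModelWithCorners ℝ VB HB) {B : Type} [TopologicalSpace B] [ChartedSpace HB B]
    {VE HE : Type} [NormedAddCommGroup VE] [NormedSpace ℝ VE] [TopologicalSpace HE]
    (IE : ModelWithCorners ℝ VE HE) {E : Type u} [TopologicalSpace E] [ChartedSpace HE E]
    (q : E → B) : Prop :=
  ContMDiff IE IB ∞ q ∧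
  ∃ 𝒯 : Set (Trivialization M q),
    (∀ e ∈ 𝒯, ContMDiffOn IE (IB.prod 𝓘(ℝ, V)) ∞ e e.source ∧
      ContMDiffOn (IB.prod 𝓘(ℝ, V)) IE ∞ e.toOpenPartialHomeomorph.symm e.target) ∧
    (∀ z : B, ∃ e ∈ 𝒯, z ∈ e.baseSet) ∧
    ∀ e ∈ 𝒯, ∀ e' ∈ 𝒯, ∀ z ∈ e.baseSet ∩ e'.baseSet,
      IsOrientationPreserving o (fun y => (e' (e.toOpenPartialHomeomorph.symm (z, y))).2)

/-! ### Generalized eigenspaces -/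

/-- For commuting endomorphisms `A`, `C` of a finite-dimensional real vector space, the maximal
subspace on which all generalized eigenvalues of `A` and of `C` are negative real numbers: the
intersection of the sum of the generalized eigenspaces of `A` for negative real eigenvalues with
the corresponding sum for `C`. -/
def jointNegativeSubspace {W : Type*} [AddCommGroup W] [Module ℝ W] (A C : Module.End ℝ W) :
    Submodule ℝ W :=
  (⨆ r : Iio (0 : ℝ), A.maxGenEigenspace (r : ℝ)) ⊓
    (⨆ r : Iio (0 : ℝ), C.maxGenEigenspace (r : ℝ))

end General

section Manifold

variable {n : ℕ} {X : Type u} [TopologicalSpace X] [ChartedSpace (EuclideanSpace ℝ (Fin n)) X]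

variable (n) in
/-- Smoothness on `[0,1] × S` of a family `h t`, `t ∈ [0,1]`, of self-maps of `X`. -/
def IsSmoothFamilyOn (S : Set X) (h : ℝ → X → X) : Prop :=
  ContMDiffOn (𝓘(ℝ, ℝ).prod (𝓡 n)) (𝓡 n) ∞ (fun p : ℝ × X => h p.1 p.2) (Icc 0 1 ×ˢ S)

variable (n) in
/-- The differential of `f` at a fixed point `x` of `f`, as an endomorphism of the tangent space
at `x` (for `f x ≠ x` this has no meaning). -/
def differentialAtFixedPoint (f : X → X) (x : X) :
    TangentSpace (𝓡 n) x →L[ℝ] TangentSpace (𝓡 n) x :=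
  mfderiv (𝓡 n) (𝓡 n) f x

/-- `b` is a smooth isotopy from the commutator `[a, c] = a c a⁻¹ c⁻¹` to the identity through
diffeomorphisms of `X` which fix `x` and whose differentials at `x` are the identity. Only the
times `t ∈ [0,1]` matter. -/
structure IsCommutatorIsotopy (a c : X ≃ₘ⟮𝓡 n, 𝓡 n⟯ X) (x : X)
    (b : ℝ → X ≃ₘ⟮𝓡 n, 𝓡 n⟯ X) : Prop where
  smooth : IsSmoothFamilyOn n univ (fun t => b t)
  zero : ∀ y, b 0 y = a (c (a.symm (c.symm y)))
  one : ∀ y, b 1 y = y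
  fixes : ∀ t ∈ Icc (0 : ℝ) 1, b t x = x
  differential : ∀ t ∈ Icc (0 : ℝ) 1,
    differentialAtFixedPoint n (b t) x = ContinuousLinearMap.id ℝ _

/-! ### The punctured manifold and its diffeomorphisms rel boundary -/

/-- For coordinates `φ : O → ℝⁿ` on `X` (with image all of `ℝⁿ`), the complement `X°` of the open
unit ball of these coordinates. -/
def punctured (φ : OpenPartialHomeomorph X (EuclideanSpace ℝ (Fin n))) : Set X :=
  (φ.symm '' Metric.ball 0 1)ᶜ

/-- The boundary sphere of `X°`. -/
def puncturedBoundary (φ : OpenPartialHomeomorph X (EuclideanSpace ℝ (Fin n))) : Set X :=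
  φ.symm '' Metric.sphere 0 1

open Classical in
/-- A self-map of a subset `S` of `X`, extended by the identity to a self-map of `X`. -/
def extendById {S : Set X} (f : S → S) : X → X :=
  fun y => if h : y ∈ S then f ⟨y, h⟩ else y

/-- The permutation `f` of `X°` belongs to `Diff⁺(X°, ∂)`: it is smooth with smooth inverse,
preserves the orientation, and is the identity near the boundary. (As `f` is the identity near
the boundary, its extension by the identity is smooth, and it preserves the orientation if and
only if `f` does.) -/
structure IsDiffRelBoundary (o : OrientedAtlas (EuclideanSpace ℝ (Fin n)) X)
    (φ : OpenPartialHomeomorph X (EuclideanSpace ℝ (Fin n)))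
    (f : Equiv.Perm (punctured φ)) : Prop where
  smooth : ContMDiffOn (𝓡 n) (𝓡 n) ∞ (extendById f) (punctured φ)
  smooth_symm : ContMDiffOn (𝓡 n) (𝓡 n) ∞ (extendById f.symm) (punctured φ)
  orientation : IsOrientationPreserving o (extendById f)
  near_boundary : ∀ᶠ y in 𝓝ˢ (puncturedBoundary φ), extendById f y = y

/-- `f` and `g` have the same smooth mapping class rel boundary: they are smoothly isotopic
through elements of `Diff⁺(X°, ∂)`. -/
def IsotopicRelBoundary (o : OrientedAtlas (EuclideanSpace ℝ (Fin n)) X)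
    (φ : OpenPartialHomeomorph X (EuclideanSpace ℝ (Fin n)))
    (f g : Equiv.Perm (punctured φ)) : Prop :=
  ∃ h : ℝ → Equiv.Perm (punctured φ),
    IsSmoothFamilyOn n (punctured φ) (fun t => extendById (h t)) ∧
    (∀ t ∈ Icc (0 : ℝ) 1, IsDiffRelBoundary o φ (h t)) ∧ h 0 = f ∧ h 1 = g

/-- The diffeomorphism `τ` of `X°` is a Dehn twist along the boundary: in the collar
`{1 ≤ |v| ≤ 2} ≅ [0,1] × Sⁿ⁻¹` it is `(t, ω) ↦ (t, α(t) ω)`, where `α` is a smooth loop in `SO(n)`,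
constant near its endpoints, whose class generates `π₁(SO(n))`, and it is the identity elsewhere.
(`α.extend` extends the loop to `ℝ` by the constant `1`, so the first formula covers also the
points of the coordinate neighbourhood outside the collar.) -/
def IsBoundaryDehnTwist (φ : OpenPartialHomeomorph X (EuclideanSpace ℝ (Fin n)))
    (τ : Equiv.Perm (punctured φ)) : Prop :=
  ∃ α : Path (1 : Matrix.specialOrthogonalGroup (Fin n) ℝ) 1,
    (∀ i j, ContDiff ℝ ∞ (fun t => (α.extend t).1 i j)) ∧
    (∃ ε > 0, ∀ t, t < ε ∨ 1 - ε < t → α.extend t = 1) ∧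
    Subgroup.zpowers (FundamentalGroup.fromPath (Path.Homotopic.Quotient.mk α)) = ⊤ ∧
    (∀ v, 1 ≤ ‖v‖ → extendById τ (φ.symm v) =
      φ.symm (Matrix.toEuclideanLin (α.extend (‖v‖ - 1)).1 v)) ∧
    (∀ y, y ∉ φ.source → extendById τ y = y)

/-! ### The mapping torus of a pair -/

/-- The gluing of `ℝ × ℝ × X` that defines the mapping torus of `a` and `c` over
`T² = ℝ² / ℤ²`, for an isotopy `b` from `[a, c]` to the identity. Going once around the second
circle glues by `c`; going once around the first circle glues by the path `f t`, `t ∈ [0,1]`, of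
diffeomorphisms from `f 0 = a` to `f 1 = c a c⁻¹` given by `f t = b t ∘ c a c⁻¹`, with time
reparametrised so that it is constant near the ends. Thus over the circles `t = 0` and `s = 0` one
has the mapping tori of `a` and of `c`, and `b` is used to extend over the `2`-cell. -/
inductive MappingTorusRel (a c : X ≃ₘ⟮𝓡 n, 𝓡 n⟯ X) (b : ℝ → X ≃ₘ⟮𝓡 n, 𝓡 n⟯ X) :
    ℝ × ℝ × X → ℝ × ℝ × X → Prop
  | fst (s t : ℝ) (y : X) (ht : t ∈ Icc (0 : ℝ) 1) : MappingTorusRel a c b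
      (s, t, y) (s + 1, t, b (Real.smoothTransition (3 * t - 1)) (c (a (c.symm y))))
  | snd (s t : ℝ) (y : X) : MappingTorusRel a c b (s, t, y) (s, t + 1, c y)

/-- The total space `X_{a,c}` of the mapping torus, with the quotient topology. -/
def MappingTorus (a c : X ≃ₘ⟮𝓡 n, 𝓡 n⟯ X) (b : ℝ → X ≃ₘ⟮𝓡 n, 𝓡 n⟯ X) : Type u :=
  Quot (MappingTorusRel a c b)

instance (a c : X ≃ₘ⟮𝓡 n, 𝓡 n⟯ X) (b : ℝ → X ≃ₘ⟮𝓡 n, 𝓡 n⟯ X) :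
    TopologicalSpace (MappingTorus a c b) :=
  inferInstanceAs (TopologicalSpace (Quot (MappingTorusRel a c b)))

/-- The quotient map onto the mapping torus. -/
def MappingTorus.mk (a c : X ≃ₘ⟮𝓡 n, 𝓡 n⟯ X) (b : ℝ → X ≃ₘ⟮𝓡 n, 𝓡 n⟯ X) :
    ℝ × ℝ × X → MappingTorus a c b :=
  Quot.mk _

/-- The projection `X_{a,c} → T²`, `[s, t, y] ↦ (e^{2πis}, e^{2πit})`. -/
def MappingTorus.proj (a c : X ≃ₘ⟮𝓡 n, 𝓡 n⟯ X) (b : ℝ → X ≃ₘ⟮𝓡 n, 𝓡 n⟯ X) :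
    MappingTorus a c b → Circle × Circle :=
  Quot.lift (fun p => (Circle.exp (2 * Real.pi * p.1), Circle.exp (2 * Real.pi * p.2.1))) (by
    rintro _ _ (⟨s, t, y, _⟩ | ⟨s, t, y⟩) <;> simp [mul_add, Circle.exp_add])

end Manifold

end

/-! Let A and C be the differentials of a and c at x. They commute, because [a,c] is joined to the
identity through maps with trivial differential at x. Projecting to the negative generalized
eigenspaces deforms A and C to commuting involutions a₀ = 1 - 2e and c₀ = 1 - 2d. Positivity of the
determinants makes the ranks of e and d even, so if the rank of ed is odd, the rank of (1-e)d is odd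
as well. Choose v in the range of ed and w in the range of (1-e)d. The range of d is the plane of v,
w plus an even-dimensional space with a complex structure K that commutes with a₀, while the
generator J of the plane anticommutes with a₀. The path rot (J+K) t, 0 ≤ t ≤ π, joins 1 to c₀, and
its commutator with a₀ is a₀ rot(-t) a₀ rot(t) = rot J (2t): one full turn in a plane
(`exists_normal_form`, `conj_rot_mul_rot`). Such a turn generates the fundamental group of the
automorphisms of positive determinant (`IsPlaneGenerator.generatesLoops`).

For (1), every path of linear maps used is realised as the path of differentials of an isotopy
supported in the coordinates (`exists_realization`). Multiplying a and c by such isotopies gives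
maps with trivial differential. Modulo isotopies with trivial differential at the centre, their
commutator is computed in a quotient group and becomes the end of an isotopy whose differentials
make the full turn above (`exists_straightened_pair`). The Dehn twist is the end of an isotopy with
the same differentials (`realizes_implant_twist`), so the two differ by an isotopy with trivial
differentials. This can be made trivial near the point (`exists_flat_pair`), and conjugation by a
strong contraction enlarges the small ball to one containing the closed unit ball
(`exists_isotopy_twist`).

For (2), the mapping torus is the quotient of ℝ × ℝ × X by a smooth action of ℤ². Over the torus
traced by x, the frame bundle is glued by the commuting holonomies A and C. A spin structure
restricts to a double cover whose monodromy takes values in a group of order two, hence is abelian,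
so a commutator loop of frames acts trivially. That loop is homotopic to a full turn in the fibre,
up to orientation (`IsCoveringMap.exists_lift_of_commute`). So the double cover has trivial
monodromy along the fibre and admits a section there, which a spin structure forbids. -/

noncomputable section

/-! ### One-parameter rotations generated by J with J³ = -J. -/

section Rotations

/-- The rotation by the angle `t` with infinitesimal generator `J`, where `J ^ 3 = -J`. -/
def rot {R : Type*} [Ring R] [Algebra ℝ R] (J : R) (t : ℝ) : R :=
  1 + Real.sin t • J + (1 - Real.cos t) • (J * J)

variable {R : Type*} [Ring R] [Algebra ℝ R]

@[simp] theorem rot_zero (J : R) : rot J 0 = 1 := by simp [rot]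

theorem rot_pi (J : R) : rot J Real.pi = 1 + (2 : ℝ) • (J * J) := by
  simp [rot]; norm_num

theorem rot_two_pi_mul_int (J : R) (k : ℤ) : rot J (2 * Real.pi * k) = 1 := by
  have h1 : Real.sin (2 * Real.pi * k) = 0 := by
    rw [show 2 * Real.pi * (k : ℝ) = ((2 * k : ℤ) : ℝ) * Real.pi by push_cast; ring]
    exact Real.sin_int_mul_pi _
  have h2 : Real.cos (2 * Real.pi * k) = 1 := by
    rw [mul_comm]; exact Real.cos_int_mul_two_pi k
  simp [rot, h1, h2]

theorem rot_neg (J : R) (t : ℝ) : rot (-J) t = rot J (-t) := by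
  simp [rot]

theorem rot_add {J : R} (hJ : J * J * J = -J) (s t : ℝ) : rot J (s + t) = rot J s * rot J t := by
  have h4 : J * J * (J * J) = -(J * J) := by rw [← mul_assoc, hJ, neg_mul]
  have h3 : J * (J * J) = -J := by rw [← mul_assoc, hJ]
  simp only [rot, mul_add, add_mul, mul_one, one_mul, smul_mul_assoc, mul_smul_comm, h4,
    h3, hJ, Real.sin_add, Real.cos_add]
  module

theorem rot_mul_rot_neg {J : R} (hJ : J * J * J = -J) (t : ℝ) : rot J t * rot J (-t) = 1 := by
  rw [← rot_add hJ]; simp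

/-- Generators that annihilate each other act on complementary subspaces, so all mixed terms of the
product vanish. -/
theorem rot_add_generator {J K : R} (hJK : J * K = 0) (hKJ : K * J = 0) (t : ℝ) :
    rot (J + K) t = rot J t * rot K t := by
  have h1 : J * (K * K) = 0 := by rw [← mul_assoc, hJK, zero_mul]
  have h2 : J * J * K = 0 := by rw [mul_assoc, hJK, mul_zero]
  have h3 : J * J * (K * K) = 0 := by rw [mul_assoc, h1, mul_zero]
  simp only [rot, mul_add, add_mul, mul_one, one_mul, smul_mul_assoc, mul_smul_comm,
    hJK, hKJ, h1, h2, h3, smul_zero, add_zero]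
  module

theorem conj_rot {J K a b : R} (hab : a * b = 1) (h : a * J = K * a) (t : ℝ) :
    a * rot J t * b = rot K t := by
  have h2 : a * (J * J) = K * K * a := by rw [← mul_assoc, h, mul_assoc, h, mul_assoc]
  have : a * rot J t = rot K t * a := by
    simp only [rot, mul_add, add_mul, mul_one, one_mul, smul_mul_assoc, mul_smul_comm, h, h2]
  rw [this, mul_assoc, hab, mul_one]

theorem Commute.rot {a J : R} (h : Commute a J) (t : ℝ) : Commute a (rot J t) := by
  unfold _root_.rot
  exact ((Commute.one_right a).add_right (h.smul_right _)).add_right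
    ((h.mul_right h).smul_right _)

theorem map_rot {S F : Type*} [Ring S] [Algebra ℝ S] [FunLike F R S] [AlgHomClass F ℝ R S]
    (φ : F) (J : R) (t : ℝ) : φ (rot J t) = rot (φ J) t := by
  simp [rot, map_add, map_smul, map_mul]

end Rotations

/-! ### Normal form of a pair of commuting automorphisms. -/

section LinearAlgebra

open Module Polynomial

variable {V : Type*} [AddCommGroup V] [Module ℝ V]

/-- The negative generalized eigenvectors of `A`. -/
def negativeSubspace (A : End ℝ V) : Submodule ℝ V := ⨆ r : Iio (0 : ℝ), A.maxGenEigenspace (r : ℝ)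

/-- `J` is the infinitesimal rotation of a plane which has the basis `v, w`, vanishing on a
complement of this plane. -/
def IsPlaneGenerator (J : End ℝ V) : Prop :=
  ∃ (v w : V) (f g : Dual ℝ V), f v = 1 ∧ f w = 0 ∧ g v = 0 ∧ g w = 1 ∧
    J = f.smulRight w - g.smulRight v

theorem IsPlaneGenerator.cube {J : End ℝ V} (h : IsPlaneGenerator J) : J * J * J = -J := by
  obtain ⟨v, w, f, g, h1, h2, h3, h4, rfl⟩ := h
  ext x
  simp [h1, h2, h3, h4]
  module

/-- Powers of distinct linear factors are coprime, so the kernel of their product is the sum of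
their kernels, each of which consists of generalized eigenvectors. -/
theorem ker_prod_le_negativeSubspace (A : End ℝ V) (S : Finset ℝ) (hS : ∀ r ∈ S, r < 0)
    (d : ℝ → ℕ) : LinearMap.ker (aeval A (∏ r ∈ S, (X - C r) ^ d r)) ≤ negativeSubspace A := by
  classical
  induction S using Finset.induction_on with
  | empty => intro x hx; simp_all
  | insert r S hr ih =>
    rw [Finset.prod_insert hr]
    have hc : IsCoprime ((X - C r) ^ d r) (∏ r ∈ S, (X - C r) ^ d r) := by
      refine IsCoprime.prod_right fun t ht => IsCoprime.pow ?_
      exact isCoprime_X_sub_C_of_isUnit_sub (sub_ne_zero.2 (by rintro rfl; exact hr ht)).isUnit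
    rw [← sup_ker_aeval_eq_ker_aeval_mul_of_coprime A hc]
    refine sup_le ?_ (ih fun t ht => hS t (Finset.mem_insert_of_mem ht))
    refine le_trans ?_ (le_iSup (fun r : Iio (0 : ℝ) => A.maxGenEigenspace (r : ℝ))
      ⟨r, hS r (Finset.mem_insert_self _ _)⟩)
    intro x hx
    rw [End.mem_maxGenEigenspace]
    refine ⟨d r, ?_⟩
    simpa [Algebra.algebraMap_eq_smul_one] using hx

/-- The minimal polynomial factors as f g, where f collects the negative roots with multiplicity and
g has none. A Bézout relation u f + v g = 1 makes e = (v g)(A) the projection to the negative part;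
as a polynomial in A it commutes with whatever commutes with A. The map (1 - 2e)A has no eigenvalue
in (-∞, 0], so no point of the segment from 1 to it is singular. -/
theorem exists_negative_projection [FiniteDimensional ℝ V] (A : End ℝ V)
    (hA : Function.Injective A) :
    ∃ e : End ℝ V, IsIdempotentElem e ∧ LinearMap.range e = negativeSubspace A ∧
      (∀ T, Commute T A → Commute T e) ∧
      ∀ s ∈ Icc (0 : ℝ) 1, Function.Injective ⇑((1 - s) • (1 : End ℝ V) + s • ((1 - (2 : ℝ) • e) * A)) := by
  classical
  set q := minpoly ℝ A with hq
  have hq0 : q ≠ 0 := minpoly.ne_zero (Algebra.IsIntegral.isIntegral A)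
  have hqA : aeval A q = 0 := minpoly.aeval ℝ A
  set S := q.roots.toFinset.filter (· < 0) with hS
  set f : ℝ[X] := ∏ r ∈ S, (X - C r) ^ q.rootMultiplicity r with hf
  have hfq : f ∣ q := by
    refine Finset.prod_dvd_of_coprime ?_ fun r _ => pow_rootMultiplicity_dvd q r
    intro r _ t _ hrt
    exact IsCoprime.pow (isCoprime_X_sub_C_of_isUnit_sub (sub_ne_zero.2 hrt).isUnit)
  obtain ⟨g, hg⟩ := hfq
  -- A negative root of g would exceed the multiplicity of that root of q already exhausted by f.
  have hgr : ∀ r < 0, g.eval r ≠ 0 := by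
    intro r hr h0
    by_cases hrS : r ∈ S
    · obtain ⟨g', hg'⟩ := dvd_iff_isRoot.2 h0
      obtain ⟨f', hf'⟩ := Finset.dvd_prod_of_mem (fun r => (X - C r) ^ q.rootMultiplicity r) hrS
      have : (X - C r) ^ (q.rootMultiplicity r + 1) ∣ q :=
        ⟨f' * g', by
            have h1 := hg
            rw [hf, hf', hg'] at h1
            rw [pow_succ]; linear_combination h1⟩
      have := (le_rootMultiplicity_iff hq0).2 this
      omega
    · apply hrS
      simp only [hS, Finset.mem_filter, Multiset.mem_toFinset, mem_roots hq0, hr, and_true]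
      rw [IsRoot.def, hg, eval_mul, h0, mul_zero]
  have hcop : ∀ r < 0, ∀ k : ℕ, IsCoprime ((X - C r) ^ k) g := by
    intro r hr k
    refine IsCoprime.pow_left ?_
    refine (irreducible_X_sub_C r).coprime_iff_not_dvd.2 fun h => hgr r hr ?_
    exact dvd_iff_isRoot.1 h
  have hfg : IsCoprime f g := IsCoprime.prod_left fun r hr =>
    hcop r (Finset.mem_filter.1 hr).2 _
  obtain ⟨u, v, huv⟩ := hfg
  have hsum : aeval A (v * g) + aeval A (u * f) = 1 := by
    rw [← map_add, add_comm, huv, map_one]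
  have hprod : ∀ p : ℝ[X], aeval A (p * q) = 0 := fun p => by rw [map_mul, hqA, mul_zero]
  have hid : IsIdempotentElem (aeval A (v * g)) := by
    have h0 : aeval A (v * g) * aeval A (u * f) = 0 := by
      rw [← map_mul, show v * g * (u * f) = v * u * q by rw [hg]; ring, hprod]
    have := congrArg (aeval A (v * g) * ·) hsum
    simp only [mul_add, h0, add_zero, mul_one] at this
    exact this
  have hfe : ∀ x, aeval A f (aeval A (v * g) x) = 0 := by
    intro x
    rw [← Module.End.mul_apply, ← map_mul, show f * (v * g) = v * q by rw [hg]; ring, hprod]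
    rfl
  have hrange : LinearMap.range (aeval A (v * g)) = negativeSubspace A := by
    apply le_antisymm
    · rintro _ ⟨x, rfl⟩
      exact ker_prod_le_negativeSubspace A S (fun r hr => (Finset.mem_filter.1 hr).2) _ (hfe x)
    · refine iSup_le fun r x hx => ?_
      obtain ⟨k, hk⟩ := (End.mem_maxGenEigenspace _ _ _).1 hx
      have hk' : aeval A ((X - C (r : ℝ)) ^ k) x = 0 := by
        simpa [Algebra.algebraMap_eq_smul_one] using hk
      obtain ⟨p1, p2, hp⟩ := hcop r r.2 k
      have h1 : aeval A (u * f) x = 0 := by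
        have e1 := congrArg (fun p => aeval A p x) (show u * f = (u * f * p1) * (X - C (r : ℝ)) ^ k
          + (p2 * u) * q by rw [hg]; linear_combination (-(u * f)) * hp)
        simpa only [map_add, map_mul _ _ ((X - C (r : ℝ)) ^ k), hprod, LinearMap.add_apply,
          Module.End.mul_apply, hk', map_zero, LinearMap.zero_apply, add_zero] using e1
      refine ⟨x, ?_⟩
      have := congrArg (fun T : End ℝ V => T x) hsum
      rw [LinearMap.add_apply, h1, add_zero] at this
      exact this
  have hcomA : ∀ T, Commute T A → Commute T (aeval A (v * g)) := fun T hT =>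
    Algebra.commute_of_mem_adjoin_singleton_of_commute (aeval_mem_adjoin_singleton ℝ A) hT
  refine ⟨aeval A (v * g), hid, hrange, ?_, ?_⟩
  · exact hcomA
  · set e := aeval A (v * g) with he
    have hee : ∀ x, e (e x) = e x := fun x => congrArg (fun T : End ℝ V => T x) hid
    have hAe : ∀ x, A (e x) = e (A x) := by
      intro x
      have : Commute A e := hcomA A (Commute.refl A)
      exact congrArg (fun T : End ℝ V => T x) this
    intro s hs
    rw [← LinearMap.ker_eq_bot, LinearMap.ker_eq_bot']
    intro x hx
    have hx' : (1 - s) • x + s • (A x - (2 : ℝ) • e (A x)) = 0 := by simpa using hx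
    rcases eq_or_lt_of_le hs.1 with rfl | hs0
    · simpa using hx'
    -- As 1 - 2e is -1 on the range of e and +1 on its kernel, the two components of a kernel vector
    -- are eigenvectors of A for opposite eigenvalues, each of the sign that its component excludes.
    have h1 : A (e x) = ((1 - s) / s) • e x := by
      have := congrArg e hx'
      simp only [map_add, map_smul, map_sub, hee, map_zero] at this
      rw [hAe, div_eq_inv_mul, mul_smul, eq_inv_smul_iff₀ hs0.ne']
      linear_combination (norm := module) -this
    have h2 : A (x - e x) = (-((1 - s) / s)) • (x - e x) := by
      have := congrArg e hx'
      simp only [map_add, map_smul, map_sub, hee, map_zero] at this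
      rw [map_sub, hAe, div_eq_inv_mul, neg_smul, mul_smul, ← smul_neg, eq_inv_smul_iff₀ hs0.ne']
      linear_combination (norm := module) hx' - this
    have hex : e x = 0 := by
      have h3 : aeval A f (e x) = f.eval ((1 - s) / s) • e x := by
        by_cases h0 : e x = 0
        · simp [h0]
        exact Module.End.aeval_apply_of_hasEigenvector ⟨End.mem_eigenspace_iff.2 h1, h0⟩
      rw [hfe] at h3
      refine (smul_eq_zero.1 h3.symm).resolve_left ?_
      rw [hf, eval_prod, ← ne_eq, Finset.prod_ne_zero_iff]
      intro r hr
      have : r < 0 := (Finset.mem_filter.1 hr).2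
      have : 0 ≤ (1 - s) / s := div_nonneg (by linarith [hs.2]) hs0.le
      simp only [eval_pow, eval_sub, eval_X, eval_C]
      exact pow_ne_zero _ (by linarith)
    rw [hex, sub_zero] at h2
    rcases eq_or_lt_of_le hs.2 with rfl | hs1
    · simp only [sub_self, zero_div, neg_zero, zero_smul] at h2
      exact (map_eq_zero_iff A hA).1 h2
    · have hneg : -((1 - s) / s) < 0 := by
        have : 0 < (1 - s) / s := div_pos (by linarith) hs0
        linarith
      have : x ∈ negativeSubspace A :=
        le_iSup (fun r : Iio (0 : ℝ) => A.maxGenEigenspace (r : ℝ)) ⟨_, hneg⟩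
          (End.eigenspace_le_maxGenEigenspace (End.mem_eigenspace_iff.2 h2))
      rw [← hrange] at this
      obtain ⟨y, hy⟩ := this
      rw [← hy, hee] at hex
      rw [← hy, hex]

/-- A decomposition of the range of an idempotent of odd rank into a line and a complex subspace. -/
theorem exists_decomposition_of_odd [FiniteDimensional ℝ V] {e : End ℝ V} (he : IsIdempotentElem e)
    (hodd : Odd (finrank ℝ (LinearMap.range e))) :
    ∃ (v : V) (f : Dual ℝ V) (I : End ℝ V), f v = 1 ∧ (∀ x, f (e x) = f x) ∧ e v = v ∧
      e * I = I ∧ I * e = I ∧ I v = 0 ∧ (∀ x, f (I x) = 0) ∧ I * I = f.smulRight v - e := by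
  obtain ⟨k, hk⟩ := hodd
  have hW : finrank ℝ (ℝ × (Fin k → ℝ) × (Fin k → ℝ)) = finrank ℝ (LinearMap.range e) := by
    simp [hk, Module.finrank_prod]; omega
  let L : (ℝ × (Fin k → ℝ) × (Fin k → ℝ)) ≃ₗ[ℝ] LinearMap.range e := LinearEquiv.ofFinrankEq _ _ hW
  let i : (ℝ × (Fin k → ℝ) × (Fin k → ℝ)) →ₗ[ℝ] V := (LinearMap.range e).subtype ∘ₗ L.toLinearMap
  let p : V →ₗ[ℝ] (ℝ × (Fin k → ℝ) × (Fin k → ℝ)) := L.symm.toLinearMap ∘ₗ e.rangeRestrict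
  have hee : ∀ x, e (e x) = e x := fun x => congrArg (fun T : End ℝ V => T x) he
  have hip : ∀ x, i (p x) = e x := by intro x; simp [i, p]
  have hei : ∀ w, e (i w) = i w := by
    intro w
    obtain ⟨y, hy⟩ := (L w).2
    simp only [i, LinearMap.comp_apply, Submodule.subtype_apply, LinearEquiv.coe_coe]
    rw [← hy, hee]
  have hinj : Function.Injective i := by
    intro x y h; exact L.injective (Subtype.ext h)
  have hpi : ∀ w, p (i w) = w := by
    intro w; apply hinj; rw [hip, hei]
  have hpe : ∀ x, p (e x) = p x := by
    intro x; apply hinj; rw [hip, hip, hee]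
  let I0 : (ℝ × (Fin k → ℝ) × (Fin k → ℝ)) →ₗ[ℝ] (ℝ × (Fin k → ℝ) × (Fin k → ℝ)) := (0 : ℝ →ₗ[ℝ] ℝ).prodMap
    ((-LinearMap.snd ℝ (Fin k → ℝ) (Fin k → ℝ)).prod (LinearMap.fst ℝ _ _))
  refine ⟨i (1, 0), LinearMap.fst ℝ _ _ ∘ₗ p, i ∘ₗ I0 ∘ₗ p, ?_, ?_, hei _, ?_, ?_, ?_, ?_, ?_⟩
  · simp [hpi]
  · intro x; simp [hpe]
  · ext x; simp [hei]
  · ext x; simp [hpe]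
  · simp only [LinearMap.comp_apply, hpi]
    rw [show I0 (1, 0) = 0 by simp [I0], map_zero]
  · intro x; simp [hpi, I0]
  · ext x
    simp only [Module.End.mul_apply, LinearMap.comp_apply, hpi, LinearMap.sub_apply,
      LinearMap.smulRight_apply]
    rw [← hip x, ← map_smul, ← map_sub]
    congr 1
    ext <;> simp [I0]

/-- An even-dimensional range is identified with ℝᵏ × ℝᵏ and carries the standard complex structure,
extended by zero along the kernel of e. -/
theorem exists_complex_structure_of_even [FiniteDimensional ℝ V] {e : End ℝ V}
    (he : IsIdempotentElem e) (heven : Even (finrank ℝ (LinearMap.range e))) :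
    ∃ I : End ℝ V, e * I = I ∧ I * e = I ∧ I * I = -e := by
  obtain ⟨k, hk⟩ := heven
  have hW : finrank ℝ ((Fin k → ℝ) × (Fin k → ℝ)) = finrank ℝ (LinearMap.range e) := by
    simp [hk, Module.finrank_prod]
  let L : ((Fin k → ℝ) × (Fin k → ℝ)) ≃ₗ[ℝ] LinearMap.range e := LinearEquiv.ofFinrankEq _ _ hW
  let i : ((Fin k → ℝ) × (Fin k → ℝ)) →ₗ[ℝ] V := (LinearMap.range e).subtype ∘ₗ L.toLinearMap
  let p : V →ₗ[ℝ] ((Fin k → ℝ) × (Fin k → ℝ)) := L.symm.toLinearMap ∘ₗ e.rangeRestrict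
  have hee : ∀ x, e (e x) = e x := fun x => congrArg (fun T : End ℝ V => T x) he
  have hip : ∀ x, i (p x) = e x := by intro x; simp [i, p]
  have hei : ∀ w, e (i w) = i w := by
    intro w
    obtain ⟨y, hy⟩ := (L w).2
    simp only [i, LinearMap.comp_apply, Submodule.subtype_apply, LinearEquiv.coe_coe]
    rw [← hy, hee]
  have hinj : Function.Injective i := by
    intro x y h; exact L.injective (Subtype.ext h)
  have hpi : ∀ w, p (i w) = w := by
    intro w; apply hinj; rw [hip, hei]
  have hpe : ∀ x, p (e x) = p x := by
    intro x; apply hinj; rw [hip, hip, hee]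
  let I0 : ((Fin k → ℝ) × (Fin k → ℝ)) →ₗ[ℝ] ((Fin k → ℝ) × (Fin k → ℝ)) :=
    (-LinearMap.snd ℝ (Fin k → ℝ) (Fin k → ℝ)).prod (LinearMap.fst ℝ _ _)
  refine ⟨i ∘ₗ I0 ∘ₗ p, ?_, ?_, ?_⟩
  · ext x; simp [hei]
  · ext x; simp [hpe]
  · ext x
    simp only [Module.End.mul_apply, LinearMap.comp_apply, hpi, LinearMap.neg_apply]
    rw [← hip x, ← map_neg]
    congr 1

/-- If the rank were odd, -1 on the range would be a reflection in one line combined with a half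
turn on the complement, which has negative determinant. -/
theorem even_finrank_range_of_det_pos [FiniteDimensional ℝ V] {e : End ℝ V}
    (he : IsIdempotentElem e) (hdet : 0 < LinearMap.det (1 - (2 : ℝ) • e)) :
    Even (finrank ℝ (LinearMap.range e)) := by
  by_contra hodd
  rw [Nat.not_even_iff_odd] at hodd
  obtain ⟨v, f, I, hfv, hfe, hev, heI, hIe, hIv, hfI, hII⟩ := exists_decomposition_of_odd he hodd
  have hcube : I * I * I = -I := by
    rw [hII, sub_mul, heI]; ext x; simp [hfI]
  -- The transvection is the reflection in v, of determinant -1; the half turn is the square of a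
  -- quarter turn, so its determinant is a square.
  have h1 : (1 - (2 : ℝ) • e) =
      LinearMap.transvection f (-(2 : ℝ) • v) * (rot I (Real.pi / 2) * rot I (Real.pi / 2)) := by
    rw [← rot_add hcube, add_halves, rot_pi, hII]
    ext x
    simp [LinearMap.transvection.apply, hfv, hfe]
    module
  rw [h1, map_mul, map_mul, LinearMap.transvection.det] at hdet
  simp only [map_smul, hfv, smul_eq_mul] at hdet
  nlinarith [mul_self_nonneg (LinearMap.det (rot I (Real.pi / 2)))]

/-- The determinant is continuous and nonvanishing along the segment and equals 1 at its start. -/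
theorem det_pos_of_segment [FiniteDimensional ℝ V] {B : End ℝ V}
    (h : ∀ s ∈ Icc (0 : ℝ) 1, Function.Injective ⇑((1 - s) • (1 : End ℝ V) + s • B))
    {s : ℝ} (hs : s ∈ Icc (0 : ℝ) 1) : 0 < LinearMap.det ((1 - s) • (1 : End ℝ V) + s • B) := by
  let F : ℝ → ℝ := fun s => LinearMap.det ((1 - s) • (1 : End ℝ V) + s • B)
  have hF : Continuous F := by
    let b := Module.finBasis ℝ V
    have : F = fun s => Matrix.det ((1 - s) • (1 : Matrix _ _ ℝ) + s • LinearMap.toMatrix b b B) := by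
      ext s
      simp only [F]
      rw [← LinearMap.det_toMatrix b]
      simp [map_add, map_smul, LinearMap.toMatrix_one]
    rw [this]
    exact Continuous.matrix_det (by fun_prop)
  have hne : ∀ s ∈ Icc (0 : ℝ) 1, F s ≠ 0 := by
    intro s hs h0
    have := LinearMap.bot_lt_ker_of_det_eq_zero h0
    rw [LinearMap.ker_eq_bot.2 (h s hs)] at this
    exact absurd this (lt_irrefl _)
  by_contra hneg
  have h0 : F 0 = 1 := by simp [F]
  have hle : F s ≤ 0 := not_lt.1 hneg
  obtain ⟨t, ht, ht0⟩ := intermediate_value_Icc' hs.1 hF.continuousOn (show (0 : ℝ) ∈ Icc (F s) (F 0) from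
    ⟨hle, by rw [h0]; norm_num⟩)
  exact hne t ⟨ht.1, ht.2.trans hs.2⟩ ht0

/-- The rank of an idempotent is its trace, and the two products are commuting idempotents with sum
c. -/
theorem finrank_range_mul_add [FiniteDimensional ℝ V] {a c : End ℝ V} (ha : IsIdempotentElem a)
    (hc : IsIdempotentElem c) (h : Commute a c) :
    finrank ℝ (LinearMap.range (a * c)) + finrank ℝ (LinearMap.range ((1 - a) * c)) =
      finrank ℝ (LinearMap.range c) := by
  have h1 : IsIdempotentElem (a * c) := ha.mul_of_commute h hc
  have h2 : IsIdempotentElem ((1 - a) * c) :=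
    ha.one_sub.mul_of_commute ((Commute.one_left c).sub_left h) hc
  have e1 := (LinearMap.IsIdempotentElem.isProj_range _ h1).trace
  have e2 := (LinearMap.IsIdempotentElem.isProj_range _ h2).trace
  have e3 := (LinearMap.IsIdempotentElem.isProj_range _ hc).trace
  have : ((finrank ℝ (LinearMap.range (a * c)) + finrank ℝ (LinearMap.range ((1 - a) * c)) : ℕ) : ℝ)
      = finrank ℝ (LinearMap.range c) := by
    push_cast
    rw [← e1, ← e2, ← e3, ← map_add, ← add_mul]
    simp
  exact_mod_cast this

theorem range_mul_of_commute {a c : End ℝ V} (ha : IsIdempotentElem a) (hc : IsIdempotentElem c)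
    (h : Commute a c) : LinearMap.range (a * c) = LinearMap.range a ⊓ LinearMap.range c := by
  apply le_antisymm
  · rintro _ ⟨x, rfl⟩
    exact ⟨⟨c x, rfl⟩, ⟨a x, by rw [← Module.End.mul_apply, ← h.eq]⟩⟩
  · rintro x ⟨⟨y, rfl⟩, ⟨z, hz⟩⟩
    refine ⟨a y, ?_⟩
    have ha' : a (a y) = a y := congrArg (fun T : End ℝ V => T y) ha
    have hc' : c (c z) = c z := congrArg (fun T : End ℝ V => T z) hc
    rw [Module.End.mul_apply, ← hz, hc', hz, ha']

theorem finrank_range_mul_le_left [FiniteDimensional ℝ V] (a c : End ℝ V) :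
    finrank ℝ (LinearMap.range (a * c)) ≤ finrank ℝ (LinearMap.range a) :=
  Submodule.finrank_mono (LinearMap.range_comp_le_range c a)

/-- The normal form of a pair of commuting automorphisms `A`, `C` whose joint negative subspace has
odd dimension: they can be deformed, through commuting pairs, to commuting involutions `a`, `c`,
where `c` is a rotation by `π` whose generator is the sum of a generator `J` of a plane, which
anticommutes with `a`, and of a generator `K` which commutes with `a`. -/
theorem exists_normal_form [FiniteDimensional ℝ V] {A C : End ℝ V} (hAC : Commute A C)
    (hA : 0 < LinearMap.det A) (hC : 0 < LinearMap.det C)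
    (hodd : Odd (finrank ℝ ↥(negativeSubspace A ⊓ negativeSubspace C))) :
    ∃ a c J K L : End ℝ V, a * a = 1 ∧ c * c = 1 ∧
      (∀ T, Commute T A → Commute T a) ∧ (∀ T, Commute T C → Commute T c) ∧
      (∀ s ∈ Icc (0 : ℝ) 1, 0 < LinearMap.det ((1 - s) • (1 : End ℝ V) + s • (a * A))) ∧
      (∀ s ∈ Icc (0 : ℝ) 1, 0 < LinearMap.det ((1 - s) • (1 : End ℝ V) + s • (c * C))) ∧
      IsPlaneGenerator J ∧ a * J = -J * a ∧ Commute c J ∧ Commute a K ∧ J * K = 0 ∧ K * J = 0 ∧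
      K * K * K = -K ∧ rot (J + K) Real.pi = c ∧
      L * L * L = -L ∧ rot L Real.pi = a ∧ 3 ≤ finrank ℝ V := by
  have inj : ∀ {T : End ℝ V}, 0 < LinearMap.det T → Function.Injective T := fun {T} h =>
    LinearMap.ker_eq_bot.1 (by_contra fun h0 => h.ne' (LinearMap.det_eq_zero_iff_ker_ne_bot.2 h0))
  obtain ⟨e, he, hre, hTe, hse⟩ := exists_negative_projection A (inj hA)
  obtain ⟨d, hd, hrd, hTd, hsd⟩ := exists_negative_projection C (inj hC)
  have hed : Commute e d := hTd e (hTe C hAC.symm).symm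
  have hpos : ∀ {A e : End ℝ V}, 0 < LinearMap.det A → (∀ s ∈ Icc (0 : ℝ) 1,
      Function.Injective ⇑((1 - s) • (1 : End ℝ V) + s • ((1 - (2 : ℝ) • e) * A))) →
      0 < LinearMap.det (1 - (2 : ℝ) • e) := by
    intro A e hA hs
    have := det_pos_of_segment hs (right_mem_Icc.2 zero_le_one)
    rw [sub_self, zero_smul, zero_add, one_smul, map_mul] at this
    exact pos_of_mul_pos_left this hA.le
  have hevA := even_finrank_range_of_det_pos he (hpos hA hse)
  have hevC := even_finrank_range_of_det_pos hd (hpos hC hsd)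
  have h1 : IsIdempotentElem (e * d) := he.mul_of_commute hed hd
  have hcomm' : Commute (1 - e) d := (Commute.one_left d).sub_left hed
  have h2 : IsIdempotentElem ((1 - e) * d) := he.one_sub.mul_of_commute hcomm' hd
  have hodd1 : Odd (finrank ℝ (LinearMap.range (e * d))) := by
    rw [range_mul_of_commute he hd hed, hre, hrd]; exact hodd
  have hsum1 := finrank_range_mul_add he hd hed
  have hsum2 := finrank_range_mul_add hd he hed.symm
  rw [← hed.eq] at hsum2
  -- The rank of d is even and is the sum of the ranks of ed and (1-e)d; in the same way for e
  -- below.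
  have hodd2 : Odd (finrank ℝ (LinearMap.range ((1 - e) * d))) := by
    have : Even (finrank ℝ (LinearMap.range (e * d)) + finrank ℝ (LinearMap.range ((1 - e) * d))) := by
      rw [hsum1]; exact hevC
    rw [Nat.even_add'] at this
    exact this.1 hodd1
  have hodd3 : Odd (finrank ℝ (LinearMap.range ((1 - d) * e))) := by
    have : Even (finrank ℝ (LinearMap.range (e * d)) + finrank ℝ (LinearMap.range ((1 - d) * e))) := by
      rw [hsum2]; exact hevA
    rw [Nat.even_add'] at this
    exact this.1 hodd1
  -- The ranks of ed, (1-d)e and (1-e)d are odd, hence positive, and the three ranges are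
  -- independent.
  have hdim : 3 ≤ finrank ℝ V := by
    have h3 := finrank_range_mul_add he (IsIdempotentElem.one : IsIdempotentElem (1 : End ℝ V)) (Commute.one_right e)
    rw [mul_one, mul_one] at h3
    have h4 : finrank ℝ (LinearMap.range (1 : End ℝ V)) = finrank ℝ V := by
      rw [Module.End.one_eq_id, LinearMap.range_id, finrank_top]
    have h5 := finrank_range_mul_le_left (1 - e) d
    have := hodd1.pos; have := hodd2.pos; have := hodd3.pos
    omega
  -- One line is left over in each of the two odd-dimensional halves of the range of d; I and K are
  -- complex structures on what remains of the halves.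
  obtain ⟨v, f, I, hfv, hfe, hev, heI, hIe, hIv, hfI, hII⟩ := exists_decomposition_of_odd h1 hodd1
  obtain ⟨w, g, K, hgw, hge, hew, heK, hKe, hKw, hgK, hKK⟩ := exists_decomposition_of_odd h2 hodd2
  obtain ⟨L, heL, hLe, hLL⟩ := exists_complex_structure_of_even he hevA
  have hee : ∀ x, e (e x) = e x := fun x => congrArg (fun T : End ℝ V => T x) he
  have hdd : ∀ x, d (d x) = d x := fun x => congrArg (fun T : End ℝ V => T x) hd
  have hde : ∀ x, d (e x) = e (d x) := fun x => congrArg (fun T : End ℝ V => T x) hed.symm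
  have p12 : (e * d) * ((1 - e) * d) = 0 := by ext x; simp [hde, hdd, hee]
  have p21 : ((1 - e) * d) * (e * d) = 0 := by ext x; simp [hde, hdd, hee]
  have f0 : ∀ x, f (((1 - e) * d) x) = 0 := by
    intro x
    rw [← hfe, ← Module.End.mul_apply, p12, LinearMap.zero_apply, map_zero]
  have g0 : ∀ x, g ((e * d) x) = 0 := by
    intro x
    rw [← hge, ← Module.End.mul_apply, p21, LinearMap.zero_apply, map_zero]
  have hfw : f w = 0 := by rw [← hew, f0]
  have hgv : g v = 0 := by rw [← hev, g0]
  have hIK : I * K = 0 := by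
    rw [← hIe, ← heK, mul_assoc, ← mul_assoc (e * d), p12, zero_mul, mul_zero]
  have hKI : K * I = 0 := by
    rw [← hKe, ← heI, mul_assoc, ← mul_assoc _ _ I, p21, zero_mul, mul_zero]
  have hIw : I w = 0 := by
    rw [← hIe, ← hew, ← Module.End.mul_apply, mul_assoc, p12, mul_zero, LinearMap.zero_apply]
  have hKv : K v = 0 := by
    rw [← hKe, ← hev, ← Module.End.mul_apply, mul_assoc, p21, mul_zero, LinearMap.zero_apply]
  have hfK : ∀ x, f (K x) = 0 := by intro x; rw [← heK, Module.End.mul_apply, f0]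
  have hgI : ∀ x, g (I x) = 0 := by intro x; rw [← heI, Module.End.mul_apply, g0]
  have ee1 : e * (e * d) = e * d := by rw [← mul_assoc, he]
  have ee2 : e * ((1 - e) * d) = 0 := by rw [← mul_assoc, mul_sub, mul_one, he, sub_self, zero_mul]
  have ee1' : (e * d) * e = e * d := by rw [mul_assoc, ← hed.eq, ee1]
  have ee2' : ((1 - e) * d) * e = 0 := by
    rw [mul_assoc, ← hed.eq, ← mul_assoc, sub_mul, one_mul, he, sub_self, zero_mul]
  have eI : e * I = I := by rw [← heI, ← mul_assoc, ee1]
  have Ie : I * e = I := by rw [← hIe, mul_assoc, ee1']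
  have eK : e * K = 0 := by rw [← heK, ← mul_assoc, ee2, zero_mul]
  have Ke : K * e = 0 := by rw [← hKe, mul_assoc, ee2', mul_zero]
  have ev : e v = v := by
    conv_lhs => rw [← hev, ← Module.End.mul_apply, ee1, hev]
  have ew : e w = 0 := by rw [← hew, ← Module.End.mul_apply, ee2, LinearMap.zero_apply]
  have fe : ∀ x, f (e x) = f x := by
    intro x; rw [← hfe (e x), ← Module.End.mul_apply, ee1', hfe]
  have ge : ∀ x, g (e x) = 0 := by
    intro x; rw [← hge (e x), ← Module.End.mul_apply, ee2', LinearMap.zero_apply, map_zero]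
  have hsumed : e * d + (1 - e) * d = d := by rw [← add_mul]; simp
  -- J rotates the plane of the two leftover lines. Since e fixes v and kills w, the involution 1 -
  -- 2e reflects this plane and so reverses J.
  set J : End ℝ V := f.smulRight w - g.smulRight v with hJ
  have hJ2 : J * J = -(f.smulRight v + g.smulRight w) := by
    ext x; simp [hJ, hfv, hfw, hgv, hgw]; module
  have hJgen : IsPlaneGenerator J := ⟨v, w, f, g, hfv, hfw, hgv, hgw, rfl⟩
  have hJIK : J * (I + K) = 0 := by ext x; simp [hJ, hfI, hfK, hgI, hgK]
  have hIKJ : (I + K) * J = 0 := by ext x; simp [hJ, hIv, hIw, hKv, hKw]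
  have hIK2 : (I + K) * (I + K) = f.smulRight v + g.smulRight w - d := by
    rw [add_mul, mul_add, mul_add, hIK, hKI, hII, hKK]
    linear_combination (norm := abel) -hsumed
  have hsq : (J + (I + K)) * (J + (I + K)) = -d := by
    rw [add_mul, mul_add J, mul_add (I + K), hJIK, hIKJ, hJ2, hIK2]; abel
  have hrot : rot (J + (I + K)) Real.pi = 1 - (2 : ℝ) • d := by
    rw [rot_pi, hsq, smul_neg, sub_eq_add_neg]
  have h4 : ∀ {e : End ℝ V}, IsIdempotentElem e → (1 - (2 : ℝ) • e) * (1 - (2 : ℝ) • e) = 1 := by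
    intro e he
    simp only [mul_sub, sub_mul, mul_one, one_mul, smul_mul_assoc, mul_smul_comm, he.eq]
    module
  refine ⟨1 - (2 : ℝ) • e, 1 - (2 : ℝ) • d, J, I + K, L, h4 he, h4 hd,
    fun T hT => (Commute.one_right T).sub_right ((hTe T hT).smul_right _),
    fun T hT => (Commute.one_right T).sub_right ((hTd T hT).smul_right _),
    fun s hs => det_pos_of_segment hse hs, fun s hs => det_pos_of_segment hsd hs, hJgen,
    ?_, ?_, ?_, hJIK, hIKJ, ?_, hrot, ?_, ?_, hdim⟩
  · ext x
    simp [hJ, ev, ew, fe, ge]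
    module
  · rw [← hrot]
    refine (Commute.rot ?_ _).symm
    rw [commute_iff_eq, mul_add, add_mul, hJIK, hIKJ]
  · refine (Commute.one_left _).sub_left (Commute.smul_left ?_ _)
    rw [commute_iff_eq, mul_add, add_mul, eI, Ie, eK, Ke]
  · rw [hIK2]
    ext x
    have hKI' : ∀ x, K (I x) = 0 := fun x => congrArg (fun T : End ℝ V => T x) hKI
    have a1 : ∀ x, e (d (I x)) = I x := fun x => congrArg (fun T : End ℝ V => T x) heI
    have a2 : ∀ x, e (K x) = 0 := fun x => congrArg (fun T : End ℝ V => T x) eK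
    have a3 : ∀ x, d (K x) = K x := by
      intro x
      have := congrArg (fun T : End ℝ V => T x) heK
      simpa [← hde, a2] using this
    have a4 : ∀ x, d (I x) = I x := by
      intro x
      conv_lhs => rw [← a1 x, ← hde, hdd, hde, a1]
    simp [hfI, hfK, hgI, hgK, a3, a4]
  · rw [hLL, neg_mul, heL]
  · rw [rot_pi, hLL, smul_neg, sub_eq_add_neg]

end LinearAlgebra

/-! ### Loops in the group of automorphisms of positive determinant. -/

section GeneralLinearLoops

open Module unitInterval
open scoped RealInnerProductSpace

/-- The endomorphisms with positive determinant. -/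
def GLPos (V : Type*) [NormedAddCommGroup V] [NormedSpace ℝ V] : Submonoid (V →L[ℝ] V) where
  carrier := {T | 0 < T.det}
  one_mem' := by simp [ContinuousLinearMap.det]
  mul_mem' {S T} hS hT := by
    have : (S * T).det = S.det * T.det := by
      simp [ContinuousLinearMap.det]
    change 0 < (S * T).det
    rw [this]
    exact mul_pos hS hT

variable {V : Type*} [NormedAddCommGroup V] [NormedSpace ℝ V]

theorem mem_GLPos {T : V →L[ℝ] V} : T ∈ GLPos V ↔ 0 < T.det := Iff.rfl

theorem continuousLinearMap_det_mul (S T : V →L[ℝ] V) : (S * T).det = S.det * T.det := by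
  simp [ContinuousLinearMap.det]

/-- The loop in `GLPos V` given by a closed curve of endomorphisms. -/
def GLPos.mkLoop (M : ℝ → V →L[ℝ] V) (hM : Continuous M) (hpos : ∀ t : I, 0 < (M t).det)
    (h0 : M 0 = 1) (h1 : M 1 = 1) : Path (1 : GLPos V) 1 where
  toFun t := ⟨M t, hpos t⟩
  continuous_toFun := by fun_prop
  source' := Subtype.ext (by simpa using h0)
  target' := Subtype.ext (by simpa using h1)

theorem GLPos.homotopic_of {M N : Path (1 : GLPos V) 1} (H : ℝ → ℝ → V →L[ℝ] V)
    (hc : Continuous fun p : I × I => H p.1 p.2) (hpos : ∀ s t : I, 0 < (H s t).det)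
    (h0 : ∀ t : I, H 0 t = M t) (h1 : ∀ t : I, H 1 t = N t)
    (hs0 : ∀ s : I, H s 0 = 1) (hs1 : ∀ s : I, H s 1 = 1) : M.Homotopic N := by
  refine ⟨⟨⟨⟨fun p => ⟨H p.1 p.2, hpos _ _⟩, hc.subtype_mk _⟩, ?_, ?_⟩, ?_⟩⟩
  · intro t; exact Subtype.ext (by simpa using h0 t)
  · intro t; exact Subtype.ext (by simpa using h1 t)
  · rintro s t (rfl | rfl)
    · exact Subtype.ext (by simpa using hs0 s)
    · exact Subtype.ext (by simpa using hs1 s)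

theorem continuous_rot {R : Type*} [NormedRing R] [NormedAlgebra ℝ R] (J : R) :
    Continuous (rot J) := by
  unfold rot; fun_prop

/-- A rotation is the square of the rotation by half the angle, which is invertible. -/
theorem det_rot_pos {J : V →L[ℝ] V} (hJ : J * J * J = -J) (t : ℝ) : 0 < (rot J t).det := by
  have h1 : (rot J t) = rot J (t / 2) * rot J (t / 2) := by rw [← rot_add hJ, add_halves]
  have h2 : (rot J (t / 2)).det * (rot J (-(t / 2))).det = 1 := by
    rw [← continuousLinearMap_det_mul, rot_mul_rot_neg hJ]; simp [ContinuousLinearMap.det]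
  rw [h1, continuousLinearMap_det_mul]
  exact mul_self_pos.2 (left_ne_zero_of_mul_eq_one h2)

/-- The loop of the `k`-fold rotation with generator `J`. -/
def rotLoop (J : V →L[ℝ] V) (hJ : J * J * J = -J) (k : ℤ) : Path (1 : GLPos V) 1 :=
  GLPos.mkLoop (fun t => rot J (2 * Real.pi * k * t))
    ((continuous_rot J).comp (by fun_prop)) (fun t => det_rot_pos hJ _) (by simp)
    (by rw [mul_one]; exact rot_two_pi_mul_int J k)

@[simp] theorem coe_rotLoop (J : V →L[ℝ] V) (hJ : J * J * J = -J) (k : ℤ) (t : I) :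
    (rotLoop J hJ k t : V →L[ℝ] V) = rot J (2 * Real.pi * k * t) := rfl

/-- `J` is a plane generator whose rotation loop generates the fundamental group of the group of
automorphisms with positive determinant. -/
def GeneratesLoops (J : V →L[ℝ] V) : Prop :=
  ∃ hJ : J * J * J = -J, ∀ M : Path (1 : GLPos V) 1, ∃ k : ℤ, M.Homotopic (rotLoop J hJ k)

theorem continuous_det_clm [FiniteDimensional ℝ V] :
    Continuous (ContinuousLinearMap.det : (V →L[ℝ] V) → ℝ) :=
  ContinuousLinearMap.continuous_det

/-- The automorphisms of positive determinant form an open set, so a close C¹ approximation is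
homotopic to the loop along segments. Differentiability serves to find a vector avoiding a cone over
a curve. -/
theorem GLPos.exists_contDiff_homotopic [FiniteDimensional ℝ V] (M : Path (1 : GLPos V) 1) :
    ∃ (N : ℝ → V →L[ℝ] V) (hc : ContDiff ℝ 1 N) (hpos : ∀ t : I, 0 < (N t).det)
      (h0 : N 0 = 1) (h1 : N 1 = 1),
      M.Homotopic (GLPos.mkLoop N hc.continuous hpos h0 h1) := by
  have hopen : IsOpen {T : V →L[ℝ] V | 0 < T.det} := isOpen_lt continuous_const continuous_det_clm
  let F : ℝ → V →L[ℝ] V := fun t => (M.extend t : V →L[ℝ] V)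
  have hF : Continuous F := by fun_prop
  have hF0 : F 0 = 1 := by simp [F]
  have hF1 : F 1 = 1 := by simp [F]
  have hK : IsCompact (F '' Icc 0 1) := isCompact_Icc.image hF
  obtain ⟨δ, hδ, hsub⟩ := hK.exists_thickening_subset_open hopen (by
    rintro _ ⟨t, _, rfl⟩; exact (M.extend t).2)
  obtain ⟨g, hg, happ, -⟩ := hF.exists_contDiff_approx 1 (continuous_const (y := δ / 4))
    (fun _ => by positivity)
  -- The affine correction restores the endpoints; with the approximation error it stays below three
  -- times δ/4.
  let N : ℝ → V →L[ℝ] V := fun t => g t - (1 - t) • (g 0 - 1) - t • (g 1 - 1)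
  have hN : ContDiff ℝ 1 N := by
    have : ContDiff ℝ 1 g := hg
    fun_prop
  have hNF : ∀ t ∈ Icc (0 : ℝ) 1, ‖N t - F t‖ < δ := by
    intro t ht
    have e1 := happ t; have e2 := happ 0; have e3 := happ 1
    rw [dist_eq_norm] at e1 e2 e3
    rw [hF0] at e2; rw [hF1] at e3
    have b2 : ‖(1 - t) • (g 0 - 1)‖ ≤ δ / 4 := by
      rw [norm_smul, Real.norm_of_nonneg (by linarith [ht.2])]
      nlinarith [ht.1, norm_nonneg (g 0 - 1)]
    have b3 : ‖t • (g 1 - 1)‖ ≤ δ / 4 := by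
      rw [norm_smul, Real.norm_of_nonneg ht.1]
      nlinarith [ht.2, norm_nonneg (g 1 - 1)]
    calc ‖N t - F t‖ = ‖(g t - F t) - (1 - t) • (g 0 - 1) - t • (g 1 - 1)‖ := by
          congr 1; simp only [N]; abel
      _ ≤ ‖g t - F t‖ + ‖(1 - t) • (g 0 - 1)‖ + ‖t • (g 1 - 1)‖ :=
          (norm_sub_le _ _).trans (by gcongr; exact norm_sub_le _ _)
      _ < δ := by linarith
  have hseg : ∀ s t : I, 0 < ((1 - (s : ℝ)) • F t + (s : ℝ) • N t).det := by
    intro s t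
    apply hsub
    rw [Metric.mem_thickening_iff]
    refine ⟨F t, mem_image_of_mem _ t.2, ?_⟩
    rw [dist_eq_norm, show (1 - (s : ℝ)) • F t + (s : ℝ) • N t - F t = (s : ℝ) • (N t - F t) by
      module, norm_smul, Real.norm_of_nonneg s.2.1]
    have := hNF t t.2
    nlinarith [s.2.2, norm_nonneg (N t - F t)]
  refine ⟨N, hN, fun t => by simpa using hseg 1 t, by simp [N], by simp [N], ?_⟩
  have hNc := hN.continuous
  refine GLPos.homotopic_of (fun s t => (1 - s) • F t + s • N t) (by fun_prop) hseg ?_ ?_ ?_ ?_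
  · intro t; simp [F]
  · intro t; simp [GLPos.mkLoop]
  · intro s; simp only [hF0, N]; module
  · intro s; simp only [hF1, N]; module

/-- Conjugation by a linear isomorphism is a homeomorphism between the groups which respects
rotations, so homotopies can be carried back and forth. -/
theorem GeneratesLoops.conj {W : Type*} [NormedAddCommGroup W] [NormedSpace ℝ W]
    {J : V →L[ℝ] V} (hJ : GeneratesLoops J) (e : V ≃L[ℝ] W) :
    GeneratesLoops (e.toContinuousLinearMap ∘L J ∘L e.symm.toContinuousLinearMap) := by
  obtain ⟨hJ3, h⟩ := hJ
  have hdet : ∀ T : V →L[ℝ] V,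
      (e.toContinuousLinearMap ∘L T ∘L e.symm.toContinuousLinearMap).det = T.det :=
    fun T => LinearMap.det_conj (T : V →ₗ[ℝ] V) e.toLinearEquiv
  have hdet' : ∀ T : W →L[ℝ] W,
      (e.symm.toContinuousLinearMap ∘L T ∘L e.toContinuousLinearMap).det = T.det :=
    fun T => LinearMap.det_conj (T : W →ₗ[ℝ] W) e.symm.toLinearEquiv
  have hc : Continuous fun T : V →L[ℝ] V =>
    (e.toContinuousLinearMap ∘L T ∘L e.symm.toContinuousLinearMap) := by fun_prop
  have hc' : Continuous fun T : W →L[ℝ] W =>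
    (e.symm.toContinuousLinearMap ∘L T ∘L e.toContinuousLinearMap) := by fun_prop
  let φ : C(GLPos V, GLPos W) :=
    ⟨fun T => ⟨e.toContinuousLinearMap ∘L T.1 ∘L e.symm.toContinuousLinearMap,
      by rw [mem_GLPos, hdet]; exact T.2⟩, by fun_prop⟩
  let ψ : C(GLPos W, GLPos V) :=
    ⟨fun T => ⟨e.symm.toContinuousLinearMap ∘L T.1 ∘L e.toContinuousLinearMap,
      by rw [mem_GLPos, hdet']; exact T.2⟩, by fun_prop⟩
  have hφ1 : φ 1 = 1 := Subtype.ext (by ext x; simp [φ])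
  have hψ1 : ψ 1 = 1 := Subtype.ext (by ext x; simp [ψ])
  refine ⟨by ext x; simpa using congrArg (fun T : V →L[ℝ] V => e (T (e.symm x))) hJ3, fun M => ?_⟩
  obtain ⟨k, hk⟩ := h ((M.map ψ.continuous).cast hψ1.symm hψ1.symm)
  obtain ⟨G⟩ := hk.map φ
  refine ⟨k, ⟨⟨G.toHomotopy.cast ?_ ?_, ?_⟩⟩⟩
  · ext t x; simp [φ, ψ]
  · ext t x
    simp [φ, rot]
  · intro s t ht
    have := G.eq_fst s ht
    refine this.trans ?_
    exact Subtype.ext (by ext x; simp [φ, ψ])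

/-- Two plane generators are conjugate. -/
theorem IsPlaneGenerator.exists_conj [FiniteDimensional ℝ V] {J K : Module.End ℝ V}
    (hJ : IsPlaneGenerator J) (hK : IsPlaneGenerator K) :
    ∃ e : V ≃ₗ[ℝ] V, (e : V →ₗ[ℝ] V) ∘ₗ J ∘ₗ (e.symm : V →ₗ[ℝ] V) = K := by
  have key : ∀ {J : Module.End ℝ V}, IsPlaneGenerator J → ∃ (U : Submodule ℝ V)
      (e : V ≃ₗ[ℝ] (ℝ × ℝ) × U), finrank ℝ U + 2 = finrank ℝ V ∧
      ∀ x, e (J x) = ((-(e x).1.2, (e x).1.1), 0) := by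
    -- The space splits as the plane, with coordinates f and g, and their common kernel, on which
    -- the generator vanishes.
    rintro J ⟨v, w, f, g, hfv, hfw, hgv, hgw, rfl⟩
    let P : V →ₗ[ℝ] ℝ × ℝ := f.prod g
    let A : V →ₗ[ℝ] LinearMap.ker P := LinearMap.codRestrict _
      (LinearMap.id - f.smulRight v - g.smulRight w) (by
        intro x; simp [P, hfv, hfw, hgv, hgw])
    have hA : ∀ x, (A x : V) = x - f x • v - g x • w := fun x => rfl
    let E : V ≃ₗ[ℝ] (ℝ × ℝ) × LinearMap.ker P := LinearEquiv.ofLinearMap (P.prod A)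
      (LinearMap.coprod ((LinearMap.fst ℝ ℝ ℝ).smulRight v + (LinearMap.snd ℝ ℝ ℝ).smulRight w)
        (LinearMap.ker P).subtype)
      (by
        apply LinearMap.ext
        rintro ⟨⟨a, b⟩, ⟨y, hy⟩⟩
        have h1 : f y = 0 := congrArg Prod.fst hy
        have h2 : g y = 0 := congrArg Prod.snd hy
        ext <;> simp [P, hA, hfv, hfw, hgv, hgw, h1, h2])
      (by
        ext x
        simp [P, hA])
    refine ⟨LinearMap.ker P, E, ?_, ?_⟩
    · have := E.finrank_eq
      simp only [Module.finrank_prod, Module.finrank_self] at this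
      omega
    · intro x
      ext <;> simp [E, P, hA, hfv, hfw, hgv, hgw]
  obtain ⟨U, e, hU, he⟩ := key hJ
  obtain ⟨U', e', hU', he'⟩ := key hK
  let m : U ≃ₗ[ℝ] U' := LinearEquiv.ofFinrankEq U U' (by omega)
  let E := e ≪≫ₗ ((LinearEquiv.refl ℝ (ℝ × ℝ)).prodCongr m) ≪≫ₗ e'.symm
  refine ⟨E, ?_⟩
  ext x
  simp only [LinearMap.comp_apply, LinearEquiv.coe_coe]
  apply e'.injective
  rw [he']
  obtain ⟨y, rfl⟩ := E.surjective x
  simp only [E, LinearEquiv.trans_apply, LinearEquiv.apply_symm_apply,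
    he]
  simp

end GeneralLinearLoops

/-! ### Reduction of loops to a hyperplane. -/

section Reduction

open Module unitInterval
open scoped RealInnerProductSpace

variable {V : Type*} [NormedAddCommGroup V] [InnerProductSpace ℝ V]

/-- For linearly independent `v`, `w`: the linear form which vanishes on `w` and is orthogonal to
the complement of the plane spanned by `v`, `w`, with value `1` at `v`. -/
def planeForm (v w : V) : V →L[ℝ] ℝ :=
  (⟪w, w⟫ * ⟪v, v⟫ - ⟪w, v⟫ ^ 2)⁻¹ • innerSL ℝ (⟪w, w⟫ • v - ⟪w, v⟫ • w)

theorem planeForm_right (v w : V) : planeForm v w w = 0 := by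
  simp only [planeForm, smul_apply, innerSL_apply_apply, inner_sub_left,
    real_inner_smul_left, real_inner_comm v w, smul_eq_mul]
  ring

/-- Up to the factor ⟪v, v⟫, the Gram determinant is the squared norm of the nonzero vector ⟪v, v⟫ w
- ⟪w, v⟫ v, a multiple of the component of w orthogonal to v. -/
theorem gram_pos {v w : V} (hv : v ≠ 0) (hw : ∀ r : ℝ, r • v ≠ w) :
    0 < ⟪w, w⟫ * ⟪v, v⟫ - ⟪w, v⟫ ^ 2 := by
  have hvv : 0 < ⟪v, v⟫ := real_inner_self_pos.2 hv
  have hp : ⟪v, v⟫ • w - ⟪w, v⟫ • v ≠ 0 := by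
    intro h
    apply hw (⟪v, v⟫⁻¹ * ⟪w, v⟫)
    rw [mul_smul, inv_smul_eq_iff₀ hvv.ne', sub_eq_zero.1 h]
  have := real_inner_self_pos.2 hp
  simp only [inner_sub_left, inner_sub_right, real_inner_smul_left, real_inner_smul_right,
    real_inner_comm v w] at this
  rw [real_inner_comm v w]
  refine pos_of_mul_pos_right (a := ⟪v, v⟫) ?_ hvv.le
  linarith

theorem gram_pos_symm {v w : V} (hv : v ≠ 0) (hw : ∀ r : ℝ, r • v ≠ w) :
    0 < ⟪v, v⟫ * ⟪w, w⟫ - ⟪v, w⟫ ^ 2 := by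
  rw [mul_comm, real_inner_comm w v]; exact gram_pos hv hw

theorem planeForm_left {v w : V} (h : 0 < ⟪w, w⟫ * ⟪v, v⟫ - ⟪w, v⟫ ^ 2) : planeForm v w v = 1 := by
  simp only [planeForm, smul_apply, innerSL_apply_apply, inner_sub_left,
    real_inner_smul_left, smul_eq_mul]
  rw [inv_mul_eq_one₀ h.ne']
  ring

theorem continuous_planeForm {α : Type*} [TopologicalSpace α] {v w : α → V} (hv : Continuous v)
    (hw : Continuous w) (h : ∀ t, 0 < ⟪w t, w t⟫ * ⟪v t, v t⟫ - ⟪w t, v t⟫ ^ 2) :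
    Continuous fun t => planeForm (v t) (w t) := by
  unfold planeForm
  have h1 : Continuous fun t => ⟪w t, w t⟫ * ⟪v t, v t⟫ - ⟪w t, v t⟫ ^ 2 := by fun_prop
  exact (h1.inv₀ fun t => (h t).ne').smul ((innerSL ℝ).continuous.comp (by fun_prop))

/-- The transvection `x ↦ x + f x • u`. -/
def clmTransvection {V : Type*} [NormedAddCommGroup V] [NormedSpace ℝ V] (f : V →L[ℝ] ℝ) (u : V) :
    V →L[ℝ] V := 1 + f.smulRight u

section

variable {V : Type*} [NormedAddCommGroup V] [NormedSpace ℝ V]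

@[simp] theorem clmTransvection_apply (f : V →L[ℝ] ℝ) (u x : V) :
    clmTransvection f u x = x + f x • u := by simp [clmTransvection]

theorem det_clmTransvection [FiniteDimensional ℝ V] {f : V →L[ℝ] ℝ} {u : V} (h : f u = 0) :
    (clmTransvection f u).det = 1 := by
  have : ((clmTransvection f u : V →L[ℝ] V) : V →ₗ[ℝ] V) =
      LinearMap.transvection (f : V →ₗ[ℝ] ℝ) u := by
    ext x; simp [LinearMap.transvection.apply]
  rw [ContinuousLinearMap.det, this, LinearMap.transvection.det]
  simp [h]

theorem continuous_clmTransvection {α : Type*} [TopologicalSpace α] {f : α → V →L[ℝ] ℝ} {u : α → V}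
    (hf : Continuous f) (hu : Continuous u) : Continuous fun t => clmTransvection (f t) (u t) := by
  unfold clmTransvection
  refine continuous_const.add ?_
  exact ((ContinuousLinearMap.smulRightL ℝ V V).continuous.comp hf).clm_apply hu

end

/-- A product of transvections in the planes `⟨v, w⟩` and `⟨e, w⟩` which for `s = 1` maps `v` to `e`. -/
def planeMove (e w v : V) (s : ℝ) : V →L[ℝ] V :=
  clmTransvection (planeForm e w) (-s • w) * clmTransvection (planeForm w e) (s • e) *
    clmTransvection (planeForm w v) (-s • v) * clmTransvection (planeForm v w) (s • w)

theorem det_planeMove [FiniteDimensional ℝ V] (e w v : V) (s : ℝ) : (planeMove e w v s).det = 1 := by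
  simp only [planeMove, continuousLinearMap_det_mul]
  rw [det_clmTransvection, det_clmTransvection, det_clmTransvection, det_clmTransvection]
  · simp
  all_goals simp [planeForm_right]

/-- For v = e the two outer shears cancel after the two inner ones. This keeps the homotopies below
constant at the ends of loops. -/
theorem planeMove_self (e w : V) (s : ℝ) : planeMove e w e s = 1 := by
  ext x
  simp [planeMove, planeForm_right]

theorem planeMove_zero (e w v : V) : planeMove e w v 0 = 1 := by
  ext x
  simp [planeMove]

/-- The four shears carry v to v + w, then to w, then to w + e, then to e. -/
theorem planeMove_one {e w v : V} (h1 : planeForm v w v = 1) (h2 : planeForm w v w = 1)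
    (h3 : planeForm e w e = 1) (h4 : planeForm w e w = 1) : planeMove e w v 1 v = e := by
  simp [planeMove, planeForm_right, h1, h2, h3, h4]

theorem continuous_planeMove (e w : V) {α : Type*} [TopologicalSpace α] {s : α → ℝ} {v : α → V}
    (hs : Continuous s) (hv : Continuous v)
    (h1 : ∀ t, 0 < ⟪w, w⟫ * ⟪v t, v t⟫ - ⟪w, v t⟫ ^ 2)
    (h2 : ∀ t, 0 < ⟪v t, v t⟫ * ⟪w, w⟫ - ⟪v t, w⟫ ^ 2) :
    Continuous fun t => planeMove e w (v t) (s t) := by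
  refine Continuous.mul (Continuous.mul (Continuous.mul ?_ ?_) ?_) ?_
  · exact continuous_clmTransvection continuous_const (by fun_prop)
  · exact continuous_clmTransvection continuous_const (by fun_prop)
  · exact continuous_clmTransvection (continuous_planeForm continuous_const hv h2) (by fun_prop)
  · exact continuous_clmTransvection (continuous_planeForm hv continuous_const h1) (by fun_prop)

/-- In dimension at least three, every loop of automorphisms is homotopic to a loop of
automorphisms which fix a given vector. -/
theorem GLPos.exists_homotopic_fixing [FiniteDimensional ℝ V] (hdim : 3 ≤ finrank ℝ V) {e : V}
    (he : e ≠ 0) (M : Path (1 : GLPos V) 1) :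
    ∃ N : Path (1 : GLPos V) 1, M.Homotopic N ∧ ∀ t, (N t : V →L[ℝ] V) e = e := by
  obtain ⟨N, hN, hpos, h0, h1, hMN⟩ := GLPos.exists_contDiff_homotopic M
  -- A C¹ image of ℝ² has dense complement in dimension at least three. So some w is independent of
  -- N t e for every t at once, and e can be reached from each N t e by way of this one w.
  have hdense : Dense (range fun p : ℝ × ℝ => p.1 • N p.2 e)ᶜ := by
    refine ContDiff.dense_compl_range_of_finrank_lt_finrank (by fun_prop) ?_
    simp only [Module.finrank_prod, Module.finrank_self]; omega
  obtain ⟨w, hw⟩ := hdense.nonempty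
  have hw' : ∀ t r : ℝ, r • N t e ≠ w := fun t r h => hw ⟨(r, t), h⟩
  have hv : ∀ t : I, N t e ≠ 0 := by
    intro t h
    have hinj : LinearMap.ker (N t : V →ₗ[ℝ] V) = ⊥ :=
      by_contra fun h0 => (hpos t).ne' (LinearMap.det_eq_zero_iff_ker_ne_bot.2 h0)
    exact he (LinearMap.ker_eq_bot'.1 hinj e h)
  have hNe0 : N 0 e = e := by rw [h0]; rfl
  have hNe1 : N 1 e = e := by rw [h1]; rfl
  have hwe : ∀ r : ℝ, r • e ≠ w := fun r => by simpa [hNe0] using hw' 0 r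
  have hNc : Continuous N := hN.continuous
  -- At the ends of the loop N t e = e, where the move is the identity for every s.
  let H : ℝ → ℝ → V →L[ℝ] V := fun s t => planeMove e w (N t e) s * N t
  have hc1 : Continuous fun p : I × I => N p.2 := by fun_prop
  have hc2 : Continuous fun p : I × I => N p.2 e := by fun_prop
  have hc3 : Continuous fun p : I × I => (p.1 : ℝ) := by fun_prop
  have G1 : ∀ p : I × I, 0 < ⟪w, w⟫ * ⟪N p.2 e, N p.2 e⟫ - ⟪w, N p.2 e⟫ ^ 2 :=
    fun p => gram_pos (hv p.2) (hw' p.2)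
  have G2 : ∀ p : I × I, 0 < ⟪N p.2 e, N p.2 e⟫ * ⟪w, w⟫ - ⟪N p.2 e, w⟫ ^ 2 :=
    fun p => gram_pos_symm (hv p.2) (hw' p.2)
  have hHc : Continuous fun p : I × I => H p.1 p.2 :=
    Continuous.mul (continuous_planeMove e w hc3 hc2 G1 G2) hc1
  have hHpos : ∀ s t : I, 0 < (H s t).det := by
    intro s t
    simp only [H]
    rw [continuousLinearMap_det_mul, det_planeMove, one_mul]
    exact hpos t
  have hH0 : ∀ s, H s 0 = 1 := by
    intro s; simp only [H, hNe0, planeMove_self, one_mul]; exact h0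
  have hH1 : ∀ s, H s 1 = 1 := by
    intro s; simp only [H, hNe1, planeMove_self, one_mul]; exact h1
  let L : Path (1 : GLPos V) 1 :=
    { toFun := fun t => ⟨H (1 : I) t, hHpos 1 t⟩
      continuous_toFun := Continuous.subtype_mk
        (hHc.comp ((continuous_const (y := (1 : I))).prodMk continuous_id)) _
      source' := Subtype.ext (hH0 _)
      target' := Subtype.ext (hH1 _) }
  refine ⟨L, hMN.trans ?_, ?_⟩
  · refine GLPos.homotopic_of H hHc hHpos ?_ ?_ (fun s => hH0 s) (fun s => hH1 s)
    · intro t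
      change planeMove e w (N t e) 0 * N t = N t
      rw [planeMove_zero, one_mul]
    · intro t; rfl
  · intro t
    have G3 := planeForm_left (gram_pos (hv t) (hw' t))
    have G4 := planeForm_left (gram_pos_symm (hv t) (hw' t))
    have G5 := planeMove_one G3 G4 (planeForm_left (gram_pos he hwe))
      (planeForm_left (gram_pos_symm he hwe))
    change (H ((1 : I) : ℝ) t) e = e
    rw [Icc.coe_one]
    exact G5

section Hyperplane

variable {U : Submodule ℝ V} {e : V} {f : V →L[ℝ] ℝ} {p : V →L[ℝ] U}

/-- The extension of an endomorphism of a hyperplane `U` which fixes the vector `e` of a complement,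
where `p` and `f` are the projections to `U` and to the coordinate of `e`. -/
def extendHyperplane (e : V) (f : V →L[ℝ] ℝ) (p : V →L[ℝ] U) (B : U →L[ℝ] U) : V →L[ℝ] V :=
  f.smulRight e + U.subtypeL ∘L B ∘L p

theorem extendHyperplane_apply (B : U →L[ℝ] U) (x : V) :
    extendHyperplane e f p B x = f x • e + B (p x) := rfl

theorem continuous_extendHyperplane [FiniteDimensional ℝ V] (e : V) (f : V →L[ℝ] ℝ) (p : V →L[ℝ] U) :
    Continuous (extendHyperplane e f p) := by
  unfold extendHyperplane
  fun_prop

theorem det_extendHyperplane [FiniteDimensional ℝ V] (hfe : f e = 1)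
    (hfU : ∀ u : U, f u = 0) (hpe : p e = 0) (hpU : ∀ u : U, p u = u)
    (hsum : ∀ x, (p x : V) + f x • e = x) (B : U →L[ℝ] U) :
    (extendHyperplane e f p B).det = B.det := by
  let E : V ≃ₗ[ℝ] ℝ × U := LinearEquiv.ofLinearMap
    ((f : V →ₗ[ℝ] ℝ).prod (p : V →ₗ[ℝ] U))
    (LinearMap.coprod (LinearMap.toSpanSingleton ℝ V e) U.subtype)
    (by
      apply LinearMap.ext
      rintro ⟨a, u⟩
      ext <;> simp [hfe, hfU, hpe, hpU])
    (by ext x; simpa [add_comm] using hsum x)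
  have h1 : (extendHyperplane e f p B : V →ₗ[ℝ] V) = (E.symm : ℝ × U →ₗ[ℝ] V) ∘ₗ
      ((LinearMap.id : ℝ →ₗ[ℝ] ℝ).prodMap (B : U →ₗ[ℝ] U)) ∘ₗ (E.symm.symm : V →ₗ[ℝ] ℝ × U) := by
    ext x
    simp [E, extendHyperplane_apply]
  rw [ContinuousLinearMap.det, h1, LinearMap.det_conj, LinearMap.det_prodMap]
  simp [ContinuousLinearMap.det]

/-- An automorphism fixing e is block triangular with respect to the line of e and U; the
transvection removes the off-diagonal block. -/
theorem extendHyperplane_compress (hsum : ∀ x, (p x : V) + f x • e = x)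
    {T : V →L[ℝ] V} (hT : T e = e) :
    extendHyperplane e f p (p ∘L T ∘L U.subtypeL) =
      T * clmTransvection (f ∘L T ∘L U.subtypeL ∘L p) (-(1 : ℝ) • e) := by
  ext x
  have h1 := hsum (T (p x))
  have h2 : T x = T (p x) + f x • e := by
    conv_lhs => rw [← hsum x, map_add, map_smul, hT]
  simp only [extendHyperplane_apply, ContinuousLinearMap.comp_apply, mul_apply_eq_comp,
    clmTransvection_apply, Submodule.subtypeL_apply, map_add, map_smul, hT, h2]
  linear_combination (norm := module) h1

theorem extendHyperplane_rot (hpU : ∀ u : U, p u = u) (hsum : ∀ x, (p x : V) + f x • e = x)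
    (J : U →L[ℝ] U) (t : ℝ) :
    extendHyperplane e f p (rot J t) = rot (U.subtypeL ∘L J ∘L p) t := by
  ext x
  have h1 := hsum x
  simp [extendHyperplane_apply, rot, hpU]
  linear_combination (norm := module) h1

/-- The off-diagonal block is scaled away linearly; the shears involved have determinant 1, so
positivity is never lost. -/
theorem GLPos.exists_homotopic_compress [FiniteDimensional ℝ V] (hfU : ∀ u : U, f u = 0)
    (hpe : p e = 0) (N : Path (1 : GLPos V) 1)
    (N' : Path (1 : GLPos V) 1)
    (hN' : ∀ t, (N' t : V →L[ℝ] V) =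
      N t * clmTransvection (f ∘L (N t : V →L[ℝ] V) ∘L U.subtypeL ∘L p) (-(1 : ℝ) • e)) :
    N.Homotopic N' := by
  let F : ℝ → V →L[ℝ] V := fun t => (N.extend t : V →L[ℝ] V)
  have hF : Continuous F := by fun_prop
  refine GLPos.homotopic_of (fun s t => F t *
      clmTransvection (f ∘L F t ∘L U.subtypeL ∘L p) (-s • e)) ?_ ?_ ?_ ?_ ?_ ?_
  · refine Continuous.mul (by fun_prop) ?_
    exact continuous_clmTransvection (by fun_prop) (by fun_prop)
  · intro s t
    rw [continuousLinearMap_det_mul, det_clmTransvection (by simp [hpe]), mul_one]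
    exact (N.extend t).2
  · intro t; ext x; simp [F]
  · intro t; rw [hN']; simp [F]
  · intro s; ext x; simp [F, hfU]
  · intro s; ext x; simp [F, hfU]

/-- This is the inductive step. A loop is made to fix e, then made block diagonal, and thereby
becomes the extension of a loop of the hyperplane, which is homotopic to a multiple rotation. -/
theorem GeneratesLoops.of_hyperplane [FiniteDimensional ℝ V] (hdim : 3 ≤ finrank ℝ V)
    (hfe : f e = 1)
    (hfU : ∀ u : U, f u = 0) (hpe : p e = 0) (hpU : ∀ u : U, p u = u)
    (hsum : ∀ x, (p x : V) + f x • e = x) {J : U →L[ℝ] U} (hJ : GeneratesLoops J) :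
    GeneratesLoops (U.subtypeL ∘L J ∘L p) := by
  obtain ⟨hJ3, hJ⟩ := hJ
  have hι1 : extendHyperplane e f p 1 = 1 := by
    ext x; rw [extendHyperplane_apply, add_comm]; exact hsum x
  have hmem : ∀ B : GLPos U, extendHyperplane e f p B.1 ∈ GLPos V := fun B => by
    rw [mem_GLPos, det_extendHyperplane hfe hfU hpe hpU hsum]; exact B.2
  let φ : C(GLPos U, GLPos V) := ⟨fun B => ⟨extendHyperplane e f p B.1, hmem B⟩,
    Continuous.subtype_mk ((continuous_extendHyperplane e f p).comp continuous_subtype_val) hmem⟩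
  have hφ1 : φ 1 = 1 := Subtype.ext hι1
  have he : e ≠ 0 := fun h => by rw [h, map_zero] at hfe; exact zero_ne_one hfe
  refine ⟨?_, fun M => ?_⟩
  · ext x
    simpa [hpU] using congrArg (fun T : U →L[ℝ] U => ((T (p x) : U) : V)) hJ3
  obtain ⟨N, hMN, hNe⟩ := GLPos.exists_homotopic_fixing hdim he M
  have hdet : ∀ t, 0 < (p ∘L (N t : V →L[ℝ] V) ∘L U.subtypeL).det := by
    intro t
    rw [← det_extendHyperplane hfe hfU hpe hpU hsum, extendHyperplane_compress hsum (hNe t),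
      continuousLinearMap_det_mul, det_clmTransvection (by simp [hpe]), mul_one]
    exact (N t).2
  let P : Path (1 : GLPos U) 1 :=
    { toFun := fun t => ⟨p ∘L (N t : V →L[ℝ] V) ∘L U.subtypeL, hdet t⟩
      continuous_toFun := Continuous.subtype_mk (by fun_prop) _
      source' := Subtype.ext (by ext u; simp [hpU])
      target' := Subtype.ext (by ext u; simp [hpU]) }
  obtain ⟨k, hk⟩ := hJ P
  refine ⟨k, hMN.trans ?_⟩
  refine (GLPos.exists_homotopic_compress hfU hpe N ((P.map φ.continuous).cast
      hφ1.symm hφ1.symm) fun t => extendHyperplane_compress hsum (hNe t)).trans ?_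
  obtain ⟨G⟩ := hk.map φ
  refine ⟨⟨G.toHomotopy.cast ?_ ?_, ?_⟩⟩
  · ext t x; rfl
  · ext t : 1
    exact Subtype.ext (extendHyperplane_rot hpU hsum J _)
  · intro s t ht
    exact G.eq_fst s ht

end Hyperplane

end Reduction

/-! ### Plane rotations generate the fundamental group. -/

section Generation

open Module unitInterval
open scoped RealInnerProductSpace

/-- The representation of a complex number by a complex structure. -/
def complexAction {V : Type*} [NormedAddCommGroup V] [NormedSpace ℝ V] (J : V →L[ℝ] V) (z : ℂ) :
    V →L[ℝ] V := z.re • 1 + z.im • J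

section

variable {V : Type*} [NormedAddCommGroup V] [NormedSpace ℝ V] {J : V →L[ℝ] V}

theorem complexAction_mul (hJ : J * J = -1) (z w : ℂ) :
    complexAction J (z * w) = complexAction J z * complexAction J w := by
  simp only [complexAction, Complex.mul_re, Complex.mul_im, add_mul, mul_add, smul_mul_assoc,
    mul_smul_comm, one_mul, mul_one, hJ]
  module

@[simp] theorem complexAction_one : complexAction J 1 = 1 := by simp [complexAction]

theorem continuous_complexAction : Continuous (complexAction J) := by
  unfold complexAction
  exact (Complex.continuous_re.smul continuous_const).add
    (Complex.continuous_im.smul continuous_const)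

theorem det_complexAction_exp_pos (hJ : J * J = -1) (z : ℂ) :
    0 < (complexAction J (Complex.exp z)).det := by
  have h1 : complexAction J (Complex.exp z) =
      complexAction J (Complex.exp (z / 2)) * complexAction J (Complex.exp (z / 2)) := by
    rw [← complexAction_mul hJ, ← Complex.exp_add, add_halves]
  have h2 : (complexAction J (Complex.exp (z / 2))).det *
      (complexAction J (Complex.exp (-(z / 2)))).det = 1 := by
    rw [← continuousLinearMap_det_mul, ← complexAction_mul hJ, ← Complex.exp_add]
    simp [ContinuousLinearMap.det]
  rw [h1, continuousLinearMap_det_mul]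
  exact mul_self_pos.2 (left_ne_zero_of_mul_eq_one h2)

theorem complexAction_exp_mul_I (hJ : J * J = -1) (t : ℝ) :
    complexAction J (Complex.exp (t * Complex.I)) = rot J t := by
  simp only [complexAction, rot, hJ, Complex.exp_ofReal_mul_I_re, Complex.exp_ofReal_mul_I_im]
  module

end

/-- In dimension two the image of the first basis vector describes a loop in ℂ \ {0}. Dividing by
this loop leaves automorphisms that fix the vector, a convex set under positivity of the
determinant; the loop itself is straightened through its logarithm. -/
theorem exists_generatesLoops_of_finrank_eq_two {V : Type*} [NormedAddCommGroup V]
    [NormedSpace ℝ V] [FiniteDimensional ℝ V] (hdim : finrank ℝ V = 2) :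
    ∃ J : V →L[ℝ] V, IsPlaneGenerator (J : End ℝ V) ∧ GeneratesLoops J := by
  let b : Basis (Fin 2) ℝ V := (finBasis ℝ V).reindex (finCongr hdim)
  let J : V →L[ℝ] V := LinearMap.toContinuousLinearMap
    ((b.coord 0).smulRight (b 1) - (b.coord 1).smulRight (b 0))
  have hJx : ∀ x, J x = b.repr x 0 • b 1 - b.repr x 1 • b 0 := fun x => rfl
  have hexp : ∀ x, b.repr x 0 • b 0 + b.repr x 1 • b 1 = x := by
    intro x
    conv_rhs => rw [← b.sum_repr x, Fin.sum_univ_two]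
  have hJ2 : J * J = -1 := by
    ext x
    have := hexp x
    simp only [mul_apply_eq_comp, hJx, map_sub, map_smul, Basis.repr_self, Finsupp.coe_sub,
      Finsupp.coe_smul, Pi.sub_apply, Pi.smul_apply, neg_apply, one_apply_eq_self]
    simp
    linear_combination (norm := module) -this
  have hgen : IsPlaneGenerator (J : End ℝ V) :=
    ⟨b 0, b 1, b.coord 0, b.coord 1, by simp, by simp, by simp, by simp, rfl⟩
  have hJ3 : J * J * J = -J := by rw [hJ2, neg_one_mul]
  refine ⟨J, hgen, hJ3, fun M => ?_⟩
  let F : ℝ → V →L[ℝ] V := fun t => (M.extend t : V →L[ℝ] V)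
  have hF : Continuous F := by fun_prop
  have hF0 : F 0 = 1 := by simp [F]
  have hF1 : F 1 = 1 := by simp [F]
  have hFpos : ∀ t, 0 < (F t).det := fun t => (M.extend t).2
  -- The complex number that takes `b 0` to its image under F t.
  let z : ℝ → ℂ := fun t => ⟨b.repr (F t (b 0)) 0, b.repr (F t (b 0)) 1⟩
  have hzJ : ∀ t, complexAction J (z t) (b 0) = F t (b 0) := by
    intro t
    simp only [complexAction, z, add_apply, smul_apply, one_apply_eq_self, hJx]
    simpa using hexp (F t (b 0))
  have hz0 : ∀ t, z t ≠ 0 := by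
    intro t h
    have h1 := hzJ t
    rw [h] at h1
    have h2 : (F t) (b 0) = 0 := by rw [← h1]; simp [complexAction]
    have hinj : LinearMap.ker (F t : V →ₗ[ℝ] V) = ⊥ :=
      by_contra fun h0 => (hFpos t).ne' (LinearMap.det_eq_zero_iff_ker_ne_bot.2 h0)
    exact b.ne_zero 0 (LinearMap.ker_eq_bot'.1 hinj _ h2)
  have hcoord : ∀ i, Continuous fun t => b.repr (F t (b 0)) i := fun i =>
    (LinearMap.continuous_of_finiteDimensional (b.coord i)).comp (hF.clm_apply continuous_const)
  have hzc : Continuous z := by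
    have : z = fun t => (b.repr (F t (b 0)) 0 : ℂ) + (b.repr (F t (b 0)) 1 : ℂ) * Complex.I := by
      ext t; exact Complex.mk_eq_add_mul_I _ _
    rw [this]
    have h0 := hcoord 0; have h1 := hcoord 1
    fun_prop
  have hzz : z 0 = 1 := by simp only [z, hF0]; apply Complex.ext <;> simp
  let γ : C(I, {z : ℂ // z ≠ 0}) := ⟨fun t => ⟨z t, hz0 t⟩, by fun_prop⟩
  obtain ⟨Γ, hΓ, hΓ0⟩ := Complex.isCoveringMap_exp.exists_path_lifts γ 0
    (Subtype.ext (by simpa [γ] using hzz))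
  have hΓz : ∀ t : I, Complex.exp (Γ t) = z t := fun t =>
    congrArg Subtype.val (congrFun hΓ t)
  have hz1 : z 1 = 1 := by simp only [z, hF1]; apply Complex.ext <;> simp
  -- The lift through exp ends at 2πik; k is the winding number.
  obtain ⟨k, hk⟩ := Complex.exp_eq_one_iff.1 ((hΓz 1).trans (by simpa using hz1))
  let ζ : ℝ → ℂ := fun t => Γ (projIcc 0 1 zero_le_one t)
  have hζc : Continuous ζ := Γ.continuous.comp continuous_projIcc
  have hζ : ∀ t : I, ζ t = Γ t := fun t => by simp [ζ]
  have hζ0 : ζ 0 = 0 := by simp [ζ, hΓ0]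
  have hζ1 : ζ 1 = k * (2 * Real.pi * Complex.I) := by simp [ζ, hk]
  let R : ℝ → V →L[ℝ] V := fun t => complexAction J (Complex.exp (-ζ t)) * F t
  have hRc : Continuous R :=
    (continuous_complexAction.comp (Complex.continuous_exp.comp hζc.neg)).mul hF
  have hR0 : R 0 = 1 := by simp [R, hζ0, hF0]
  have hR1 : R 1 = 1 := by
    simp only [R, hF1, hζ1, mul_one]
    rw [Complex.exp_neg, Complex.exp_int_mul_two_pi_mul_I]; simp
  have hRb : ∀ t : I, R t (b 0) = b 0 := by
    intro t
    simp only [R, mul_apply_eq_comp]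
    rw [← hzJ, ← hΓz, hζ, ← mul_apply_eq_comp, ← complexAction_mul hJ2, ← Complex.exp_add]
    simp
  have hRpos : ∀ t : I, 0 < (R t).det := by
    intro t
    simp only [R, continuousLinearMap_det_mul]
    exact mul_pos (det_complexAction_exp_pos hJ2 _) (hFpos t)
  have hdet : ∀ T : V →L[ℝ] V, T (b 0) = b 0 → T.det = b.repr (T (b 1)) 1 := by
    intro T hT
    rw [ContinuousLinearMap.det, ← LinearMap.det_toMatrix b, Matrix.det_fin_two]
    simp [LinearMap.toMatrix_apply, hT]
  -- For maps fixing `b 0` the determinant is one diagonal entry, which is affine along the segment.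
  have hseg : ∀ s t : I, 0 < ((1 - (s : ℝ)) • R t + (s : ℝ) • 1).det := by
    intro s t
    have h1 := hRpos t
    rw [hdet _ (hRb t)] at h1
    rw [hdet _ (by simp [hRb]; module)]
    simp only [add_apply, smul_apply, one_apply_eq_self, map_add, map_smul,
      Finsupp.coe_add, Finsupp.coe_smul, Pi.add_apply, Pi.smul_apply, smul_eq_mul,
      Basis.repr_self, Finsupp.single_eq_same, mul_one]
    rcases eq_or_lt_of_le s.2.1 with h0 | h0
    · simpa [← h0] using h1
    · linarith [mul_nonneg (sub_nonneg.2 s.2.2) h1.le]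
  let w : ℝ → ℝ → ℂ := fun s t =>
    (1 - s : ℝ) * ζ t + (s : ℝ) * ((2 * Real.pi * k * t : ℝ) * Complex.I)
  have hwc : Continuous fun p : I × I => w p.1 p.2 := by
    have : Continuous fun p : I × I => ζ p.2 := hζc.comp (by fun_prop)
    fun_prop
  refine ⟨k, GLPos.homotopic_of (fun s t => complexAction J (Complex.exp (w s t)) *
    ((1 - s) • R t + s • 1)) ?_ ?_ ?_ ?_ ?_ ?_⟩
  · refine (continuous_complexAction.comp (Complex.continuous_exp.comp hwc)).mul ?_
    have : Continuous fun p : I × I => R p.2 := hRc.comp (by fun_prop)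
    fun_prop
  · intro s t
    rw [continuousLinearMap_det_mul]
    exact mul_pos (det_complexAction_exp_pos hJ2 _) (hseg s t)
  · intro t
    simp only [w, sub_zero, Complex.ofReal_one, one_mul, Complex.ofReal_zero, zero_mul, add_zero,
      one_smul, zero_smul, R]
    rw [← mul_assoc, ← complexAction_mul hJ2, ← Complex.exp_add]
    simp [F]
  · intro t
    simp only [w, sub_self, Complex.ofReal_one, one_mul, Complex.ofReal_zero, zero_mul, zero_add,
      one_smul, zero_smul, mul_one]
    rw [complexAction_exp_mul_I hJ2]; rfl
  · intro s
    simp only [w, hζ0, hR0]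
    simp
    module
  · intro s
    simp only [w, hζ1, hR1]
    have : ((1 - (s : ℝ) : ℝ) : ℂ) * (k * (2 * Real.pi * Complex.I)) +
        ((s : ℝ) : ℂ) * (((2 * Real.pi * k * 1 : ℝ) : ℂ) * Complex.I) =
        k * (2 * Real.pi * Complex.I) := by push_cast; ring
    rw [this, Complex.exp_int_mul_two_pi_mul_I]
    simp
    module

/-- By induction on the dimension, passing to the hyperplane orthogonal to a unit vector. -/
theorem exists_generatesLoops_of_innerProductSpace (n : ℕ) : ∀ (V : Type u) [NormedAddCommGroup V]
    [InnerProductSpace ℝ V] [FiniteDimensional ℝ V], finrank ℝ V = n + 2 →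
    ∃ J : V →L[ℝ] V, IsPlaneGenerator (J : End ℝ V) ∧ GeneratesLoops J := by
  induction n with
  | zero => intro V _ _ _ h; exact exists_generatesLoops_of_finrank_eq_two h
  | succ n ih =>
    intro V _ _ _ h
    have : Nontrivial V := nontrivial_of_finrank_pos (R := ℝ) (by omega)
    obtain ⟨e, he⟩ := exists_norm_eq V (zero_le_one (α := ℝ))
    let f : V →L[ℝ] ℝ := innerSL ℝ e
    have hfe : f e = 1 := by simp [f, he]
    let U : Submodule ℝ V := LinearMap.ker (f : V →ₗ[ℝ] ℝ)
    have hfU : ∀ u : U, f u = 0 := fun u => u.2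
    let p : V →L[ℝ] U := (ContinuousLinearMap.id ℝ V - f.smulRight e).codRestrict U (by
      intro x
      change f (x - f x • e) = 0
      simp [hfe])
    have hp : ∀ x, (p x : V) = x - f x • e := fun x => rfl
    have hU : finrank ℝ U = n + 2 := by
      have h1 := LinearMap.finrank_range_add_finrank_ker (f : V →ₗ[ℝ] ℝ)
      have h2 : LinearMap.range (f : V →ₗ[ℝ] ℝ) = ⊤ :=
        LinearMap.range_eq_top.2 fun r => ⟨r • e, by simp [hfe]⟩
      rw [h2, finrank_top, finrank_self] at h1
      change finrank ℝ (LinearMap.ker (f : V →ₗ[ℝ] ℝ)) = n + 2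
      omega
    obtain ⟨J, ⟨v, w, g1, g2, a1, a2, a3, a4, hJ⟩, hJ'⟩ := ih U hU
    have hpU : ∀ u : U, p u = u := fun u => Subtype.ext (by simp [hp, hfU])
    refine ⟨U.subtypeL ∘L J ∘L p, ?_, hJ'.of_hyperplane (by omega) hfe hfU
      (Subtype.ext (by simp [hp, hfe])) hpU fun x => by simp [hp]⟩
    refine ⟨v, w, g1 ∘ₗ (p : V →ₗ[ℝ] U), g2 ∘ₗ (p : V →ₗ[ℝ] U), by simp [hpU, a1],
      by simp [hpU, a2], by simp [hpU, a3], by simp [hpU, a4], ?_⟩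
    ext x
    have := congrArg (fun T : End ℝ U => ((T (p x) : U) : V)) hJ
    simpa using this

theorem finrank_ge_two_of_isPlaneGenerator {V : Type*} [AddCommGroup V] [Module ℝ V]
    [FiniteDimensional ℝ V] {J : End ℝ V} (hJ : IsPlaneGenerator J) : 2 ≤ finrank ℝ V := by
  obtain ⟨v, w, f, g, h1, h2, h3, h4, -⟩ := hJ
  have : Function.Surjective (f.prod g) := by
    rintro ⟨a, b⟩
    exact ⟨a • v + b • w, by simp [h1, h2, h3, h4]⟩
  have := LinearMap.finrank_le_finrank_of_surjective this
  simpa using this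

/-- The rotation loop of any plane generates the fundamental group of the group of automorphisms
with positive determinant. -/
theorem IsPlaneGenerator.generatesLoops {V : Type*} [NormedAddCommGroup V] [NormedSpace ℝ V]
    [FiniteDimensional ℝ V] {J : V →L[ℝ] V} (hJ : IsPlaneGenerator (J : End ℝ V)) :
    GeneratesLoops J := by
  obtain ⟨n, hn⟩ := Nat.exists_eq_add_of_le' (finrank_ge_two_of_isPlaneGenerator hJ)
  obtain ⟨K, ⟨v, w, f, g, h1, h2, h3, h4, hKe⟩, hK⟩ := exists_generatesLoops_of_innerProductSpace n
    (EuclideanSpace ℝ (Fin (n + 2))) (by simp)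
  let e : EuclideanSpace ℝ (Fin (n + 2)) ≃L[ℝ] V :=
    ContinuousLinearEquiv.ofFinrankEq (by simp [hn])
  have hK' := hK.conj e
  have hgen : IsPlaneGenerator ((e.toContinuousLinearMap ∘L K ∘L e.symm.toContinuousLinearMap :
      V →L[ℝ] V) : End ℝ V) := by
    refine ⟨e v, e w, f ∘ₗ (e.symm.toLinearEquiv : V →ₗ[ℝ] _),
      g ∘ₗ (e.symm.toLinearEquiv : V →ₗ[ℝ] _), by simp [h1], by simp [h2], by simp [h3],
      by simp [h4], ?_⟩
    ext x
    have := congrArg (fun T : End ℝ _ => e (T (e.symm x))) hKe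
    simpa using this
  obtain ⟨E, hE⟩ := hgen.exists_conj hJ
  have := hK'.conj E.toContinuousLinearEquiv
  convert this using 1
  ext x
  exact (congrArg (fun T : End ℝ V => T x) hE).symm

end Generation

/-! ### Retraction to SO(n) and a smooth generating loop. -/

section SpecialOrthogonal

open Module unitInterval InnerProductSpace

variable {Y : Type*} [TopologicalSpace Y]

theorem continuous_gramSchmidt {E ι : Type*} [NormedAddCommGroup E] [InnerProductSpace ℝ E]
    [LinearOrder ι] [LocallyFiniteOrderBot ι] [WellFoundedLT ι] {f : Y → ι → E}
    (hf : Continuous f) (hli : ∀ y, LinearIndependent ℝ (f y)) (i : ι) :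
    Continuous fun y => gramSchmidt ℝ (f y) i := by
  induction i using WellFoundedLT.induction with
  | ind i ih =>
    have h : (fun y => gramSchmidt ℝ (f y) i) = fun y => f y i - ∑ j ∈ Finset.Iio i,
        (inner ℝ (gramSchmidt ℝ (f y) j) (f y i) / ‖gramSchmidt ℝ (f y) j‖ ^ 2) •
          gramSchmidt ℝ (f y) j := by
      funext y
      exact eq_sub_of_add_eq (gramSchmidt_def'' ℝ (f y) i).symm
    rw [h]
    have hfi : Continuous fun y => f y i := (continuous_apply i).comp hf
    refine hfi.sub (continuous_finsetSum _ fun j hj => ?_)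
    have hj' := ih j (Finset.mem_Iio.1 hj)
    refine ((hj'.inner hfi).div (hj'.norm.pow 2) fun y => ?_).smul hj'
    exact pow_ne_zero _ (norm_ne_zero_iff.2 (gramSchmidt_ne_zero _ (hli y)))

/-- These are the diagonal entries of the triangular change of basis; their positivity makes
orthonormalization preserve orientation. -/
theorem inner_gramSchmidtNormed_pos {E ι : Type*} [NormedAddCommGroup E] [InnerProductSpace ℝ E]
    [LinearOrder ι] [LocallyFiniteOrderBot ι] [WellFoundedLT ι] {f : ι → E}
    (hli : LinearIndependent ℝ f) (i : ι) :
    0 < inner ℝ (gramSchmidtNormed ℝ f i) (f i) := by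
  have h0 : gramSchmidt ℝ f i ≠ 0 := gramSchmidt_ne_zero i hli
  have h : inner ℝ (gramSchmidt ℝ f i) (f i) = ‖gramSchmidt ℝ f i‖ ^ 2 := by
    conv_lhs => rw [gramSchmidt_def'' ℝ f i]
    rw [inner_add_right, inner_sum, Finset.sum_eq_zero, add_zero, real_inner_self_eq_norm_sq]
    intro j hj
    rw [inner_smul_right, gramSchmidt_orthogonal ℝ f (Finset.mem_Iio.1 hj).ne', mul_zero]
  have hn := norm_pos_iff.2 h0
  rw [gramSchmidtNormed, inner_smul_left, h]
  simp only [conj_trivial]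
  change 0 < ‖gramSchmidt ℝ f i‖⁻¹ * ‖gramSchmidt ℝ f i‖ ^ 2
  positivity

variable {n : ℕ}

local notation "E" => EuclideanSpace ℝ (Fin n)

/-- The frame of images of the standard basis vectors. -/
def standardFrame (T : E →L[ℝ] E) (i : Fin n) : E := T (EuclideanSpace.basisFun (Fin n) ℝ i)

theorem continuous_standardFrame : Continuous (standardFrame (n := n)) := by
  unfold standardFrame; fun_prop

theorem det_standardFrame (T : E →L[ℝ] E) :
    (EuclideanSpace.basisFun (Fin n) ℝ).toBasis.det (standardFrame T) = T.det := by
  have := (EuclideanSpace.basisFun (Fin n) ℝ).toBasis.det_comp (T : E →ₗ[ℝ] E)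
    (EuclideanSpace.basisFun (Fin n) ℝ).toBasis
  rw [Basis.det_self, mul_one] at this
  rw [ContinuousLinearMap.det, ← this]
  congr 1

theorem linearIndependent_standardFrame {T : E →L[ℝ] E} (hT : T ∈ GLPos E) :
    LinearIndependent ℝ (standardFrame T) :=
  (Basis.is_basis_iff_det (EuclideanSpace.basisFun (Fin n) ℝ).toBasis).2
    (by rw [det_standardFrame]; exact isUnit_iff_ne_zero.2 (ne_of_gt hT)) |>.1

/-- The determinant of the frame is that of the orthonormalized frame times the product of the
positive diagonal entries. -/
theorem det_gramSchmidtNormed_standardFrame {T : E →L[ℝ] E} (hT : T ∈ GLPos E) :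
    (Matrix.of fun i j => (gramSchmidtNormed ℝ (standardFrame T) j).ofLp i) ∈
      Matrix.specialOrthogonalGroup (Fin n) ℝ := by
  set f := standardFrame T
  have hf : LinearIndependent ℝ f := linearIndependent_standardFrame hT
  have ho : Orthonormal ℝ (gramSchmidtNormed ℝ f) := gramSchmidtNormed_orthonormal hf
  set M : Matrix (Fin n) (Fin n) ℝ :=
    Matrix.of fun i j => (gramSchmidtNormed ℝ f j).ofLp i with hM
  have hfr : finrank ℝ E = Fintype.card (Fin n) := by simp
  let q := gramSchmidtOrthonormalBasis hfr f
  have hq : ∀ i, q i = gramSchmidtNormed ℝ f i := fun i =>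
    gramSchmidtOrthonormalBasis_apply hfr (ho.ne_zero i)
  have hMq : M = (EuclideanSpace.basisFun (Fin n) ℝ).toBasis.toMatrix q.toBasis := by
    ext i j
    simp [hM, Basis.toMatrix_apply, hq]
  have horth : M.transpose * M = 1 := by
    ext i j
    have := orthonormal_iff_ite.1 ho i j
    rw [Matrix.one_apply, ← this, Matrix.mul_apply]
    simp [hM, PiLp.inner_apply, mul_comm]
  have hpos : 0 < M.det := by
    have h1 : (EuclideanSpace.basisFun (Fin n) ℝ).toBasis.det f = M.det * q.toBasis.det f := by
      rw [hMq, Basis.det_apply, Basis.det_apply, ← Matrix.det_mul, Basis.toMatrix_mul_toMatrix]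
    have h2 : 0 < q.toBasis.det f := by
      rw [gramSchmidtOrthonormalBasis_det]
      refine Finset.prod_pos fun i _ => ?_
      change 0 < inner ℝ (q i) (f i)
      rw [hq]
      exact inner_gramSchmidtNormed_pos hf i
    have h3 : 0 < M.det * q.toBasis.det f := by
      rw [← h1, det_standardFrame]; exact hT
    exact (pos_iff_pos_of_mul_pos h3).2 h2
  refine Matrix.mem_specialOrthogonalGroup_iff.2 ⟨(Matrix.mem_orthogonalGroup_iff' _ _).2 horth, ?_⟩
  have := congrArg Matrix.det horth
  rw [Matrix.det_mul, Matrix.det_transpose, Matrix.det_one] at this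
  nlinarith

/-- The Gram–Schmidt retraction onto the special orthogonal group. -/
def GLPos.gramSchmidt : C(GLPos E, Matrix.specialOrthogonalGroup (Fin n) ℝ) where
  toFun T := ⟨_, det_gramSchmidtNormed_standardFrame T.2⟩
  continuous_toFun := by
    refine Continuous.subtype_mk (continuous_matrix fun i j => ?_) _
    have h := continuous_gramSchmidt (f := fun T : GLPos E => standardFrame T.1)
      (continuous_standardFrame.comp continuous_subtype_val)
      (fun T => linearIndependent_standardFrame T.2) j
    have h2 : Continuous fun T : GLPos E => gramSchmidtNormed ℝ (standardFrame T.1) j := by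
      unfold gramSchmidtNormed
      have h3 : Continuous fun T : GLPos E => (‖_root_.InnerProductSpace.gramSchmidt ℝ (standardFrame T.1) j‖)⁻¹ := by
        refine (h.norm.inv₀ fun T => ?_)
        exact norm_ne_zero_iff.2 (gramSchmidt_ne_zero _ (linearIndependent_standardFrame T.2))
      exact h3.smul h
    exact (EuclideanSpace.proj (𝕜 := ℝ) i).continuous.comp h2

theorem det_toEuclideanCLM (A : Matrix (Fin n) (Fin n) ℝ) :
    (Matrix.toEuclideanCLM (𝕜 := ℝ) A).det = A.det := by
  rw [ContinuousLinearMap.det, Matrix.coe_toEuclideanCLM_eq_toEuclideanLin,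
    Matrix.toEuclideanLin_eq_toLin_orthonormal, LinearMap.det_toLin]

/-- The special orthogonal group as a subgroup of the automorphisms with positive determinant. -/
def specialOrthogonalToGLPos : C(Matrix.specialOrthogonalGroup (Fin n) ℝ, GLPos E) where
  toFun A := ⟨Matrix.toEuclideanCLM (𝕜 := ℝ) A.1, by
    rw [mem_GLPos, det_toEuclideanCLM, (Matrix.mem_specialOrthogonalGroup_iff.1 A.2).2]
    exact one_pos⟩
  continuous_toFun := by
    refine Continuous.subtype_mk ?_ _
    exact (LinearMap.continuous_of_finiteDimensional
      (Matrix.toEuclideanCLM (n := Fin n) (𝕜 := ℝ)).toAlgEquiv.toLinearMap).comp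
      continuous_subtype_val

theorem GLPos.gramSchmidt_toGLPos (A : Matrix.specialOrthogonalGroup (Fin n) ℝ) :
    GLPos.gramSchmidt (specialOrthogonalToGLPos A) = A := by
  obtain ⟨A, hA⟩ := A
  have h := (Matrix.mem_orthogonalGroup_iff' _ _).1 (Matrix.mem_specialOrthogonalGroup_iff.1 hA).1
  have hcol : ∀ i j, (standardFrame (Matrix.toEuclideanCLM (𝕜 := ℝ) A) j).ofLp i = A i j := by
    intro i j
    simp [standardFrame]
  have ho : Orthonormal ℝ (standardFrame (Matrix.toEuclideanCLM (𝕜 := ℝ) A)) := by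
    refine orthonormal_iff_ite.2 fun i j => ?_
    rw [← Matrix.one_apply, ← h, Matrix.mul_apply]
    simp [PiLp.inner_apply, hcol, mul_comm]
  apply Subtype.ext
  ext i j
  change (gramSchmidtNormed ℝ (standardFrame (Matrix.toEuclideanCLM (𝕜 := ℝ) A)) j).ofLp i = A i j
  rw [gramSchmidtNormed, gramSchmidt_of_orthogonal ℝ fun i j hij => ho.2 hij, ho.1 j]
  simp [hcol]

/-- The infinitesimal rotation of the first two coordinates. -/
def standardGenerator (m : ℕ) : Matrix (Fin (m + 2)) (Fin (m + 2)) ℝ :=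
  Matrix.single 1 0 1 - Matrix.single 0 1 1

theorem standardGenerator_cube (m : ℕ) :
    standardGenerator m * standardGenerator m * standardGenerator m = -standardGenerator m := by
  have h1 : ¬ (1 : Fin (m + 2)) = 0 := by simp
  simp [standardGenerator, sub_mul, mul_sub, Matrix.single_mul_single_of_ne, h1]
  abel

theorem isPlaneGenerator_standardGenerator (m : ℕ) : IsPlaneGenerator
    ((Matrix.toEuclideanCLM (𝕜 := ℝ) (standardGenerator m) :
      EuclideanSpace ℝ (Fin (m + 2)) →L[ℝ] EuclideanSpace ℝ (Fin (m + 2))) :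
      End ℝ (EuclideanSpace ℝ (Fin (m + 2)))) := by
  refine ⟨EuclideanSpace.single 0 1, EuclideanSpace.single 1 1,
    (EuclideanSpace.proj (𝕜 := ℝ) 0 : EuclideanSpace ℝ (Fin (m + 2)) →L[ℝ] ℝ),
    (EuclideanSpace.proj (𝕜 := ℝ) 1 : EuclideanSpace ℝ (Fin (m + 2)) →L[ℝ] ℝ),
    by simp, by simp, by simp, by simp, ?_⟩
  ext x i
  simp [standardGenerator, Matrix.mulVec, dotProduct, Matrix.single_apply, ite_and, eq_comm (b := i)]

theorem rot_standardGenerator_mem {m : ℕ} (t : ℝ) :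
    rot (standardGenerator m) t ∈ Matrix.specialOrthogonalGroup (Fin (m + 2)) ℝ := by
  have hT : (standardGenerator m).transpose = -standardGenerator m := by
    simp [standardGenerator]
  have ho : ∀ t, (rot (standardGenerator m) t).transpose * rot (standardGenerator m) t = 1 := by
    intro t
    have : (rot (standardGenerator m) t).transpose = rot (standardGenerator m) (-t) := by
      simp [rot, hT]
    rw [this, ← rot_add (standardGenerator_cube m), neg_add_cancel, rot_zero]
  refine Matrix.mem_specialOrthogonalGroup_iff.2
    ⟨(Matrix.mem_orthogonalGroup_iff' _ _).2 (ho t), ?_⟩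
  have h := congrArg Matrix.det (ho (t / 2))
  rw [Matrix.det_mul, Matrix.det_transpose, Matrix.det_one] at h
  rw [← add_halves t, rot_add (standardGenerator_cube m), Matrix.det_mul, h]

/-- The rotations of the first two coordinates. -/
def rotationLine (m : ℕ) : C(ℝ, Matrix.specialOrthogonalGroup (Fin (m + 2)) ℝ) where
  toFun s := ⟨rot (standardGenerator m) (2 * Real.pi * s), rot_standardGenerator_mem _⟩
  continuous_toFun := by
    refine Continuous.subtype_mk ?_ _
    unfold rot
    fun_prop

theorem toEuclideanCLM_rotationLine (m : ℕ) (s : ℝ) :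
    Matrix.toEuclideanCLM (𝕜 := ℝ) (rotationLine m s).1 =
      rot (Matrix.toEuclideanCLM (𝕜 := ℝ) (standardGenerator m)) (2 * Real.pi * s) :=
  map_rot (Matrix.toEuclideanCLM (n := Fin (m + 2)) (𝕜 := ℝ)) _ _

/-- The loop obtained from a `1`-periodic line `R` by running along `R ∘ u`. -/
def windLoop (R : C(ℝ, Y)) (y : Y) (u : C(ℝ, ℝ)) (h0 : R (u 0) = y) (h1 : R (u 1) = y) :
    Path y y where
  toFun t := R (u t)
  continuous_toFun := by fun_prop
  source' := by simpa using h0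
  target' := by simpa using h1

/-- Reparametrisations with equal ends are joined by convex combination inside the line. Running
first through u and then through v adds their end values, by periodicity of R, so the class depends
on the winding number through a power. -/
theorem fromPath_windLoop (R : C(ℝ, Y)) (hR : ∀ (t : ℝ) (k : ℤ), R (t + k) = R t) (y : Y)
    (h0 : R 0 = y) (k : ℤ) (u : C(ℝ, ℝ)) (hu0 : u 0 = 0) (hu : u 1 = k) (a0 a1)
    (v : C(ℝ, ℝ)) (hv0 : v 0 = 0) (hv : v 1 = 1) (b0 b1) :
    FundamentalGroup.fromPath (Path.Homotopic.Quotient.mk (windLoop R y u a0 a1)) =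
    FundamentalGroup.fromPath (Path.Homotopic.Quotient.mk (windLoop R y v b0 b1)) ^ k := by
  have hint : ∀ k : ℤ, R k = y := fun k => by simpa [h0] using hR 0 k
  have key : ∀ (u v : C(ℝ, ℝ)) (_ : u 0 = v 0) (_ : u 1 = v 1) (a0 a1 b0 b1),
      FundamentalGroup.fromPath (Path.Homotopic.Quotient.mk (windLoop R y u a0 a1)) =
      FundamentalGroup.fromPath (Path.Homotopic.Quotient.mk (windLoop R y v b0 b1)) := by
    intro u v huv0 huv1 a0 a1 b0 b1
    refine congrArg FundamentalGroup.fromPath (Quotient.sound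
      (s := Path.Homotopic.setoid y y) ⟨⟨⟨⟨fun p => R ((1 - (p.1 : ℝ)) * u p.2 + p.1 * v p.2),
        by fun_prop⟩, ?_, ?_⟩, ?_⟩⟩)
    · intro t; simp [windLoop]
    · intro t; simp [windLoop]
    · rintro s t (rfl | rfl)
      · simp only [windLoop, ContinuousMap.coe_mk, Icc.coe_zero, huv0]
        ring_nf
      · simp only [windLoop, ContinuousMap.coe_mk, Icc.coe_one, huv1]
        ring_nf
  have hmul : ∀ (u v : C(ℝ, ℝ)) (k : ℤ) (a0 a1 b0 b1 c0 c1), u 0 = 0 → u 1 = k → v 0 = 0 →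
      FundamentalGroup.fromPath (Path.Homotopic.Quotient.mk (windLoop R y
        ⟨fun t => u (min (2 * t) 1) + v (max (2 * t - 1) 0), by fun_prop⟩ c0 c1)) =
      FundamentalGroup.fromPath (Path.Homotopic.Quotient.mk (windLoop R y v b0 b1)) *
      FundamentalGroup.fromPath (Path.Homotopic.Quotient.mk (windLoop R y u a0 a1)) := by
    intro u v k a0 a1 b0 b1 c0 c1 hu0 hu1 hv0
    -- In a product of classes the right factor is run through first.
    rw [FundamentalGroup.mul_def]
    refine Eq.trans ?_ (Path.Homotopic.Quotient.mk_trans _ _)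
    refine congrArg Path.Homotopic.Quotient.mk ?_
    ext t
    rw [Path.trans_apply]
    split_ifs with ht
    · change R (u _ + v _) = R (u (2 * t))
      rw [min_eq_left (by linarith), max_eq_right (by linarith), hv0, add_zero]
    · change R (u _ + v _) = R (v (2 * t - 1))
      rw [min_eq_right (by linarith), max_eq_left (by linarith), hu1, add_comm, hR]
  have hlin : ∀ k : ℤ, ∀ c0 c1, FundamentalGroup.fromPath (Path.Homotopic.Quotient.mk
      (windLoop R y ⟨fun t => k * t, by fun_prop⟩ c0 c1)) =
      FundamentalGroup.fromPath (Path.Homotopic.Quotient.mk (windLoop R y v b0 b1)) ^ k := by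
    have step : ∀ k : ℤ, ∀ c0 c1 d0 d1, FundamentalGroup.fromPath (Path.Homotopic.Quotient.mk
        (windLoop R y ⟨fun t => (k + 1 : ℤ) * t, by fun_prop⟩ c0 c1)) =
        FundamentalGroup.fromPath (Path.Homotopic.Quotient.mk (windLoop R y v b0 b1)) *
        FundamentalGroup.fromPath (Path.Homotopic.Quotient.mk
        (windLoop R y ⟨fun t => k * t, by fun_prop⟩ d0 d1)) := by
      intro k c0 c1 d0 d1
      rw [← hmul _ v k d0 d1 b0 b1 (by simp [hv0, h0])
        (by norm_num [hv]; exact_mod_cast hint (k + 1)) (by simp) (by simp) hv0]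
      exact key _ _ (by simp [hv0]) (by norm_num [hv]) _ _ _ _
    have hc0 : ∀ k : ℤ, R ((⟨fun t => k * t, by fun_prop⟩ : C(ℝ, ℝ)) 0) = y := by simp [h0]
    have hc1 : ∀ k : ℤ, R ((⟨fun t => k * t, by fun_prop⟩ : C(ℝ, ℝ)) 1) = y := by
      simpa using hint
    intro k
    induction k with
    | zero =>
      intro c0 c1
      rw [zpow_zero]
      refine Eq.trans ?_ (rfl : FundamentalGroup.fromPath (Path.Homotopic.Quotient.mk
        (Path.refl y)) = 1)
      refine congrArg FundamentalGroup.fromPath (congrArg Path.Homotopic.Quotient.mk ?_)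
      ext t
      simp [windLoop, h0]
    | succ k ih =>
      intro c0 c1
      rw [step k c0 c1 (hc0 _) (hc1 _), ih (hc0 _) (hc1 _), add_comm, zpow_one_add]
    | pred k ih =>
      intro c0 c1
      have h := step (-k - 1) (hc0 _) (hc1 _) c0 c1
      have h2 := ih (hc0 _) (hc1 _)
      rw [show ((-(k : ℤ) - 1) + 1) = -(k : ℤ) by ring, h2] at h
      have e : ∀ p : FundamentalGroup Y y, p ^ (-(k : ℤ) - 1) = p⁻¹ * p ^ (-(k : ℤ)) := fun p => by
        rw [← zpow_neg_one, ← zpow_add, sub_eq_neg_add]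
      rw [e, h, inv_mul_cancel_left]
  rw [← hlin k (by simp [h0]) (by simpa using hint k)]
  exact key _ _ (by simpa using hu0) (by simpa using hu) _ _ _ _

/-- The profile of a Dehn twist. -/
def twistProfile (t : ℝ) : ℝ := Real.smoothTransition (3 * t - 1)

theorem contDiff_twistProfile : ContDiff ℝ ∞ twistProfile :=
  Real.smoothTransition.contDiff.comp (by fun_prop)

theorem twistProfile_of_le {t : ℝ} (ht : t ≤ 1 / 3) : twistProfile t = 0 :=
  Real.smoothTransition.zero_of_nonpos (by linarith)

theorem twistProfile_of_ge {t : ℝ} (ht : 2 / 3 ≤ t) : twistProfile t = 1 :=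
  Real.smoothTransition.one_of_one_le (by linarith)

theorem rotationLine_add_int (m : ℕ) (t : ℝ) (k : ℤ) :
    rotationLine m (t + k) = rotationLine m t := by
  apply Subtype.ext
  change rot _ _ = rot _ _
  rw [mul_add, rot_add (standardGenerator_cube m), mul_comm (2 * Real.pi) (k : ℝ),
    mul_comm (k : ℝ), rot_two_pi_mul_int, mul_one]

theorem rotationLine_zero (m : ℕ) : rotationLine m 0 = 1 := by
  apply Subtype.ext
  change rot _ _ = 1
  simp

/-- There is a smooth loop of rotations in a plane, constant near its ends, whose class generates
the fundamental group of the special orthogonal group. -/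
theorem exists_generating_rotation_loop (hn : 2 ≤ n) : ∃ J : E →L[ℝ] E,
    IsPlaneGenerator (J : End ℝ E) ∧ (∀ t v, ‖rot J t v‖ = ‖v‖) ∧
    ∃ α : Path (1 : Matrix.specialOrthogonalGroup (Fin n) ℝ) 1,
      (∀ t, Matrix.toEuclideanCLM (𝕜 := ℝ) (α.extend t).1 =
        rot J (2 * Real.pi * twistProfile t)) ∧
      (∀ i j, ContDiff ℝ ∞ (fun t => (α.extend t).1 i j)) ∧
      (∃ ε > 0, ∀ t, t < ε ∨ 1 - ε < t → α.extend t = 1) ∧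
      Subgroup.zpowers (FundamentalGroup.fromPath (Path.Homotopic.Quotient.mk α)) = ⊤ := by
  obtain ⟨m, rfl⟩ := Nat.exists_eq_add_of_le' hn
  have hR0 := rotationLine_zero m
  have hR1 : rotationLine m 1 = 1 := by
    have := rotationLine_add_int m 0 1
    simpa [hR0] using this
  let v : C(ℝ, ℝ) := ⟨twistProfile, contDiff_twistProfile.continuous⟩
  have hv0 : v 0 = 0 := twistProfile_of_le (by norm_num)
  have hv1 : v 1 = 1 := twistProfile_of_ge (by norm_num)
  let α := windLoop (rotationLine m) 1 v (by rw [hv0, hR0]) (by rw [hv1, hR1])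
  have hα : ∀ t, α.extend t = rotationLine m (twistProfile t) := by
    intro t
    rcases le_total t 0 with ht | ht
    · rw [Path.extend_of_le_zero _ ht, twistProfile_of_le (by linarith), hR0]
    rcases le_total 1 t with ht' | ht'
    · rw [Path.extend_of_one_le _ ht', twistProfile_of_ge (by linarith), hR1]
    · rw [Path.extend_apply _ ⟨ht, ht'⟩]; rfl
  refine ⟨Matrix.toEuclideanCLM (𝕜 := ℝ) (standardGenerator m),
    isPlaneGenerator_standardGenerator m, ?_, α, ?_, ?_, ⟨1 / 3, by norm_num, ?_⟩, ?_⟩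
  · intro t w
    have h := (Matrix.mem_orthogonalGroup_iff' _ _).1
      (Matrix.mem_specialOrthogonalGroup_iff.1 (rot_standardGenerator_mem (m := m) t)).1
    have hmap := map_rot (Matrix.toEuclideanCLM (n := Fin (m + 2)) (𝕜 := ℝ)) (standardGenerator m) t
    rw [← hmap, ← sq_eq_sq₀ (norm_nonneg _) (norm_nonneg _), EuclideanSpace.real_norm_sq_eq,
      EuclideanSpace.real_norm_sq_eq]
    have h1 : ∀ z : Fin (m + 2) → ℝ, ∑ i, z i ^ 2 = z ⬝ᵥ z := fun z => by
      simp [dotProduct, sq]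
    rw [h1, h1, Matrix.ofLp_toEuclideanCLM, Matrix.dotProduct_mulVec, ← Matrix.mulVec_transpose,
      Matrix.mulVec_mulVec, h, Matrix.one_mulVec]
  · intro t; rw [hα, toEuclideanCLM_rotationLine]
  · intro i j
    simp only [hα]
    have h1 := contDiff_twistProfile
    change ContDiff ℝ ∞ fun t => (rot (standardGenerator m) (2 * Real.pi * twistProfile t)) i j
    simp only [rot, Matrix.add_apply, Matrix.smul_apply, smul_eq_mul]
    have h2 : ContDiff ℝ ∞ fun t => Real.sin (2 * Real.pi * twistProfile t) := by fun_prop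
    have h3 : ContDiff ℝ ∞ fun t => Real.cos (2 * Real.pi * twistProfile t) := by fun_prop
    fun_prop
  · rintro t (ht | ht)
    · rw [hα, twistProfile_of_le ht.le, hR0]
    · rw [hα, twistProfile_of_ge (by linarith), hR1]
  · rw [eq_top_iff]
    rintro p -
    induction p using Path.Homotopic.Quotient.ind with
    | _ M =>
    obtain ⟨hJ, hgen⟩ := (isPlaneGenerator_standardGenerator m).generatesLoops
    have hι1 : specialOrthogonalToGLPos (1 : Matrix.specialOrthogonalGroup (Fin (m + 2)) ℝ) = 1 :=
      Subtype.ext (map_one (Matrix.toEuclideanCLM (n := Fin (m + 2)) (𝕜 := ℝ)))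
    obtain ⟨k, hk⟩ := hgen ((M.map specialOrthogonalToGLPos.continuous).cast hι1.symm hι1.symm)
    -- A loop in SO(n) is a multiple rotation up to homotopy in the larger group; the Gram–Schmidt
    -- retraction brings the homotopy back and fixes both ends, which lie in SO(n) already.
    have hr := hk.map GLPos.gramSchmidt
    have hr1 : GLPos.gramSchmidt (1 : GLPos (EuclideanSpace ℝ (Fin (m + 2)))) = 1 := by
      rw [← hι1, GLPos.gramSchmidt_toGLPos]
    let u : C(ℝ, ℝ) := ⟨fun t => k * t, by fun_prop⟩
    have hu1 : rotationLine m (u 1) = 1 := by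
      have := rotationLine_add_int m 0 k
      simpa [u, hR0] using this
    refine ⟨k, ?_⟩
    refine (fromPath_windLoop (rotationLine m) (rotationLine_add_int m) 1 hR0 k u (by simp [u])
      (by simp [u]) (by simp [u, hR0]) hu1 v hv0 hv1 _ _).symm.trans ?_
    refine congrArg FundamentalGroup.fromPath (Quotient.sound
      (s := Path.Homotopic.setoid _ _) ?_)
    obtain ⟨H⟩ := hr.symm
    refine ⟨⟨⟨H.toContinuousMap, ?_, ?_⟩, ?_⟩⟩
    · intro t
      refine (H.apply_zero t).trans ?_
      change GLPos.gramSchmidt (rotLoop _ hJ k t) = rotationLine m (u t)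
      rw [← GLPos.gramSchmidt_toGLPos (rotationLine m (u t))]
      congr 1
      apply Subtype.ext
      rw [coe_rotLoop]
      refine Eq.trans ?_ (toEuclideanCLM_rotationLine m _).symm
      simp only [u, ContinuousMap.coe_mk, mul_assoc]
    · intro t
      refine (H.apply_one t).trans ?_
      exact GLPos.gramSchmidt_toGLPos (M t)
    · rintro s t (rfl | rfl)
      · refine (H.source s).trans ?_
        simp [windLoop, u, hR0, hr1]
      · refine (H.target s).trans ?_
        change _ = rotationLine m (u (1 : I))
        rw [Icc.coe_one, hu1, hr1]

end SpecialOrthogonal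

/-! ### Smooth families of diffeomorphisms and their inverses. -/

section SmoothPaths

/-- The inverse function theorem applied to (t, u) ↦ (t, G(t, u)), whose differential is block
triangular. -/
theorem exists_local_inverse_family {E : Type*} [NormedAddCommGroup E] [NormedSpace ℝ E]
    [FiniteDimensional ℝ E] {G : ℝ × E → E} {t₀ : ℝ} {u₀ : E} (hG : ContDiffAt ℝ ∞ G (t₀, u₀))
    (hinj : Function.Injective (fderiv ℝ (fun u => G (t₀, u)) u₀)) :
    ∃ L : ℝ × E → E, ContDiffAt ℝ ∞ L (t₀, G (t₀, u₀)) ∧ L (t₀, G (t₀, u₀)) = u₀ ∧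
      ∀ᶠ q in 𝓝 (t₀, G (t₀, u₀)), G (q.1, L q) = q.2 := by
  have : CompleteSpace E := FiniteDimensional.complete ℝ E
  let F : ℝ × E → ℝ × E := fun p => (p.1, G p)
  have hF : ContDiffAt ℝ ∞ F (t₀, u₀) := contDiffAt_fst.prodMk hG
  have hGd : HasFDerivAt G (fderiv ℝ G (t₀, u₀)) (t₀, u₀) :=
    (hG.differentiableAt (by simp)).hasFDerivAt
  have hF1 : HasFDerivAt F ((ContinuousLinearMap.fst ℝ ℝ E).prod (fderiv ℝ G (t₀, u₀)))
      (t₀, u₀) := hasFDerivAt_fst.prodMk hGd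
  have hpart : fderiv ℝ (fun u => G (t₀, u)) u₀ =
      (fderiv ℝ G (t₀, u₀)).comp (ContinuousLinearMap.inr ℝ ℝ E) :=
    (hGd.comp u₀ (hasFDerivAt_prodMk_right t₀ u₀)).fderiv
  have hinj' : Function.Injective
      (((ContinuousLinearMap.fst ℝ ℝ E).prod (fderiv ℝ G (t₀, u₀)) : ℝ × E →L[ℝ] ℝ × E) :
        ℝ × E →ₗ[ℝ] ℝ × E) := by
    rw [injective_iff_map_eq_zero]
    rintro ⟨s, u⟩ h
    have hs : s = 0 := congrArg Prod.fst h
    have hu : fderiv ℝ G (t₀, u₀) (s, u) = 0 := congrArg Prod.snd h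
    subst hs
    rw [Prod.mk_eq_zero]
    refine ⟨rfl, hinj ?_⟩
    rw [hpart, map_zero]
    exact hu
  let e : (ℝ × E) ≃L[ℝ] ℝ × E := (LinearEquiv.ofInjectiveEndo _ hinj').toContinuousLinearEquiv
  have he : HasFDerivAt F (e : ℝ × E →L[ℝ] ℝ × E) (t₀, u₀) := by
    have : (e : ℝ × E →L[ℝ] ℝ × E) =
        (ContinuousLinearMap.fst ℝ ℝ E).prod (fderiv ℝ G (t₀, u₀)) := by ext x <;> rfl
    rwa [this]
  have hinv := hF.to_localInverse he (by simp)
  have hev := (hF.hasStrictFDerivAt' he (by simp)).eventually_right_inverse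
  have hval := hF.localInverse_apply_image he (by simp)
  refine ⟨fun q => (hF.localInverse he (by simp) q).2, contDiffAt_snd.comp _ hinv,
    congrArg Prod.snd hval, ?_⟩
  filter_upwards [hev] with q hq
  change F (hF.localInverse he (by simp) q) = q at hq
  have h1 : (hF.localInverse he (by simp) q).1 = q.1 := (Prod.ext_iff.1 hq).1
  have h2 : G (hF.localInverse he (by simp) q) = q.2 := (Prod.ext_iff.1 hq).2
  rw [← h1, Prod.mk.eta, h2]

/-- A jointly smooth family of perturbations of the identity of a vector space by maps with
Lipschitz constant `1/2` consists of diffeomorphisms, and the inverses are jointly smooth. -/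
theorem exists_perm_of_perturbation {E : Type*} [NormedAddCommGroup E] [NormedSpace ℝ E]
    [FiniteDimensional ℝ E] {p : ℝ × E → E} (hp : ContDiff ℝ ∞ p)
    (hd : ∀ t u, ‖fderiv ℝ (fun u => p (t, u)) u‖ ≤ 1 / 2) :
    ∃ h : ℝ → Equiv.Perm E, (∀ t u, h t u = u - p (t, u)) ∧
      ContDiff ℝ ∞ (fun q : ℝ × E => (h q.1).symm q.2) := by
  have : CompleteSpace E := FiniteDimensional.complete ℝ E
  have hpt : ∀ t, ContDiff ℝ ∞ fun u => p (t, u) := fun t => by fun_prop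
  have hdiff : ∀ t, Differentiable ℝ fun u => p (t, u) := fun t => (hpt t).differentiable (by simp)
  have hlip : ∀ t, LipschitzWith (1 / 2) fun u => p (t, u) := fun t =>
    lipschitzWith_of_nnnorm_fderiv_le (hdiff t) fun u => by
      rw [← NNReal.coe_le_coe]; simpa using hd t u
  have hbij : ∀ t, Function.Bijective fun u => u - p (t, u) := by
    intro t
    constructor
    · intro u v huv
      have h1 : u - v = p (t, u) - p (t, v) := by
        exact sub_eq_sub_iff_sub_eq_sub.1 huv
      have h2 := (hlip t).norm_sub_le u v
      rw [← h1] at h2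
      have h3 : ((1 / 2 : NNReal) : ℝ) = 1 / 2 := by simp
      rw [h3] at h2
      have : ‖u - v‖ = 0 := by linarith [norm_nonneg (u - v)]
      exact sub_eq_zero.1 (norm_eq_zero.1 this)
    · intro w
      -- Solving u - p(t, u) = w amounts to finding a fixed point of this contraction.
      have hc : ContractingWith (1 / 2) fun u => w + p (t, u) := by
        refine ⟨by norm_num, LipschitzWith.of_dist_le_mul fun u v => ?_⟩
        rw [dist_add_left]
        exact (hlip t).dist_le_mul u v
      refine ⟨hc.fixedPoint, ?_⟩
      have := hc.fixedPoint_isFixedPt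
      change w + p (t, hc.fixedPoint) = hc.fixedPoint at this
      change hc.fixedPoint - p (t, hc.fixedPoint) = w
      exact sub_eq_of_eq_add this.symm
  refine ⟨fun t => Equiv.ofBijective _ (hbij t), fun t u => rfl, ?_⟩
  rw [contDiff_iff_contDiffAt]
  rintro ⟨t₀, w₀⟩
  obtain ⟨u₀, hu₀⟩ := (hbij t₀).2 w₀
  change u₀ - p (t₀, u₀) = w₀ at hu₀
  let G : ℝ × E → E := fun q => q.2 - p q
  have hG : ContDiff ℝ ∞ G := by fun_prop
  have hinj : Function.Injective (fderiv ℝ (fun u => G (t₀, u)) u₀) := by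
    have h1 : fderiv ℝ (fun u => G (t₀, u)) u₀ =
        ContinuousLinearMap.id ℝ E - fderiv ℝ (fun u => p (t₀, u)) u₀ :=
      ((hasFDerivAt_id u₀).sub (hdiff t₀ u₀).hasFDerivAt).fderiv
    rw [h1, injective_iff_map_eq_zero]
    intro v hv
    have h2 : v = fderiv ℝ (fun u => p (t₀, u)) u₀ v := sub_eq_zero.1 hv
    have h3 := (fderiv ℝ (fun u => p (t₀, u)) u₀).le_of_opNorm_le (hd t₀ u₀) v
    rw [← h2] at h3
    exact norm_eq_zero.1 (by linarith [norm_nonneg v])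
  obtain ⟨L, hL, -, hL2⟩ := exists_local_inverse_family hG.contDiffAt hinj
  change ContDiffAt ℝ ∞ L (t₀, u₀ - p (t₀, u₀)) at hL
  change ∀ᶠ q in 𝓝 (t₀, u₀ - p (t₀, u₀)), _ at hL2
  rw [hu₀] at hL hL2
  refine hL.congr_of_eventuallyEq ?_
  filter_upwards [hL2] with q hq
  rw [Equiv.symm_apply_eq]
  exact hq.symm

theorem contMDiffAt_prod_iff_contDiffAt {E F : Type*} [NormedAddCommGroup E] [NormedSpace ℝ E]
    [NormedAddCommGroup F] [NormedSpace ℝ F] {f : ℝ × E → F} {p : ℝ × E} :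
    ContMDiffAt (𝓘(ℝ, ℝ).prod 𝓘(ℝ, E)) 𝓘(ℝ, F) ∞ f p ↔ ContDiffAt ℝ ∞ f p := by
  rw [← contMDiffAt_iff_contDiffAt, modelWithCornersSelf_prod, ← chartedSpaceSelf_prod]

variable {n : ℕ} {X : Type u} [TopologicalSpace X] [ChartedSpace (EuclideanSpace ℝ (Fin n)) X]

local notation "E" => EuclideanSpace ℝ (Fin n)

variable (n X) in
/-- The group of smooth paths of diffeomorphisms of `X`, parametrised by the line. -/
def SmoothPaths : Subgroup (ℝ → Equiv.Perm X) where
  carrier := {h | ContMDiff (𝓘(ℝ, ℝ).prod (𝓡 n)) (𝓡 n) ∞ (fun p : ℝ × X => h p.1 p.2) ∧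
    ContMDiff (𝓘(ℝ, ℝ).prod (𝓡 n)) (𝓡 n) ∞ (fun p : ℝ × X => (h p.1).symm p.2)}
  one_mem' := ⟨contMDiff_snd, contMDiff_snd⟩
  mul_mem' hh hk := ⟨hh.1.comp (contMDiff_fst.prodMk hk.1), hk.2.comp
    (contMDiff_fst.prodMk hh.2)⟩
  inv_mem' hh := ⟨hh.2, hh.1⟩

namespace SmoothPaths

theorem comp_time {h : ℝ → Equiv.Perm X} (hh : h ∈ SmoothPaths n X) {σ : ℝ → ℝ}
    (hσ : ContDiff ℝ ∞ σ) : (fun t => h (σ t)) ∈ SmoothPaths n X :=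
  ⟨hh.1.comp ((hσ.contMDiff.comp contMDiff_fst).prodMk contMDiff_snd),
    hh.2.comp ((hσ.contMDiff.comp contMDiff_fst).prodMk contMDiff_snd)⟩

theorem const {h : ℝ → Equiv.Perm X} (hh : h ∈ SmoothPaths n X) (t : ℝ) :
    (fun _ => h t) ∈ SmoothPaths n X := comp_time hh contDiff_const

theorem contMDiff {h : ℝ → Equiv.Perm X} (hh : h ∈ SmoothPaths n X) (t : ℝ) :
    ContMDiff (𝓡 n) (𝓡 n) ∞ (h t) :=
  hh.1.comp (contMDiff_const.prodMk contMDiff_id)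

theorem contMDiff_symm {h : ℝ → Equiv.Perm X} (hh : h ∈ SmoothPaths n X) (t : ℝ) :
    ContMDiff (𝓡 n) (𝓡 n) ∞ (h t).symm :=
  hh.2.comp (contMDiff_const.prodMk contMDiff_id)

theorem continuous {h : ℝ → Equiv.Perm X} (hh : h ∈ SmoothPaths n X) :
    Continuous fun p : ℝ × X => h p.1 p.2 := hh.1.continuous

theorem const_of_contMDiff {g : Equiv.Perm X} (h1 : ContMDiff (𝓡 n) (𝓡 n) ∞ g)
    (h2 : ContMDiff (𝓡 n) (𝓡 n) ∞ g.symm) : (fun _ => g) ∈ SmoothPaths n X :=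
  ⟨h1.comp contMDiff_snd, h2.comp contMDiff_snd⟩

end SmoothPaths

variable [IsManifold (𝓡 n) ∞ X]

/-- A jointly smooth family of diffeomorphisms has jointly smooth inverses. -/
theorem SmoothPaths.of_contMDiff {h : ℝ → Equiv.Perm X}
    (h1 : ContMDiff (𝓘(ℝ, ℝ).prod (𝓡 n)) (𝓡 n) ∞ (fun p : ℝ × X => h p.1 p.2))
    (h2 : ∀ t, ContMDiff (𝓡 n) (𝓡 n) ∞ (h t).symm) : h ∈ SmoothPaths n X := by
  refine ⟨h1, ?_⟩
  rintro ⟨t₀, z₀⟩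
  set y₀ := (h t₀).symm z₀ with hy₀
  have hyz : h t₀ y₀ = z₀ := by simp [hy₀]
  set e := chartAt E y₀
  set e' := chartAt E z₀
  have hes := mem_chart_source E y₀
  have hes' := mem_chart_source E z₀
  have he := contMDiffOn_chart (I := 𝓡 n) (n := ∞) (x := y₀)
  have he' := contMDiffOn_chart (I := 𝓡 n) (n := ∞) (x := z₀)
  have hesymm := contMDiffOn_chart_symm (I := 𝓡 n) (n := ∞) (x := y₀)
  have hesymm' := contMDiffOn_chart_symm (I := 𝓡 n) (n := ∞) (x := z₀)
  have hte := e.map_source hes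
  have hte' := e'.map_source hes'
  have hsymm : ContMDiffAt 𝓘(ℝ, E) (𝓡 n) ∞ e.symm (e y₀) :=
    hesymm.contMDiffAt (e.open_target.mem_nhds hte)
  have hsymm' : ContMDiffAt 𝓘(ℝ, E) (𝓡 n) ∞ e'.symm (e' z₀) :=
    hesymm'.contMDiffAt (e'.open_target.mem_nhds hte')
  have hey : e.symm (e y₀) = y₀ := e.left_inv hes
  have hez : e'.symm (e' z₀) = z₀ := e'.left_inv hes'
  let G : ℝ × E → E := fun q => e' (h q.1 (e.symm q.2))
  have hGm : ContMDiffAt (𝓘(ℝ, ℝ).prod 𝓘(ℝ, E)) 𝓘(ℝ, E) ∞ G (t₀, e y₀) := by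
    have a1 : ContMDiffAt (𝓘(ℝ, ℝ).prod 𝓘(ℝ, E)) (𝓘(ℝ, ℝ).prod (𝓡 n)) ∞
        (fun q : ℝ × E => (q.1, e.symm q.2)) (t₀, e y₀) :=
      contMDiffAt_fst.prodMk (ContMDiffAt.comp (t₀, e y₀) hsymm contMDiffAt_snd)
    have a2 : ContMDiffAt (𝓘(ℝ, ℝ).prod 𝓘(ℝ, E)) (𝓡 n) ∞
        (fun q : ℝ × E => h q.1 (e.symm q.2)) (t₀, e y₀) :=
      ContMDiffAt.comp (t₀, e y₀) h1.contMDiffAt a1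
    refine ContMDiffAt.comp (t₀, e y₀) ?_ a2
    refine he'.contMDiffAt (e'.open_source.mem_nhds ?_)
    rw [hey, hyz]; exact hes'
  have hG : ContDiffAt ℝ ∞ G (t₀, e y₀) := contMDiffAt_prod_iff_contDiffAt.1 hGm
  have hG0 : G (t₀, e y₀) = e' z₀ := by simp only [G]; rw [hey, hyz]
  -- The inverse diffeomorphism at time t₀ supplies a left inverse of the differential by the chain
  -- rule.
  have hinj : Function.Injective (fderiv ℝ (fun u => G (t₀, u)) (e y₀)) := by
    let H : E → E := fun w => e ((h t₀).symm (e'.symm w))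
    have hHm : ContMDiffAt 𝓘(ℝ, E) 𝓘(ℝ, E) ∞ H (e' z₀) := by
      have a2 : ContMDiffAt 𝓘(ℝ, E) (𝓡 n) ∞ (fun w => (h t₀).symm (e'.symm w)) (e' z₀) :=
        ContMDiffAt.comp (e' z₀) (h2 t₀).contMDiffAt hsymm'
      refine ContMDiffAt.comp (e' z₀) ?_ a2
      refine he.contMDiffAt (e.open_source.mem_nhds ?_)
      rw [hez]; exact hes
    have hH := contMDiffAt_iff_contDiffAt.1 hHm
    have hGt : ContDiffAt ℝ ∞ (fun u => G (t₀, u)) (e y₀) :=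
      ContDiffAt.comp (f := fun u : E => (t₀, u)) (e y₀) hG
        (contDiffAt_const.prodMk contDiffAt_id)
    have hcomp : (fun u => H (G (t₀, u))) =ᶠ[𝓝 (e y₀)] id := by
      have c1 : ContinuousAt (fun u => h t₀ (e.symm u)) (e y₀) := by
        refine ContinuousAt.comp (x := e y₀) ?_ hsymm.continuousAt
        exact (h1.comp (contMDiff_const.prodMk contMDiff_id)).continuous.continuousAt
      have c2 : (fun u => h t₀ (e.symm u)) (e y₀) ∈ e'.source := by
        change h t₀ (e.symm (e y₀)) ∈ _
        rw [hey, hyz]; exact hes'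
      filter_upwards [c1 (e'.open_source.mem_nhds c2), e.open_target.mem_nhds hte] with u hu hu'
      simp only [H, G]
      rw [e'.left_inv hu, Equiv.symm_apply_apply, e.right_inv hu', id]
    have hd1 : HasFDerivAt H (fderiv ℝ H (e' z₀)) ((fun u => G (t₀, u)) (e y₀)) := by
      change HasFDerivAt H _ (G (t₀, e y₀))
      rw [hG0]; exact (hH.differentiableAt (by simp)).hasFDerivAt
    have hd := hd1.comp (e y₀) (hGt.differentiableAt (by simp)).hasFDerivAt
    have hd' := hd.unique ((hasFDerivAt_id (e y₀)).congr_of_eventuallyEq hcomp)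
    refine Function.LeftInverse.injective (g := fderiv ℝ H (e' z₀)) fun v => ?_
    exact congrArg (fun T : E →L[ℝ] E => T v) hd'
  obtain ⟨L, hL, hL0, hL2⟩ := exists_local_inverse_family hG hinj
  rw [hG0] at hL hL0 hL2
  have hcz : ContMDiffAt (𝓘(ℝ, ℝ).prod (𝓡 n)) (𝓘(ℝ, ℝ).prod 𝓘(ℝ, E)) ∞
      (fun q : ℝ × X => (q.1, e' q.2)) (t₀, z₀) :=
    contMDiffAt_fst.prodMk (ContMDiffAt.comp (t₀, z₀)
      (he'.contMDiffAt (e'.open_source.mem_nhds hes')) contMDiffAt_snd)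
  have hLm : ContMDiffAt (𝓘(ℝ, ℝ).prod 𝓘(ℝ, E)) 𝓘(ℝ, E) ∞ L (t₀, e' z₀) :=
    contMDiffAt_prod_iff_contDiffAt.2 hL
  have hLc : ContMDiffAt (𝓘(ℝ, ℝ).prod (𝓡 n)) 𝓘(ℝ, E) ∞
      (fun q : ℝ × X => L (q.1, e' q.2)) (t₀, z₀) :=
    ContMDiffAt.comp (t₀, z₀) hLm hcz
  have hfin : ContMDiffAt (𝓘(ℝ, ℝ).prod (𝓡 n)) (𝓡 n) ∞
      (fun q : ℝ × X => e.symm (L (q.1, e' q.2))) (t₀, z₀) := by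
    refine ContMDiffAt.comp (t₀, z₀) (g := e.symm) ?_ hLc
    change ContMDiffAt _ _ _ _ (L (t₀, e' z₀))
    rw [hL0]
    exact hsymm
  refine hfin.congr_of_eventuallyEq ?_
  have hh : ContinuousAt (fun q : ℝ × X => h q.1 (e.symm (L (q.1, e' q.2)))) (t₀, z₀) :=
    ContinuousAt.comp (x := (t₀, z₀)) h1.continuous.continuousAt
      (continuousAt_fst.prodMk hfin.continuousAt)
  have hmem : (fun q : ℝ × X => h q.1 (e.symm (L (q.1, e' q.2)))) (t₀, z₀) ∈ e'.source := by
    change h t₀ (e.symm (L (t₀, e' z₀))) ∈ _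
    rw [hL0, hey, hyz]; exact hes'
  have hsrc : ∀ᶠ q : ℝ × X in 𝓝 (t₀, z₀), q.2 ∈ e'.source :=
    continuousAt_snd (e'.open_source.mem_nhds hes')
  filter_upwards [hh (e'.open_source.mem_nhds hmem), hcz.continuousAt.eventually hL2, hsrc]
    with q q1 q2 q3
  rw [Equiv.symm_apply_eq]
  exact (e'.injOn q1 q3 q2).symm

end SmoothPaths

/-! ### Diffeomorphisms supported in a coordinate neighbourhood. -/

section Implant

variable {n : ℕ} {X : Type u} [TopologicalSpace X]

local notation:max "𝔼" n:max => EuclideanSpace ℝ (Fin n)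

/-- Coordinates onto the model space as an equivalence. -/
def chartEquiv (φ : OpenPartialHomeomorph X 𝔼 n) (hφ : φ.target = univ) :
    𝔼 n ≃ {y // y ∈ φ.source} where
  toFun v := ⟨φ.symm v, φ.map_target (hφ ▸ mem_univ v)⟩
  invFun y := φ y
  left_inv v := φ.right_inv (hφ ▸ mem_univ v)
  right_inv y := Subtype.ext (φ.left_inv y.2)

open Classical in
/-- Permutations of the model space, transported by coordinates and extended by the identity. -/
def implant (φ : OpenPartialHomeomorph X 𝔼 n) (hφ : φ.target = univ) :
    Equiv.Perm 𝔼 n →* Equiv.Perm X :=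
  Equiv.Perm.extendDomainHom (chartEquiv φ hφ)

variable {φ : OpenPartialHomeomorph X 𝔼 n} {hφ : φ.target = univ}

theorem implant_apply (g : Equiv.Perm 𝔼 n) (v : 𝔼 n) :
    implant φ hφ g (φ.symm v) = φ.symm (g v) := by
  classical
  exact Equiv.Perm.extendDomain_apply_image g (chartEquiv φ hφ) v

theorem implant_of_notMem (g : Equiv.Perm 𝔼 n) {y : X} (hy : y ∉ φ.source) :
    implant φ hφ g y = y := by
  classical
  exact Equiv.Perm.extendDomain_apply_not_subtype g (chartEquiv φ hφ) hy

theorem implant_symm (g : Equiv.Perm 𝔼 n) : (implant φ hφ g).symm = implant φ hφ g.symm :=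
  (map_inv (implant φ hφ) g).symm

/-- Inside the coordinates smoothness is inherited from the model. At any other point the family is
the identity nearby, because the image of the closed ball of radius R is compact, hence closed. -/
theorem contMDiff_implant [T2Space X] [ChartedSpace (𝔼 n) X] [IsManifold (𝓡 n) ∞ X]
    (hmax : φ ∈ IsManifold.maximalAtlas (𝓡 n) ∞ X) {h : ℝ → Equiv.Perm 𝔼 n}
    (h1 : ContDiff ℝ ∞ fun q : ℝ × 𝔼 n => h q.1 q.2) {R : ℝ}
    (hR : ∀ t v, R ≤ ‖v‖ → h t v = v) :
    ContMDiff (𝓘(ℝ, ℝ).prod (𝓡 n)) (𝓡 n) ∞ fun p : ℝ × X => implant φ hφ (h p.1) p.2 := by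
  have hs := contMDiffOn_symm_of_mem_maximalAtlas hmax
  have hf := contMDiffOn_of_mem_maximalAtlas hmax
  have hsymm : ContMDiff 𝓘(ℝ, 𝔼 n) (𝓡 n) ∞ φ.symm := by
    rw [← contMDiffOn_univ, ← hφ]; exact hs
  rintro ⟨t₀, y₀⟩
  by_cases hy : y₀ ∈ φ.source
  · have h1' : ContMDiffAt (𝓘(ℝ, ℝ).prod 𝓘(ℝ, 𝔼 n)) 𝓘(ℝ, 𝔼 n) ∞ (fun q : ℝ × 𝔼 n => h q.1 q.2)
        (t₀, φ y₀) := contMDiffAt_prod_iff_contDiffAt.2 h1.contDiffAt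
    have h2 : ContMDiffAt (𝓘(ℝ, ℝ).prod (𝓡 n)) (𝓘(ℝ, ℝ).prod 𝓘(ℝ, 𝔼 n)) ∞
        (fun q : ℝ × X => (q.1, φ q.2)) (t₀, y₀) :=
      contMDiffAt_fst.prodMk (ContMDiffAt.comp (t₀, y₀)
        (hf.contMDiffAt (φ.open_source.mem_nhds hy)) contMDiffAt_snd)
    have h3 : ContMDiffAt (𝓘(ℝ, ℝ).prod (𝓡 n)) 𝓘(ℝ, 𝔼 n) ∞
        (fun q : ℝ × X => h q.1 (φ q.2)) (t₀, y₀) :=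
      ContMDiffAt.comp (g := fun q : ℝ × 𝔼 n => h q.1 q.2) (t₀, y₀) h1' h2
    refine (ContMDiffAt.comp (t₀, y₀) hsymm.contMDiffAt h3).congr_of_eventuallyEq ?_
    filter_upwards [continuousAt_snd (φ.open_source.mem_nhds hy)] with q hq
    change implant φ hφ (h q.1) q.2 = φ.symm (h q.1 (φ q.2))
    rw [← implant_apply (hφ := hφ), φ.left_inv hq]
  · have hK : IsClosed (φ.symm '' Metric.closedBall 0 R) :=
      ((isCompact_closedBall 0 R).image hsymm.continuous).isClosed
    have hyK : y₀ ∉ φ.symm '' Metric.closedBall 0 R := by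
      rintro ⟨v, -, rfl⟩
      exact hy (φ.map_target (hφ ▸ mem_univ v))
    refine contMDiffAt_snd.congr_of_eventuallyEq ?_
    filter_upwards [continuousAt_snd (hK.isOpen_compl.mem_nhds hyK)] with q hq
    by_cases hq' : q.2 ∈ φ.source
    · have hqn : R ≤ ‖φ q.2‖ := by
        by_contra hlt
        exact hq ⟨φ q.2, by simpa using (not_le.1 hlt).le, φ.left_inv hq'⟩
      have h4 : implant φ hφ (h q.1) (φ.symm (φ q.2)) = φ.symm (φ q.2) := by
        rw [implant_apply, hR _ _ hqn]
      rwa [φ.left_inv hq'] at h4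
    · exact implant_of_notMem _ hq'

theorem implant_mem_smoothPaths [T2Space X] [ChartedSpace (𝔼 n) X] [IsManifold (𝓡 n) ∞ X]
    (hmax : φ ∈ IsManifold.maximalAtlas (𝓡 n) ∞ X) {h : ℝ → Equiv.Perm 𝔼 n}
    (h1 : ContDiff ℝ ∞ fun q : ℝ × 𝔼 n => h q.1 q.2)
    (h2 : ContDiff ℝ ∞ fun q : ℝ × 𝔼 n => (h q.1).symm q.2) {R : ℝ}
    (hR : ∀ t v, R ≤ ‖v‖ → h t v = v) : (fun t => implant φ hφ (h t)) ∈ SmoothPaths n X := by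
  refine ⟨contMDiff_implant hmax h1 hR, ?_⟩
  simp only [implant_symm]
  exact contMDiff_implant (h := fun t => (h t).symm) hmax h2 fun t v hv => by
    rw [Equiv.symm_apply_eq, hR t v hv]

/-- A smooth radial cutoff function, equal to `1` on the unit ball. -/
def radialBump (v : 𝔼 n) : ℝ := Real.smoothTransition (2 - ‖v‖ ^ 2)

theorem contDiff_radialBump : ContDiff ℝ ∞ (radialBump : 𝔼 n → ℝ) :=
  Real.smoothTransition.contDiff.comp (contDiff_const.sub (contDiff_norm_sq ℝ))

theorem radialBump_of_le {v : 𝔼 n} (hv : ‖v‖ ≤ 1) : radialBump v = 1 :=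
  Real.smoothTransition.one_of_one_le (by nlinarith [norm_nonneg v])

theorem radialBump_of_ge {v : 𝔼 n} (hv : 3 / 2 ≤ ‖v‖) : radialBump v = 0 :=
  Real.smoothTransition.zero_of_nonpos (by nlinarith)

theorem radialBump_nonneg (v : 𝔼 n) : 0 ≤ radialBump v := Real.smoothTransition.nonneg _

theorem radialBump_le_one (v : 𝔼 n) : radialBump v ≤ 1 := Real.smoothTransition.le_one _

theorem exists_bound_fderiv_radialBump (n : ℕ) :
    ∃ C, 0 ≤ C ∧ ∀ v : 𝔼 n, ‖fderiv ℝ radialBump v‖ ≤ C := by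
  have hc : HasCompactSupport (radialBump : 𝔼 n → ℝ) :=
    HasCompactSupport.intro (isCompact_closedBall 0 (3 / 2)) fun v hv => by
      refine radialBump_of_ge ?_
      simp at hv; linarith
  obtain ⟨C, hC⟩ := (hc.fderiv ℝ).exists_bound_of_continuous
    (contDiff_radialBump.continuous_fderiv (by simp))
  exact ⟨C, (norm_nonneg _).trans (hC 0), hC⟩

/-- Cutting off a family of maps fixing `0` with small derivatives. -/
theorem exists_cutoff_bound (n : ℕ) : ∃ δ > 0, ∀ ε > 0, ∀ p : ℝ × 𝔼 n → 𝔼 n,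
    ContDiffOn ℝ ∞ p (univ ×ˢ Metric.ball 0 (2 * ε)) → (∀ t, p (t, 0) = 0) →
    (∀ t, ∀ u ∈ Metric.ball 0 (2 * ε), ‖fderiv ℝ (fun u => p (t, u)) u‖ ≤ δ) →
    ContDiff ℝ ∞ (fun q : ℝ × 𝔼 n => radialBump (ε⁻¹ • q.2) • p q) ∧
    ∀ t u, ‖fderiv ℝ (fun u => radialBump (ε⁻¹ • u) • p (t, u)) u‖ ≤ 1 / 2 := by
  obtain ⟨C, hC0, hC⟩ := exists_bound_fderiv_radialBump n
  -- The product rule gives at most δ from the derivative of p, and (C/ε)(2εδ) from the derivative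
  -- of the cutoff, as |p| ≤ 2εδ on the ball by the mean value inequality. The sum (1 + 2C)δ = 1/2
  -- does not depend on ε.
  refine ⟨1 / (2 * (1 + 2 * C)), by positivity, fun ε hε p hp hp0 hpd => ?_⟩
  set δ := 1 / (2 * (1 + 2 * C)) with hδ
  have hδ0 : 0 ≤ δ := by positivity
  have hopen : IsOpen ((univ : Set ℝ) ×ˢ Metric.ball (0 : 𝔼 n) (2 * ε)) :=
    isOpen_univ.prod Metric.isOpen_ball
  have hb : ContDiff ℝ ∞ fun u : 𝔼 n => radialBump (ε⁻¹ • u) :=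
    contDiff_radialBump.comp (contDiff_const_smul _)
  have hfar : ∀ u : 𝔼 n, ¬ ‖u‖ < 2 * ε → ∀ᶠ v in 𝓝 u, radialBump (ε⁻¹ • v) = 0 := by
    intro u hu
    have : ∀ᶠ v in 𝓝 u, 3 / 2 * ε < ‖v‖ :=
      continuous_norm.continuousAt.eventually (lt_mem_nhds (by linarith))
    filter_upwards [this] with v hv
    refine radialBump_of_ge ?_
    rw [norm_smul, norm_inv, Real.norm_of_nonneg hε.le, inv_mul_eq_div, le_div_iff₀ hε]
    exact hv.le
  constructor
  · rw [contDiff_iff_contDiffAt]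
    rintro ⟨t, u⟩
    by_cases hu : ‖u‖ < 2 * ε
    · exact (hb.comp contDiff_snd).contDiffAt.smul
        (hp.contDiffAt (hopen.mem_nhds ⟨mem_univ _, by simpa using hu⟩))
    · refine (contDiffAt_const (c := (0 : 𝔼 n))).congr_of_eventuallyEq ?_
      filter_upwards [(continuousAt_snd : ContinuousAt Prod.snd (t, u)).eventually (hfar u hu)] with q hq
      simp only [hq, zero_smul]
  · intro t u
    by_cases hu : ‖u‖ < 2 * ε
    · have hdiff : ∀ v ∈ Metric.ball (0 : 𝔼 n) (2 * ε),
          DifferentiableAt ℝ (fun u => p (t, u)) v := by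
        intro v hv
        have := hp.contDiffAt (hopen.mem_nhds (x := (t, v)) ⟨mem_univ _, hv⟩)
        exact (this.comp (f := fun u : 𝔼 n => (t, u)) v
          (contDiffAt_const.prodMk contDiffAt_id)).differentiableAt (by simp)
      have hub : u ∈ Metric.ball (0 : 𝔼 n) (2 * ε) := by simpa using hu
      have h1 := (convex_ball (0 : 𝔼 n) (2 * ε)).norm_image_sub_le_of_norm_fderiv_le (𝕜 := ℝ)
        hdiff (hpd t) (Metric.mem_ball_self (by positivity)) hub
      rw [hp0, sub_zero, sub_zero] at h1
      have hbd : HasFDerivAt (fun u : 𝔼 n => radialBump (ε⁻¹ • u))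
          (ε⁻¹ • fderiv ℝ radialBump (ε⁻¹ • u)) u := by
        have h2 : HasFDerivAt (fun u : 𝔼 n => ε⁻¹ • u) (ε⁻¹ • ContinuousLinearMap.id ℝ 𝔼 n) u :=
          (hasFDerivAt_id u).fun_const_smul _
        have h3 := ((contDiff_radialBump.differentiable (by simp)) (ε⁻¹ • u)).hasFDerivAt.comp u h2
        have h4 : ε⁻¹ • fderiv ℝ radialBump (ε⁻¹ • u) = (fderiv ℝ radialBump (ε⁻¹ • u)).comp
            (ε⁻¹ • ContinuousLinearMap.id ℝ (𝔼 n)) := by ext v; simp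
        rw [h4]
        exact h3
      rw [(hbd.fun_smul (hdiff u hub).hasFDerivAt).fderiv]
      refine (norm_add_le _ _).trans ?_
      rw [norm_smul, ContinuousLinearMap.norm_smulRight_apply, norm_smul, norm_inv,
        Real.norm_of_nonneg hε.le, Real.norm_of_nonneg (radialBump_nonneg _)]
      have h4 : ‖p (t, u)‖ ≤ δ * (2 * ε) :=
        h1.trans (mul_le_mul_of_nonneg_left hu.le hδ0)
      have h5 : radialBump (ε⁻¹ • u) * ‖fderiv ℝ (fun u => p (t, u)) u‖ ≤ 1 * δ :=
        mul_le_mul (radialBump_le_one _) (hpd t u hub) (norm_nonneg _) zero_le_one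
      have h6 : ε⁻¹ * ‖fderiv ℝ radialBump (ε⁻¹ • u)‖ * ‖p (t, u)‖ ≤
          ε⁻¹ * C * (δ * (2 * ε)) := by
        gcongr
        exact hC _
      have h7 : ε⁻¹ * C * (δ * (2 * ε)) = 2 * C * δ := by field_simp
      have h8 : (1 + 2 * C) * δ = 1 / 2 := by rw [hδ]; field_simp
      linarith
    · have h0 : (fun u => radialBump (ε⁻¹ • u) • p (t, u)) =ᶠ[𝓝 u] fun _ => (0 : 𝔼 n) := by
        filter_upwards [hfar u hu] with v hv
        simp only [hv, zero_smul]
      rw [h0.fderiv_eq]; simp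

/-- A permutation fixes the centre of the coordinates `φ` and has differential `T` there. -/
structure HasChartDeriv (φ : OpenPartialHomeomorph X 𝔼 n) (g : Equiv.Perm X) (T : 𝔼 n →L[ℝ] 𝔼 n) :
    Prop where
  fixes : g (φ.symm 0) = φ.symm 0
  mem_source : ∀ᶠ u in 𝓝 (0 : 𝔼 n), g (φ.symm u) ∈ φ.source
  hasFDerivAt : HasFDerivAt (fun u => φ (g (φ.symm u))) T 0

namespace HasChartDeriv

variable {g g' : Equiv.Perm X} {T T' : 𝔼 n →L[ℝ] 𝔼 n}

theorem unique (h : HasChartDeriv φ g T) (h' : HasChartDeriv φ g T') : T = T' :=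
  h.hasFDerivAt.unique h'.hasFDerivAt

theorem mul (hφ : φ.target = univ) (h : HasChartDeriv φ g T) (h' : HasChartDeriv φ g' T') :
    HasChartDeriv φ (g * g') (T * T') := by
  have h0 : φ (φ.symm 0) = 0 := φ.right_inv (hφ ▸ mem_univ _)
  have hval : φ (g' (φ.symm 0)) = 0 := by rw [h'.fixes, h0]
  have hev : (fun u => φ ((g * g') (φ.symm u))) =ᶠ[𝓝 0]
      (fun u => φ (g (φ.symm u))) ∘ fun u => φ (g' (φ.symm u)) := by
    filter_upwards [h'.mem_source] with u hu
    simp only [Equiv.Perm.mul_apply, Function.comp_apply]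
    rw [φ.left_inv hu]
  refine ⟨by rw [Equiv.Perm.mul_apply, h'.fixes, h.fixes], ?_, ?_⟩
  · have hc : Filter.Tendsto (fun u => φ (g' (φ.symm u))) (𝓝 0) (𝓝 0) := by
      have := h'.hasFDerivAt.continuousAt
      rwa [ContinuousAt, hval] at this
    filter_upwards [h'.mem_source, hc.eventually h.mem_source] with u hu hu'
    rwa [φ.left_inv hu] at hu'
  · refine HasFDerivAt.congr_of_eventuallyEq ?_ hev
    refine HasFDerivAt.comp 0 ?_ h'.hasFDerivAt
    simp only [hval]
    exact h.hasFDerivAt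

theorem one (hφ : φ.target = univ) : HasChartDeriv φ (1 : Equiv.Perm X) 1 := by
  have h : ∀ u : 𝔼 n, u ∈ φ.target := fun u => hφ ▸ mem_univ u
  refine ⟨rfl, Filter.Eventually.of_forall fun u => φ.map_target (h u), ?_⟩
  refine (hasFDerivAt_id (0 : 𝔼 n)).congr_of_eventuallyEq (Filter.Eventually.of_forall fun u => ?_)
  exact φ.right_inv (h u)

theorem exists_of_contMDiff (hφ : φ.target = univ) [ChartedSpace (𝔼 n) X]
    [IsManifold (𝓡 n) ∞ X]
    (hmax : φ ∈ IsManifold.maximalAtlas (𝓡 n) ∞ X) (hg : ContMDiff (𝓡 n) (𝓡 n) ∞ g)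
    (hx : g (φ.symm 0) = φ.symm 0) : ∃ T, HasChartDeriv φ g T := by
  have hs := contMDiffOn_symm_of_mem_maximalAtlas hmax
  have hf := contMDiffOn_of_mem_maximalAtlas hmax
  have hsymm : ContMDiff 𝓘(ℝ, 𝔼 n) (𝓡 n) ∞ φ.symm := by
    rw [← contMDiffOn_univ, ← hφ]; exact hs
  have hmem : g (φ.symm 0) ∈ φ.source := by rw [hx]; exact φ.map_target (hφ ▸ mem_univ _)
  have hgc : ContMDiff 𝓘(ℝ, 𝔼 n) (𝓡 n) ∞ (fun u => g (φ.symm u)) := hg.comp hsymm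
  have h1 : ContMDiffAt 𝓘(ℝ, 𝔼 n) 𝓘(ℝ, 𝔼 n) ∞ (fun u => φ (g (φ.symm u))) 0 :=
    ContMDiffAt.comp 0 (hf.contMDiffAt (φ.open_source.mem_nhds hmem)) hgc.contMDiffAt
  exact ⟨_, hx, hgc.continuous.continuousAt.eventually (φ.open_source.mem_nhds hmem),
    ((contMDiffAt_iff_contDiffAt.1 h1).differentiableAt (by simp)).hasFDerivAt⟩

theorem inv (hφ : φ.target = univ) [ChartedSpace (𝔼 n) X]
    [IsManifold (𝓡 n) ∞ X] (hmax : φ ∈ IsManifold.maximalAtlas (𝓡 n) ∞ X)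
    (hg : ContMDiff (𝓡 n) (𝓡 n) ∞ g.symm) (h : HasChartDeriv φ g T) {S : 𝔼 n →L[ℝ] 𝔼 n}
    (hST : S * T = 1) : HasChartDeriv φ g⁻¹ S := by
  obtain ⟨T', hT'⟩ := exists_of_contMDiff (g := g⁻¹) hφ hmax hg
    (by rw [Equiv.Perm.inv_eq_iff_eq, h.fixes])
  have h1 := (h.mul hφ hT').unique (by rw [mul_inv_cancel]; exact one hφ)
  have : S = T' := by
    calc S = S * (T * T') := by rw [h1, mul_one]
      _ = T' := by rw [← mul_assoc, hST, one_mul]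
  rwa [this]

end HasChartDeriv

variable [T2Space X] [ChartedSpace (𝔼 n) X] [IsManifold (𝓡 n) ∞ X]

/-- Implanting cut-off families of maps in coordinates. -/
theorem exists_cutoff_path (hφ : φ.target = univ)
    (hmax : φ ∈ IsManifold.maximalAtlas (𝓡 n) ∞ X) : ∃ δ > 0, ∀ ε > 0, ∀ p : ℝ × 𝔼 n → 𝔼 n,
    ContDiffOn ℝ ∞ p (univ ×ˢ Metric.ball 0 (2 * ε)) → (∀ t, p (t, 0) = 0) →
    (∀ t, ∀ u ∈ Metric.ball 0 (2 * ε), ‖fderiv ℝ (fun u => p (t, u)) u‖ ≤ δ) →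
    ∃ q ∈ SmoothPaths n X, (∀ t u, q t (φ.symm u) =
      φ.symm (u - radialBump (ε⁻¹ • u) • p (t, u))) ∧ (∀ t, ∀ y ∉ φ.source, q t y = y) ∧
      ∀ t T, HasFDerivAt (fun u => p (t, u)) T 0 → HasChartDeriv φ (q t) (1 - T) := by
  obtain ⟨δ, hδ, H⟩ := exists_cutoff_bound n
  refine ⟨δ, hδ, fun ε hε p hp hp0 hpd => ?_⟩
  obtain ⟨h1, h2⟩ := H ε hε p hp hp0 hpd
  obtain ⟨h, ha, hb⟩ := exists_perm_of_perturbation h1 h2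
  have hmem : ∀ u : 𝔼 n, u ∈ φ.target := fun u => hφ ▸ mem_univ u
  have hval : ∀ t u, implant φ hφ (h t) (φ.symm u) =
      φ.symm (u - radialBump (ε⁻¹ • u) • p (t, u)) := fun t u => by rw [implant_apply, ha]
  refine ⟨fun t => implant φ hφ (h t), implant_mem_smoothPaths (R := 2 * ε) hmax ?_ hb ?_,
    hval, fun t y hy => implant_of_notMem _ hy, ?_⟩
  · simp only [ha]; fun_prop
  · intro t v hv
    have : radialBump (ε⁻¹ • v) = 0 := by
      refine radialBump_of_ge ?_
      rw [norm_smul, norm_inv, Real.norm_of_nonneg hε.le, inv_mul_eq_div, le_div_iff₀ hε]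
      linarith
    simp [ha, this]
  · intro t T hT
    refine ⟨by simp [hval, hp0], Filter.Eventually.of_forall fun u => ?_, ?_⟩
    · rw [hval]; exact φ.map_target (hmem _)
    · refine ((hasFDerivAt_id (0 : 𝔼 n)).sub hT).congr_of_eventuallyEq ?_
      filter_upwards [Metric.ball_mem_nhds (0 : 𝔼 n) hε] with u hu
      have : radialBump (ε⁻¹ • u) = 1 := by
        refine radialBump_of_le ?_
        rw [norm_smul, norm_inv, Real.norm_of_nonneg hε.le, inv_mul_eq_div, div_le_one hε]
        exact (mem_ball_zero_iff.1 hu).le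
      rw [hval, φ.right_inv (hmem _), this, one_smul]
      rfl

end Implant

/-! ### Prescribing differentials of isotopies, and flattening near a point. -/

section Realization

local notation:max "𝔼" n:max => EuclideanSpace ℝ (Fin n)

theorem isUnit_of_det_ne_zero {V : Type*} [NormedAddCommGroup V] [NormedSpace ℝ V]
    [FiniteDimensional ℝ V] {T : V →L[ℝ] V} (hT : T.det ≠ 0) : IsUnit T :=
  ⟨(ContinuousLinearEquiv.unitsEquiv ℝ V).symm (T.toContinuousLinearEquivOfDetNeZero hT), by
    ext v; rfl⟩

variable {n : ℕ} {X : Type u} [TopologicalSpace X] [T2Space X] [ChartedSpace (𝔼 n) X]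
  [IsManifold (𝓡 n) ∞ X] {φ : OpenPartialHomeomorph X (𝔼 n)}

omit [T2Space X] [ChartedSpace (𝔼 n) X] [IsManifold (𝓡 n) ∞ X] in
theorem ext_of_chart {g g' : Equiv.Perm X} (h1 : ∀ u, g (φ.symm u) = g' (φ.symm u))
    (h2 : ∀ y ∉ φ.source, g y = g' y) : g = g' := by
  ext y
  by_cases hy : y ∈ φ.source
  · rw [← φ.left_inv hy, h1]
  · exact h2 y hy

/-- Every smooth path of invertible linear maps starting at the identity is, up to
reparametrisation, the path of differentials at a point of an isotopy. -/
theorem exists_realization (hφ : φ.target = univ)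
    (hmax : φ ∈ IsManifold.maximalAtlas (𝓡 n) ∞ X) {κ : ℝ → 𝔼 n →L[ℝ] 𝔼 n}
    (hκ : ContDiff ℝ ∞ κ) (h0 : κ 0 = 1) (hpos : ∀ t ∈ Icc (0 : ℝ) 1, 0 < (κ t).det) :
    ∃ h ∈ SmoothPaths n X, h 0 = 1 ∧
      ∀ t, HasChartDeriv φ (h t) (κ (Real.smoothTransition t)) := by
  obtain ⟨δ, hδ, H⟩ := exists_cutoff_path hφ hmax
  have hunit : ∀ t ∈ Icc (0 : ℝ) 1, IsUnit (κ t) := fun t ht =>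
    isUnit_of_det_ne_zero (hpos t ht).ne'
  have hinv : ∀ t ∈ Icc (0 : ℝ) 1, ContDiffAt ℝ ∞ (fun r => Ring.inverse (κ r)) t := by
    intro t ht
    obtain ⟨w, hw⟩ := hunit t ht
    refine ContDiffAt.comp (g := Ring.inverse) t ?_ hκ.contDiffAt
    rw [← hw]
    exact contDiffAt_ringInverse ℝ w
  have hmulinv : ∀ t ∈ Icc (0 : ℝ) 1, Ring.inverse (κ t) * κ t = 1 := fun t ht =>
    Ring.inverse_mul_cancel _ (hunit t ht)
  have hfc : ContinuousOn (fun q : ℝ × ℝ => κ q.1 * Ring.inverse (κ q.2))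
      (Icc (0 : ℝ) 1 ×ˢ Icc (0 : ℝ) 1) := by
    intro q hq
    refine ContinuousAt.continuousWithinAt ?_
    exact (hκ.continuous.continuousAt.comp continuousAt_fst).mul
      (ContinuousAt.comp (x := q) (g := fun r => Ring.inverse (κ r)) (f := Prod.snd)
        (hinv q.2 hq.2).continuousAt continuousAt_snd)
  -- The quotients of nearby values of κ are uniformly close to 1, so after subdivision each step is
  -- a perturbation small enough to be cut off.
  obtain ⟨η, hη, hunif⟩ := Metric.uniformContinuousOn_iff.1
    ((isCompact_Icc.prod isCompact_Icc).uniformContinuousOn_of_continuous hfc) δ hδ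
  obtain ⟨N, hN⟩ := exists_nat_one_div_lt hη
  set M : ℝ := N + 1 with hM
  have hM0 : 0 < M := by positivity
  let σ := Real.smoothTransition
  have hσ0 : ∀ t, 0 ≤ σ t := Real.smoothTransition.nonneg
  have hσ1 : ∀ t, σ t ≤ 1 := Real.smoothTransition.le_one
  have hσc : ContDiff ℝ ∞ σ := Real.smoothTransition.contDiff
  have hmem : ∀ t c : ℝ, 0 ≤ c → c ≤ M → σ t * (c / M) ∈ Icc (0 : ℝ) 1 := by
    intro t c hc hc'
    refine ⟨mul_nonneg (hσ0 t) (by positivity), ?_⟩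
    exact mul_le_one₀ (hσ1 t) (by positivity) ((div_le_one hM0).2 hc')
  -- The i-th isotopy follows κ on the initial part [0, i/M] of the path only, so that each further
  -- step is a small correction at all times.
  have claim : ∀ i : ℕ, (i : ℝ) ≤ M → ∃ h ∈ SmoothPaths n X, h 0 = 1 ∧
      ∀ t, HasChartDeriv φ (h t) (κ (σ t * (i / M))) := by
    intro i
    induction i with
    | zero =>
      intro _
      refine ⟨1, one_mem _, rfl, fun t => ?_⟩
      simp only [Nat.cast_zero, zero_div, mul_zero, h0]
      exact HasChartDeriv.one hφ
    | succ i ih =>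
      intro hi
      push_cast at hi ⊢
      obtain ⟨h, hh, hh0, hhD⟩ := ih (by linarith)
      -- The linear correction from the i-th to the next path of differentials.
      let l : ℝ → 𝔼 n →L[ℝ] 𝔼 n := fun t =>
        κ (σ t * ((i + 1) / M)) * Ring.inverse (κ (σ t * (i / M)))
      have hi0 : (0 : ℝ) ≤ i := Nat.cast_nonneg i
      have hl : ContDiff ℝ ∞ l := by
        refine ContDiff.clm_comp (hκ.comp (by fun_prop)) ?_
        rw [contDiff_iff_contDiffAt]
        intro t
        exact ContDiffAt.comp (g := fun r => Ring.inverse (κ r)) t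
          (hinv _ (hmem t i hi0 (by linarith))) (by fun_prop)
      have hl1 : ∀ t, ‖1 - l t‖ ≤ δ := by
        intro t
        have m1 := hmem t (i + 1) (by linarith) hi
        have m2 := hmem t i hi0 (by linarith)
        have := hunif (σ t * ((i + 1) / M), σ t * (i / M)) ⟨m1, m2⟩
          (σ t * (i / M), σ t * (i / M)) ⟨m2, m2⟩ (by
            rw [Prod.dist_eq, dist_self, Real.dist_eq]
            have e : σ t * ((i + 1) / M) - σ t * (i / M) = σ t * (1 / M) := by ring
            have e1 : 0 ≤ σ t * (1 / M) := mul_nonneg (hσ0 t) (by positivity)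
            rw [e, max_eq_left (abs_nonneg _), abs_of_nonneg e1]
            calc σ t * (1 / M) ≤ 1 * (1 / M) := by gcongr; exact hσ1 t
              _ < η := by rw [one_mul]; exact hN)
        rw [dist_comm, dist_eq_norm] at this
        simp only [Ring.mul_inverse_cancel _ (hunit _ m2)] at this
        exact this.le
      have hl0 : l 0 = 1 := by
        have : σ 0 = 0 := Real.smoothTransition.zero
        simp [l, this, h0]
      have hd : ∀ t u, HasFDerivAt (fun u => (1 - l t) u) (1 - l t) u := fun t u =>
        (1 - l t).hasFDerivAt
      obtain ⟨q, hq, hq1, hq2, hqD⟩ := H 1 one_pos (fun q => (1 - l q.1) q.2)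
        (by
          have : ContDiff ℝ ∞ fun q : ℝ × 𝔼 n => 1 - l q.1 :=
            contDiff_const.sub (hl.comp contDiff_fst)
          exact (this.clm_apply contDiff_snd).contDiffOn)
        (fun t => map_zero _) (fun t u _ => by rw [(hd t u).fderiv]; exact hl1 t)
      refine ⟨q * h, mul_mem hq hh, ?_, fun t => ?_⟩
      · rw [Pi.mul_apply, hh0, mul_one]
        refine ext_of_chart (φ := φ) (fun u => ?_) fun y hy => hq2 0 y hy
        rw [hq1]
        simp [hl0]
      · have := (hqD t _ (hd t 0)).mul hφ (hhD t)
        rwa [sub_sub_cancel, mul_assoc, hmulinv _ (hmem t i hi0 (by linarith)), mul_one] at this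
  obtain ⟨h, hh, hh0, hhD⟩ := claim (N + 1) (by simp [hM])
  refine ⟨h, hh, hh0, fun t => ?_⟩
  have := hhD t
  rwa [Nat.cast_add, Nat.cast_one, div_self hM0.ne', mul_one] at this

/-- The tube lemma over the compact time interval: one radius serves for all times. -/
theorem exists_ball_of_isOpen {V : Type*} [NormedAddCommGroup V] {S : Set (ℝ × V)}
    (hS : IsOpen S) (h : ∀ t ∈ Icc (0 : ℝ) 1, (t, (0 : V)) ∈ S) :
    ∃ r > 0, ∀ t ∈ Icc (0 : ℝ) 1, ∀ v : V, ‖v‖ < r → (t, v) ∈ S := by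
  obtain ⟨A, B, -, hB, hA, hB0, hAB⟩ := generalized_tube_lemma (s := Icc (0 : ℝ) 1)
    (t := {(0 : V)}) isCompact_Icc isCompact_singleton hS (by
      rintro ⟨t, v⟩ ⟨ht, hv⟩
      rw [mem_singleton_iff] at hv
      simp only at hv
      subst hv
      exact h t ht)
  obtain ⟨r, hr, hrB⟩ := Metric.isOpen_iff.1 hB 0 (hB0 rfl)
  exact ⟨r, hr, fun t ht v hv => hAB ⟨hA ht, hrB (by simpa using hv)⟩⟩

/-- Straightening diffeomorphisms with trivial differential at a point near this point. -/
theorem exists_flattening (hφ : φ.target = univ)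
    (hmax : φ ∈ IsManifold.maximalAtlas (𝓡 n) ∞ X) {h : ℝ → Equiv.Perm X}
    (hh : h ∈ SmoothPaths n X) (hD : ∀ t ∈ Icc (0 : ℝ) 1, HasChartDeriv φ (h t) 1)
    {l : ℝ → ℝ} (hl : ContDiff ℝ ∞ l) (hl0 : ∀ t, 0 ≤ l t) (hl1 : ∀ t, l t ≤ 1)
    {r₀ : ℝ} (hr₀ : 0 < r₀) :
    ∃ q ∈ SmoothPaths n X, (∀ t, HasChartDeriv φ (q t) 1) ∧ (∀ t, l t = 0 → q t = 1) ∧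
      (∀ t, (∀ u, ‖u‖ < r₀ → h (Real.smoothTransition t) (φ.symm u) = φ.symm u) → q t = 1) ∧
      ∃ r > 0, ∀ t, l t = 1 → ∀ u, ‖u‖ < r →
        q t (h (Real.smoothTransition t) (φ.symm u)) = φ.symm u := by
  obtain ⟨δ, hδ, H⟩ := exists_cutoff_path hφ hmax
  let σ := Real.smoothTransition
  have hσ : ∀ t, σ t ∈ Icc (0 : ℝ) 1 := fun t =>
    ⟨Real.smoothTransition.nonneg t, Real.smoothTransition.le_one t⟩
  have hσc : ContDiff ℝ ∞ σ := Real.smoothTransition.contDiff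
  have hmem : ∀ u : 𝔼 n, u ∈ φ.target := fun u => hφ ▸ mem_univ u
  have hf := contMDiffOn_of_mem_maximalAtlas hmax
  have hsymm : ContMDiff 𝓘(ℝ, 𝔼 n) (𝓡 n) ∞ φ.symm := by
    rw [← contMDiffOn_univ, ← hφ]; exact contMDiffOn_symm_of_mem_maximalAtlas hmax
  have hkm : ContMDiff (𝓘(ℝ, ℝ).prod 𝓘(ℝ, 𝔼 n)) (𝓡 n) ∞
      (fun p : ℝ × 𝔼 n => (h p.1).symm (φ.symm p.2)) :=
    hh.2.comp (contMDiff_fst.prodMk (hsymm.comp contMDiff_snd))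
  let W : Set (ℝ × 𝔼 n) := {p | (h p.1).symm (φ.symm p.2) ∈ φ.source}
  have hW : IsOpen W := φ.open_source.preimage hkm.continuous
  -- K is the inverse of h in coordinates. Implanting u - l(t)(u - K), cut off, yields h⁻¹ near the
  -- centre where l = 1. The differential of u - K vanishes at 0, so it is small on a small ball.
  let K : ℝ × 𝔼 n → 𝔼 n := fun p => φ ((h p.1).symm (φ.symm p.2))
  have hK : ∀ p ∈ W, ContDiffAt ℝ ∞ K p := fun p hp =>
    contMDiffAt_prod_iff_contDiffAt.1
      (ContMDiffAt.comp p (hf.contMDiffAt (φ.open_source.mem_nhds hp)) hkm.contMDiffAt)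
  let D : ℝ × 𝔼 n → 𝔼 n →L[ℝ] 𝔼 n := fun p =>
    (fderiv ℝ K p).comp (ContinuousLinearMap.inr ℝ ℝ (𝔼 n))
  have hKD : ∀ p ∈ W, HasFDerivAt (fun u => K (p.1, u)) (D p) p.2 := fun p hp =>
    HasFDerivAt.comp (g := K) (f := fun u => (p.1, u)) p.2
      ((hK p hp).differentiableAt (by simp)).hasFDerivAt (hasFDerivAt_prodMk_right p.1 p.2)
  have hKW : ContDiffOn ℝ ∞ K W := fun p hp => (hK p hp).contDiffWithinAt
  have hDc : ContinuousOn D W :=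
    (hKW.continuousOn_fderiv_of_isOpen hW (by simp)).clm_comp continuousOn_const
  have hinvD : ∀ t ∈ Icc (0 : ℝ) 1, HasChartDeriv φ (h t)⁻¹ 1 := fun t ht =>
    (hD t ht).inv hφ hmax (SmoothPaths.contMDiff_symm hh t) (mul_one 1)
  have hW0 : ∀ t ∈ Icc (0 : ℝ) 1, (t, (0 : 𝔼 n)) ∈ W := by
    intro t ht
    change (h t)⁻¹ (φ.symm 0) ∈ φ.source
    rw [(hinvD t ht).fixes]; exact φ.map_target (hmem 0)
  have hD0 : ∀ t ∈ Icc (0 : ℝ) 1, D (t, 0) = 1 := fun t ht =>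
    (hKD (t, 0) (hW0 t ht)).unique (hinvD t ht).hasFDerivAt
  have hK0 : ∀ t ∈ Icc (0 : ℝ) 1, K (t, 0) = 0 := by
    intro t ht
    change φ ((h t)⁻¹ (φ.symm 0)) = 0
    rw [(hinvD t ht).fixes, φ.right_inv (hmem 0)]
  have hV : IsOpen (W ∩ (fun p => ‖1 - D p‖) ⁻¹' Iio δ) :=
    (continuousOn_const.sub hDc).norm.isOpen_inter_preimage hW isOpen_Iio
  obtain ⟨ρ, hρ, hρV⟩ := exists_ball_of_isOpen hV fun t ht => ⟨hW0 t ht, by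
    simp only [mem_preimage, hD0 t ht, sub_self, norm_zero]; exact hδ⟩
  -- The bound by r₀ keeps the cutoff inside the ball where a locally trivial h is already the
  -- identity, so that no correction is made there.
  set ε := min ρ r₀ / 2 with hε
  have hε0 : 0 < ε := by positivity
  have hερ : 2 * ε ≤ ρ := by rw [hε]; linarith [min_le_left ρ r₀]
  have hεr : 2 * ε ≤ r₀ := by rw [hε]; linarith [min_le_right ρ r₀]
  have hball : ∀ t, ∀ u ∈ Metric.ball (0 : 𝔼 n) (2 * ε), (σ t, u) ∈ W ∧ ‖1 - D (σ t, u)‖ < δ :=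
    fun t u hu => hρV (σ t) (hσ t) u ((mem_ball_zero_iff.1 hu).trans_le hερ)
  have hpD : ∀ t, ∀ u ∈ Metric.ball (0 : 𝔼 n) (2 * ε),
      HasFDerivAt (fun u => l t • (u - K (σ t, u))) (l t • (1 - D (σ t, u))) u := fun t u hu =>
    ((hasFDerivAt_id u).sub (hKD (σ t, u) (hball t u hu).1)).fun_const_smul (l t)
  have h0b : (0 : 𝔼 n) ∈ Metric.ball (0 : 𝔼 n) (2 * ε) := Metric.mem_ball_self (by positivity)
  obtain ⟨q, hq, hq1, hq2, hqD⟩ := H ε hε0 (fun p => l p.1 • (p.2 - K (σ p.1, p.2)))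
    (by
      rintro ⟨t, u⟩ ⟨-, hu⟩
      refine ContDiffAt.contDiffWithinAt ?_
      have a1 : ContDiffAt ℝ ∞ (fun p : ℝ × 𝔼 n => K (σ p.1, p.2)) (t, u) :=
        ContDiffAt.comp (f := fun p : ℝ × 𝔼 n => (σ p.1, p.2)) (t, u) (hK _ (hball t u hu).1)
          (by fun_prop)
      have a2 : ContDiffAt ℝ ∞ (fun p : ℝ × 𝔼 n => l p.1) (t, u) :=
        (hl.comp contDiff_fst).contDiffAt
      exact a2.smul (contDiffAt_snd.sub a1))
    (fun t => by simp [hK0 _ (hσ t)])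
    (fun t u hu => by
      rw [(hpD t u hu).fderiv, norm_smul, Real.norm_of_nonneg (hl0 t)]
      calc l t * ‖1 - D (σ t, u)‖ ≤ 1 * δ := by gcongr; exacts [hl1 t, (hball t u hu).2.le]
        _ = δ := one_mul δ)
  refine ⟨q, hq, fun t => ?_, fun t ht => ?_, fun t ht => ?_, ?_⟩
  · have := hqD t _ (hpD t 0 h0b)
    rwa [hD0 _ (hσ t), sub_self, smul_zero, sub_zero] at this
  · refine ext_of_chart (φ := φ) (fun u => ?_) fun y hy => hq2 t y hy
    rw [hq1]; simp [ht]
  · refine ext_of_chart (φ := φ) (fun u => ?_) fun y hy => hq2 t y hy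
    rw [hq1]
    by_cases hu : ‖u‖ < r₀
    · have : K (σ t, u) = u := by
        change φ ((h (σ t)).symm (φ.symm u)) = u
        rw [(Equiv.symm_apply_eq _).2 (ht u hu).symm, φ.right_inv (hmem u)]
      simp [this]
    · have : radialBump (ε⁻¹ • u) = 0 := by
        refine radialBump_of_ge ?_
        rw [norm_smul, norm_inv, Real.norm_of_nonneg hε0.le, inv_mul_eq_div, le_div_iff₀ hε0]
        linarith
      simp [this]
  · have hfm : ContMDiff (𝓘(ℝ, ℝ).prod 𝓘(ℝ, 𝔼 n)) (𝓡 n) ∞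
        (fun p : ℝ × 𝔼 n => h p.1 (φ.symm p.2)) :=
      hh.1.comp (contMDiff_fst.prodMk (hsymm.comp contMDiff_snd))
    have hO : IsOpen (φ.source ∩ (fun y => ‖φ y‖) ⁻¹' Iio ε) :=
      φ.continuousOn.norm.isOpen_inter_preimage φ.open_source isOpen_Iio
    obtain ⟨r, hr, hrO⟩ := exists_ball_of_isOpen (hO.preimage hfm.continuous) fun t ht => by
      simp only [mem_preimage, (hD t ht).fixes]
      refine ⟨φ.map_target (hmem 0), ?_⟩
      simpa [φ.right_inv (hmem 0)] using hε0
    refine ⟨r, hr, fun t ht u hu => ?_⟩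
    obtain ⟨b1, b2⟩ := hrO (σ t) (hσ t) u hu
    simp only at b1 b2
    have b3 : ‖φ (h (σ t) (φ.symm u))‖ < ε := b2
    set w := φ (h (σ t) (φ.symm u)) with hw
    have b4 : h (Real.smoothTransition t) (φ.symm u) = φ.symm w := (φ.left_inv b1).symm
    have b5 : K (σ t, w) = u := by
      change φ ((h (σ t)).symm (φ.symm w)) = u
      rw [← b4, Equiv.symm_apply_apply, φ.right_inv (hmem u)]
    have b6 : radialBump (ε⁻¹ • w) = 1 := by
      refine radialBump_of_le ?_
      rw [norm_smul, norm_inv, Real.norm_of_nonneg hε0.le, inv_mul_eq_div, div_le_one hε0]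
      exact b3.le
    rw [b4, hq1]
    simp [ht, b5, b6]

end Realization

/-! ### Transitivity of isotopies on a connected component. -/

section Homogeneity

local notation:max "𝔼" n:max => EuclideanSpace ℝ (Fin n)

variable {n : ℕ} {X : Type u} [TopologicalSpace X] [ChartedSpace (𝔼 n) X]
  [IsManifold (𝓡 n) ∞ X]

/-- A chart is restricted to the preimage of a ball, and the ball is identified with the whole model
space. -/
theorem exists_chart_target_eq_univ (y : X) :
    ∃ ψ ∈ IsManifold.maximalAtlas (𝓡 n) ∞ X, ψ.target = univ ∧ y ∈ ψ.source := by
  set e := chartAt (𝔼 n) y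
  have hy : y ∈ e.source := mem_chart_source _ y
  obtain ⟨r, hr, hrt⟩ := Metric.isOpen_iff.1 e.open_target (e y) (e.map_source hy)
  let β : OpenPartialHomeomorph (𝔼 n) (𝔼 n) := OpenPartialHomeomorph.univBall (e y) r
  have hβs : β.source = univ := OpenPartialHomeomorph.univBall_source _ _
  have hβt : β.target = Metric.ball (e y) r := OpenPartialHomeomorph.univBall_target _ hr
  refine ⟨e.trans β.symm, ?_, ?_, ?_⟩
  · refine OpenPartialHomeomorph.mem_maximalAtlas_of_contMDiffOn (I := 𝓡 n) (n := ∞) _ ?_ ?_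
    · have h1 : ContMDiffOn 𝓘(ℝ, 𝔼 n) 𝓘(ℝ, 𝔼 n) ∞ β.symm β.target := by
        rw [contMDiffOn_iff_contDiffOn, hβt]
        exact OpenPartialHomeomorph.contDiffOn_univBall_symm
      rw [OpenPartialHomeomorph.trans_source]
      exact h1.comp ((contMDiffOn_chart (x := y)).mono inter_subset_left) fun z hz => hz.2
    · have h1 : ContMDiff 𝓘(ℝ, 𝔼 n) 𝓘(ℝ, 𝔼 n) ∞ β := by
        rw [contMDiff_iff_contDiff]
        exact OpenPartialHomeomorph.contDiff_univBall
      rw [OpenPartialHomeomorph.trans_target]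
      exact (contMDiffOn_chart_symm (x := y)).comp h1.contMDiffOn fun z hz => hz.2
  · rw [OpenPartialHomeomorph.trans_target]
    refine eq_univ_of_forall fun v => ⟨?_, ?_⟩
    · change v ∈ β.source
      rw [hβs]; trivial
    · refine hrt ?_
      rw [← hβt]
      exact β.map_source (hβs ▸ mem_univ v)
  · rw [OpenPartialHomeomorph.trans_source]
    refine ⟨hy, ?_⟩
    change e y ∈ β.target
    rw [hβt]
    exact Metric.mem_ball_self hr

variable [T2Space X]

/-- Points in the same component are exchanged by a diffeomorphism isotopic to the identity. -/
theorem exists_smoothPath_apply_eq {x y : X} (hy : y ∈ connectedComponent x) :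
    ∃ h ∈ SmoothPaths n X, h 0 = 1 ∧ h 1 x = y := by
  let O : X → Set X := fun x => {y | ∃ h ∈ SmoothPaths n X, h 0 = 1 ∧ h 1 x = y}
  have hself : ∀ x, x ∈ O x := fun x => ⟨1, one_mem _, rfl, rfl⟩
  have hsymm : ∀ x y, y ∈ O x → x ∈ O y := by
    rintro x y ⟨h, hh, h0, h1⟩
    refine ⟨h⁻¹, inv_mem hh, by simp [h0], ?_⟩
    rw [← h1]; simp
  have htrans : ∀ x y z, y ∈ O x → z ∈ O y → z ∈ O x := by
    rintro x y z ⟨h, hh, h0, h1⟩ ⟨k, hk, k0, k1⟩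
    exact ⟨k * h, mul_mem hk hh, by simp [h0, k0], by simp [h1, k1]⟩
  have hnhds : ∀ y, O y ∈ 𝓝 y := by
    intro y
    obtain ⟨ψ, hmax, hψ, hyψ⟩ := exists_chart_target_eq_univ (n := n) y
    obtain ⟨C, hC0, hC⟩ := exists_bound_fderiv_radialBump n
    -- Cut-off translations by vectors of this length have derivative at most 1/2 away from the
    -- identity, C being a bound for the derivative of the cutoff.
    have hopen : IsOpen (ψ.source ∩ ψ ⁻¹' Metric.ball (ψ y) (1 / (2 * (C + 1)))) :=
      ψ.continuousOn.isOpen_inter_preimage ψ.open_source Metric.isOpen_ball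
    refine Filter.mem_of_superset (hopen.mem_nhds
      ⟨hyψ, Metric.mem_ball_self (by positivity)⟩) ?_
    rintro z ⟨hz, hzb⟩
    set w := ψ z - ψ y with hw
    have hwn : ‖w‖ ≤ 1 / (2 * (C + 1)) := by
      rw [hw, ← dist_eq_norm]; exact (Metric.mem_ball.1 hzb).le
    let σ := Real.smoothTransition
    have hσ : ContDiff ℝ ∞ σ := Real.smoothTransition.contDiff
    let p : ℝ × 𝔼 n → 𝔼 n := fun q => (-(σ q.1 * radialBump (q.2 - ψ y))) • w
    have hp : ContDiff ℝ ∞ p := by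
      have := contDiff_radialBump (n := n)
      fun_prop
    have hpd : ∀ t u, ‖fderiv ℝ (fun u => p (t, u)) u‖ ≤ 1 / 2 := by
      intro t u
      have h1 : HasFDerivAt (fun u : 𝔼 n => radialBump (u - ψ y))
          (fderiv ℝ radialBump (u - ψ y)) u :=
        HasFDerivAt.comp (g := radialBump) (f := fun u => u - ψ y) u
          ((contDiff_radialBump.differentiable (by simp)) (u - ψ y)).hasFDerivAt
          ((hasFDerivAt_id u).sub_const _)
      have h2 : HasFDerivAt (fun u => p (t, u))
          ((-(σ t • fderiv ℝ radialBump (u - ψ y))).smulRight w) u :=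
        (h1.const_mul (σ t)).neg.smul_const w
      rw [h2.fderiv, ContinuousLinearMap.norm_smulRight_apply, norm_neg, norm_smul,
        Real.norm_of_nonneg (Real.smoothTransition.nonneg t)]
      calc σ t * ‖fderiv ℝ radialBump (u - ψ y)‖ * ‖w‖
          ≤ 1 * (C + 1) * (1 / (2 * (C + 1))) := by
            gcongr
            · exact Real.smoothTransition.le_one t
            · linarith [hC (u - ψ y)]
        _ = 1 / 2 := by field_simp
    obtain ⟨h, h1, h2⟩ := exists_perm_of_perturbation hp hpd
    refine ⟨fun t => implant ψ hψ (h t), implant_mem_smoothPaths (R := ‖ψ y‖ + 3 / 2) hmax ?_ h2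
      ?_, ?_, ?_⟩
    · simp only [h1]; fun_prop
    · intro t v hv
      have : radialBump (v - ψ y) = 0 := by
        refine radialBump_of_ge ?_
        linarith [norm_sub_norm_le v (ψ y)]
      simp [h1, p, this]
    · have : h 0 = 1 := by
        ext1 v
        simp [h1, p, σ, Real.smoothTransition.zero]
      simp only [this, map_one]
    · have hb : radialBump (0 : 𝔼 n) = 1 := radialBump_of_le (by simp)
      have e1 : implant ψ hψ (h 1) (ψ.symm (ψ y)) = ψ.symm (ψ z) := by
        rw [implant_apply, h1]
        simp [p, σ, Real.smoothTransition.one, hb, hw]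
      rwa [ψ.left_inv hyψ, ψ.left_inv hz] at e1
  -- Orbits are open and partition X, hence are also closed.
  have hO : IsClopen (O x) := by
    constructor
    · rw [← isOpen_compl_iff, isOpen_iff_mem_nhds]
      intro y hy
      refine Filter.mem_of_superset (hnhds y) fun z hz hz' => hy ?_
      exact htrans _ _ _ hz' (hsymm _ _ hz)
    · rw [isOpen_iff_mem_nhds]
      intro y hy
      exact Filter.mem_of_superset (hnhds y) fun z hz => htrans _ _ _ hy hz
  exact hO.connectedComponent_subset (hself x) hy

end Homogeneity

/-! ### Orientation behaviour of compositions, inverses and isotopies. -/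

section Orientation

local notation:max "𝔼" n:max => EuclideanSpace ℝ (Fin n)

variable {n : ℕ} {X : Type u} [TopologicalSpace X]

/-- The Jacobian determinant of `g` at `y` in the coordinates `φ` and `ψ`. -/
def chartJacobian (φ ψ : OpenPartialHomeomorph X (𝔼 n)) (g : X → X) (y : X) : ℝ :=
  (fderiv ℝ (ψ ∘ g ∘ φ.symm) (φ y)).det

theorem chartJacobian_comp {φ ψ χ : OpenPartialHomeomorph X (𝔼 n)} {f g : X → X} {y : X}
    (hy : y ∈ φ.source) (hψ : g y ∈ ψ.source) (hg : ContinuousAt g y)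
    (h1 : DifferentiableAt ℝ (ψ ∘ g ∘ φ.symm) (φ y))
    (h2 : DifferentiableAt ℝ (χ ∘ f ∘ ψ.symm) (ψ (g y))) :
    chartJacobian φ χ (f ∘ g) y = chartJacobian ψ χ f (g y) * chartJacobian φ ψ g y := by
  have hev : χ ∘ (f ∘ g) ∘ φ.symm =ᶠ[𝓝 (φ y)] (χ ∘ f ∘ ψ.symm) ∘ (ψ ∘ g ∘ φ.symm) := by
    have hc : ContinuousAt (g ∘ φ.symm) (φ y) := by
      refine ContinuousAt.comp ?_ (φ.continuousAt_symm (φ.map_source hy))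
      rwa [φ.left_inv hy]
    have hm : (g ∘ φ.symm) (φ y) ∈ ψ.source := by
      rwa [Function.comp_apply, φ.left_inv hy]
    filter_upwards [hc (ψ.open_source.mem_nhds hm)] with u hu
    have : ψ.symm (ψ (g (φ.symm u))) = g (φ.symm u) := ψ.left_inv hu
    simp [this]
  have hval : (ψ ∘ g ∘ φ.symm) (φ y) = ψ (g y) := by simp [φ.left_inv hy]
  rw [chartJacobian, hev.fderiv_eq, fderiv_comp _ (by rwa [hval]) h1, hval]
  exact continuousLinearMap_det_mul _ _

theorem chartJacobian_id {φ : OpenPartialHomeomorph X (𝔼 n)} {y : X} (hy : y ∈ φ.source) :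
    chartJacobian φ φ id y = 1 := by
  have hev : φ ∘ id ∘ φ.symm =ᶠ[𝓝 (φ y)] id := by
    filter_upwards [φ.open_target.mem_nhds (φ.map_source hy)] with u hu
    exact φ.right_inv hu
  rw [chartJacobian, hev.fderiv_eq, fderiv_id]
  simp [ContinuousLinearMap.det]

variable [ChartedSpace (𝔼 n) X] [IsManifold (𝓡 n) ∞ X]

theorem contDiffAt_chart_rep {φ ψ : OpenPartialHomeomorph X (𝔼 n)}
    (hφ : φ ∈ IsManifold.maximalAtlas (𝓡 n) ∞ X) (hψ : ψ ∈ IsManifold.maximalAtlas (𝓡 n) ∞ X)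
    {g : X → X} {y : X} (hy : y ∈ φ.source) (hy' : g y ∈ ψ.source)
    (hg : ContMDiffAt (𝓡 n) (𝓡 n) ∞ g y) : ContDiffAt ℝ ∞ (ψ ∘ g ∘ φ.symm) (φ y) := by
  rw [← contMDiffAt_iff_contDiffAt]
  have h1 : ContMDiffAt 𝓘(ℝ, 𝔼 n) (𝓡 n) ∞ φ.symm (φ y) :=
    contMDiffAt_symm_of_mem_maximalAtlas hφ (φ.map_source hy)
  have hl := φ.left_inv hy
  refine ContMDiffAt.comp (I' := 𝓡 n) (φ y) (g := ψ) ?_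
    (ContMDiffAt.comp (I' := 𝓡 n) (φ y) (g := g) ?_ h1)
  · rw [Function.comp_apply, hl]
    exact contMDiffAt_of_mem_maximalAtlas hψ hy'
  · rwa [hl]

variable {o : OrientedAtlas (𝔼 n) X}

namespace IsOrientationPreserving

theorem comp {f g : X → X} (hf : IsOrientationPreserving o f) (hg : IsOrientationPreserving o g)
    (hf' : ContMDiff (𝓡 n) (𝓡 n) ∞ f) (hg' : ContMDiff (𝓡 n) (𝓡 n) ∞ g) :
    IsOrientationPreserving o (f ∘ g) := by
  intro φ hφ χ hχ y hy hy'
  obtain ⟨ψ, hψ, hyψ⟩ := o.covers (g y)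
  have hd := contDiffAt_chart_rep (o.charts_subset hφ) (o.charts_subset hψ) hy hyψ hg'.contMDiffAt
  have hd' := contDiffAt_chart_rep (o.charts_subset hψ) (o.charts_subset hχ) hyψ hy'
    hf'.contMDiffAt
  change 0 < chartJacobian φ χ (f ∘ g) y
  rw [chartJacobian_comp hy hyψ hg'.continuous.continuousAt (hd.differentiableAt (by simp))
    (hd'.differentiableAt (by simp))]
  exact mul_pos (hf ψ hψ χ hχ _ hyψ hy') (hg φ hφ ψ hψ _ hy hyψ)

omit [IsManifold (𝓡 n) ∞ X] in
theorem id : IsOrientationPreserving o (id : X → X) :=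
  fun φ hφ ψ hψ y hy hy' => o.compatible φ hφ ψ hψ y ⟨hy, hy'⟩

end IsOrientationPreserving

theorem chartJacobian_mul_symm {φ ψ : OpenPartialHomeomorph X (𝔼 n)}
    (hφ : φ ∈ IsManifold.maximalAtlas (𝓡 n) ∞ X) (hψ : ψ ∈ IsManifold.maximalAtlas (𝓡 n) ∞ X)
    {g : Equiv.Perm X} (h1 : ContMDiff (𝓡 n) (𝓡 n) ∞ g) (h2 : ContMDiff (𝓡 n) (𝓡 n) ∞ g.symm)
    {y : X} (hy : y ∈ φ.source) (hy' : g y ∈ ψ.source) :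
    chartJacobian ψ φ g.symm (g y) * chartJacobian φ ψ g y = 1 := by
  have hy2 : g.symm (g y) ∈ φ.source := by rwa [Equiv.symm_apply_apply]
  rw [← chartJacobian_comp hy hy' h1.continuous.continuousAt
    ((contDiffAt_chart_rep hφ hψ hy hy' h1.contMDiffAt).differentiableAt (by simp))
    ((contDiffAt_chart_rep hψ hφ hy' hy2 h2.contMDiffAt).differentiableAt (by simp))]
  rw [Equiv.symm_comp_self, chartJacobian_id hy]

namespace IsOrientationPreserving

theorem symm {g : Equiv.Perm X} (hg : IsOrientationPreserving o g)
    (h1 : ContMDiff (𝓡 n) (𝓡 n) ∞ g) (h2 : ContMDiff (𝓡 n) (𝓡 n) ∞ g.symm) :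
    IsOrientationPreserving o g.symm := by
  intro φ hφ ψ hψ y hy hy'
  have hy2 : g (g.symm y) ∈ φ.source := by rwa [Equiv.apply_symm_apply]
  have h := chartJacobian_mul_symm (o.charts_subset hψ) (o.charts_subset hφ) h1 h2 hy' hy2
  rw [Equiv.apply_symm_apply] at h
  have hpos : 0 < chartJacobian ψ φ g (g.symm y) := hg ψ hψ φ hφ _ hy' hy2
  change 0 < chartJacobian φ ψ g.symm y
  exact (pos_iff_pos_of_mul_pos (h ▸ one_pos)).2 hpos

/-- At a fixed point y the Jacobian in oriented charts is nonzero and depends continuously on time,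
while a change of oriented chart keeps its sign. The set S of good times is therefore open and
closed in ℝ. -/
theorem smoothPath {h : ℝ → Equiv.Perm X} (hh : h ∈ SmoothPaths n X) {t₁ : ℝ}
    (h1 : IsOrientationPreserving o (h t₁)) (t₂ : ℝ) : IsOrientationPreserving o (h t₂) := by
  intro φ hφ ψ₂ hψ₂ y hy hy₂
  let S : Set ℝ := {t | ∀ ψ ∈ o.charts, h t y ∈ ψ.source → 0 < chartJacobian φ ψ (h t) y}
  have hloc : ∀ t₀, ∀ᶠ t in 𝓝 t₀, (t ∈ S ↔ t₀ ∈ S) := by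
    intro t₀
    obtain ⟨ψ, hψ, hyψ⟩ := o.covers (h t₀ y)
    have hsrc : ∀ᶠ t in 𝓝 t₀, h t y ∈ ψ.source := by
      have : Continuous fun t => h t y := (SmoothPaths.continuous hh).comp
        (continuous_id.prodMk continuous_const)
      exact this.continuousAt (ψ.open_source.mem_nhds hyψ)
    have hiff : ∀ t, h t y ∈ ψ.source → (t ∈ S ↔ 0 < chartJacobian φ ψ (h t) y) := by
      refine fun t ht => ⟨fun hS => hS ψ hψ ht, fun hpos χ hχ hyχ => ?_⟩
      have e := chartJacobian_comp (f := _root_.id) (g := h t) (χ := χ) hy ht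
        (SmoothPaths.contMDiff hh t).continuous.continuousAt
        ((contDiffAt_chart_rep (o.charts_subset hφ) (o.charts_subset hψ) hy ht
          (SmoothPaths.contMDiff hh t).contMDiffAt).differentiableAt (by simp))
        ((contDiffAt_chart_rep (o.charts_subset hψ) (o.charts_subset hχ) ht hyχ
          contMDiffAt_id).differentiableAt (by simp))
      rw [Function.id_comp] at e
      rw [e]
      exact mul_pos (IsOrientationPreserving.id ψ hψ χ hχ _ ht hyχ) hpos
    have hc : ContinuousAt (fun t => chartJacobian φ ψ (h t) y) t₀ := by
      let G : ℝ × 𝔼 n → 𝔼 n := fun q => ψ (h q.1 (φ.symm q.2))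
      have hGm : ContMDiffAt (𝓘(ℝ, ℝ).prod 𝓘(ℝ, 𝔼 n)) 𝓘(ℝ, 𝔼 n) ∞ G (t₀, φ y) := by
        have a1 : ContMDiffAt 𝓘(ℝ, 𝔼 n) (𝓡 n) ∞ φ.symm (φ y) :=
          contMDiffAt_symm_of_mem_maximalAtlas (o.charts_subset hφ) (φ.map_source hy)
        have a2 : ContMDiffAt (𝓘(ℝ, ℝ).prod 𝓘(ℝ, 𝔼 n)) (𝓡 n) ∞
            (fun q : ℝ × 𝔼 n => h q.1 (φ.symm q.2)) (t₀, φ y) :=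
          ContMDiffAt.comp (t₀, φ y) hh.1.contMDiffAt
            (contMDiffAt_fst.prodMk (ContMDiffAt.comp (t₀, φ y) a1 contMDiffAt_snd))
        refine ContMDiffAt.comp (t₀, φ y) (g := ψ) ?_ a2
        refine contMDiffAt_of_mem_maximalAtlas (o.charts_subset hψ) ?_
        simp only
        rwa [φ.left_inv hy]
      have hG : ContDiffAt ℝ ∞ G (t₀, φ y) := contMDiffAt_prod_iff_contDiffAt.1 hGm
      have hGe : ∀ᶠ q in 𝓝 (t₀, φ y), DifferentiableAt ℝ G q := by
        filter_upwards [(hG.of_le (m := 1) (by simp)).eventually (by simp)] with q hq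
        exact hq.differentiableAt (by simp)
      have hmk : ContinuousAt (fun t : ℝ => (t, φ y)) t₀ := by fun_prop
      have hev : (fun t => chartJacobian φ ψ (h t) y) =ᶠ[𝓝 t₀] fun t =>
          ((fderiv ℝ G (t, φ y)).comp (ContinuousLinearMap.inr ℝ ℝ (𝔼 n))).det := by
        filter_upwards [hmk.eventually hGe] with t ht
        have : HasFDerivAt (ψ ∘ h t ∘ φ.symm)
            ((fderiv ℝ G (t, φ y)).comp (ContinuousLinearMap.inr ℝ ℝ (𝔼 n))) (φ y) :=
          HasFDerivAt.comp (g := G) (f := fun u => (t, u)) (φ y) ht.hasFDerivAt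
            (hasFDerivAt_prodMk_right t (φ y))
        rw [chartJacobian, this.fderiv]
      refine ContinuousAt.congr ?_ hev.symm
      have hd : ContinuousAt (fun t : ℝ => fderiv ℝ G (t, φ y)) t₀ :=
        ContinuousAt.comp (g := fderiv ℝ G) (f := fun t : ℝ => (t, φ y))
          ((hG.fderiv_right (m := 0) (by simp)).continuousAt) hmk
      exact (continuous_det_clm (V := 𝔼 n)).continuousAt.comp
        (hd.clm_comp continuousAt_const)
    have hne : chartJacobian φ ψ (h t₀) y ≠ 0 := right_ne_zero_of_mul_eq_one
      (chartJacobian_mul_symm (o.charts_subset hφ) (o.charts_subset hψ)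
        (SmoothPaths.contMDiff hh t₀) (SmoothPaths.contMDiff_symm hh t₀) hy hyψ)
    rcases lt_or_gt_of_ne hne with hlt | hgt
    · filter_upwards [hsrc, hc.eventually (gt_mem_nhds hlt)] with t h1 h2
      rw [hiff t h1, hiff t₀ hyψ]
      exact ⟨fun h => absurd h h2.not_gt, fun h => absurd h hlt.not_gt⟩
    · filter_upwards [hsrc, hc.eventually (lt_mem_nhds hgt)] with t h1 h2
      rw [hiff t h1, hiff t₀ hyψ]
      exact ⟨fun _ => hgt, fun _ => h2⟩
  have hS : IsClopen S := by
    constructor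
    · rw [← isOpen_compl_iff, isOpen_iff_mem_nhds]
      intro t ht
      filter_upwards [hloc t] with s hs hs'
      exact ht (hs.1 hs')
    · rw [isOpen_iff_mem_nhds]
      intro t ht
      filter_upwards [hloc t] with s hs
      exact hs.2 ht
  have hu : S = univ := hS.eq_univ ⟨t₁, fun ψ hψ hy' => h1 φ hφ ψ hψ y hy hy'⟩
  exact (hu ▸ mem_univ t₂ : t₂ ∈ S) ψ₂ hψ₂ hy₂

end IsOrientationPreserving

end Orientation

/-! ### Smooth paths of automorphisms and conjugation of plane generators. -/

section LinearPaths

open Module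

variable {V : Type*} [NormedAddCommGroup V] [NormedSpace ℝ V]

theorem contDiff_rot (J : V →L[ℝ] V) : ContDiff ℝ ∞ (rot J) := by
  unfold rot
  fun_prop

variable [FiniteDimensional ℝ V]

theorem exists_normal_form_clm {A C : V →L[ℝ] V} (hAC : Commute A C) (hA : 0 < A.det)
    (hC : 0 < C.det) (hodd : Odd (finrank ℝ ↥(negativeSubspace (A : End ℝ V) ⊓
      negativeSubspace (C : End ℝ V)))) :
    ∃ a c J K L : V →L[ℝ] V, a * a = 1 ∧ c * c = 1 ∧
      (∀ T, Commute T A → Commute T a) ∧ (∀ T, Commute T C → Commute T c) ∧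
      (∀ s ∈ Icc (0 : ℝ) 1, 0 < ((1 - s) • (1 : V →L[ℝ] V) + s • (a * A)).det) ∧
      (∀ s ∈ Icc (0 : ℝ) 1, 0 < ((1 - s) • (1 : V →L[ℝ] V) + s • (c * C)).det) ∧
      IsPlaneGenerator (J : End ℝ V) ∧ a * J = -J * a ∧ Commute c J ∧ Commute a K ∧
      J * K = 0 ∧ K * J = 0 ∧ K * K * K = -K ∧ rot (J + K) Real.pi = c ∧
      L * L * L = -L ∧ rot L Real.pi = a ∧ 3 ≤ finrank ℝ V := by
  let Φ : End ℝ V ≃ₐ[ℝ] (V →L[ℝ] V) := Module.End.toContinuousLinearMap V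
  have hΦ : ∀ T : V →L[ℝ] V, Φ (T : End ℝ V) = T := fun T => by ext v; rfl
  have hdet : ∀ T : End ℝ V, (Φ T).det = LinearMap.det T := LinearMap.det_toContinuousLinearMap
  have hcomm : ∀ {S T : V →L[ℝ] V}, Commute S T → Commute (S : End ℝ V) (T : End ℝ V) :=
    fun {S T} h => Φ.injective (by rw [map_mul, map_mul, hΦ, hΦ]; exact h)
  obtain ⟨a, c, J, K, L, h1, h2, h3, h4, h5, h6, h7, h8, h9, h10, h11, h12, h13, h14, h15, h16,
    h17⟩ := exists_normal_form (A := (A : End ℝ V)) (C := (C : End ℝ V)) (hcomm hAC) hA hC hodd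
  refine ⟨Φ a, Φ c, Φ J, Φ K, Φ L, ?_, ?_, ?_, ?_, ?_, ?_, h7, ?_, h9.map Φ, h10.map Φ, ?_, ?_,
    ?_, ?_, ?_, ?_, h17⟩
  · rw [← map_mul, h1, map_one]
  · rw [← map_mul, h2, map_one]
  · intro T hT
    have := (h3 T (hcomm hT)).map Φ
    rwa [hΦ] at this
  · intro T hT
    have := (h4 T (hcomm hT)).map Φ
    rwa [hΦ] at this
  · intro s hs
    have := h5 s hs
    rw [← hdet] at this
    simpa only [map_add, map_smul, map_mul, map_one, hΦ] using this
  · intro s hs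
    have := h6 s hs
    rw [← hdet] at this
    simpa only [map_add, map_smul, map_mul, map_one, hΦ] using this
  · rw [← map_mul, h8, map_mul, map_neg]
  · rw [← map_mul, h11, map_zero]
  · rw [← map_mul, h12, map_zero]
  · rw [← map_mul, ← map_mul, h13, map_neg]
  · rw [← map_add, ← map_rot, h14]
  · rw [← map_mul, ← map_mul, h15, map_neg]
  · rw [← map_rot, h16]

/-- The automorphisms with positive determinant are joined to the identity by smooth paths. -/
theorem exists_path_of_det_pos {Q : V →L[ℝ] V} (hQ : 0 < Q.det) :
    ∃ κ : ℝ → V →L[ℝ] V, ContDiff ℝ ∞ κ ∧ κ 0 = 1 ∧ κ 1 = Q ∧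
      ∀ t ∈ Icc (0 : ℝ) 1, 0 < (κ t).det := by
  have hinj : Function.Injective (Q : End ℝ V) :=
    LinearMap.ker_eq_bot.1 (by_contra fun h0 => hQ.ne' (LinearMap.det_eq_zero_iff_ker_ne_bot.2 h0))
  obtain ⟨e, he, -, -, hse⟩ := exists_negative_projection (Q : End ℝ V) hinj
  have hpos : 0 < LinearMap.det (1 - (2 : ℝ) • e) := by
    have := det_pos_of_segment hse (right_mem_Icc.2 zero_le_one)
    rw [sub_self, zero_smul, zero_add, one_smul, map_mul] at this
    exact pos_of_mul_pos_left this hQ.le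
  obtain ⟨I, heI, hIe, hII⟩ := exists_complex_structure_of_even he
    (even_finrank_range_of_det_pos he hpos)
  have hI3 : I * I * I = -I := by rw [hII, neg_mul, heI]
  let Φ : End ℝ V ≃ₐ[ℝ] (V →L[ℝ] V) := Module.End.toContinuousLinearMap V
  have hΦ : ∀ T : V →L[ℝ] V, Φ (T : End ℝ V) = T := fun T => by ext v; rfl
  have hdet : ∀ T : End ℝ V, (Φ T).det = LinearMap.det T := LinearMap.det_toContinuousLinearMap
  have hL3 : Φ I * Φ I * Φ I = -Φ I := by rw [← map_mul, ← map_mul, hI3, map_neg]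
  have hrot : rot (Φ I) Real.pi = Φ (1 - (2 : ℝ) • e) := by
    rw [← map_rot, rot_pi, hII, smul_neg, sub_eq_add_neg]
  have hqq : (1 - (2 : ℝ) • e) * (1 - (2 : ℝ) • e) = 1 := by
    have hee : e * e = e := he
    simp only [sub_mul, mul_sub, one_mul, mul_one, smul_mul_assoc, mul_smul_comm, hee]
    module
  -- Q is the product of the involution 1 - 2e and of (1 - 2e)Q; the former is a half turn, since e
  -- has even rank, and the latter is joined to 1 by a segment.
  refine ⟨fun t => rot (Φ I) (Real.pi * t) *
    ((1 - t) • (1 : V →L[ℝ] V) + t • (Φ (1 - (2 : ℝ) • e) * Q)), ?_, ?_, ?_, ?_⟩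
  · refine ContDiff.clm_comp ((contDiff_rot (Φ I)).comp (by fun_prop)) ?_
    fun_prop
  · simp
  · simp only [mul_one, hrot, sub_self, zero_smul, zero_add, one_smul]
    rw [← mul_assoc, ← map_mul, hqq, map_one, one_mul]
  · intro t ht
    rw [continuousLinearMap_det_mul]
    refine mul_pos (det_rot_pos hL3 _) ?_
    have := det_pos_of_segment hse ht
    rw [← hdet] at this
    simpa only [map_add, map_smul, map_mul, map_one, hΦ] using this

/-- In dimension at least `3`, infinitesimal rotations of planes are conjugate by automorphisms
of positive determinant. -/
theorem IsPlaneGenerator.exists_conj_det_pos {J K : V →L[ℝ] V}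
    (hJ : IsPlaneGenerator (J : End ℝ V)) (hK : IsPlaneGenerator (K : End ℝ V))
    (hV : 3 ≤ finrank ℝ V) : ∃ Q R : V →L[ℝ] V, Q * R = 1 ∧ R * Q = 1 ∧ 0 < Q.det ∧
      Q * J * R = K := by
  obtain ⟨e, he⟩ := hJ.exists_conj hK
  let ε := e.toContinuousLinearEquiv
  let Q : V →L[ℝ] V := ε
  let R : V →L[ℝ] V := ε.symm
  have hQR : Q * R = 1 := by ext v; simp [Q, R]
  have hRQ : R * Q = 1 := by ext v; simp [Q, R]
  have hconj : Q * J * R = K := by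
    ext v
    exact congrArg (fun T : End ℝ V => T v) he
  have hdet : Q.det * R.det = 1 := by
    rw [← continuousLinearMap_det_mul, hQR]; simp [ContinuousLinearMap.det]
  rcases lt_or_gt_of_ne (left_ne_zero_of_mul_eq_one hdet) with hneg | hpos
  · obtain ⟨v, w, f, g, h1, h2, h3, h4, hKe⟩ := hK
    -- A conjugation of negative determinant is corrected by a reflection which fixes the plane of K
    -- pointwise; the third dimension supplies its axis x.
    obtain ⟨x, hx, hx0⟩ : ∃ x : V, f.prod g x = 0 ∧ x ≠ 0 := by
      have : LinearMap.ker (f.prod g) ≠ ⊥ := by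
        refine LinearMap.ker_ne_bot_of_finrank_lt ?_
        simp; omega
      obtain ⟨x, hx, hx0⟩ := (Submodule.ne_bot_iff _).1 this
      exact ⟨x, hx, hx0⟩
    have hfx : f x = 0 := congrArg Prod.fst hx
    have hgx : g x = 0 := congrArg Prod.snd hx
    obtain ⟨h₀, hh₀⟩ := Projective.exists_dual_eq_one ℝ hx0
    let h : Dual ℝ V := h₀ - h₀ v • f - h₀ w • g
    have hhx : h x = 1 := by simp [h, hfx, hgx, hh₀]
    have hhv : h v = 0 := by simp [h, h1, h3]
    have hhw : h w = 0 := by simp [h, h2, h4]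
    let S : V →L[ℝ] V := LinearMap.toContinuousLinearMap (LinearMap.transvection h (-(2 : ℝ) • x))
    have hS : ∀ y, S y = y + h y • (-(2 : ℝ) • x) := fun y => LinearMap.transvection.apply _ _ _
    have hK' : ∀ y, K y = f y • w - g y • v := fun y => congrArg (fun T : End ℝ V => T y) hKe
    have hSS : S * S = 1 := by
      ext y
      simp only [mul_apply_eq_comp, hS, map_add, map_smul, hhx, smul_eq_mul, one_apply_eq_self]
      module
    have hSK : S * K = K * S := by
      ext y
      simp only [mul_apply_eq_comp, hS, hK', map_add, map_sub, map_smul, hhv, hhw, hfx, hgx,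
        smul_eq_mul]
      module
    have hSdet : S.det = -1 := by
      refine (LinearMap.det_toContinuousLinearMap _).trans ?_
      rw [LinearMap.transvection.det, map_smul, hhx]
      norm_num
    refine ⟨S * Q, R * S, ?_, ?_, ?_, ?_⟩
    · rw [mul_assoc, ← mul_assoc Q, hQR, one_mul, hSS]
    · rw [mul_assoc, ← mul_assoc S, hSS, one_mul, hRQ]
    · rw [continuousLinearMap_det_mul, hSdet]; linarith
    · calc S * Q * J * (R * S) = S * (Q * J * R) * S := by simp only [mul_assoc]
        _ = K := by rw [hconj, hSK, mul_assoc, hSS, mul_one]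
  · exact ⟨Q, R, hQR, hRQ, hpos, hconj⟩

end LinearPaths

/-! ### Commutators modulo isotopies with trivial differentials. -/

section Straightening

open Module

local notation:max "𝔼" n:max => EuclideanSpace ℝ (Fin n)

variable {n : ℕ} {X : Type u} [TopologicalSpace X] [ChartedSpace (𝔼 n) X]

/-- The end of an isotopy starting at the identity whose differentials at the centre of `φ` are
given by `κ`. -/
def Realizes (φ : OpenPartialHomeomorph X (𝔼 n)) (κ : ℝ → 𝔼 n →L[ℝ] 𝔼 n) (g : Equiv.Perm X) :
    Prop :=
  ∃ h ∈ SmoothPaths n X, h 0 = 1 ∧ h 1 = g ∧ ∀ t, HasChartDeriv φ (h t) (κ t)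

variable {φ : OpenPartialHomeomorph X (𝔼 n)} {κ κ' : ℝ → 𝔼 n →L[ℝ] 𝔼 n} {g g' p : Equiv.Perm X}
  {P : 𝔼 n →L[ℝ] 𝔼 n}

theorem Realizes.hasChartDeriv (h : Realizes φ κ g) : HasChartDeriv φ g (κ 1) := by
  obtain ⟨k, -, -, rfl, hD⟩ := h
  exact hD 1

theorem Realizes.mem (h : Realizes φ κ g) : (fun _ => g) ∈ SmoothPaths n X := by
  obtain ⟨k, hk, -, rfl, -⟩ := h
  exact SmoothPaths.const hk 1

theorem Realizes.mul (hφ : φ.target = univ) (h : Realizes φ κ g) (h' : Realizes φ κ' g') :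
    Realizes φ (fun t => κ t * κ' t) (g * g') := by
  obtain ⟨k, hk, k0, rfl, hD⟩ := h
  obtain ⟨k', hk', k0', rfl, hD'⟩ := h'
  exact ⟨k * k', mul_mem hk hk', by simp [k0, k0'], rfl, fun t => (hD t).mul hφ (hD' t)⟩

variable [IsManifold (𝓡 n) ∞ X]

theorem HasChartDeriv.isUnit (hφ : φ.target = univ)
    (hmax : φ ∈ IsManifold.maximalAtlas (𝓡 n) ∞ X) (hp : (fun _ => p) ∈ SmoothPaths n X)
    (h : HasChartDeriv φ p P) : IsUnit P := by
  obtain ⟨Q, hQ⟩ := HasChartDeriv.exists_of_contMDiff (g := p⁻¹) hφ hmax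
    (SmoothPaths.contMDiff_symm hp 0) (by rw [Equiv.Perm.inv_eq_iff_eq, h.fixes])
  refine ⟨⟨P, Q, ?_, ?_⟩, rfl⟩
  · exact (h.mul hφ hQ).unique (by rw [mul_inv_cancel]; exact HasChartDeriv.one hφ)
  · exact (hQ.mul hφ h).unique (by rw [inv_mul_cancel]; exact HasChartDeriv.one hφ)

theorem HasChartDeriv.inverse (hφ : φ.target = univ)
    (hmax : φ ∈ IsManifold.maximalAtlas (𝓡 n) ∞ X) (hp : (fun _ => p) ∈ SmoothPaths n X)
    (h : HasChartDeriv φ p P) : HasChartDeriv φ p⁻¹ (Ring.inverse P) :=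
  h.inv hφ hmax (SmoothPaths.contMDiff_symm hp 0)
    (Ring.inverse_mul_cancel _ (h.isUnit hφ hmax hp))

namespace Realizes

theorem inv (hφ : φ.target = univ) (hmax : φ ∈ IsManifold.maximalAtlas (𝓡 n) ∞ X)
    (h : Realizes φ κ g) : Realizes φ (fun t => Ring.inverse (κ t)) g⁻¹ := by
  obtain ⟨k, hk, k0, rfl, hD⟩ := h
  exact ⟨k⁻¹, inv_mem hk, by simp [k0], rfl,
    fun t => (hD t).inverse hφ hmax (SmoothPaths.const hk t)⟩

theorem isUnit (hφ : φ.target = univ) (hmax : φ ∈ IsManifold.maximalAtlas (𝓡 n) ∞ X)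
    (h : Realizes φ κ g) (t : ℝ) : IsUnit (κ t) := by
  obtain ⟨k, hk, k0, rfl, hD⟩ := h
  exact (hD t).isUnit hφ hmax (SmoothPaths.const hk t)

theorem conj (hφ : φ.target = univ) (hmax : φ ∈ IsManifold.maximalAtlas (𝓡 n) ∞ X)
    (hp : (fun _ => p) ∈ SmoothPaths n X) (hP : HasChartDeriv φ p P) (h : Realizes φ κ g) :
    Realizes φ (fun t => P * κ t * Ring.inverse P) (p * g * p⁻¹) := by
  obtain ⟨k, hk, k0, rfl, hD⟩ := h
  exact ⟨(fun _ => p) * k * (fun _ => p)⁻¹, mul_mem (mul_mem hp hk) (inv_mem hp), by simp [k0], rfl,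
    fun t => (hP.mul hφ (hD t)).mul hφ (hP.inverse hφ hmax hp)⟩

/-- Ends of isotopies with equal differentials agree modulo isotopies with trivial differentials, so
in the quotient only the path of differentials counts. -/
theorem mul_inv_of_eq (hφ : φ.target = univ)
    (hmax : φ ∈ IsManifold.maximalAtlas (𝓡 n) ∞ X) (h : Realizes φ κ g) (h' : Realizes φ κ g') :
    Realizes φ (fun _ => 1) (g * g'⁻¹) := by
  have := h.mul hφ (h'.inv hφ hmax)
  simpa only [Ring.mul_inverse_cancel _ (h.isUnit hφ hmax _)] using this

/-- Conjugating the isotopy by p leaves its differentials unchanged when P commutes with them. -/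
theorem commutator (hφ : φ.target = univ)
    (hmax : φ ∈ IsManifold.maximalAtlas (𝓡 n) ∞ X) (hp : (fun _ => p) ∈ SmoothPaths n X)
    (hP : HasChartDeriv φ p P) (h : Realizes φ κ g) (hc : ∀ t, Commute P (κ t)) :
    Realizes φ (fun _ => 1) (p * g * p⁻¹ * g⁻¹) := by
  refine mul_inv_of_eq (κ := κ) hφ hmax ?_ h
  have := h.conj hφ hmax hp hP
  simpa only [(hc _).eq, mul_assoc, Ring.mul_inverse_cancel _ (hP.isUnit hφ hmax hp),
    mul_one] using this

end Realizes

/-- The diffeomorphisms which fix the centre of the coordinates `φ`. -/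
def fixingGroup (φ : OpenPartialHomeomorph X (𝔼 n)) : Subgroup (Equiv.Perm X) where
  carrier := {g | (fun _ => g) ∈ SmoothPaths n X ∧ g (φ.symm 0) = φ.symm 0}
  one_mem' := ⟨one_mem (SmoothPaths n X), rfl⟩
  mul_mem' h h' := ⟨mul_mem h.1 h'.1, by rw [Equiv.Perm.mul_apply, h'.2, h.2]⟩
  inv_mem' h := ⟨inv_mem h.1, by rw [Equiv.Perm.inv_eq_iff_eq, h.2]⟩

theorem HasChartDeriv.mem_fixingGroup (hp : (fun _ => p) ∈ SmoothPaths n X)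
    (h : HasChartDeriv φ p P) : p ∈ fixingGroup φ := ⟨hp, h.fixes⟩

theorem Realizes.mem_fixingGroup (h : Realizes φ κ g) : g ∈ fixingGroup φ :=
  h.hasChartDeriv.mem_fixingGroup h.mem

/-- The diffeomorphisms isotopic to the identity through diffeomorphisms with trivial differential
at the centre of the coordinates. -/
def nullGroup (hφ : φ.target = univ) (hmax : φ ∈ IsManifold.maximalAtlas (𝓡 n) ∞ X) :
    Subgroup (fixingGroup φ) where
  carrier := {g | Realizes φ (fun _ => 1) (g : Equiv.Perm X)}
  one_mem' := ⟨1, one_mem _, rfl, rfl, fun _ => HasChartDeriv.one hφ⟩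
  mul_mem' h h' := by simpa using h.mul hφ h'
  inv_mem' h := by simpa using h.inv hφ hmax

instance (hφ : φ.target = univ) (hmax : φ ∈ IsManifold.maximalAtlas (𝓡 n) ∞ X) :
    (nullGroup hφ hmax).Normal where
  conj_mem g hg p := by
    obtain ⟨P, hP⟩ := HasChartDeriv.exists_of_contMDiff hφ hmax
      (SmoothPaths.contMDiff p.2.1 0) p.2.2
    have := Realizes.conj hφ hmax p.2.1 hP hg
    simp only [mul_one, Ring.mul_inverse_cancel _ (hP.isUnit hφ hmax p.2.1)] at this
    exact this

/-- The factor l drops out since it commutes with the second entry of the commutator. The product a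
m⁻¹ commutes with c n⁻¹, so only its commutator with k⁻¹ survives, up to conjugation. -/
theorem commutator_eq_of_commute {Γ : Type*} [Group Γ] {a c m n l k : Γ} (h1 : Commute a c)
    (h2 : Commute a n) (h3 : Commute c m) (h4 : Commute n m)
    (h5 : Commute (c * (n⁻¹ * k⁻¹)) l) :
    (a * (m⁻¹ * l⁻¹)) * (c * (n⁻¹ * k⁻¹)) * (a * (m⁻¹ * l⁻¹))⁻¹ * (c * (n⁻¹ * k⁻¹))⁻¹ =
      (c * n⁻¹) * ((a * m⁻¹) * k⁻¹ * (a * m⁻¹)⁻¹ * k) * (c * n⁻¹)⁻¹ := by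
  have hpq : Commute (a * m⁻¹) (c * n⁻¹) :=
    (h1.mul_right h2.inv_right).mul_left ((h3.symm.inv_left).mul_right h4.symm.inv_inv)
  have h5' : l⁻¹ * (c * (n⁻¹ * k⁻¹)) = (c * (n⁻¹ * k⁻¹)) * l⁻¹ := h5.symm.inv_left
  calc _ = (a * m⁻¹) * (l⁻¹ * (c * (n⁻¹ * k⁻¹))) * l * (a * m⁻¹)⁻¹ * (c * (n⁻¹ * k⁻¹))⁻¹ := by group
    _ = ((a * m⁻¹) * (c * n⁻¹)) * k⁻¹ * (a * m⁻¹)⁻¹ * k * (c * n⁻¹)⁻¹ := by rw [h5']; group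
    _ = _ := by rw [hpq.eq]; group

/-- Conjugation by a reverses J and fixes K: the K-rotations cancel and the J-rotations add up. At t
= π the path has made a full turn; this is the source of the nontrivial loop. -/
theorem conj_rot_mul_rot {R : Type*} [Ring R] [Algebra ℝ R] {a J K : R} (haa : a * a = 1)
    (haJ : a * J = -J * a) (haK : Commute a K) (hJK : J * K = 0) (hKJ : K * J = 0)
    (hJ : J * J * J = -J) (hK : K * K * K = -K) (t : ℝ) :
    a * rot (J + K) (-t) * a * rot (J + K) t = rot J (2 * t) := by
  have h1 : a * (J + K) = (-J + K) * a := by rw [mul_add, add_mul, haJ, haK.eq]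
  rw [conj_rot haa h1, rot_add_generator (by rw [neg_mul, hJK, neg_zero])
    (by rw [mul_neg, hKJ, neg_zero]), add_comm J K, rot_add_generator hKJ hJK, rot_neg, neg_neg]
  have h2 : rot K (-t) * rot K t = 1 := by rw [← rot_add hK, neg_add_cancel, rot_zero]
  rw [mul_assoc, ← mul_assoc (rot K (-t)), h2, one_mul, ← rot_add hJ, two_mul]

variable [T2Space X]

/-- Two diffeomorphisms whose commutator is isotopic to the identity relative to the first order
jet at a common fixed point, and whose differentials have a joint negative subspace of odd
dimension, can be modified by isotopies to have trivial differentials, so that the commutator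
becomes the end of an isotopy whose differentials run once through a loop of rotations. -/
theorem exists_straightened_pair (hφ : φ.target = univ)
    (hmax : φ ∈ IsManifold.maximalAtlas (𝓡 n) ∞ X) {a c : Equiv.Perm X}
    (ha : (fun _ => a) ∈ SmoothPaths n X) (hc : (fun _ => c) ∈ SmoothPaths n X)
    {A C : 𝔼 n →L[ℝ] 𝔼 n} (haA : HasChartDeriv φ a A) (hcC : HasChartDeriv φ c C)
    (hA : 0 < A.det) (hC : 0 < C.det)
    (hodd : Odd (finrank ℝ ↥(negativeSubspace (A : End ℝ (𝔼 n)) ⊓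
      negativeSubspace (C : End ℝ (𝔼 n)))))
    (hac : Realizes φ (fun _ => 1) (a * c * a⁻¹ * c⁻¹)) :
    3 ≤ n ∧ ∃ J : 𝔼 n →L[ℝ] 𝔼 n, IsPlaneGenerator (J : End ℝ (𝔼 n)) ∧
    ∃ κ₁ κ₂ m₁ m₂, Realizes φ κ₁ m₁ ∧ Realizes φ κ₂ m₂ ∧ HasChartDeriv φ (a * m₁) 1 ∧
      HasChartDeriv φ (c * m₂) 1 ∧
      ∀ g, Realizes φ (fun t => rot J (2 * Real.pi * Real.smoothTransition t)) g →
        Realizes φ (fun _ => 1)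
          ((a * m₁) * (c * m₂) * (a * m₁)⁻¹ * (c * m₂)⁻¹ * g⁻¹) := by
  have hAu := haA.isUnit hφ hmax ha
  have hCu := hcC.isUnit hφ hmax hc
  have hAC : Commute A C := by
    have h1 := (((haA.mul hφ hcC).mul hφ (haA.inverse hφ hmax ha)).mul hφ
      (hcC.inverse hφ hmax hc)).unique hac.hasChartDeriv
    calc A * C = A * C * (Ring.inverse A * (Ring.inverse C * C) * A) := by
          rw [Ring.inverse_mul_cancel _ hCu, mul_one, Ring.inverse_mul_cancel _ hAu, mul_one]
      _ = (A * C * Ring.inverse A * Ring.inverse C) * (C * A) := by simp only [mul_assoc]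
      _ = C * A := by rw [h1, one_mul]
  obtain ⟨a₀, c₀, J, K, L, haa, hcc, hTa, hTc, hsA, hsC, hJ, haJ, hcJ, haK, hJK, hKJ, hK3, hJKc,
    hL3, hLa, hn⟩ := exists_normal_form_clm hAC hA hC hodd
  have hJ3 : J * J * J = -J :=
    ContinuousLinearMap.ext fun v => congrArg (fun T : End ℝ (𝔼 n) => T v) hJ.cube
  have hJK3 : (J + K) * (J + K) * (J + K) = -(J + K) := by
    have h1 : K * K * J = 0 := by rw [mul_assoc, hKJ, mul_zero]
    have h2 : J * J * K = 0 := by rw [mul_assoc, hJK, mul_zero]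
    simp only [mul_add, add_mul, hJK, hKJ, hJ3, hK3, h1, h2, zero_mul, add_zero, zero_add, neg_add]
  let σ := Real.smoothTransition
  have hσ1 : σ 1 = 1 := Real.smoothTransition.one
  have real : ∀ {κ : ℝ → 𝔼 n →L[ℝ] 𝔼 n}, ContDiff ℝ ∞ κ → κ 0 = 1 →
      (∀ t ∈ Icc (0 : ℝ) 1, 0 < (κ t).det) → ∃ g, Realizes φ (fun t => κ (σ t)) g := by
    intro κ h1 h2 h3
    obtain ⟨h, hh, h0, hD⟩ := exists_realization hφ hmax h1 h2 h3
    exact ⟨h 1, h, hh, h0, rfl, hD⟩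
  have rotreal : ∀ {J : 𝔼 n →L[ℝ] 𝔼 n}, J * J * J = -J →
      ∃ g, Realizes φ (fun t => rot J (Real.pi * σ t)) g := fun {J} hJ =>
    real (κ := fun s => rot J (Real.pi * s)) ((contDiff_rot J).comp (by fun_prop)) (by simp)
      fun t _ => det_rot_pos hJ _
  -- The ends m and w have differentials a₀ A and c₀ C, so dividing by them turns A and C into a₀
  -- and c₀; dividing further by l and k turns these into 1.
  obtain ⟨m, hm⟩ := real (κ := fun s => (1 - s) • (1 : 𝔼 n →L[ℝ] 𝔼 n) + s • (a₀ * A))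
    (by fun_prop) (by simp) hsA
  obtain ⟨w, hw⟩ := real (κ := fun s => (1 - s) • (1 : 𝔼 n →L[ℝ] 𝔼 n) + s • (c₀ * C))
    (by fun_prop) (by simp) hsC
  obtain ⟨l, hl⟩ := rotreal hL3
  obtain ⟨k, hk⟩ := rotreal hJK3
  have hm1 : HasChartDeriv φ m (a₀ * A) := by
    have := hm.hasChartDeriv
    rwa [hσ1, sub_self, one_smul, zero_smul ℝ (1 : 𝔼 n →L[ℝ] 𝔼 n), zero_add] at this
  have hw1 : HasChartDeriv φ w (c₀ * C) := by
    have := hw.hasChartDeriv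
    rwa [hσ1, sub_self, one_smul, zero_smul ℝ (1 : 𝔼 n →L[ℝ] 𝔼 n), zero_add] at this
  have hl1 : HasChartDeriv φ l a₀ := by
    have := hl.hasChartDeriv
    rwa [hσ1, mul_one, hLa] at this
  have hk1 : HasChartDeriv φ k c₀ := by
    have := hk.hasChartDeriv
    rwa [hσ1, mul_one, hJKc] at this
  have hseg : ∀ {T B : 𝔼 n →L[ℝ] 𝔼 n} (s : ℝ), Commute T B →
      Commute T ((1 - s) • (1 : 𝔼 n →L[ℝ] 𝔼 n) + s • B) := by
    intro T B s h
    refine ContinuousLinearMap.ext fun v => ?_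
    have := congrArg (fun S : 𝔼 n →L[ℝ] 𝔼 n => S v) h.eq
    simp only [mul_apply_eq_comp] at this
    simp [this]
  have hAc0 : Commute A c₀ := hTc A hAC
  have hCa0 : Commute C a₀ := hTa C hAC.symm
  have hc0a0 : Commute c₀ a₀ := hTa c₀ hAc0.symm
  -- the differentials of the modified diffeomorphisms
  have hinv : ∀ {B b : 𝔼 n →L[ℝ] 𝔼 n}, b * b = 1 → IsUnit (b * B) →
      B * Ring.inverse (b * B) = b := by
    intro B b hb hu
    calc B * Ring.inverse (b * B) = (b * b) * B * Ring.inverse (b * B) := by rw [hb, one_mul]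
      _ = b * ((b * B) * Ring.inverse (b * B)) := by simp only [mul_assoc]
      _ = b := by rw [Ring.mul_inverse_cancel _ hu, mul_one]
  have hmu := hm1.isUnit hφ hmax hm.mem
  have hwu := hw1.isUnit hφ hmax hw.mem
  have hstarA : HasChartDeriv φ (a * m⁻¹) a₀ := by
    have := haA.mul hφ (hm1.inverse hφ hmax hm.mem)
    rwa [hinv haa hmu] at this
  have hstarC : HasChartDeriv φ (c * w⁻¹) c₀ := by
    have := hcC.mul hφ (hw1.inverse hφ hmax hw.mem)
    rwa [hinv hcc hwu] at this
  have hstarAm : (fun _ => a * m⁻¹) ∈ SmoothPaths n X := mul_mem ha (inv_mem hm.mem)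
  have hstarCm : (fun _ => c * w⁻¹) ∈ SmoothPaths n X := mul_mem hc (inv_mem hw.mem)
  have hA' : HasChartDeriv φ (a * (m⁻¹ * l⁻¹)) 1 := by
    have := hstarA.mul hφ (hl1.inverse hφ hmax hl.mem)
    rwa [Ring.mul_inverse_cancel _ (hl1.isUnit hφ hmax hl.mem), mul_assoc] at this
  have hC' : HasChartDeriv φ (c * (w⁻¹ * k⁻¹)) 1 := by
    have := hstarC.mul hφ (hk1.inverse hφ hmax hk.mem)
    rwa [Ring.mul_inverse_cancel _ (hk1.isUnit hφ hmax hk.mem), mul_assoc] at this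
  have hC'm : (fun _ => c * (w⁻¹ * k⁻¹)) ∈ SmoothPaths n X :=
    mul_mem hc (mul_mem (inv_mem hw.mem) (inv_mem hk.mem))
  -- the loop of rotations
  have hW : Realizes φ (fun t => rot J (2 * Real.pi * σ t))
      ((c * w⁻¹) * ((a * m⁻¹) * k⁻¹ * (a * m⁻¹)⁻¹ * k) * (c * w⁻¹)⁻¹) := by
    -- The differentials are a₀ rot(-πσ) a₀ rot(πσ), a full turn in the plane of J, conjugated by
    -- c₀, which commutes with J.
    have h1 := (((hk.inv hφ hmax).conj hφ hmax hstarAm hstarA).mul hφ hk).conj hφ hmax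
      hstarCm hstarC
    have ea : Ring.inverse a₀ = a₀ := Ring.inverse_unit ⟨a₀, a₀, haa, haa⟩
    have ec : Ring.inverse c₀ = c₀ := Ring.inverse_unit ⟨c₀, c₀, hcc, hcc⟩
    have ek : ∀ t, Ring.inverse (rot (J + K) t) = rot (J + K) (-t) := fun t =>
      Ring.inverse_unit ⟨rot (J + K) t, rot (J + K) (-t), by
        rw [← rot_add hJK3, add_neg_cancel, rot_zero], by
        rw [← rot_add hJK3, neg_add_cancel, rot_zero]⟩
    have e : ∀ t, c₀ * rot J t * c₀ = rot J t := fun t => by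
      rw [(hcJ.rot t).eq, mul_assoc, hcc, mul_one]
    simp only [ea, ec, ek, conj_rot_mul_rot haa haJ haK hJK hKJ hJ3 hK3, e] at h1
    simpa only [mul_assoc] using h1
  refine ⟨by simpa using hn, J, hJ, _, _, m⁻¹ * l⁻¹, w⁻¹ * k⁻¹,
    (hm.inv hφ hmax).mul hφ (hl.inv hφ hmax), (hw.inv hφ hmax).mul hφ (hk.inv hφ hmax), hA', hC',
    fun g hg => ?_⟩
  -- the computation modulo isotopies with trivial differentials
  let N := nullGroup hφ hmax
  let pr : fixingGroup φ →* fixingGroup φ ⧸ N := QuotientGroup.mk' N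
  have hpr : ∀ p q : fixingGroup φ, Realizes φ (fun _ => 1) (p * q * p⁻¹ * q⁻¹ : Equiv.Perm X) →
      Commute (pr p) (pr q) := by
    intro p q h
    have h1 : pr (p * q * p⁻¹ * q⁻¹) = 1 := (QuotientGroup.eq_one_iff _).2 h
    rw [map_mul, map_mul, map_mul, map_inv, map_inv, mul_inv_eq_one, mul_inv_eq_iff_eq_mul] at h1
    exact h1
  have comm : ∀ {p q : Equiv.Perm X} {P κ} (hp : (fun _ => p) ∈ SmoothPaths n X)
      (hP : HasChartDeriv φ p P) (hq : Realizes φ κ q), (∀ t, Commute P (κ t)) →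
      Commute (pr ⟨p, hP.mem_fixingGroup hp⟩) (pr ⟨q, hq.mem_fixingGroup⟩) :=
    fun hp hP hq hc => hpr _ _ (Realizes.commutator hφ hmax hp hP hq hc)
  -- Each commutation holds in the quotient because one differential commutes with the whole path of
  -- the other factor; the last one because the straightened map has differential 1.
  have key := commutator_eq_of_commute (l := pr ⟨l, hl.mem_fixingGroup⟩)
    (k := pr ⟨k, hk.mem_fixingGroup⟩)
    (hpr ⟨a, haA.mem_fixingGroup ha⟩ ⟨c, hcC.mem_fixingGroup hc⟩ hac)
    (comm ha haA hw fun t => hseg _ (hAc0.mul_right hAC))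
    (comm hc hcC hm fun t => hseg _ (hCa0.mul_right hAC.symm))
    (comm hw.mem hw1 hm fun t => hseg _ ((hc0a0.mul_left hCa0).mul_right
      (hAc0.symm.mul_left hAC.symm)))
    (comm hC'm hC' hl fun t => Commute.one_left _)
  have h2 := hW.mul_inv_of_eq hφ hmax hg
  have h3 : pr (⟨a, haA.mem_fixingGroup ha⟩ * (⟨m, hm.mem_fixingGroup⟩⁻¹ *
      ⟨l, hl.mem_fixingGroup⟩⁻¹) * (⟨c, hcC.mem_fixingGroup hc⟩ * (⟨w, hw.mem_fixingGroup⟩⁻¹ *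
      ⟨k, hk.mem_fixingGroup⟩⁻¹)) * (⟨a, haA.mem_fixingGroup ha⟩ * (⟨m, hm.mem_fixingGroup⟩⁻¹ *
      ⟨l, hl.mem_fixingGroup⟩⁻¹))⁻¹ * (⟨c, hcC.mem_fixingGroup hc⟩ * (⟨w, hw.mem_fixingGroup⟩⁻¹ *
      ⟨k, hk.mem_fixingGroup⟩⁻¹))⁻¹ * (⟨_, hW.mem_fixingGroup⟩)⁻¹) = 1 := by
    rw [map_mul, map_inv, mul_inv_eq_one]
    exact key
  have h4 : Realizes φ (fun _ => 1) _ := (QuotientGroup.eq_one_iff _).1 h3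
  have h5 := h4.mul hφ h2
  simp only [mul_one] at h5
  convert h5 using 1
  simp only [Subgroup.coe_mul, Subgroup.coe_inv]
  group

end Straightening

/-! ### Making the pair trivial near the fixed point. -/

section Flattening

open Module

local notation:max "𝔼" n:max => EuclideanSpace ℝ (Fin n)

variable {n : ℕ} {X : Type u} [TopologicalSpace X] [ChartedSpace (𝔼 n) X]
  [IsManifold (𝓡 n) ∞ X]

/-- The orientation preserving diffeomorphisms. -/
def orientedGroup (o : OrientedAtlas (𝔼 n) X) : Subgroup (Equiv.Perm X) where
  carrier := {g | (fun _ => g) ∈ SmoothPaths n X ∧ IsOrientationPreserving o g}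
  one_mem' := ⟨one_mem (SmoothPaths n X), IsOrientationPreserving.id⟩
  mul_mem' h h' := ⟨mul_mem h.1 h'.1, h.2.comp h'.2 (SmoothPaths.contMDiff h.1 0)
    (SmoothPaths.contMDiff h'.1 0)⟩
  inv_mem' h := ⟨inv_mem h.1, h.2.symm (SmoothPaths.contMDiff h.1 0)
    (SmoothPaths.contMDiff_symm h.1 0)⟩

variable {o : OrientedAtlas (𝔼 n) X}

theorem SmoothPaths.mem_orientedGroup {h : ℝ → Equiv.Perm X} (hh : h ∈ SmoothPaths n X) {s : ℝ}
    (h0 : h s ∈ orientedGroup o) (t : ℝ) : h t ∈ orientedGroup o :=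
  ⟨SmoothPaths.const hh t, IsOrientationPreserving.smoothPath hh h0.2 t⟩

variable {φ : OpenPartialHomeomorph X (𝔼 n)} {κ κ' : ℝ → 𝔼 n →L[ℝ] 𝔼 n} {g g' p : Equiv.Perm X}
  {P : 𝔼 n →L[ℝ] 𝔼 n}

theorem Realizes.mem_orientedGroup (h : Realizes φ κ g) : g ∈ orientedGroup o := by
  obtain ⟨k, hk, k0, rfl, -⟩ := h
  exact SmoothPaths.mem_orientedGroup hk (s := 0) (by rw [k0]; exact one_mem _) 1

variable [T2Space X]

/-- Plane generators are conjugate by automorphisms of positive determinant. Such an automorphism is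
the differential of a diffeomorphism isotopic to the identity, and conjugating the pair by the
latter replaces the plane by the given one. -/
theorem exists_pair_of_planeGenerator (hφ : φ.target = univ)
    (hmax : φ ∈ IsManifold.maximalAtlas (𝓡 n) ∞ X) {a c : Equiv.Perm X}
    (ha : a ∈ orientedGroup o) (hc : c ∈ orientedGroup o)
    {A C : 𝔼 n →L[ℝ] 𝔼 n} (haA : HasChartDeriv φ a A) (hcC : HasChartDeriv φ c C)
    (hA : 0 < A.det) (hC : 0 < C.det)
    (hodd : Odd (finrank ℝ ↥(negativeSubspace (A : End ℝ (𝔼 n)) ⊓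
      negativeSubspace (C : End ℝ (𝔼 n)))))
    (hac : Realizes φ (fun _ => 1) (a * c * a⁻¹ * c⁻¹)) :
    3 ≤ n ∧ ∀ J : 𝔼 n →L[ℝ] 𝔼 n, IsPlaneGenerator (J : End ℝ (𝔼 n)) →
      ∃ a' ∈ orientedGroup o, ∃ c' ∈ orientedGroup o, HasChartDeriv φ a' 1 ∧
        HasChartDeriv φ c' 1 ∧
        ∀ g, Realizes φ (fun t => rot J (2 * Real.pi * Real.smoothTransition t)) g →
          Realizes φ (fun _ => 1) (a' * c' * a'⁻¹ * c'⁻¹ * g⁻¹) := by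
  obtain ⟨hn, J₁, hJ₁, κ₁, κ₂, m₁, m₂, hm₁, hm₂, ham, hcm, H⟩ :=
    exists_straightened_pair hφ hmax ha.1 hc.1 haA hcC hA hC hodd hac
  refine ⟨hn, fun J hJ => ?_⟩
  obtain ⟨Q, R, hQR, hRQ, hQ, hQJ⟩ := hJ₁.exists_conj_det_pos hJ (by simpa using hn)
  obtain ⟨κ, h1, h2, h3, h4⟩ := exists_path_of_det_pos hQ
  obtain ⟨h, hh, h0, hD⟩ := exists_realization hφ hmax h1 h2 h4
  have hq := hD 1
  rw [Real.smoothTransition.one, h3] at hq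
  have hqm := SmoothPaths.const hh 1
  have hqo : h 1 ∈ orientedGroup o := SmoothPaths.mem_orientedGroup hh (s := 0)
    (by rw [h0]; exact one_mem _) 1
  set q := h 1
  have hRi : Ring.inverse Q = R := Ring.inverse_unit ⟨Q, R, hQR, hRQ⟩
  have hqi := hq.inverse hφ hmax hqm
  rw [hRi] at hqi
  refine ⟨q * (a * m₁) * q⁻¹, mul_mem (mul_mem hqo (mul_mem ha hm₁.mem_orientedGroup))
    (inv_mem hqo), q * (c * m₂) * q⁻¹, mul_mem (mul_mem hqo (mul_mem hc hm₂.mem_orientedGroup))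
    (inv_mem hqo), ?_, ?_, fun g hg => ?_⟩
  · simpa only [mul_one, hQR] using (hq.mul hφ ham).mul hφ hqi
  · simpa only [mul_one, hQR] using (hq.mul hφ hcm).mul hφ hqi
  · have e : ∀ t, R * rot J t * Q = rot J₁ t := fun t => by
      refine conj_rot hRQ ?_ t
      rw [← hQJ]
      calc R * (Q * J₁ * R) = (R * Q) * J₁ * R := by simp only [mul_assoc]
        _ = J₁ * R := by rw [hRQ, one_mul]
    have hQi : Ring.inverse R = Q := Ring.inverse_unit ⟨R, Q, hRQ, hQR⟩
    have h5 := hg.conj (p := q⁻¹) hφ hmax (inv_mem hqm) hqi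
    rw [hQi] at h5
    simp only [e] at h5
    have h6 := (H _ h5).conj hφ hmax hqm hq
    simp only [mul_one, hRi, hQR] at h6
    convert h6 using 1
    group

/-- Diffeomorphisms with trivial differentials at the centre can be modified by isotopies so as
to be the identity near the centre, and similarly for an isotopy. -/
theorem exists_flat_pair (hφ : φ.target = univ)
    (hmax : φ ∈ IsManifold.maximalAtlas (𝓡 n) ∞ X) {a c g : Equiv.Perm X}
    (ha : a ∈ orientedGroup o) (hc : c ∈ orientedGroup o)
    (haD : HasChartDeriv φ a 1) (hcD : HasChartDeriv φ c 1)
    (hg : (fun _ => g) ∈ SmoothPaths n X) {r₀ : ℝ} (hr₀ : 0 < r₀)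
    (hgr : ∀ u, ‖u‖ < r₀ → g (φ.symm u) = φ.symm u)
    (hac : Realizes φ (fun _ => 1) (a * c * a⁻¹ * c⁻¹ * g⁻¹)) :
    ∃ a' ∈ orientedGroup o, ∃ c' ∈ orientedGroup o, ∃ r > 0, r ≤ r₀ ∧
      ∃ ν ∈ SmoothPaths n X, ν 0 = 1 ∧ ν 1 = a' * c' * a'⁻¹ * c'⁻¹ * g⁻¹ ∧
      ∀ u, ‖u‖ < r → a' (φ.symm u) = φ.symm u ∧ c' (φ.symm u) = φ.symm u ∧
        ∀ t, ν t (φ.symm u) = φ.symm u := by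
  -- The constant family f is flattened with strength growing from 0 to 1; its correction is thereby
  -- an isotopy starting at the identity with trivial differentials.
  have flat : ∀ {f : Equiv.Perm X}, f ∈ orientedGroup o → HasChartDeriv φ f 1 →
      ∃ q, Realizes φ (fun _ => 1) q ∧ ∃ r > 0, ∀ u, ‖u‖ < r → (q * f) (φ.symm u) = φ.symm u := by
    intro f hf hfD
    obtain ⟨q, hq, hD, h0, -, r, hr, h1⟩ := exists_flattening hφ hmax hf.1 (fun _ _ => hfD)
      (l := Real.smoothTransition) Real.smoothTransition.contDiff Real.smoothTransition.nonneg
      Real.smoothTransition.le_one one_pos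
    exact ⟨q 1, ⟨q, hq, h0 _ Real.smoothTransition.zero, rfl, hD⟩, r, hr,
      h1 1 Real.smoothTransition.one⟩
  obtain ⟨p, hp, r₁, hr₁, H₁⟩ := flat ha haD
  obtain ⟨q, hq, r₂, hr₂, H₂⟩ := flat hc hcD
  have hg0 : g ∈ fixingGroup φ := ⟨hg, hgr 0 (by simpa using hr₀)⟩
  -- The corrections p and q are trivial in the quotient, so they do not affect the commutator
  -- there.
  have key : Realizes φ (fun _ => 1) ((p * a) * (q * c) * (p * a)⁻¹ * (q * c)⁻¹ * g⁻¹) := by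
    let N := nullGroup hφ hmax
    let ϖ : fixingGroup φ →* fixingGroup φ ⧸ N := QuotientGroup.mk' N
    have e1 : ϖ ⟨p, hp.mem_fixingGroup⟩ = 1 := (QuotientGroup.eq_one_iff _).2 hp
    have e2 : ϖ ⟨q, hq.mem_fixingGroup⟩ = 1 := (QuotientGroup.eq_one_iff _).2 hq
    let a₀ : fixingGroup φ := ⟨a, haD.mem_fixingGroup ha.1⟩
    let c₀ : fixingGroup φ := ⟨c, hcD.mem_fixingGroup hc.1⟩
    let g₀ : fixingGroup φ := ⟨g, hg0⟩
    have e3 : ϖ (a₀ * c₀ * a₀⁻¹ * c₀⁻¹ * g₀⁻¹) = 1 := (QuotientGroup.eq_one_iff _).2 hac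
    refine (QuotientGroup.eq_one_iff (N := N) ((⟨p, hp.mem_fixingGroup⟩ * a₀) *
      (⟨q, hq.mem_fixingGroup⟩ * c₀) * (⟨p, hp.mem_fixingGroup⟩ * a₀)⁻¹ *
      (⟨q, hq.mem_fixingGroup⟩ * c₀)⁻¹ * g₀⁻¹)).1 ?_
    change ϖ _ = 1
    simp only [map_mul, map_inv, e1, e2, one_mul] at e3 ⊢
    exact e3
  obtain ⟨ν, hν, ν0, ν1, hνD⟩ := key
  have hinv : ∀ {f : Equiv.Perm X} {y}, f y = y → f⁻¹ y = y := fun h => by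
    rw [Equiv.Perm.inv_eq_iff_eq, h]
  -- The isotopy is now flattened at full strength for all times. At both ends it is already the
  -- identity on a ball of the prescribed radius, so the correction k does not move them.
  obtain ⟨k, hk, -, -, k0, r, hr, hr1⟩ := exists_flattening hφ hmax hν (fun t _ => hνD t)
    (l := fun _ => 1) contDiff_const (fun _ => zero_le_one) (fun _ => le_rfl)
    (lt_min (lt_min hr₁ hr₂) hr₀)
  have hσ : ContDiff ℝ ∞ Real.smoothTransition := Real.smoothTransition.contDiff
  have k00 : k 0 = 1 := k0 0 fun u _ => by rw [Real.smoothTransition.zero, ν0]; rfl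
  have k01 : k 1 = 1 := k0 1 fun u hu => by
    rw [lt_min_iff, lt_min_iff] at hu
    rw [Real.smoothTransition.one, ν1]
    simp only [Equiv.Perm.mul_apply] at *
    have i1 := hinv (f := p * a) (H₁ u hu.1.1)
    have i2 := hinv (f := q * c) (H₂ u hu.1.2)
    rw [hinv (hgr u hu.2), i2, i1, H₂ u hu.1.2, H₁ u hu.1.1]
  refine ⟨p * a, mul_mem hp.mem_orientedGroup ha, q * c, mul_mem hq.mem_orientedGroup hc,
    min r (min (min r₁ r₂) r₀), lt_min hr (lt_min (lt_min hr₁ hr₂) hr₀),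
    (min_le_right _ _).trans (min_le_right _ _), fun t => k t * ν (Real.smoothTransition t),
    mul_mem hk (SmoothPaths.comp_time hν hσ), ?_, ?_, fun u hu => ?_⟩
  · simp [k00, Real.smoothTransition.zero, ν0]
  · change k 1 * ν (Real.smoothTransition 1) = _
    rw [k01, Real.smoothTransition.one, ν1, one_mul]
  · rw [lt_min_iff, lt_min_iff, lt_min_iff] at hu
    exact ⟨H₁ u hu.2.1.1, H₂ u hu.2.1.2, fun t => hr1 t rfl u hu.1⟩

end Flattening

/-! ### The Dehn twist and the enlargement of the fixed ball. -/

section Twist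

open Module

local notation:max "𝔼" n:max => EuclideanSpace ℝ (Fin n)

variable {n : ℕ}

/-- The diffeomorphism which rotates each sphere around the origin by a constant angle. -/
def twist {J : 𝔼 n →L[ℝ] 𝔼 n} (hJ : J * J * J = -J) (hiso : ∀ t v, ‖rot J t v‖ = ‖v‖)
    (ϑ : 𝔼 n → ℝ) (hϑ : ∀ u v, ‖u‖ = ‖v‖ → ϑ u = ϑ v) : Equiv.Perm (𝔼 n) where
  toFun v := rot J (ϑ v) v
  invFun v := rot J (-ϑ v) v
  left_inv v := by
    change rot J (-ϑ (rot J (ϑ v) v)) (rot J (ϑ v) v) = v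
    rw [hϑ _ v (hiso _ _)]
    have := rot_add hJ (-ϑ v) (ϑ v)
    rw [neg_add_cancel, rot_zero] at this
    exact (congrArg (fun T : 𝔼 n →L[ℝ] 𝔼 n => T v) this).symm
  right_inv v := by
    change rot J (ϑ (rot J (-ϑ v) v)) (rot J (-ϑ v) v) = v
    rw [hϑ _ v (hiso _ _)]
    exact congrArg (fun T : 𝔼 n →L[ℝ] 𝔼 n => T v) (rot_mul_rot_neg hJ (ϑ v))

/-- The angles of a Dehn twist supported in the annulus between the radii `1` and `2`. -/
def twistAngle (v : 𝔼 n) : ℝ := 2 * Real.pi * (twistProfile (‖v‖ - 1) - 1)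

theorem twistAngle_congr (u v : 𝔼 n) (h : ‖u‖ = ‖v‖) : twistAngle u = twistAngle v := by
  rw [twistAngle, h, twistAngle]

theorem twistAngle_of_le {v : 𝔼 n} (hv : ‖v‖ ≤ 4 / 3) : twistAngle v = -(2 * Real.pi) := by
  rw [twistAngle, twistProfile_of_le (by linarith)]
  ring

theorem twistAngle_of_ge {v : 𝔼 n} (hv : 5 / 3 ≤ ‖v‖) : twistAngle v = 0 := by
  rw [twistAngle, twistProfile_of_ge (by linarith), sub_self, mul_zero]

theorem contDiff_twistAngle : ContDiff ℝ ∞ (twistAngle : 𝔼 n → ℝ) := by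
  refine contDiff_iff_contDiffAt.2 fun v => ?_
  by_cases hv : v = 0
  · refine (contDiffAt_const (c := -(2 * Real.pi))).congr_of_eventuallyEq ?_
    filter_upwards [Metric.ball_mem_nhds v one_pos] with u hu
    rw [hv, mem_ball_zero_iff] at hu
    exact twistAngle_of_le (by linarith)
  · exact contDiffAt_const.mul (((contDiff_twistProfile.contDiffAt).comp v
      ((contDiffAt_norm ℝ hv).sub contDiffAt_const)).sub contDiffAt_const)

/-- A smooth isotopy of radial diffeomorphisms with compact support from the identity to a
diffeomorphism which contracts a large ball as much as desired. -/
theorem exists_dilation (n : ℕ) {r : ℝ} (hr : 0 < r) : ∃ d : ℝ → Equiv.Perm (𝔼 n),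
    ContDiff ℝ ∞ (fun q : ℝ × 𝔼 n => d q.1 q.2) ∧
    ContDiff ℝ ∞ (fun q : ℝ × 𝔼 n => (d q.1).symm q.2) ∧ d 0 = 1 ∧
    (∀ t v, 3 ≤ ‖v‖ → d t v = v) ∧ (∀ t u v, ‖u‖ = ‖v‖ → ‖d t u‖ = ‖d t v‖) ∧
    (∀ t (L : 𝔼 n →L[ℝ] 𝔼 n), (∀ v, ‖L v‖ = ‖v‖) → ∀ v, d t (L v) = L (d t v)) ∧
    ∀ v, ‖v‖ ≤ 2 → ‖d 1 v‖ < r := by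
  let f : 𝔼 n → 𝔼 n := fun u => radialBump ((1 / 2 : ℝ) • u) • u
  have hf : ContDiff ℝ ∞ f :=
    (contDiff_radialBump.comp (contDiff_const_smul (1 / 2 : ℝ))).smul contDiff_id
  have norm_half : ∀ u : 𝔼 n, ‖(1 / 2 : ℝ) • u‖ = ‖u‖ / 2 := fun u => by
    rw [norm_smul, Real.norm_of_nonneg (by norm_num)]; ring
  have hf3 : ∀ u, 3 ≤ ‖u‖ → f u = 0 := fun u hu => by
    simp only [f]
    rw [radialBump_of_ge (by rw [norm_half]; linarith), zero_smul]
  have hsupp : HasCompactSupport f := HasCompactSupport.of_support_subset_isCompact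
    (isCompact_closedBall 0 3) fun u hu => by
      rw [mem_closedBall_zero_iff]
      by_contra h
      exact hu (hf3 u (not_le.1 h).le)
  obtain ⟨C, hC⟩ := (hsupp.fderiv (𝕜 := ℝ)).exists_bound_of_continuous
    (hf.continuous_fderiv (by simp))
  have hC0 : 0 ≤ C := (norm_nonneg _).trans (hC 0)
  -- Small enough for the radial perturbation s f to have derivative at most 1/2; iteration then
  -- gives any desired contraction.
  let s : ℝ := 1 / (2 * (C + 1))
  have hs0 : 0 < s := by positivity
  have hsC : s * C ≤ 1 / 2 := by
    simp only [s]; rw [div_mul_eq_mul_div, one_mul, div_le_div_iff₀ (by positivity) (by norm_num)]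
    linarith
  have hs1 : s ≤ 1 / 2 := by
    simp only [s]; rw [div_le_div_iff₀ (by positivity) (by norm_num)]
    linarith
  let σ := Real.smoothTransition
  have hσ0 : ∀ t, 0 ≤ σ t := Real.smoothTransition.nonneg
  have hσ1 : ∀ t, σ t ≤ 1 := Real.smoothTransition.le_one
  have hσc : ContDiff ℝ ∞ σ := Real.smoothTransition.contDiff
  obtain ⟨K, hK, hKs⟩ := exists_perm_of_perturbation (p := fun q : ℝ × 𝔼 n => (s * σ q.1) • f q.2)
    (by fun_prop) (fun t u => by
      have h1 : HasFDerivAt (fun u => (s * σ t) • f u) ((s * σ t) • fderiv ℝ f u) u :=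
        ((hf.differentiable (by simp)) u).hasFDerivAt.fun_const_smul _
      rw [h1.fderiv, norm_smul, Real.norm_of_nonneg (mul_nonneg hs0.le (hσ0 t))]
      have h2 := hC u
      have h3 := hσ0 t
      have h4 := hσ1 t
      calc s * σ t * ‖fderiv ℝ f u‖ ≤ s * 1 * C := by gcongr
        _ ≤ 1 / 2 := by linarith)
  have hKe : ∀ t u, K t u = (1 - s * σ t * radialBump ((1 / 2 : ℝ) • u)) • u := fun t u => by
    rw [hK]
    simp only [f]
    module
  have hKc : ContDiff ℝ ∞ (fun q : ℝ × 𝔼 n => K q.1 q.2) := by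
    simp only [hK]
    fun_prop
  have hbump : ∀ u v : 𝔼 n, ‖u‖ = ‖v‖ →
      radialBump ((1 / 2 : ℝ) • u) = radialBump ((1 / 2 : ℝ) • v) := fun u v h => by
    simp only [radialBump, norm_half, h]
  have main : ∀ N : ℕ, ∃ d : ℝ → Equiv.Perm (𝔼 n),
    ContDiff ℝ ∞ (fun q : ℝ × 𝔼 n => d q.1 q.2) ∧
    ContDiff ℝ ∞ (fun q : ℝ × 𝔼 n => (d q.1).symm q.2) ∧ d 0 = 1 ∧
    (∀ t v, 3 ≤ ‖v‖ → d t v = v) ∧ (∀ t u v, ‖u‖ = ‖v‖ → ‖d t u‖ = ‖d t v‖) ∧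
    (∀ t (L : 𝔼 n →L[ℝ] 𝔼 n), (∀ v, ‖L v‖ = ‖v‖) → ∀ v, d t (L v) = L (d t v)) ∧
    ∀ v, ‖v‖ ≤ 2 → d 1 v = (1 - s) ^ N • v := by
    intro N
    induction N with
    | zero =>
      exact ⟨1, contDiff_snd, contDiff_snd, rfl, fun _ _ _ => rfl, fun _ _ _ h => h,
        fun _ _ _ _ => rfl, fun v _ => by simp⟩
    | succ N ih =>
      obtain ⟨d, h1, h2, h3, h4, h5, h6, h7⟩ := ih
      refine ⟨d * K, h1.comp (contDiff_fst.prodMk hKc), hKs.comp (contDiff_fst.prodMk h2), ?_,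
        fun t v hv => ?_, fun t u v h => ?_, fun t L hL v => ?_, fun v hv => ?_⟩
      · ext1 u
        simp [h3, hKe, σ, Real.smoothTransition.zero]
      · have : K t v = v := by rw [hK]; simp only [hf3 v hv, smul_zero, sub_zero]
        rw [Pi.mul_apply, Equiv.Perm.mul_apply, this, h4 t v hv]
      · refine h5 t _ _ ?_
        rw [hKe, hKe, hbump u v h, norm_smul, norm_smul, h]
      · rw [Pi.mul_apply, Equiv.Perm.mul_apply, Equiv.Perm.mul_apply, hKe, hKe,
          hbump _ _ (hL v), ← map_smul, h6 t L hL]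
      · have e : K 1 v = (1 - s) • v := by
          rw [hKe, radialBump_of_le (by rw [norm_half]; linarith)]
          simp [σ, Real.smoothTransition.one]
        rw [Pi.mul_apply, Equiv.Perm.mul_apply, e, h7, smul_smul, pow_succ]
        rw [norm_smul, Real.norm_of_nonneg (by linarith)]
        nlinarith [norm_nonneg v]
  -- On the ball of radius 2 the N-th iterate is multiplication by (1 - s)ᴺ < r/2.
  obtain ⟨N, hN⟩ := exists_pow_lt_of_lt_one (half_pos hr) (show 1 - s < 1 by linarith)
  obtain ⟨d, h1, h2, h3, h4, h5, h6, h7⟩ := main N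
  refine ⟨d, h1, h2, h3, h4, h5, h6, fun v hv => ?_⟩
  have hp : 0 ≤ (1 - s) ^ N := pow_nonneg (by linarith) _
  rw [h7 v hv, norm_smul, Real.norm_of_nonneg hp]
  nlinarith [norm_nonneg v]

variable {J : 𝔼 n →L[ℝ] 𝔼 n} (hJ : J * J * J = -J) (hiso : ∀ t v, ‖rot J t v‖ = ‖v‖)

theorem contDiff_twist {ϑ : ℝ → 𝔼 n → ℝ} {hϑ : ∀ t u v, ‖u‖ = ‖v‖ → ϑ t u = ϑ t v}
    (h : ContDiff ℝ ∞ fun q : ℝ × 𝔼 n => ϑ q.1 q.2) :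
    ContDiff ℝ ∞ (fun q : ℝ × 𝔼 n => twist hJ hiso (ϑ q.1) (hϑ q.1) q.2) ∧
    ContDiff ℝ ∞ (fun q : ℝ × 𝔼 n => (twist hJ hiso (ϑ q.1) (hϑ q.1)).symm q.2) :=
  ⟨((contDiff_rot J).comp h).clm_apply contDiff_snd,
    ((contDiff_rot J).comp h.neg).clm_apply contDiff_snd⟩

variable {X : Type u} [TopologicalSpace X] {φ : OpenPartialHomeomorph X (𝔼 n)}

theorem HasChartDeriv.implant (hφ : φ.target = univ) {g : Equiv.Perm (𝔼 n)}
    {T : 𝔼 n →L[ℝ] 𝔼 n} (h0 : g 0 = 0) (h : HasFDerivAt g T 0) :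
    HasChartDeriv φ (implant φ hφ g) T := by
  have hm : ∀ u : 𝔼 n, u ∈ φ.target := fun u => hφ ▸ mem_univ u
  refine ⟨by rw [implant_apply, h0], Filter.Eventually.of_forall fun u => ?_, ?_⟩
  · rw [implant_apply]
    exact φ.map_target (hm _)
  · refine h.congr_of_eventuallyEq (Filter.Eventually.of_forall fun u => ?_)
    change φ (_root_.implant φ hφ g (φ.symm u)) = g u
    rw [implant_apply, φ.right_inv (hm _)]

variable [T2Space X] [ChartedSpace (𝔼 n) X] [IsManifold (𝓡 n) ∞ X]

theorem implant_twist_mem_smoothPaths (hφ : φ.target = univ)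
    (hmax : φ ∈ IsManifold.maximalAtlas (𝓡 n) ∞ X) {ϑ : ℝ → 𝔼 n → ℝ}
    (hϑ : ∀ t u v, ‖u‖ = ‖v‖ → ϑ t u = ϑ t v)
    (h : ContDiff ℝ ∞ fun q : ℝ × 𝔼 n => ϑ q.1 q.2) {R : ℝ} (hR : ∀ t v, R ≤ ‖v‖ → ϑ t v = 0) :
    (fun t => implant φ hφ (twist hJ hiso (ϑ t) (hϑ t))) ∈ SmoothPaths n X := by
  have h1 := contDiff_twist hJ hiso (hϑ := hϑ) h
  refine implant_mem_smoothPaths hmax h1.1 h1.2 (R := R) fun t v hv => ?_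
  change rot J (ϑ t v) v = v
  rw [hR t v hv, rot_zero]
  rfl

/-- The angle is -2π on the inner ball and 0 far out, so scaling it by σ(t) gives an isotopy of
compact support. Near the centre this is linear and turns once around; the negative sign explains
the generator -J. -/
theorem realizes_implant_twist (hφ : φ.target = univ)
    (hmax : φ ∈ IsManifold.maximalAtlas (𝓡 n) ∞ X) :
    Realizes φ (fun t => rot (-J) (2 * Real.pi * Real.smoothTransition t))
      (implant φ hφ (twist hJ hiso twistAngle twistAngle_congr)) := by
  let σ := Real.smoothTransition
  let ϑ : ℝ → 𝔼 n → ℝ := fun t v => σ t * twistAngle v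
  have hϑ : ∀ t u v, ‖u‖ = ‖v‖ → ϑ t u = ϑ t v := fun t u v h => by
    simp only [ϑ, twistAngle_congr u v h]
  have hσc : ContDiff ℝ ∞ σ := Real.smoothTransition.contDiff
  have hc : ContDiff ℝ ∞ fun q : ℝ × 𝔼 n => ϑ q.1 q.2 :=
    (hσc.comp contDiff_fst).mul (contDiff_twistAngle.comp contDiff_snd)
  refine ⟨_, implant_twist_mem_smoothPaths hJ hiso hφ hmax hϑ hc (R := 5 / 3) fun t v hv => by
    simp only [ϑ, twistAngle_of_ge hv, mul_zero], ?_, ?_, fun t => ?_⟩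
  · have : twist hJ hiso (ϑ 0) (hϑ 0) = 1 := by
      ext1 v
      change rot J (σ 0 * twistAngle v) v = v
      simp [σ, Real.smoothTransition.zero]
    simp only [this, map_one]
  · have : twist hJ hiso (ϑ 1) (hϑ 1) = twist hJ hiso twistAngle twistAngle_congr := by
      ext1 v
      change rot J (σ 1 * twistAngle v) v = rot J (twistAngle v) v
      simp [σ, Real.smoothTransition.one]
    simp only [this]
  · refine HasChartDeriv.implant hφ (map_zero (rot J (ϑ t 0))) ?_
    change HasFDerivAt _ (rot (-J) (2 * Real.pi * σ t)) 0
    rw [rot_neg]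
    refine (rot J (-(2 * Real.pi * σ t))).hasFDerivAt.congr_of_eventuallyEq ?_
    filter_upwards [Metric.ball_mem_nhds (0 : 𝔼 n) one_pos] with u hu
    rw [mem_ball_zero_iff] at hu
    change rot J (σ t * twistAngle u) u = _
    rw [twistAngle_of_le (by linarith)]
    congr 2
    ring

variable {o : OrientedAtlas (𝔼 n) X}

/-- Diffeomorphisms which are the identity on a small coordinate ball and whose commutator is
isotopic to the twist are conjugate to diffeomorphisms which are the identity on a ball containing
the closed unit ball, with an isotopy to the twist relative to that ball. -/
theorem exists_isotopy_twist (hφ : φ.target = univ)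
    (hmax : φ ∈ IsManifold.maximalAtlas (𝓡 n) ∞ X) {a c : Equiv.Perm X}
    (ha : a ∈ orientedGroup o) (hc : c ∈ orientedGroup o) {r : ℝ} (hr : 0 < r)
    (hr1 : r ≤ 4 / 3) {ν : ℝ → Equiv.Perm X} (hν : ν ∈ SmoothPaths n X) (ν0 : ν 0 = 1)
    (ν1 : ν 1 = a * c * a⁻¹ * c⁻¹ *
      (implant φ hφ (twist hJ hiso twistAngle twistAngle_congr))⁻¹)
    (hfix : ∀ u, ‖u‖ < r → a (φ.symm u) = φ.symm u ∧ c (φ.symm u) = φ.symm u ∧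
        ∀ t, ν t (φ.symm u) = φ.symm u) :
    ∃ a' ∈ orientedGroup o, ∃ c' ∈ orientedGroup o, ∃ h ∈ SmoothPaths n X,
      h 0 = a' * c' * a'⁻¹ * c'⁻¹ ∧
      h 1 = implant φ hφ (twist hJ hiso twistAngle twistAngle_congr) ∧
      ∀ u, ‖u‖ < 4 / 3 → a' (φ.symm u) = φ.symm u ∧ c' (φ.symm u) = φ.symm u ∧
        ∀ t, h t (φ.symm u) = φ.symm u := by
  obtain ⟨d, d1, d2, d3, d4, d5, d6, d7⟩ := exists_dilation n hr
  have hdm := implant_mem_smoothPaths (hφ := hφ) hmax d1 d2 d4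
  set D := implant φ hφ (d 1) with hD
  have hDo : D ∈ orientedGroup o := SmoothPaths.mem_orientedGroup hdm (s := 0)
    (by simp only [d3, map_one]; exact one_mem _) 1
  have hDv : ∀ v, D (φ.symm v) = φ.symm (d 1 v) := fun v => implant_apply _ v
  -- Conjugation by the contraction changes the twist into the one with angle function composed with
  -- `d 1`, since radial maps commute with rotations. Interpolating the angles leads back to the
  -- original twist.
  let ϑ : ℝ → 𝔼 n → ℝ := fun t v => (1 - t) * twistAngle (d 1 v) + t * twistAngle v
  have hϑ : ∀ t u v, ‖u‖ = ‖v‖ → ϑ t u = ϑ t v := fun t u v h => by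
    simp only [ϑ, twistAngle_congr u v h, twistAngle_congr _ _ (d5 1 u v h)]
  have hd1 : ContDiff ℝ ∞ (d 1) := d1.comp (contDiff_const.prodMk contDiff_id)
  have hϑc : ContDiff ℝ ∞ fun q : ℝ × 𝔼 n => ϑ q.1 q.2 :=
    ((contDiff_const.sub contDiff_fst).mul (contDiff_twistAngle.comp (hd1.comp contDiff_snd))).add
      (contDiff_fst.mul (contDiff_twistAngle.comp contDiff_snd))
  have hϑR : ∀ t v, 3 ≤ ‖v‖ → ϑ t v = 0 := fun t v hv => by
    simp only [ϑ, d4 1 v hv, twistAngle_of_ge (by linarith : 5 / 3 ≤ ‖v‖), mul_zero, add_zero]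
  have hT := implant_twist_mem_smoothPaths hJ hiso hφ hmax hϑ hϑc hϑR
  have T0 : twist hJ hiso (ϑ 0) (hϑ 0) =
      (d 1)⁻¹ * twist hJ hiso twistAngle twistAngle_congr * d 1 := by
    rw [mul_assoc, eq_inv_mul_iff_mul_eq]
    ext1 v
    change d 1 (rot J ((1 - 0) * twistAngle (d 1 v) + 0 * twistAngle v) v) =
      rot J (twistAngle (d 1 v)) (d 1 v)
    rw [sub_zero, one_mul, zero_mul, add_zero, d6 1 _ (hiso _)]
  have T1 : twist hJ hiso (ϑ 1) (hϑ 1) = twist hJ hiso twistAngle twistAngle_congr := by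
    ext1 v
    change rot J ((1 - 1) * twistAngle (d 1 v) + 1 * twistAngle v) v = rot J (twistAngle v) v
    rw [sub_self, zero_mul, one_mul, zero_add]
  have hconj : ∀ {f : Equiv.Perm X}, (∀ u, ‖u‖ < r → f (φ.symm u) = φ.symm u) →
      ∀ u, ‖u‖ < 4 / 3 → (D⁻¹ * f * D) (φ.symm u) = φ.symm u := by
    intro f hf u hu
    simp only [Equiv.Perm.mul_apply]
    rw [Equiv.Perm.inv_eq_iff_eq, hDv, hf _ (d7 u (by linarith))]
  -- As D maps the ball of radius 2 into the ball of radius r, the conjugates are the identity on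
  -- the large ball. The isotopy ν is run backwards from the commutator to the twist.
  refine ⟨D⁻¹ * a * D, mul_mem (mul_mem (inv_mem hDo) ha) hDo,
    D⁻¹ * c * D, mul_mem (mul_mem (inv_mem hDo) hc) hDo,
    fun t => (D⁻¹ * ν (1 - t) * D) * implant φ hφ (twist hJ hiso (ϑ t) (hϑ t)),
    mul_mem (mul_mem (mul_mem (inv_mem hDo.1) (SmoothPaths.comp_time hν (by fun_prop))) hDo.1) hT,
    ?_, ?_, fun u hu => ⟨?_, ?_, fun t => ?_⟩⟩
  · simp only [sub_zero, ν1, T0, map_mul, map_inv, ← hD]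
    group
  · simp only [sub_self, ν0, T1, mul_one, inv_mul_cancel, one_mul]
  · exact hconj (fun u hu => (hfix u hu).1) u hu
  · exact hconj (fun u hu => (hfix u hu).2.1) u hu
  -- Both interpolated angles are -2π here; for the contracted point this uses r ≤ 4/3.
  · have h1 : implant φ hφ (twist hJ hiso (ϑ t) (hϑ t)) (φ.symm u) = φ.symm u := by
      rw [implant_apply]
      change φ.symm (rot J ((1 - t) * twistAngle (d 1 u) + t * twistAngle u) u) = _
      rw [twistAngle_of_le hu.le, twistAngle_of_le ((d7 u (by linarith)).le.trans hr1),
        show (1 - t) * -(2 * Real.pi) + t * -(2 * Real.pi) = 2 * Real.pi * ((-1 : ℤ) : ℝ) by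
          push_cast; ring, rot_two_pi_mul_int]
      rfl
    rw [Equiv.Perm.mul_apply, h1]
    exact hconj (fun u hu => (hfix u hu).2.2 _) u hu

end Twist

/-! ### Restriction to the complement of the open ball. -/

section Punctured

open Module

local notation:max "𝔼" n:max => EuclideanSpace ℝ (Fin n)

variable {n : ℕ} {X : Type u} [TopologicalSpace X] {φ : OpenPartialHomeomorph X (𝔼 n)}

theorem extendById_subtypePerm {S : Set X} {g : Equiv.Perm X} (h : ∀ y, g y ∈ S ↔ y ∈ S)
    (hid : ∀ y, y ∉ S → g y = y) : extendById (g.subtypePerm h) = g := by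
  ext y
  by_cases hy : y ∈ S
  · rw [extendById, dif_pos hy]
    rfl
  · rw [extendById, dif_neg hy, hid y hy]

theorem eq_of_notMem_punctured {g : Equiv.Perm X}
    (hg : ∀ u, ‖u‖ < 4 / 3 → g (φ.symm u) = φ.symm u) {y : X} (hy : y ∉ punctured φ) :
    g y = y := by
  obtain ⟨u, hu, rfl⟩ := not_not.1 hy
  rw [mem_ball_zero_iff] at hu
  exact hg u (by linarith)

theorem mem_punctured_iff {g : Equiv.Perm X}
    (hg : ∀ u, ‖u‖ < 4 / 3 → g (φ.symm u) = φ.symm u) (y : X) :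
    g y ∈ punctured φ ↔ y ∈ punctured φ := by
  by_cases hy : y ∈ punctured φ
  · refine iff_of_true (fun h => ?_) hy
    have h1 := eq_of_notMem_punctured hg (not_not.2 h)
    exact hy (g.injective h1 ▸ h)
  · rw [eq_of_notMem_punctured hg hy]

/-- A permutation which is the identity near the ball, restricted to the complement of the ball. -/
def restrictPunctured (g : Equiv.Perm X) (hg : ∀ u, ‖u‖ < 4 / 3 → g (φ.symm u) = φ.symm u) :
    Equiv.Perm (punctured φ) :=
  g.subtypePerm (mem_punctured_iff hg)

theorem extendById_restrictPunctured {g : Equiv.Perm X}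
    (hg : ∀ u, ‖u‖ < 4 / 3 → g (φ.symm u) = φ.symm u) :
    extendById (restrictPunctured g hg) = g :=
  extendById_subtypePerm _ fun _ hy => eq_of_notMem_punctured hg hy

theorem extendById_restrictPunctured_symm {g : Equiv.Perm X}
    (hg : ∀ u, ‖u‖ < 4 / 3 → g (φ.symm u) = φ.symm u) :
    extendById (restrictPunctured g hg).symm = g.symm :=
  extendById_restrictPunctured (g := g.symm) fun u hu => by rw [Equiv.symm_apply_eq, hg u hu]

variable [ChartedSpace (𝔼 n) X] [IsManifold (𝓡 n) ∞ X] {o : OrientedAtlas (𝔼 n) X}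

theorem isDiffRelBoundary_restrictPunctured (hφ : φ.target = univ) {g : Equiv.Perm X}
    (hgo : g ∈ orientedGroup o) (hg : ∀ u, ‖u‖ < 4 / 3 → g (φ.symm u) = φ.symm u) :
    IsDiffRelBoundary o φ (restrictPunctured g hg) where
  smooth := by
    rw [extendById_restrictPunctured]
    exact (SmoothPaths.contMDiff hgo.1 0).contMDiffOn
  smooth_symm := by
    rw [extendById_restrictPunctured_symm]
    exact (SmoothPaths.contMDiff_symm hgo.1 0).contMDiffOn
  orientation := by
    rw [extendById_restrictPunctured]
    exact hgo.2
  near_boundary := by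
    rw [extendById_restrictPunctured]
    have ho : IsOpen (φ.symm '' Metric.ball 0 (4 / 3)) :=
      φ.isOpen_image_symm_of_subset_target Metric.isOpen_ball (hφ ▸ subset_univ _)
    have hs : puncturedBoundary φ ⊆ φ.symm '' Metric.ball 0 (4 / 3) :=
      image_mono fun u hu => by
        rw [mem_sphere_zero_iff_norm] at hu
        rw [mem_ball_zero_iff, hu]
        norm_num
    refine Filter.mem_of_superset (ho.mem_nhdsSet.2 hs) ?_
    rintro _ ⟨u, hu, rfl⟩
    exact hg u (by simpa using hu)

variable [T2Space X]

/-- Two orientation preserving diffeomorphisms which fix the centre of the coordinates `φ`, whose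
commutator is isotopic to the identity relative to the first order jet at the centre, and whose
differentials have a joint negative subspace of odd dimension, give rise to a factorization of the
boundary Dehn twist as a commutator. -/
theorem exists_commutator_eq_boundaryDehnTwist (hφ : φ.target = univ)
    (hmax : φ ∈ IsManifold.maximalAtlas (𝓡 n) ∞ X) {a c : Equiv.Perm X}
    (ha : a ∈ orientedGroup o) (hc : c ∈ orientedGroup o)
    {A C : 𝔼 n →L[ℝ] 𝔼 n} (haA : HasChartDeriv φ a A) (hcC : HasChartDeriv φ c C)
    (hA : 0 < A.det) (hC : 0 < C.det)
    (hodd : Odd (finrank ℝ ↥(negativeSubspace (A : End ℝ (𝔼 n)) ⊓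
      negativeSubspace (C : End ℝ (𝔼 n)))))
    (hac : Realizes φ (fun _ => 1) (a * c * a⁻¹ * c⁻¹)) :
    ∃ a' c' : Equiv.Perm (punctured φ),
      IsDiffRelBoundary o φ a' ∧ IsDiffRelBoundary o φ c' ∧
      ∃ τ : Equiv.Perm (punctured φ), IsBoundaryDehnTwist φ τ ∧
        IsotopicRelBoundary o φ (a' * c' * a'⁻¹ * c'⁻¹) τ := by
  obtain ⟨hn, H⟩ := exists_pair_of_planeGenerator hφ hmax ha hc haA hcC hA hC hodd hac
  obtain ⟨J, hJ, hiso, α, hα, hα1, hα2, hα3⟩ :=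
    exists_generating_rotation_loop (n := n) (by omega)
  have hJ3 : J * J * J = -J :=
    ContinuousLinearMap.ext fun v => congrArg (fun T : End ℝ (𝔼 n) => T v) hJ.cube
  -- The twist with generator J realises the turn with generator -J; exchanging the two basis
  -- vectors shows that -J is a plane generator too.
  have hJn : IsPlaneGenerator ((-J : 𝔼 n →L[ℝ] 𝔼 n) : End ℝ (𝔼 n)) := by
    obtain ⟨v, w, f, g, h1, h2, h3, h4, h5⟩ := hJ
    refine ⟨w, v, g, f, h4, h3, h2, h1, ?_⟩
    rw [ContinuousLinearMap.toLinearMap_neg, h5, neg_sub]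
  obtain ⟨a₁, ha₁, c₁, hc₁, ha₁D, hc₁D, H₁⟩ := H (-J) hJn
  have hT := realizes_implant_twist hJ3 hiso hφ hmax
  set T := implant φ hφ (twist hJ3 hiso twistAngle twistAngle_congr) with hTdef
  have hTv : ∀ v, T (φ.symm v) = φ.symm (rot J (twistAngle v) v) := fun v => implant_apply _ v
  have hTfix : ∀ u, ‖u‖ < 4 / 3 → T (φ.symm u) = φ.symm u := fun u hu => by
    rw [hTv, twistAngle_of_le hu.le, show -(2 * Real.pi) = 2 * Real.pi * ((-1 : ℤ) : ℝ) by
      push_cast; ring, rot_two_pi_mul_int]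
    rfl
  obtain ⟨a₂, ha₂, c₂, hc₂, r, hr, hr1, ν, hν, ν0, ν1, hfix⟩ := exists_flat_pair hφ hmax ha₁ hc₁
    ha₁D hc₁D hT.mem (by norm_num : (0 : ℝ) < 4 / 3) hTfix (H₁ T hT)
  obtain ⟨a₃, ha₃, c₃, hc₃, h, hh, h0, h1, hfix'⟩ :=
    exists_isotopy_twist hJ3 hiso hφ hmax ha₂ hc₂ hr hr1 hν ν0 ν1 hfix
  have fa := fun u hu => (hfix' u hu).1
  have fc := fun u hu => (hfix' u hu).2.1
  have fh := fun t u hu => (hfix' u hu).2.2 t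
  refine ⟨restrictPunctured a₃ fa, restrictPunctured c₃ fc,
    isDiffRelBoundary_restrictPunctured hφ ha₃ fa, isDiffRelBoundary_restrictPunctured hφ hc₃ fc,
    restrictPunctured (h 1) (fh 1), ⟨α, hα1, hα2, hα3, fun v hv => ?_, fun y hy => ?_⟩,
    fun t => restrictPunctured (h t) (fh t), ?_, fun t _ => ?_, ?_, rfl⟩
  · rw [extendById_restrictPunctured, h1, hTv]
    change _ = φ.symm (Matrix.toEuclideanCLM (𝕜 := ℝ) (α.extend (‖v‖ - 1)).1 v)
    -- The twist angle differs from that of the loop α by a full turn only.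
    rw [hα, twistAngle, mul_sub, mul_one, sub_eq_add_neg, rot_add hJ3,
      show -(2 * Real.pi) = 2 * Real.pi * ((-1 : ℤ) : ℝ) by push_cast; ring,
      rot_two_pi_mul_int, mul_one]
  · rw [extendById_restrictPunctured, h1]
    exact implant_of_notMem _ hy
  · simp only [IsSmoothFamilyOn, extendById_restrictPunctured]
    exact hh.1.contMDiffOn
  · exact isDiffRelBoundary_restrictPunctured hφ (SmoothPaths.mem_orientedGroup hh (s := 1)
      (by rw [h1]; exact hT.mem_orientedGroup) t) _
  · refine Equiv.ext fun y => Subtype.ext ?_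
    change h 0 y = _
    rw [h0]
    rfl

end Punctured

/-! ### Passage from intrinsic differentials to coordinates, and the factorization. -/

section Conjugation

open Module

theorem negativeSubspace_conj {V W : Type*} [AddCommGroup V] [Module ℝ V] [AddCommGroup W]
    [Module ℝ W] (e : V ≃ₗ[ℝ] W) (A : End ℝ V) :
    negativeSubspace (e.conj A) = (negativeSubspace A).map (e : V →ₗ[ℝ] W) := by
  rw [negativeSubspace, negativeSubspace, Submodule.map_iSup]
  refine iSup_congr fun r => ?_
  ext w
  obtain ⟨v, rfl⟩ := e.surjective w
  have h1 : ∀ k : ℕ, ((e.conj A - (r : ℝ) • 1) ^ k) (e v) = e (((A - (r : ℝ) • 1) ^ k) v) := by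
    intro k
    induction k generalizing v with
    | zero => rfl
    | succ k ih =>
      rw [pow_succ, pow_succ, Module.End.mul_apply, Module.End.mul_apply, ← ih]
      simp [LinearEquiv.conj_apply]
  simp only [End.mem_maxGenEigenspace, Submodule.mem_map, h1]
  constructor
  · rintro ⟨k, hk⟩
    exact ⟨v, ⟨k, by simpa using hk⟩, rfl⟩
  · rintro ⟨v', ⟨k, hk⟩, hv⟩
    rw [← e.injective hv]
    exact ⟨k, by rw [hk, map_zero]⟩

local notation:max "𝔼" n:max => EuclideanSpace ℝ (Fin n)

variable {n : ℕ} {X : Type u} [TopologicalSpace X] [ChartedSpace (𝔼 n) X]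
  [IsManifold (𝓡 n) ∞ X] {x : X}

/-- The differential of a chart, as an isomorphism of the tangent space with the model space. -/
theorem exists_chart_differential {ψ : OpenPartialHomeomorph X (𝔼 n)}
    (hmax : ψ ∈ IsManifold.maximalAtlas (𝓡 n) ∞ X) (hx : x ∈ ψ.source) :
    ∃ e : 𝔼 n ≃L[ℝ] 𝔼 n, ∀ f : X → X, ContMDiff (𝓡 n) (𝓡 n) ∞ f → f x = x →
      HasFDerivAt (ψ ∘ f ∘ ψ.symm) ((e : 𝔼 n →L[ℝ] 𝔼 n) ∘L
        (differentialAtFixedPoint n f x : 𝔼 n →L[ℝ] 𝔼 n) ∘L (e.symm : 𝔼 n →L[ℝ] 𝔼 n)) (ψ x) := by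
  have he : ψ.MDifferentiable (𝓡 n) 𝓘(ℝ, 𝔼 n) :=
    ⟨(contMDiffOn_of_mem_maximalAtlas hmax).mdifferentiableOn (by simp),
      (contMDiffOn_symm_of_mem_maximalAtlas hmax).mdifferentiableOn (by simp)⟩
  let e : 𝔼 n ≃L[ℝ] 𝔼 n := he.mfderiv hx
  have h1 : HasMFDerivAt (𝓡 n) 𝓘(ℝ, 𝔼 n) ψ x (e : 𝔼 n →L[ℝ] 𝔼 n) :=
    (he.mdifferentiableAt hx).hasMFDerivAt
  refine ⟨e, fun f hf hfx => ?_⟩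
  let D : 𝔼 n →L[ℝ] 𝔼 n := differentialAtFixedPoint n f x
  have h2 : HasMFDerivAt (𝓡 n) (𝓡 n) f x D := (hf.mdifferentiable (by simp) x).hasMFDerivAt
  have h1' : HasMFDerivAt (𝓡 n) 𝓘(ℝ, 𝔼 n) ψ (f x) (e : 𝔼 n →L[ℝ] 𝔼 n) := by
    rw [hfx]; exact h1
  have h3 : HasMFDerivAt (𝓡 n) 𝓘(ℝ, 𝔼 n) (ψ ∘ f) x ((e : 𝔼 n →L[ℝ] 𝔼 n) ∘L D) := h1'.comp x h2
  have h4 : DifferentiableAt ℝ (ψ ∘ f ∘ ψ.symm) (ψ x) :=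
    (contDiffAt_chart_rep hmax hmax hx (by rwa [hfx]) hf.contMDiffAt).differentiableAt (by simp)
  have h5 : HasMFDerivAt 𝓘(ℝ, 𝔼 n) 𝓘(ℝ, 𝔼 n) (ψ ∘ f ∘ ψ.symm) (ψ x)
    (fderiv ℝ (ψ ∘ f ∘ ψ.symm) (ψ x)) := h4.hasFDerivAt.hasMFDerivAt
  have h6 : HasMFDerivAt (𝓡 n) 𝓘(ℝ, 𝔼 n) ((ψ ∘ f ∘ ψ.symm) ∘ ψ) x
    (fderiv ℝ (ψ ∘ f ∘ ψ.symm) (ψ x) ∘L (e : 𝔼 n →L[ℝ] 𝔼 n)) := h5.comp x h1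
  have h7 : (e : 𝔼 n →L[ℝ] 𝔼 n) ∘L D = fderiv ℝ (ψ ∘ f ∘ ψ.symm) (ψ x) ∘L (e : 𝔼 n →L[ℝ] 𝔼 n) := by
    refine hasMFDerivAt_unique h3 (h6.congr_of_eventuallyEq ?_)
    filter_upwards [ψ.open_source.mem_nhds hx] with y hy
    simp only [Function.comp_apply]
    rw [ψ.left_inv hy]
  have h8 : (e : 𝔼 n →L[ℝ] 𝔼 n) ∘L D ∘L (e.symm : 𝔼 n →L[ℝ] 𝔼 n) =
      fderiv ℝ (ψ ∘ f ∘ ψ.symm) (ψ x) := by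
    rw [← ContinuousLinearMap.comp_assoc, h7, ContinuousLinearMap.comp_assoc]
    refine ContinuousLinearMap.ext fun v => ?_
    simp
  change HasFDerivAt _ ((e : 𝔼 n →L[ℝ] 𝔼 n) ∘L D ∘L (e.symm : 𝔼 n →L[ℝ] 𝔼 n)) _
  rw [h8]
  exact h4.hasFDerivAt

theorem finrank_negativeSubspace_conj (e : 𝔼 n ≃L[ℝ] 𝔼 n) (D D' : 𝔼 n →L[ℝ] 𝔼 n) :
    finrank ℝ ↥(negativeSubspace
      (((e : 𝔼 n →L[ℝ] 𝔼 n) ∘L D ∘L (e.symm : 𝔼 n →L[ℝ] 𝔼 n) : 𝔼 n →L[ℝ] 𝔼 n) : End ℝ (𝔼 n)) ⊓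
      negativeSubspace (((e : 𝔼 n →L[ℝ] 𝔼 n) ∘L D' ∘L (e.symm : 𝔼 n →L[ℝ] 𝔼 n) :
        𝔼 n →L[ℝ] 𝔼 n) : End ℝ (𝔼 n))) =
      finrank ℝ ↥(negativeSubspace (D : End ℝ (𝔼 n)) ⊓ negativeSubspace (D' : End ℝ (𝔼 n))) := by
  have h : ∀ D : 𝔼 n →L[ℝ] 𝔼 n, negativeSubspace
      (((e : 𝔼 n →L[ℝ] 𝔼 n) ∘L D ∘L (e.symm : 𝔼 n →L[ℝ] 𝔼 n) : 𝔼 n →L[ℝ] 𝔼 n) : End ℝ (𝔼 n)) =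
      (negativeSubspace (D : End ℝ (𝔼 n))).map (e.toLinearEquiv : 𝔼 n →ₗ[ℝ] 𝔼 n) := fun D =>
    negativeSubspace_conj e.toLinearEquiv (D : End ℝ (𝔼 n))
  rw [h, h, ← Submodule.map_inf _ e.injective, LinearEquiv.finrank_map_eq]

theorem det_conj_clm (e : 𝔼 n ≃L[ℝ] 𝔼 n) (D : 𝔼 n →L[ℝ] 𝔼 n) :
    ((e : 𝔼 n →L[ℝ] 𝔼 n) ∘L D ∘L (e.symm : 𝔼 n →L[ℝ] 𝔼 n)).det = D.det :=
  LinearMap.det_conj (D : 𝔼 n →ₗ[ℝ] 𝔼 n) e.toLinearEquiv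

/-- At a fixed point source and target charts can be taken equal, so the Jacobian is a conjugate of
the differential. -/
theorem IsOrientationPreserving.det_differential_pos {o : OrientedAtlas (𝔼 n) X} {f : X → X}
    (ho : IsOrientationPreserving o f) (hf : ContMDiff (𝓡 n) (𝓡 n) ∞ f) (hfx : f x = x) :
    0 < (differentialAtFixedPoint n f x : 𝔼 n →L[ℝ] 𝔼 n).det := by
  obtain ⟨ψ, hψ, hx⟩ := o.covers x
  obtain ⟨e, he⟩ := exists_chart_differential (o.charts_subset hψ) hx
  have := ho ψ hψ ψ hψ x hx (by rwa [hfx])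
  rw [(he f hf hfx).fderiv] at this
  exact this.trans_eq (det_conj_clm e _)

variable [T2Space X]

/-- The centre of φ need not be x. An isotopy moves x there, a and c are conjugated by its end p,
and the differentials at the centre become conjugates of those at x through the chart φ ∘ p. -/
theorem commutator_factorization (o : OrientedAtlas (𝔼 n) X) (a c : X ≃ₘ⟮𝓡 n, 𝓡 n⟯ X)
    (ha : IsOrientationPreserving o a) (hc : IsOrientationPreserving o c)
    (hax : a x = x) (hcx : c x = x)
    (b : ℝ → X ≃ₘ⟮𝓡 n, 𝓡 n⟯ X) (hb : IsCommutatorIsotopy a c x b)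
    (hodd : Odd (Module.finrank ℝ (jointNegativeSubspace
      (differentialAtFixedPoint n a x).toLinearMap (differentialAtFixedPoint n c x).toLinearMap)))
    {φ : OpenPartialHomeomorph X (𝔼 n)}
    (hmax : φ ∈ IsManifold.maximalAtlas (𝓡 n) ∞ X) (hφ : φ.target = univ)
    (hφx : φ.symm 0 ∈ connectedComponent x) :
    ∃ a' c' : Equiv.Perm (punctured φ),
      IsDiffRelBoundary o φ a' ∧ IsDiffRelBoundary o φ c' ∧
      ∃ τ : Equiv.Perm (punctured φ), IsBoundaryDehnTwist φ τ ∧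
        IsotopicRelBoundary o φ (a' * c' * a'⁻¹ * c'⁻¹) τ := by
  obtain ⟨h, hh, h0, h1⟩ := exists_smoothPath_apply_eq (n := n) hφx
  have hpo : h 1 ∈ orientedGroup o := SmoothPaths.mem_orientedGroup hh (s := 0)
    (by rw [h0]; exact one_mem _) 1
  set p := h 1
  have hp1 := SmoothPaths.contMDiff hpo.1 0
  have hp2 := SmoothPaths.contMDiff_symm hpo.1 0
  let P : X ≃ₜ X := ⟨p, hp1.continuous, hp2.continuous⟩
  let ψ : OpenPartialHomeomorph X (𝔼 n) := P.toOpenPartialHomeomorph.trans φ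
  have hψs : ∀ y, y ∈ ψ.source ↔ p y ∈ φ.source := fun y => by
    simp [ψ, OpenPartialHomeomorph.trans_source, P]
  have hψmax : ψ ∈ IsManifold.maximalAtlas (𝓡 n) ∞ X := by
    refine (IsManifold.mem_maximalAtlas_iff_contMDiffOn _).2 ⟨?_, ?_⟩
    · exact (contMDiffOn_of_mem_maximalAtlas hmax).comp hp1.contMDiffOn fun y hy => (hψs y).1 hy
    · exact hp2.comp_contMDiffOn ((contMDiffOn_symm_of_mem_maximalAtlas hmax).mono
        fun u _ => hφ ▸ mem_univ u)
  have hφ0 : φ (φ.symm 0) = 0 := φ.right_inv (hφ ▸ mem_univ _)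
  have hψx : ψ x = 0 := (congrArg φ h1).trans hφ0
  have hxs : x ∈ ψ.source := by rw [hψs, h1]; exact φ.map_target (hφ ▸ mem_univ _)
  obtain ⟨e, he⟩ := exists_chart_differential hψmax hxs
  have key : ∀ f : X ≃ₘ⟮𝓡 n, 𝓡 n⟯ X, f x = x → HasChartDeriv φ (p * f.toEquiv * p⁻¹)
      ((e : 𝔼 n →L[ℝ] 𝔼 n) ∘L
        (differentialAtFixedPoint n f x : 𝔼 n →L[ℝ] 𝔼 n) ∘L (e.symm : 𝔼 n →L[ℝ] 𝔼 n)) := by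
    intro f hfx
    have hx0 : p⁻¹ (φ.symm 0) = x := by rw [Equiv.Perm.inv_eq_iff_eq, h1]
    have h2 := he f f.contMDiff hfx
    rw [hψx] at h2
    have hfix : (p * f.toEquiv * p⁻¹) (φ.symm 0) = φ.symm 0 := by
      simp only [Equiv.Perm.mul_apply, hx0]
      exact (congrArg p hfx).trans h1
    have hsymm : ContMDiff 𝓘(ℝ, 𝔼 n) (𝓡 n) ∞ φ.symm := by
      rw [← contMDiffOn_univ, ← hφ]; exact contMDiffOn_symm_of_mem_maximalAtlas hmax
    have hcont : Continuous fun u => (p * f.toEquiv * p⁻¹) (φ.symm u) :=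
      hp1.continuous.comp (f.continuous.comp (hp2.continuous.comp hsymm.continuous))
    exact ⟨hfix, hcont.continuousAt.eventually (φ.open_source.mem_nhds (by
      change (p * f.toEquiv * p⁻¹) (φ.symm 0) ∈ _
      rw [hfix]; exact φ.map_target (hφ ▸ mem_univ _))), h2⟩
  have hao : a.toEquiv ∈ orientedGroup o :=
    ⟨SmoothPaths.const_of_contMDiff a.contMDiff a.symm.contMDiff, ha⟩
  have hco : c.toEquiv ∈ orientedGroup o :=
    ⟨SmoothPaths.const_of_contMDiff c.contMDiff c.symm.contMDiff, hc⟩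
  refine exists_commutator_eq_boundaryDehnTwist hφ hmax
    (mul_mem (mul_mem hpo hao) (inv_mem hpo)) (mul_mem (mul_mem hpo hco) (inv_mem hpo))
    (key a hax) (key c hcx) ?_ ?_ ?_ ?_
  · exact (ha.det_differential_pos a.contMDiff hax).trans_eq (det_conj_clm e _).symm
  · exact (hc.det_differential_pos c.contMDiff hcx).trans_eq (det_conj_clm e _).symm
  · exact (congrArg Odd (finrank_negativeSubspace_conj e _ _)).mpr hodd
  -- The given isotopy ends at the identity and is controlled on [0,1] only, so it is reversed and
  -- its time is confined to [0,1].
  · let σ := Real.smoothTransition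
    have hσ : ContMDiff (𝓘(ℝ, ℝ).prod (𝓡 n)) (𝓘(ℝ, ℝ).prod (𝓡 n)) ∞
        fun q : ℝ × X => (1 - σ q.1, q.2) :=
      ((contDiff_const.sub Real.smoothTransition.contDiff).contMDiff.comp contMDiff_fst).prodMk
        contMDiff_snd
    have hσI : ∀ t, 1 - σ t ∈ Icc (0 : ℝ) 1 := fun t =>
      ⟨sub_nonneg.2 (Real.smoothTransition.le_one t),
        sub_le_self _ (Real.smoothTransition.nonneg t)⟩
    have hB : (fun t => (b (1 - σ t)).toEquiv) ∈ SmoothPaths n X :=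
      SmoothPaths.of_contMDiff (hb.smooth.comp_contMDiff hσ fun q => ⟨hσI _, mem_univ _⟩)
        fun t => (b (1 - σ t)).symm.contMDiff
    refine ⟨fun t => p * (b (1 - σ t)).toEquiv * p⁻¹,
      mul_mem (mul_mem hpo.1 hB) (inv_mem hpo.1), ?_, ?_, fun t => ?_⟩
    · have : (b (1 - σ 0)).toEquiv = 1 := Equiv.ext fun y => by
        simp only [σ, Real.smoothTransition.zero, sub_zero]
        exact hb.one y
      simp only [this, mul_one, mul_inv_cancel]
    · have : (b (1 - σ 1)).toEquiv = a.toEquiv * c.toEquiv * a.toEquiv⁻¹ * c.toEquiv⁻¹ :=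
        Equiv.ext fun y => by
          simp only [σ, Real.smoothTransition.one, sub_self]
          exact hb.zero y
      simp only [this]
      group
    · have h3 := key (b (1 - σ t)) (hb.fixes _ (hσI t))
      rw [hb.differential _ (hσI t)] at h3
      convert h3 using 1
      refine ContinuousLinearMap.ext fun v => ?_
      exact (e.apply_symm_apply v).symm

end Conjugation

/-! ### The mapping torus as a quotient by ℤ². -/

section DeckTransformations

local notation:max "𝔼" n:max => EuclideanSpace ℝ (Fin n)

variable {X : Type u}

/-- The gluing maps over the first circle, extended to all times by conjugation with `C`. -/
def gluingPath (A C : Equiv.Perm X) (β : ℝ → Equiv.Perm X) (t : ℝ) : Equiv.Perm X :=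
  C ^ ⌊t⌋ * (β (Int.fract t) * (C * A * C⁻¹)) * C ^ (-⌊t⌋)

/-- The identifications of `ℝ × ℝ × X` which define the mapping torus. -/
def deck (A C : Equiv.Perm X) (β : ℝ → Equiv.Perm X) (k l : ℤ) (p : ℝ × ℝ × X) : ℝ × ℝ × X :=
  (p.1 + k, p.2.1 + l, (C ^ l * gluingPath A C β p.2.1 ^ k) p.2.2)

variable {A C : Equiv.Perm X} {β : ℝ → Equiv.Perm X}

theorem gluingPath_add_int (t : ℝ) (l : ℤ) :
    gluingPath A C β (t + l) = C ^ l * gluingPath A C β t * C ^ (-l) := by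
  rw [gluingPath, gluingPath, Int.floor_add_intCast, Int.fract_add_intCast, add_comm ⌊t⌋, neg_add,
    zpow_add, add_comm (-l), zpow_add]
  simp only [mul_assoc]

theorem deck_zero (p : ℝ × ℝ × X) : deck A C β 0 0 p = p := by
  simp [deck]

/-- The equivariance of the gluing path under integer shifts is what makes the two circle gluings
commute and form an action of ℤ². -/
theorem deck_deck (k k' l l' : ℤ) (p : ℝ × ℝ × X) :
    deck A C β k' l' (deck A C β k l p) = deck A C β (k' + k) (l' + l) p := by
  have h : gluingPath A C β (p.2.1 + l) ^ k' = C ^ l * gluingPath A C β p.2.1 ^ k' * C ^ (-l) := by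
    rw [gluingPath_add_int, zpow_neg, conj_zpow]
  simp only [deck, ← Equiv.Perm.mul_apply]
  rw [h]
  ext
  · push_cast; ring
  · push_cast; ring
  · simp only [zpow_add, zpow_neg, mul_assoc, inv_mul_cancel_left]

/-- The conditions on a family `β` of maps for which the gluing maps fit together. -/
structure IsGluingFamily (A C : Equiv.Perm X) (β : ℝ → Equiv.Perm X) : Prop where
  eq_of_le : ∀ t ≤ 1 / 3, β t = A * C * A⁻¹ * C⁻¹
  eq_of_ge : ∀ t, 2 / 3 ≤ t → β t = 1

namespace IsGluingFamily

/-- The time reparametrisation is constant near both ends, so the formula for one unit interval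
persists slightly to the left of it and at its right end. One formula thus holds around each time,
integers included, which gives smoothness. -/
theorem gluingPath_eq (h : IsGluingFamily A C β) (k : ℤ) {t : ℝ} (h1 : (k : ℝ) - 1 / 3 < t)
    (h2 : t ≤ k + 1) :
    gluingPath A C β t = C ^ k * (β (t - k) * (C * A * C⁻¹)) * C ^ (-k) := by
  have e1 : β (-1 / 3) * (C * A * C⁻¹) = A := by
    rw [h.eq_of_le _ (by norm_num)]; group
  rcases lt_trichotomy ⌊t⌋ k with hk | hk | hk
  · have hf : ⌊t⌋ = k - 1 := by
      refine le_antisymm (by omega) (Int.le_floor.2 ?_)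
      push_cast
      linarith
    have h3 : t < k := by
      have := Int.lt_floor_add_one t
      rw [hf] at this
      push_cast at this
      linarith
    rw [gluingPath, Int.fract, hf, h.eq_of_ge _ (by push_cast; linarith),
      h.eq_of_le (t - k) (by linarith)]
    rw [zpow_sub_one, neg_sub, zpow_sub, zpow_neg, zpow_one]
    group
  · rw [gluingPath, Int.fract, hk]
  · have hf : t = k + 1 := le_antisymm h2 (by
      have : ((k + 1 : ℤ) : ℝ) ≤ t := Int.le_floor.1 hk
      push_cast at this
      exact this)
    have hf' : t = ((k + 1 : ℤ) : ℝ) := by rw [hf]; push_cast; ring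
    rw [gluingPath, hf', Int.fract_intCast, Int.floor_intCast, h.eq_of_le 0 (by norm_num),
      h.eq_of_ge (((k + 1 : ℤ) : ℝ) - k) (by push_cast; norm_num), zpow_add, neg_add, zpow_add,
      zpow_one, zpow_neg_one]
    group

theorem gluingPath_of_mem (h : IsGluingFamily A C β) {t : ℝ} (ht : t ∈ Icc (0 : ℝ) 1) :
    gluingPath A C β t = β t * (C * A * C⁻¹) := by
  have := h.gluingPath_eq 0 (t := t) (by push_cast; linarith [ht.1]) (by push_cast; linarith [ht.2])
  simpa using this

theorem gluingPath_zero (h : IsGluingFamily A C β) : gluingPath A C β 0 = A := by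
  rw [h.gluingPath_of_mem ⟨le_rfl, zero_le_one⟩, h.eq_of_le 0 (by norm_num)]
  group

variable {n : ℕ} [TopologicalSpace X] [ChartedSpace (𝔼 n) X] [IsManifold (𝓡 n) ∞ X]

theorem gluingPath_mem (h : IsGluingFamily A C β) (hA : (fun _ => A) ∈ SmoothPaths n X)
    (hC : (fun _ => C) ∈ SmoothPaths n X) (hβ : β ∈ SmoothPaths n X) :
    gluingPath A C β ∈ SmoothPaths n X := by
  have hloc : ∀ t₀ : ℝ, ∃ g ∈ SmoothPaths n X, ∀ᶠ t in 𝓝 t₀, gluingPath A C β t = g t := by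
    intro t₀
    refine ⟨(fun _ => C) ^ ⌊t₀⌋ * ((fun t => β (t - ⌊t₀⌋)) * ((fun _ => C) * (fun _ => A) *
      (fun _ => C)⁻¹)) * (fun _ => C) ^ (-⌊t₀⌋), mul_mem (mul_mem (zpow_mem hC _) (mul_mem
      (SmoothPaths.comp_time hβ (by fun_prop)) (mul_mem (mul_mem hC hA) (inv_mem hC))))
      (zpow_mem hC _), ?_⟩
    filter_upwards [Ioo_mem_nhds (show (⌊t₀⌋ : ℝ) - 1 / 3 < t₀ by linarith [Int.floor_le t₀])
      (Int.lt_floor_add_one t₀)] with t ht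
    exact h.gluingPath_eq _ ht.1 ht.2.le
  constructor
  · rintro ⟨t₀, y₀⟩
    obtain ⟨g, hg, hgt⟩ := hloc t₀
    refine (hg.1 (t₀, y₀)).congr_of_eventuallyEq ?_
    filter_upwards [continuousAt_fst.eventually hgt] with q hq
    rw [hq]
  · rintro ⟨t₀, y₀⟩
    obtain ⟨g, hg, hgt⟩ := hloc t₀
    refine (hg.2 (t₀, y₀)).congr_of_eventuallyEq ?_
    filter_upwards [continuousAt_fst.eventually hgt] with q hq
    rw [hq]

theorem contMDiff_deck (h : IsGluingFamily A C β) (hA : (fun _ => A) ∈ SmoothPaths n X)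
    (hC : (fun _ => C) ∈ SmoothPaths n X) (hβ : β ∈ SmoothPaths n X) (k l : ℤ) :
    ContMDiff (𝓘(ℝ, ℝ).prod (𝓘(ℝ, ℝ).prod (𝓡 n))) (𝓘(ℝ, ℝ).prod (𝓘(ℝ, ℝ).prod (𝓡 n))) ∞
      (deck A C β k l) := by
  have h1 : (fun _ => C) ^ l * gluingPath A C β ^ k ∈ SmoothPaths n X :=
    mul_mem (zpow_mem hC _) (zpow_mem (h.gluingPath_mem hA hC hβ) _)
  have h2 : ∀ r : ℝ, ContMDiff 𝓘(ℝ, ℝ) 𝓘(ℝ, ℝ) ∞ fun s : ℝ => s + r := fun r =>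
    (contDiff_id.add contDiff_const).contMDiff
  exact ((h2 k).comp contMDiff_fst).prodMk (((h2 l).comp (contMDiff_fst.comp contMDiff_snd)).prodMk
    (h1.1.comp contMDiff_snd))

end IsGluingFamily

variable {n : ℕ} [TopologicalSpace X] [ChartedSpace (𝔼 n) X]
  {a c : X ≃ₘ⟮𝓡 n, 𝓡 n⟯ X} {b : ℝ → X ≃ₘ⟮𝓡 n, 𝓡 n⟯ X}

/-- The reparametrized isotopy which enters the definition of the mapping torus. -/
def gluingFamily (b : ℝ → X ≃ₘ⟮𝓡 n, 𝓡 n⟯ X) (t : ℝ) : Equiv.Perm X :=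
  (b (Real.smoothTransition (3 * t - 1))).toEquiv

/-- The identifications of `ℝ × ℝ × X` for the mapping torus of `a` and `c`. -/
abbrev torusDeck (a c : X ≃ₘ⟮𝓡 n, 𝓡 n⟯ X) (b : ℝ → X ≃ₘ⟮𝓡 n, 𝓡 n⟯ X) (k l : ℤ) :
    ℝ × ℝ × X → ℝ × ℝ × X :=
  deck a.toEquiv c.toEquiv (gluingFamily b) k l

variable {x : X} (hb : IsCommutatorIsotopy a c x b)

include hb in
theorem isGluingFamily : IsGluingFamily a.toEquiv c.toEquiv (gluingFamily b) where
  eq_of_le t ht := Equiv.ext fun y => by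
    rw [gluingFamily, Real.smoothTransition.zero_of_nonpos (by linarith)]
    exact hb.zero y
  eq_of_ge t ht := Equiv.ext fun y => by
    rw [gluingFamily, Real.smoothTransition.one_of_one_le (by linarith)]
    exact hb.one y

include hb in
theorem gluingFamily_mem [IsManifold (𝓡 n) ∞ X] : gluingFamily b ∈ SmoothPaths n X := by
  refine SmoothPaths.of_contMDiff ?_ fun t => (b _).symm.contMDiff
  have hσ : ContMDiff (𝓘(ℝ, ℝ).prod (𝓡 n)) (𝓘(ℝ, ℝ).prod (𝓡 n)) ∞
      fun q : ℝ × X => (Real.smoothTransition (3 * q.1 - 1), q.2) :=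
    ((Real.smoothTransition.contDiff.comp (f := fun t : ℝ => 3 * t - 1)
      (by fun_prop)).contMDiff.comp contMDiff_fst).prodMk contMDiff_snd
  exact hb.smooth.comp_contMDiff hσ fun q =>
    ⟨⟨Real.smoothTransition.nonneg _, Real.smoothTransition.le_one _⟩, mem_univ _⟩

include hb in
-- The equivalence relation generated by the two gluings has the orbits of the ℤ²-action as classes.
theorem MappingTorus.mk_eq_mk_iff {p q : ℝ × ℝ × X} :
    MappingTorus.mk a c b p = MappingTorus.mk a c b q ↔ ∃ k l, torusDeck a c b k l p = q := by
  have hg := isGluingFamily hb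
  constructor
  · intro h
    have h' := Quot.eqvGen_exact h
    clear h
    induction h' with
    | rel p q h =>
      cases h with
      | fst s t y ht =>
        refine ⟨1, 0, ?_⟩
        simp only [torusDeck, deck, hg.gluingPath_of_mem ht]
        simp [gluingFamily]
      | snd s t y => exact ⟨0, 1, by simp [torusDeck, deck]⟩
    | refl p => exact ⟨0, 0, deck_zero p⟩
    | symm p q _ ih =>
      obtain ⟨k, l, rfl⟩ := ih
      exact ⟨-k, -l, by rw [torusDeck, deck_deck, neg_add_cancel, neg_add_cancel, deck_zero]⟩
    | trans p q r _ _ ih ih' =>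
      obtain ⟨k, l, rfl⟩ := ih
      obtain ⟨k', l', rfl⟩ := ih'
      exact ⟨k' + k, l' + l, (deck_deck ..).symm⟩
  · rintro ⟨k, l, rfl⟩
    have ind : ∀ g : ℤ → ℝ × ℝ × X → ℝ × ℝ × X, (∀ p, g 0 p = p) →
        (∀ k p, g 1 (g k p) = g (k + 1) p) →
        (∀ p, MappingTorus.mk a c b (g 1 p) = MappingTorus.mk a c b p) →
        ∀ k p, MappingTorus.mk a c b (g k p) = MappingTorus.mk a c b p := by
      intro g g0 g1 hg1 k p
      induction k with
      | zero => rw [g0]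
      | succ k ih => rw [← g1, hg1, ih]
      | pred k ih => rw [← hg1, g1, sub_add_cancel, ih]
    have h2 : ∀ l p, MappingTorus.mk a c b (torusDeck a c b 0 l p) = MappingTorus.mk a c b p := by
      refine ind (fun l => torusDeck a c b 0 l) deck_zero (fun l p => ?_) fun p => ?_
      · rw [torusDeck, deck_deck, add_zero, add_comm]
      · refine (Quot.sound ?_).symm
        convert MappingTorusRel.snd (a := a) (c := c) (b := b) p.1 p.2.1 p.2.2 using 1
        simp [torusDeck, deck]
    have h1 : ∀ k p, MappingTorus.mk a c b (torusDeck a c b k 0 p) = MappingTorus.mk a c b p := by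
      refine ind (fun k => torusDeck a c b k 0) deck_zero (fun k p => ?_) fun p => ?_
      · rw [torusDeck, deck_deck, add_zero, add_comm]
      -- The first gluing is given for times in [0,1] only; other times are reached by conjugating
      -- with a shift by the integer part.
      · have h3 : torusDeck a c b 1 0 p = torusDeck a c b 0 ⌊p.2.1⌋
            (torusDeck a c b 1 0 (torusDeck a c b 0 (-⌊p.2.1⌋) p)) := by
          simp only [torusDeck, deck_deck]
          norm_num
        rw [h3, h2]
        refine Eq.trans ?_ (h2 (-⌊p.2.1⌋) p)
        set q := torusDeck a c b 0 (-⌊p.2.1⌋) p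
        have hq : q.2.1 = Int.fract p.2.1 := by
          simp only [q, torusDeck, deck, Int.fract]
          push_cast; ring
        have hq' : q.2.1 ∈ Icc (0 : ℝ) 1 := by
          rw [hq]
          exact ⟨Int.fract_nonneg _, (Int.fract_lt_one _).le⟩
        refine (Quot.sound ?_).symm
        convert MappingTorusRel.fst (a := a) (c := c) (b := b) q.1 q.2.1 q.2.2 hq' using 1
        simp only [torusDeck, deck, hg.gluingPath_of_mem hq']
        simp [gluingFamily]
    have h3 : torusDeck a c b k l p = torusDeck a c b k 0 (torusDeck a c b 0 l p) := by
      simp only [torusDeck, deck_deck, add_zero, zero_add]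
    rw [h3, h1, h2]

end DeckTransformations

/-! ### Smooth structures on quotients by smooth identifications. -/

section QuotientManifold

variable {V H : Type} [NormedAddCommGroup V] [NormedSpace ℝ V] [TopologicalSpace H]
  {I : ModelWithCorners ℝ V H} {Y M : Type u} [TopologicalSpace Y] [ChartedSpace H Y]
  [TopologicalSpace M]

/-- Local inverses of a quotient map by smooth identifications have smooth coordinate changes. -/
theorem contMDiffAt_symm_comp_of_identifications {ι : Type*} {mk : Y → M} {D : ι → Y → Y}
    (hD : ∀ i, ContMDiff I I ∞ (D i)) (hmk : ∀ p q, mk p = mk q ↔ ∃ i, D i p = q)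
    {e : OpenPartialHomeomorph Y M} (he : EqOn e mk e.source) {q : Y} (hq : mk q ∈ e.target) :
    ContMDiffAt I I ∞ (fun p => e.symm (mk p)) q := by
  have h1 : mk (e.symm (mk q)) = mk q := by
    rw [← he (e.map_target hq), e.right_inv hq]
  -- The identification carrying q to its representative in the source of e coincides with the
  -- coordinate change near q.
  obtain ⟨i, hi⟩ := (hmk _ _).1 h1.symm
  refine (hD i q).congr_of_eventuallyEq ?_
  filter_upwards [(hD i q).continuousAt (e.open_source.mem_nhds (by
    rw [hi]; exact e.map_target hq))] with p hp
  have h2 : mk p = e (D i p) := by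
    rw [he hp]
    exact (hmk _ _).2 ⟨i, rfl⟩
  rw [h2, e.left_inv hp]

/-- The quotient of a manifold by smooth identifications, for which the quotient map is a local
homeomorphism, is a manifold. -/
theorem exists_isManifold_quotient [IsManifold I ∞ Y] {ι : Type*} {mk : Y → M} {D : ι → Y → Y}
    (hD : ∀ i, ContMDiff I I ∞ (D i)) (hmk : ∀ p q, mk p = mk q ↔ ∃ i, D i p = q)
    (hloc : IsLocalHomeomorph mk) (hsurj : Function.Surjective mk)
    (hκ : ∀ y : Y, ∃ κ : OpenPartialHomeomorph Y V, y ∈ κ.source ∧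
      ContMDiffOn I 𝓘(ℝ, V) ∞ κ κ.source ∧ ContMDiffOn 𝓘(ℝ, V) I ∞ κ.symm κ.target) :
    ∃ (_ : ChartedSpace V M) (_ : IsManifold 𝓘(ℝ, V) ∞ M), IsLocalDiffeomorph I 𝓘(ℝ, V) ∞ mk := by
  choose κ hκs hκ1 hκ2 using hκ
  choose e hes he using hloc
  choose s hs using hsurj
  have het : ∀ m, m ∈ (e (s m)).target := fun m => by
    have := (e (s m)).map_source (hes (s m))
    rwa [← he (s m), hs m] at this
  have hsm : ∀ m, (e (s m)).symm m = s m := fun m => by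
    conv_lhs => rw [← hs m]
    rw [hs m]
    have h1 := (e (s m)).left_inv (hes (s m))
    rwa [← he (s m), hs m] at h1
  have hK : ∀ y q, mk q ∈ (e y).target → ContMDiffAt I I ∞ (fun p => (e y).symm (mk p)) q :=
    fun y q hq => contMDiffAt_symm_comp_of_identifications hD hmk (fun p _ => by rw [← he y]) hq
  -- Charts of the quotient are local inverses of the quotient map followed by coordinates upstairs.
  let χ : M → OpenPartialHomeomorph M V := fun m => (e (s m)).symm.trans (κ (s m))
  have hχs : ∀ m m', m' ∈ (χ m).source ↔
      m' ∈ (e (s m)).target ∧ (e (s m)).symm m' ∈ (κ (s m)).source := fun m m' => by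
    simp [χ, OpenPartialHomeomorph.trans_source]
  have hχ : ∀ m m', χ m m' = κ (s m) ((e (s m)).symm m') := fun _ _ => rfl
  have hχsymm : ∀ m v, (χ m).symm v = mk ((κ (s m)).symm v) := fun m v => by
    change e (s m) ((κ (s m)).symm v) = _
    rw [← he (s m)]
  have hmem : ∀ m, m ∈ (χ m).source := fun m =>
    (hχs m m).2 ⟨het m, by rw [hsm]; exact hκs _⟩
  have key : ∀ m q, mk q ∈ (χ m).source → ContMDiffAt I 𝓘(ℝ, V) ∞ (fun p => χ m (mk p)) q := by
    intro m q hq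
    rw [hχs] at hq
    exact ContMDiffAt.comp (g := κ (s m)) (f := fun p => (e (s m)).symm (mk p)) q
      ((hκ1 (s m)).contMDiffAt ((κ (s m)).open_source.mem_nhds hq.2)) (hK _ _ hq.1)
  letI cs : ChartedSpace V M :=
    { atlas := range χ
      chartAt := χ
      mem_chart_source := hmem
      chart_mem_atlas := mem_range_self }
  have hman : IsManifold 𝓘(ℝ, V) ∞ M := by
    refine isManifold_of_contDiffOn _ _ _ ?_
    rintro _ _ ⟨m, rfl⟩ ⟨m', rfl⟩
    rintro v ⟨hv, -⟩
    have hv' : v ∈ (χ m).target ∧ (χ m).symm v ∈ (χ m').source := by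
      simpa [OpenPartialHomeomorph.trans_source] using hv
    have hvκ : v ∈ (κ (s m)).target := by
      have := hv'.1
      simp only [χ, OpenPartialHomeomorph.trans_target] at this
      exact this.1
    refine ContDiffAt.contDiffWithinAt ?_
    rw [← contMDiffAt_iff_contDiffAt]
    have h1 := key m' ((κ (s m)).symm v) (by rw [← hχsymm]; exact hv'.2)
    have h2 := ContMDiffAt.comp (I' := I) v h1
      ((hκ2 (s m)).contMDiffAt ((κ (s m)).open_target.mem_nhds hvκ))
    refine h2.congr_of_eventuallyEq (Filter.Eventually.of_forall fun w => ?_)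
    change χ m' ((χ m).symm w) = χ m' (mk ((κ (s m)).symm w))
    rw [hχsymm]
  have hcont : ∀ y, ContinuousAt mk y := fun y => by
    rw [he y]; exact (e y).continuousAt (hes y)
  have hmaps : ∀ q, ContMDiffAt I 𝓘(ℝ, V) ∞ mk q := by
    intro q
    have h1 := key (mk q) q (hmem _)
    have h2 : ContMDiffAt 𝓘(ℝ, V) 𝓘(ℝ, V) ∞ (χ (mk q)).symm (χ (mk q) (mk q)) :=
      contMDiffAt_symm_of_mem_maximalAtlas (IsManifold.chart_mem_maximalAtlas (mk q))
        ((χ (mk q)).map_source (hmem _))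
    refine (ContMDiffAt.comp (g := (χ (mk q)).symm) (f := fun p => χ (mk q) (mk p)) q h2
      h1).congr_of_eventuallyEq ?_
    filter_upwards [hcont q ((χ (mk q)).open_source.mem_nhds (hmem _))] with p hp
    exact ((χ (mk q)).left_inv hp).symm
  refine ⟨cs, hman, fun q => ⟨⟨(e q).toPartialEquiv, (e q).open_source, (e q).open_target,
    fun p _ => ?_, fun m hm => ?_⟩, hes q, fun p _ => by
      change mk p = e q p
      rw [← he q]⟩⟩
  · refine ContMDiffAt.contMDiffWithinAt ?_
    change ContMDiffAt _ _ _ (e q) p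
    rw [← he q]
    exact hmaps p
  · refine ContMDiffAt.contMDiffWithinAt ?_
    change ContMDiffAt _ _ _ (e q).symm m
    have h1 : ContMDiffAt 𝓘(ℝ, V) 𝓘(ℝ, V) ∞ (χ m) m :=
      contMDiffAt_of_mem_maximalAtlas (IsManifold.chart_mem_maximalAtlas m) (hmem m)
    have h2 : ContMDiffAt 𝓘(ℝ, V) I ∞ (κ (s m)).symm (χ m m) := by
      refine (hκ2 (s m)).contMDiffAt ((κ (s m)).open_target.mem_nhds ?_)
      rw [hχ, hsm]
      exact (κ (s m)).map_source (hκs _)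
    have h3 : ContMDiffAt 𝓘(ℝ, V) I ∞ (fun m' => (κ (s m)).symm (χ m m')) m :=
      ContMDiffAt.comp (g := (κ (s m)).symm) m h2 h1
    have h4 : ContMDiffAt I I ∞ (fun p => (e q).symm (mk p)) ((κ (s m)).symm (χ m m)) :=
      hK _ _ (by rw [← hχsymm, (χ m).left_inv (hmem m)]; exact hm)
    refine (ContMDiffAt.comp (I' := I) (g := fun p => (e q).symm (mk p)) m h4
      h3).congr_of_eventuallyEq ?_
    filter_upwards [(χ m).open_source.mem_nhds (hmem m)] with m' hm'
    change (e q).symm m' = (e q).symm (mk ((κ (s m)).symm (χ m m')))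
    rw [← hχsymm, (χ m).left_inv hm']

/-- Smoothness of a map on the quotient can be checked on the covering. -/
theorem IsLocalDiffeomorphAt.contMDiffAt_of_comp {V' H' V'' H'' : Type} [NormedAddCommGroup V']
    [NormedSpace ℝ V'] [TopologicalSpace H'] {J : ModelWithCorners ℝ V' H'} [ChartedSpace H' M]
    [NormedAddCommGroup V''] [NormedSpace ℝ V''] [TopologicalSpace H'']
    {J' : ModelWithCorners ℝ V'' H''} {Z : Type*} [TopologicalSpace Z] [ChartedSpace H'' Z]
    {mk : Y → M} {q : Y} (h : IsLocalDiffeomorphAt I J ∞ mk q) {g : M → Z}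
    (hg : ContMDiffAt I J' ∞ (fun p => g (mk p)) q) : ContMDiffAt J J' ∞ g (mk q) := by
  have h1 : h.localInverse (mk q) = q := h.localInverse_left_inv h.localInverse_mem_target
  have h2 : ContMDiffAt J I ∞ h.localInverse (mk q) := h.localInverse_contMDiffAt
  have h3 : ContMDiffAt I J' ∞ (fun p => g (mk p)) (h.localInverse (mk q)) := by rwa [h1]
  refine (ContMDiffAt.comp (g := fun p => g (mk p)) (mk q) h3 h2).congr_of_eventuallyEq ?_
  filter_upwards [h.localInverse_eventuallyEq_right] with m hm
  exact congrArg g hm.symm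

end QuotientManifold

/-! ### Arcs of the circle, and the mapping torus as a closed manifold. -/

section MappingTorusTopology

local notation:max "𝔼" n:max => EuclideanSpace ℝ (Fin n)

/-! ### Arcs of the circle -/

/-- The complement of the point opposite to `exp (2πs₀)`. -/
def arc (s₀ : ℝ) : Set Circle :=
  {z | ((z * Circle.exp (-(2 * Real.pi * s₀)) : Circle) : ℂ) ∈ Complex.slitPlane}

/-- The inverse of `s ↦ exp (2πs)` on an arc. -/
def arcLog (s₀ : ℝ) (z : Circle) : ℝ :=
  s₀ + Complex.arg ((z * Circle.exp (-(2 * Real.pi * s₀)) : Circle) : ℂ) / (2 * Real.pi)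

theorem isOpen_arc (s₀ : ℝ) : IsOpen (arc s₀) :=
  Complex.isOpen_slitPlane.preimage (by fun_prop)

theorem exp_arcLog (s₀ : ℝ) (z : Circle) : Circle.exp (2 * Real.pi * arcLog s₀ z) = z := by
  have h : 2 * Real.pi * arcLog s₀ z = 2 * Real.pi * s₀ +
      Complex.arg ((z * Circle.exp (-(2 * Real.pi * s₀)) : Circle) : ℂ) := by
    rw [arcLog]
    field_simp
  rw [h, Circle.exp_add, Circle.exp_arg, Circle.exp_neg, mul_comm z, mul_inv_cancel_left]

theorem arcLog_mem {s₀ : ℝ} {z : Circle} (hz : z ∈ arc s₀) :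
    arcLog s₀ z ∈ Metric.ball s₀ (1 / 2) := by
  have h1 := (Complex.mem_slitPlane_iff_arg.1 hz).1
  have h2 := lt_of_le_of_ne (Complex.arg_le_pi _) h1
  have h3 := Complex.neg_pi_lt_arg ((z * Circle.exp (-(2 * Real.pi * s₀)) : Circle) : ℂ)
  rw [Real.ball_eq_Ioo, arcLog]
  have hp := Real.pi_pos
  constructor
  · rw [sub_lt_iff_lt_add, add_assoc, lt_add_iff_pos_right, ← neg_lt_iff_pos_add,
      lt_div_iff₀ (by positivity)]
    linarith
  · rw [add_lt_add_iff_left, div_lt_iff₀ (by positivity)]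
    linarith

theorem exp_mem_arc {s₀ s : ℝ} (hs : s ∈ Metric.ball s₀ (1 / 2)) :
    Circle.exp (2 * Real.pi * s) ∈ arc s₀ ∧ arcLog s₀ (Circle.exp (2 * Real.pi * s)) = s := by
  rw [Real.ball_eq_Ioo] at hs
  have hp := Real.pi_pos
  have h1 : Circle.exp (2 * Real.pi * s) * Circle.exp (-(2 * Real.pi * s₀)) =
      Circle.exp (2 * Real.pi * (s - s₀)) := by
    rw [← Circle.exp_add]
    congr 1
    ring
  have h2 : -Real.pi < 2 * Real.pi * (s - s₀) := by nlinarith [hs.1]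
  have h3 : 2 * Real.pi * (s - s₀) < Real.pi := by nlinarith [hs.2]
  have h4 : Complex.arg (Circle.exp (2 * Real.pi * (s - s₀))) = 2 * Real.pi * (s - s₀) :=
    Circle.arg_exp h2 h3.le
  constructor
  · change ((Circle.exp (2 * Real.pi * s) * Circle.exp (-(2 * Real.pi * s₀)) : Circle) : ℂ) ∈
      Complex.slitPlane
    rw [h1, Complex.mem_slitPlane_iff_arg, h4]
    exact ⟨h3.ne, Circle.coe_ne_zero _⟩
  · rw [arcLog, h1, h4]
    field_simp
    ring

theorem contMDiffOn_arcLog (s₀ : ℝ) : ContMDiffOn (𝓡 1) 𝓘(ℝ, ℝ) ∞ (arcLog s₀) (arc s₀) := by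
  intro z hz
  refine ContMDiffAt.contMDiffWithinAt ?_
  have : Fact (Module.finrank ℝ ℂ = 1 + 1) := finrank_real_complex_fact'
  have h1 : ContMDiff (𝓡 1) 𝓘(ℝ, ℂ) ∞
      fun z : Circle => ((z : ℂ) * (Circle.exp (-(2 * Real.pi * s₀)) : ℂ)) :=
    ContMDiff.comp (I' := 𝓘(ℝ, ℂ)) (contDiff_id.mul contDiff_const).contMDiff contMDiff_coe_sphere
  have h2 : ContDiffAt ℝ ∞ (fun w : ℂ => s₀ + (Complex.log w).im / (2 * Real.pi))
      ((z : ℂ) * (Circle.exp (-(2 * Real.pi * s₀)) : ℂ)) := by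
    have h3 : ContDiffAt ℝ ∞ Complex.log ((z : ℂ) * (Circle.exp (-(2 * Real.pi * s₀)) : ℂ)) :=
      (Complex.contDiffAt_log hz).restrict_scalars ℝ
    exact contDiffAt_const.add ((Complex.imCLM.contDiff.contDiffAt.comp _ h3).div_const _)
  refine (ContMDiffAt.comp (I' := 𝓘(ℝ, ℂ)) z h2.contMDiffAt h1.contMDiffAt).congr_of_eventuallyEq ?_
  refine Filter.Eventually.of_forall fun w => ?_
  simp only [arcLog, Function.comp_apply, Complex.log_im, Circle.coe_mul]

/-! ### Topology of the mapping torus -/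

variable {X : Type u} {n : ℕ} [TopologicalSpace X] [ChartedSpace (𝔼 n) X]
  {a c : X ≃ₘ⟮𝓡 n, 𝓡 n⟯ X} {b : ℝ → X ≃ₘ⟮𝓡 n, 𝓡 n⟯ X} {x : X}

namespace MappingTorus

theorem continuous_mk : Continuous (mk a c b) := continuous_quot_mk

theorem surjective_mk : Function.Surjective (mk a c b) := Quot.mk_surjective

theorem continuous_proj : Continuous (proj a c b) :=
  continuous_quot_lift _ (by fun_prop)

variable [IsManifold (𝓡 n) ∞ X] (hb : IsCommutatorIsotopy a c x b)

include hb

theorem contMDiff_torusDeck (k l : ℤ) :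
    ContMDiff (𝓘(ℝ, ℝ).prod (𝓘(ℝ, ℝ).prod (𝓡 n))) (𝓘(ℝ, ℝ).prod (𝓘(ℝ, ℝ).prod (𝓡 n))) ∞
      (torusDeck a c b k l) :=
  (isGluingFamily hb).contMDiff_deck
    (SmoothPaths.const_of_contMDiff a.contMDiff a.symm.contMDiff)
    (SmoothPaths.const_of_contMDiff c.contMDiff c.symm.contMDiff) (gluingFamily_mem hb) k l

/-- The saturation of an open set is a union of its preimages under deck transformations. -/
theorem isOpenMap_mk : IsOpenMap (mk a c b) := by
  intro U hU
  have hq : IsQuotientMap (mk a c b) := isQuotientMap_quot_mk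
  rw [← hq.isOpen_preimage]
  have : mk a c b ⁻¹' (mk a c b '' U) = ⋃ k, ⋃ l, torusDeck a c b k l ⁻¹' U := by
    ext p
    simp only [mem_preimage, mem_image, mem_iUnion]
    constructor
    · rintro ⟨q, hq, h⟩
      obtain ⟨k, l, h⟩ := (mk_eq_mk_iff hb).1 h.symm
      exact ⟨k, l, by rwa [h]⟩
    · rintro ⟨k, l, h⟩
      exact ⟨_, h, ((mk_eq_mk_iff hb).2 ⟨k, l, rfl⟩).symm⟩
  exact this ▸ isOpen_iUnion fun k => isOpen_iUnion fun l =>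
    hU.preimage (contMDiff_torusDeck hb k l).continuous

/-- Two points of a unit square differ by an integer shift in each coordinate only if the shifts are
zero. -/
theorem injOn_mk (s₀ t₀ : ℝ) : InjOn (mk a c b)
    (Metric.ball s₀ (1 / 2) ×ˢ Metric.ball t₀ (1 / 2) ×ˢ univ) := by
  rintro ⟨s, t, y⟩ ⟨hs, ht, -⟩ ⟨s', t', y'⟩ ⟨hs', ht', -⟩ h
  obtain ⟨k, l, h⟩ := (mk_eq_mk_iff hb).1 h
  have aux : ∀ {r r' r₀ : ℝ} {k : ℤ}, r ∈ Metric.ball r₀ (1 / 2) → r' ∈ Metric.ball r₀ (1 / 2) →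
      r + k = r' → k = 0 := by
    intro r r' r₀ k h1 h2 h3
    rw [Real.ball_eq_Ioo] at h1 h2
    have h4 : |(k : ℝ)| < 1 := by
      rw [abs_lt]
      constructor <;> linarith [h1.1, h1.2, h2.1, h2.2]
    exact Int.abs_lt_one_iff.1 (by exact_mod_cast h4)
  have hk := aux hs hs' (congrArg Prod.fst h)
  have hl := aux ht ht' (congrArg (fun p => p.2.1) h)
  rw [← h, hk, hl]
  exact (deck_zero _).symm

/-- The inverse of the quotient map on a strip. -/
theorem exists_strip (s₀ t₀ : ℝ) : ∃ e : OpenPartialHomeomorph (ℝ × ℝ × X) (MappingTorus a c b),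
    e.source = Metric.ball s₀ (1 / 2) ×ˢ Metric.ball t₀ (1 / 2) ×ˢ univ ∧ ⇑e = mk a c b := by
  have : Nonempty (ℝ × ℝ × X) := ⟨(0, 0, x)⟩
  exact ⟨OpenPartialHomeomorph.ofContinuousOpen (InjOn.toPartialEquiv _ _ (injOn_mk hb s₀ t₀))
    continuous_mk.continuousOn (isOpenMap_mk hb)
    (Metric.isOpen_ball.prod (Metric.isOpen_ball.prod isOpen_univ)), rfl, rfl⟩

theorem isLocalHomeomorph_mk : IsLocalHomeomorph (mk a c b) := by
  rintro ⟨s, t, y⟩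
  obtain ⟨e, he, he'⟩ := exists_strip hb s t
  refine ⟨e, ?_, he'.symm⟩
  rw [he]
  exact ⟨Metric.mem_ball_self (by norm_num), Metric.mem_ball_self (by norm_num), mem_univ _⟩

theorem exists_mk_eq {m : MappingTorus a c b} {s t : ℝ}
    (hm : proj a c b m = (Circle.exp (2 * Real.pi * s), Circle.exp (2 * Real.pi * t))) :
    ∃ y, mk a c b (s, t, y) = m := by
  obtain ⟨⟨s', t', y⟩, rfl⟩ := surjective_mk m
  obtain ⟨h1, h2⟩ := Prod.ext_iff.1 hm
  have aux : ∀ {r r' : ℝ}, Circle.exp (2 * Real.pi * r') = Circle.exp (2 * Real.pi * r) →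
      ∃ k : ℤ, r' + k = r := by
    intro r r' h
    obtain ⟨k, hk⟩ := Circle.exp_eq_exp.1 h.symm
    refine ⟨k, ?_⟩
    have hp := Real.pi_pos
    have : 2 * Real.pi * r = 2 * Real.pi * (r' + k) := by rw [hk]; ring
    exact (mul_left_cancel₀ (by positivity) this).symm
  obtain ⟨k, rfl⟩ := aux h1
  obtain ⟨l, rfl⟩ := aux h2
  exact ⟨_, ((mk_eq_mk_iff hb).2 ⟨k, l, rfl⟩).symm⟩

/-- Points over different base points are separated by the projection; points over the same one lie
in a common strip, in which X separates them. -/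
theorem t2Space [T2Space X] : T2Space (MappingTorus a c b) := by
  refine ⟨fun m m' h => ?_⟩
  by_cases hp : proj a c b m = proj a c b m'
  · obtain ⟨⟨s, t, y⟩, rfl⟩ := surjective_mk m
    obtain ⟨y', rfl⟩ := exists_mk_eq hb hp.symm
    have hy : y ≠ y' := fun h' => h (by rw [h'])
    obtain ⟨U, U', hU, hU', hyU, hyU', hd⟩ := t2_separation hy
    have ho : ∀ {U : Set X}, IsOpen U → IsOpen (mk a c b ''
        (Metric.ball s (1 / 2) ×ˢ Metric.ball t (1 / 2) ×ˢ U)) := fun hU =>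
      isOpenMap_mk hb _ (Metric.isOpen_ball.prod (Metric.isOpen_ball.prod hU))
    have hst : s ∈ Metric.ball s (1 / 2) ∧ t ∈ Metric.ball t (1 / 2) :=
      ⟨Metric.mem_ball_self (by norm_num), Metric.mem_ball_self (by norm_num)⟩
    refine ⟨_, _, ho hU, ho hU', ⟨_, ⟨hst.1, hst.2, hyU⟩, rfl⟩, ⟨_, ⟨hst.1, hst.2, hyU'⟩, rfl⟩, ?_⟩
    rw [disjoint_left]
    rintro _ ⟨p, hp, rfl⟩ ⟨q, hq, hqp⟩
    have := injOn_mk hb s t ⟨hq.1, hq.2.1, mem_univ _⟩ ⟨hp.1, hp.2.1, mem_univ _⟩ hqp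
    rw [this] at hq
    exact disjoint_left.1 hd hp.2.2 hq.2.2
  · exact separated_by_continuous continuous_proj hp

theorem compactSpace [CompactSpace X] : CompactSpace (MappingTorus a c b) := by
  have h : mk a c b '' (Icc (0 : ℝ) 1 ×ˢ Icc (0 : ℝ) 1 ×ˢ univ) = univ := by
    refine eq_univ_of_forall fun m => ?_
    obtain ⟨⟨s, t, y⟩, rfl⟩ := surjective_mk m
    refine ⟨torusDeck a c b (-⌊s⌋) (-⌊t⌋) (s, t, y), ⟨?_, ?_, mem_univ _⟩,
      ((mk_eq_mk_iff hb).2 ⟨_, _, rfl⟩).symm⟩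
    all_goals
      simp only [torusDeck, deck, Int.cast_neg, ← sub_eq_add_neg]
      exact ⟨Int.fract_nonneg _, (Int.fract_lt_one _).le⟩
  exact ⟨h ▸ (isCompact_Icc.prod (isCompact_Icc.prod isCompact_univ)).image continuous_mk⟩

theorem exists_isManifold :
    ∃ (_ : ChartedSpace (ℝ × ℝ × 𝔼 n) (MappingTorus a c b))
      (_ : IsManifold 𝓘(ℝ, ℝ × ℝ × 𝔼 n) ∞ (MappingTorus a c b)),
      IsLocalDiffeomorph (𝓘(ℝ, ℝ).prod (𝓘(ℝ, ℝ).prod (𝓡 n))) 𝓘(ℝ, ℝ × ℝ × 𝔼 n) ∞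
        (mk a c b) := by
  refine exists_isManifold_quotient (ι := ℤ × ℤ) (D := fun i => torusDeck a c b i.1 i.2)
    (fun i => contMDiff_torusDeck hb i.1 i.2) (fun p q => by rw [mk_eq_mk_iff hb, Prod.exists])
    (isLocalHomeomorph_mk hb) surjective_mk ?_
  rintro ⟨s, t, y⟩
  refine ⟨(OpenPartialHomeomorph.refl ℝ).prod ((OpenPartialHomeomorph.refl ℝ).prod (chartAt _ y)),
    ⟨mem_univ _, mem_univ _, mem_chart_source _ y⟩, ?_, ?_⟩
  · have h1 : ContMDiffOn (𝓘(ℝ, ℝ).prod (𝓘(ℝ, ℝ).prod (𝓡 n))) 𝓘(ℝ, 𝔼 n) ∞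
        (fun p : ℝ × ℝ × X => chartAt (𝔼 n) y p.2.2)
        ((OpenPartialHomeomorph.refl ℝ).prod
          ((OpenPartialHomeomorph.refl ℝ).prod (chartAt (𝔼 n) y))).source :=
      (contMDiffOn_chart (I := 𝓡 n) (n := ∞) (x := y)).comp
        (contMDiff_snd.comp contMDiff_snd).contMDiffOn fun p hp => hp.2.2
    exact contMDiff_fst.contMDiffOn.prodMk_space
      ((contMDiff_fst.comp contMDiff_snd).contMDiffOn.prodMk_space h1)
  · have h1 : ContMDiffOn 𝓘(ℝ, ℝ × ℝ × 𝔼 n) (𝓡 n) ∞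
        (fun p : ℝ × ℝ × 𝔼 n => (chartAt (𝔼 n) y).symm p.2.2)
        ((OpenPartialHomeomorph.refl ℝ).prod
          ((OpenPartialHomeomorph.refl ℝ).prod (chartAt (𝔼 n) y))).target :=
      (contMDiffOn_chart_symm (I := 𝓡 n) (n := ∞) (x := y)).comp (t := (chartAt (𝔼 n) y).target)
        (contDiff_snd.comp contDiff_snd).contMDiff.contMDiffOn fun p hp => hp.2.2
    exact contDiff_fst.contMDiff.contMDiffOn.prodMk
      ((contDiff_fst.comp contDiff_snd).contMDiff.contMDiffOn.prodMk h1)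

end MappingTorus

end MappingTorusTopology

/-! ### Local trivializations of the mapping torus. -/

section MappingTorusBundle

local notation:max "𝔼" n:max => EuclideanSpace ℝ (Fin n)

variable {X : Type u} {n : ℕ} [TopologicalSpace X] [ChartedSpace (𝔼 n) X]
  {a c : X ≃ₘ⟮𝓡 n, 𝓡 n⟯ X} {b : ℝ → X ≃ₘ⟮𝓡 n, 𝓡 n⟯ X} {x : X}
  [IsManifold (𝓡 n) ∞ X]

namespace MappingTorus

/-- The local trivialization of the mapping torus over a product of two arcs. -/
def trivialization (hb : IsCommutatorIsotopy a c x b) (s₀ t₀ : ℝ) :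
    Trivialization X (proj a c b) :=
  let e := (exists_strip hb s₀ t₀).choose
  have he : e.source = Metric.ball s₀ (1 / 2) ×ˢ Metric.ball t₀ (1 / 2) ×ˢ univ :=
    (exists_strip hb s₀ t₀).choose_spec.1
  have he' : ⇑e = mk a c b := (exists_strip hb s₀ t₀).choose_spec.2
  have hmem : ∀ m, proj a c b m ∈ arc s₀ ×ˢ arc t₀ → m ∈ e.target := fun m hm => by
    obtain ⟨y, hy⟩ := exists_mk_eq hb (m := m) (s := arcLog s₀ (proj a c b m).1)
      (t := arcLog t₀ (proj a c b m).2) (by rw [exp_arcLog, exp_arcLog])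
    rw [← hy, ← he']
    refine e.map_source ?_
    rw [he]
    exact ⟨arcLog_mem hm.1, arcLog_mem hm.2, mem_univ _⟩
  have hes : ∀ m, proj a c b m ∈ arc s₀ ×ˢ arc t₀ → e.symm m =
      (arcLog s₀ (proj a c b m).1, arcLog t₀ (proj a c b m).2, (e.symm m).2.2) := fun m hm => by
    have h1 := e.map_target (hmem m hm)
    rw [he] at h1
    have h2 : proj a c b (mk a c b (e.symm m)) = proj a c b m := by
      rw [← he', e.right_inv (hmem m hm)]
    refine Prod.ext ?_ (Prod.ext ?_ rfl)
    · rw [← (exp_mem_arc h1.1).2]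
      exact congrArg (fun z : Circle × Circle => arcLog s₀ z.1) h2
    · rw [← (exp_mem_arc h1.2.1).2]
      exact congrArg (fun z : Circle × Circle => arcLog t₀ z.2) h2
  have hinv : ∀ (z : Circle × Circle) (y : X), proj a c b
      (mk a c b (arcLog s₀ z.1, arcLog t₀ z.2, y)) = z := fun z y =>
    Prod.ext (exp_arcLog _ _) (exp_arcLog _ _)
  { toFun := fun m => (proj a c b m, (e.symm m).2.2)
    invFun := fun q => mk a c b (arcLog s₀ q.1.1, arcLog t₀ q.1.2, q.2)
    source := proj a c b ⁻¹' (arc s₀ ×ˢ arc t₀)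
    target := (arc s₀ ×ˢ arc t₀) ×ˢ univ
    map_source' := fun m hm => ⟨hm, mem_univ _⟩
    map_target' := fun q hq => by
      rw [mem_preimage, hinv]
      exact hq.1
    left_inv' := fun m hm => by
      change mk a c b (arcLog s₀ (proj a c b m).1, arcLog t₀ (proj a c b m).2, (e.symm m).2.2) = m
      rw [← hes m hm, ← he', e.right_inv (hmem m hm)]
    right_inv' := fun q hq => by
      refine Prod.ext (hinv q.1 q.2) ?_
      change (e.symm (mk a c b (arcLog s₀ q.1.1, arcLog t₀ q.1.2, q.2))).2.2 = q.2
      rw [← he', e.left_inv (by rw [he]; exact ⟨arcLog_mem hq.1.1, arcLog_mem hq.1.2, mem_univ _⟩)]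
    open_source := ((isOpen_arc _).prod (isOpen_arc _)).preimage continuous_proj
    open_target := ((isOpen_arc _).prod (isOpen_arc _)).prod isOpen_univ
    continuousOn_toFun := continuous_proj.continuousOn.prodMk
      ((continuous_snd.comp continuous_snd).comp_continuousOn
        (e.continuousOn_symm.mono fun m hm => hmem m hm))
    continuousOn_invFun := continuous_mk.comp_continuousOn
      (((contMDiffOn_arcLog s₀).continuousOn.comp (by fun_prop) fun q hq => hq.1.1).prodMk
        (((contMDiffOn_arcLog t₀).continuousOn.comp (by fun_prop) fun q hq => hq.1.2).prodMk
          (by fun_prop)))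
    baseSet := arc s₀ ×ˢ arc t₀
    open_baseSet := (isOpen_arc _).prod (isOpen_arc _)
    source_eq := rfl
    target_eq := rfl
    proj_toFun := fun m _ => rfl }

variable (hb : IsCommutatorIsotopy a c x b)

theorem trivialization_symm_apply (s₀ t₀ : ℝ) (q : (Circle × Circle) × X) :
    (trivialization hb s₀ t₀).toOpenPartialHomeomorph.symm q =
      mk a c b (arcLog s₀ q.1.1, arcLog t₀ q.1.2, q.2) := rfl

theorem trivialization_mk {s₀ t₀ s t : ℝ} (hs : s ∈ Metric.ball s₀ (1 / 2))
    (ht : t ∈ Metric.ball t₀ (1 / 2)) (y : X) : trivialization hb s₀ t₀ (mk a c b (s, t, y)) =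
      ((Circle.exp (2 * Real.pi * s), Circle.exp (2 * Real.pi * t)), y) := by
  refine Prod.ext rfl ?_
  have he := (exists_strip hb s₀ t₀).choose_spec
  set e := (exists_strip hb s₀ t₀).choose
  change (e.symm (mk a c b (s, t, y))).2.2 = y
  rw [← he.2, e.left_inv (by rw [he.1]; exact ⟨hs, ht, mem_univ _⟩)]

include hb in
-- On a fibre, a coordinate change is a product of powers of c and of a gluing map. The latter is
-- isotopic to a along the gluing path, so orientations are preserved.
theorem isOrientableSmoothBundle_proj {o : OrientedAtlas (𝔼 n) X}
    (ha : IsOrientationPreserving o a) (hc : IsOrientationPreserving o c)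
    [ChartedSpace (ℝ × ℝ × 𝔼 n) (MappingTorus a c b)]
    (hmk : IsLocalDiffeomorph (𝓘(ℝ, ℝ).prod (𝓘(ℝ, ℝ).prod (𝓡 n))) 𝓘(ℝ, ℝ × ℝ × 𝔼 n) ∞
        (mk a c b)) :
    IsOrientableSmoothBundle o ((𝓡 1).prod (𝓡 1)) 𝓘(ℝ, ℝ × ℝ × 𝔼 n) (proj a c b) := by
  have hexp : ContMDiff 𝓘(ℝ, ℝ) (𝓡 1) ∞ fun s : ℝ => Circle.exp (2 * Real.pi * s) :=
    contMDiff_circleExp.comp (contDiff_const.mul contDiff_id).contMDiff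
  have hproj : ContMDiff (𝓘(ℝ, ℝ).prod (𝓘(ℝ, ℝ).prod (𝓡 n))) ((𝓡 1).prod (𝓡 1)) ∞
      fun p : ℝ × ℝ × X => (Circle.exp (2 * Real.pi * p.1), Circle.exp (2 * Real.pi * p.2.1)) :=
    (hexp.comp contMDiff_fst).prodMk (hexp.comp (contMDiff_fst.comp contMDiff_snd))
  refine ⟨fun m => ?_, {e | ∃ s₀ t₀, e = trivialization hb s₀ t₀}, ?_, ?_, ?_⟩
  · obtain ⟨p, rfl⟩ := surjective_mk m
    exact (hmk p).contMDiffAt_of_comp hproj.contMDiffAt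
  · rintro _ ⟨s₀, t₀, rfl⟩
    constructor
    · intro m hm
      have hm' : proj a c b m ∈ arc s₀ ×ˢ arc t₀ := hm
      obtain ⟨y, hy⟩ := exists_mk_eq hb (m := m) (s := arcLog s₀ (proj a c b m).1)
        (t := arcLog t₀ (proj a c b m).2) (by rw [exp_arcLog, exp_arcLog])
      rw [← hy]
      refine ContMDiffAt.contMDiffWithinAt ((hmk _).contMDiffAt_of_comp ?_)
      refine (hproj.prodMk (contMDiff_snd.comp contMDiff_snd)).contMDiffAt.congr_of_eventuallyEq ?_
      filter_upwards [(Metric.isOpen_ball.prod (Metric.isOpen_ball.prod isOpen_univ)).mem_nhds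
        ⟨arcLog_mem hm'.1, arcLog_mem hm'.2, mem_univ y⟩] with p hp
      exact trivialization_mk hb hp.1 hp.2.1 p.2.2
    · refine hmk.contMDiff.comp_contMDiffOn (f := fun q : (Circle × Circle) × X =>
        (arcLog s₀ q.1.1, arcLog t₀ q.1.2, q.2)) ?_
      exact ((contMDiffOn_arcLog s₀).comp (contMDiff_fst.comp contMDiff_fst).contMDiffOn
        fun q hq => hq.1.1).prodMk (((contMDiffOn_arcLog t₀).comp
          (contMDiff_snd.comp contMDiff_fst).contMDiffOn fun q hq => hq.1.2).prodMk
            contMDiff_snd.contMDiffOn)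
  · intro z
    obtain ⟨m, hm⟩ : ∃ s t : ℝ, z = (Circle.exp (2 * Real.pi * s), Circle.exp (2 * Real.pi * t)) :=
      ⟨arcLog 0 z.1, arcLog 0 z.2, by rw [exp_arcLog, exp_arcLog]⟩
    obtain ⟨t, rfl⟩ := hm
    exact ⟨_, ⟨m, t, rfl⟩, (exp_mem_arc (Metric.mem_ball_self (by norm_num))).1,
      (exp_mem_arc (Metric.mem_ball_self (by norm_num))).1⟩
  · rintro _ ⟨s₀, t₀, rfl⟩ _ ⟨s₁, t₁, rfl⟩ z ⟨hz, hz'⟩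
    have aux : ∀ {r r' : ℝ} {z : Circle}, ∃ k : ℤ, arcLog r z + k = arcLog r' z := by
      intro r r' z
      obtain ⟨k, hk⟩ := Circle.exp_eq_exp.1 ((exp_arcLog r' z).trans (exp_arcLog r z).symm)
      refine ⟨k, ?_⟩
      have hp := Real.pi_pos
      have : 2 * Real.pi * arcLog r' z = 2 * Real.pi * (arcLog r z + k) := by rw [hk]; ring
      exact (mul_left_cancel₀ (by positivity) this).symm
    obtain ⟨k, hk⟩ := aux (r := s₀) (r' := s₁) (z := z.1)
    obtain ⟨l, hl⟩ := aux (r := t₀) (r' := t₁) (z := z.2)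
    have hao : a.toEquiv ∈ orientedGroup o :=
      ⟨SmoothPaths.const_of_contMDiff a.contMDiff a.symm.contMDiff, ha⟩
    have hco : c.toEquiv ∈ orientedGroup o :=
      ⟨SmoothPaths.const_of_contMDiff c.contMDiff c.symm.contMDiff, hc⟩
    have hg := isGluingFamily hb
    have hF := hg.gluingPath_mem hao.1 hco.1 (gluingFamily_mem hb)
    have hmem : c.toEquiv ^ l * gluingPath a.toEquiv c.toEquiv (gluingFamily b)
        (arcLog t₀ z.2) ^ k ∈ orientedGroup o :=
      mul_mem (zpow_mem hco _) (zpow_mem (SmoothPaths.mem_orientedGroup hF (s := 0)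
        (by rw [hg.gluingPath_zero]; exact hao) _) _)
    convert hmem.2 using 1
    funext y
    rw [trivialization_symm_apply]
    have h1 : mk a c b (arcLog s₀ z.1, arcLog t₀ z.2, y) =
        mk a c b (arcLog s₁ z.1, arcLog t₁ z.2, (c.toEquiv ^ l * gluingPath a.toEquiv c.toEquiv
          (gluingFamily b) (arcLog t₀ z.2) ^ k) y) :=
      (mk_eq_mk_iff hb).2 ⟨k, l, by rw [torusDeck, deck, hk, hl]⟩
    rw [h1, trivialization_mk hb (arcLog_mem hz'.1) (arcLog_mem hz'.2)]

end MappingTorus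

end MappingTorusBundle

/-! ### Monodromy of double covers. -/

section Monodromy



/-- The symmetric group on two letters is abelian. For this reason a double cover cannot detect the
order in which loops are composed. -/
theorem Equiv.Perm.commute_of_natCard_eq_two {α : Type*} (h : Nat.card α = 2)
    (f g : Equiv.Perm α) : Commute f g := by
  have : Finite α := Nat.finite_of_card_ne_zero (by omega)
  have hc : Nat.card (Equiv.Perm α) = 2 := by rw [Nat.card_perm, h]; rfl
  have : Fact (Nat.Prime 2) := ⟨Nat.prime_two⟩
  have : IsCyclic (Equiv.Perm α) := isCyclic_of_prime_card hc
  exact mul_comm' f g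

variable {B : Type*} [TopologicalSpace B]

/-- The two paths along the boundary of a square, and its diagonal, are homotopic. -/
theorem Path.homotopic_of_square {S : ℝ × ℝ → B} (hS : Continuous S) {x y z w : B}
    (l : Path x y) (r : Path y z) (u : Path x w) (v : Path w z) (d : Path x z)
    (hl : ∀ t : unitInterval, l t = S (t, 0)) (hr : ∀ t : unitInterval, r t = S (1, t)) :
    ((∀ t : unitInterval, u t = S (0, t)) → (∀ t : unitInterval, v t = S (t, 1)) → (l.trans r).Homotopic (u.trans v)) ∧
    ((∀ t : unitInterval, d t = S (t, t)) → (l.trans r).Homotopic d) := by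
  obtain rfl : x = S (0, 0) := by simpa using hl 0
  obtain rfl : y = S (1, 0) := by simpa using hl 1
  obtain rfl : z = S (1, 1) := by simpa using hr 1
  have hl' : l = (Path.mk ⟨fun t : unitInterval => ((t : ℝ), (0 : ℝ)), by fun_prop⟩ (by simp) (by simp) :
      Path ((0 : ℝ), (0 : ℝ)) (1, 0)).map hS := Path.ext (funext hl)
  have hr' : r = (Path.mk ⟨fun t : unitInterval => ((1 : ℝ), (t : ℝ)), by fun_prop⟩ (by simp) (by simp) :
      Path ((1 : ℝ), (0 : ℝ)) (1, 1)).map hS := Path.ext (funext hr)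
  constructor
  · intro hu hv
    obtain rfl : w = S (0, 1) := by simpa using hu 1
    have hu' : u = (Path.mk ⟨fun t : unitInterval => ((0 : ℝ), (t : ℝ)), by fun_prop⟩ (by simp) (by simp) :
      Path ((0 : ℝ), (0 : ℝ)) (0, 1)).map hS := Path.ext (funext hu)
    have hv' : v = (Path.mk ⟨fun t : unitInterval => ((t : ℝ), (1 : ℝ)), by fun_prop⟩ (by simp) (by simp) :
      Path ((0 : ℝ), (1 : ℝ)) (1, 1)).map hS := Path.ext (funext hv)
    rw [hl', hr', hu', hv', ← Path.map_trans, ← Path.map_trans]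
    exact (SimplyConnectedSpace.paths_homotopic _ _).map ⟨S, hS⟩
  · intro hd
    have hd' : d = (Path.mk ⟨fun t : unitInterval => ((t : ℝ), (t : ℝ)), by fun_prop⟩ (by simp) (by simp) :
      Path ((0 : ℝ), (0 : ℝ)) (1, 1)).map hS := Path.ext (funext hd)
    rw [hl', hr', hd', ← Path.map_trans]
    exact (SimplyConnectedSpace.paths_homotopic _ _).map ⟨S, hS⟩

variable {P : Type*} [TopologicalSpace P] {p : P → B} (cov : IsCoveringMap p)

/-- The monodromy of a loop. -/
def IsCoveringMap.loopPerm {z : B} (l : Path z z) : Equiv.Perm (p ⁻¹' {z}) :=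
  cov.monodromyPerm z (FundamentalGroup.fromPath (Path.Homotopic.Quotient.mk l))

theorem IsCoveringMap.loopPerm_trans {z : B} (l l' : Path z z) :
    cov.loopPerm (l.trans l') = cov.loopPerm l' * cov.loopPerm l := by
  rw [IsCoveringMap.loopPerm, IsCoveringMap.loopPerm, IsCoveringMap.loopPerm, ← map_mul]
  rfl

theorem IsCoveringMap.loopPerm_congr {z : B} {l l' : Path z z} (h : l.Homotopic l') :
    cov.loopPerm l = cov.loopPerm l' := by
  rw [IsCoveringMap.loopPerm, IsCoveringMap.loopPerm, Path.Homotopic.Quotient.eq.2 h]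

variable {G : Type*} [Group G] [TopologicalSpace G] [IsTopologicalGroup G]

/-- The commutator loop has trivial monodromy, for a family of frames on the torus with commuting
holonomies. -/
theorem IsCoveringMap.loopPerm_commutator (h2 : ∀ w, (p ⁻¹' {w}).ncard = 2) {Φ : ℝ × ℝ × G → B}
    (hΦ : Continuous Φ) {A C : G} (hA : ∀ s t g, Φ (s + 1, t, A * g) = Φ (s, t, g))
    (hC : ∀ s t g, Φ (s, t + 1, C * g) = Φ (s, t, g)) (lam : Path 1 A) (γ : Path 1 C)
    (ε : Path (1 : G) 1) (hε : ∀ t, ε t = A⁻¹ * γ t * A * (γ t)⁻¹) :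
    cov.loopPerm (ε.map (f := fun g => Φ (0, 0, g)) (by fun_prop)) = 1 := by
  have hA0 : ∀ t g, Φ (1, t, g) = Φ (0, t, A⁻¹ * g) := fun t g => by
    have := hA 0 t (A⁻¹ * g)
    rwa [zero_add, mul_inv_cancel_left] at this
  have hC0 : ∀ s g, Φ (s, 1, C * g) = Φ (s, 0, g) := fun s g => by
    have := hC s 0 g
    rwa [zero_add] at this
  have hAC : A⁻¹ * C * A * C⁻¹ = 1 := by simpa using (hε 1).symm
  have hAC' : A⁻¹ * C * A = C := mul_inv_eq_one.1 hAC
  have hC1 : Φ (0, 1, C) = Φ (0, 0, 1) := by simpa using hC0 0 1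
  let z : B := Φ (0, 0, 1)
  let L : Path z z := ⟨⟨fun t => Φ (t, 0, lam t), by fun_prop⟩, by simp [z], by simp [z, hA0]⟩
  let Γ : Path z z := ⟨⟨fun t => Φ (0, t, γ t), by fun_prop⟩, by simp [z], by simp [z, hC1]⟩
  let Γ' : Path z z := ⟨⟨fun t => Φ (0, t, A⁻¹ * γ t * A), by fun_prop⟩, by simp [z], by
    simp [z, hAC', hC1]⟩
  let E : Path z z := ε.map (f := fun g => Φ (0, 0, g)) (by fun_prop)
  -- Going around s first turns Γ into its conjugate Γ': the square gives L followed by Γ' homotopic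
  -- to Γ followed by L.
  have e1 := (Path.homotopic_of_square (S := fun q => Φ (q.1, q.2, γ.extend q.2 * lam.extend q.1))
    (by fun_prop) L Γ' Γ L (L.trans L) (fun t => by simp [L]) (fun t => by
      simp [Γ', hA0, mul_assoc])).1 (fun t => by simp [Γ]) (fun t => by simp [L, hC0])
  -- The quotient of Γ' by Γ is ε, so E followed by Γ is homotopic to the diagonal Γ'. As the
  -- monodromies of L and Γ commute, those of Γ and Γ' agree, and that of E is trivial.
  have e2 := (Path.homotopic_of_square (S := fun q => Φ (0, q.2, ε.extend q.1 * γ.extend q.2))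
    (by fun_prop) E Γ E Γ Γ' (fun t => by simp [E]) (fun t => by simp [Γ])).2
      (fun t => by simp [Γ', hε])
  have e3 := cov.loopPerm_congr e1
  have e4 := cov.loopPerm_congr e2
  rw [cov.loopPerm_trans, cov.loopPerm_trans] at e3
  rw [cov.loopPerm_trans] at e4
  have hcomm := Equiv.Perm.commute_of_natCard_eq_two (α := p ⁻¹' {z})
    ((Nat.card_coe_set_eq _).trans (h2 z)) (cov.loopPerm L) (cov.loopPerm Γ)
  rw [hcomm.eq] at e3
  rw [mul_right_cancel e3] at e4
  exact mul_eq_left.1 e4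

/-- The lifting criterion: a loop lifts to a loop exactly when its monodromy fixes the chosen
starting point. -/
theorem IsCoveringMap.exists_lift_of_loopPerm {Y : Type*} [TopologicalSpace Y]
    [PathConnectedSpace Y] [LocallyPathConnectedSpace Y] {ψ : Y → B} (hψ : Continuous ψ) (y : Y)
    (hne : (p ⁻¹' {ψ y}).Nonempty) (h : ∀ l : Path y y, cov.loopPerm (l.map hψ) = 1) :
    ∃ σ : Y → P, Continuous σ ∧ ∀ y, p (σ y) = ψ y := by
  obtain ⟨e, he⟩ := hne
  obtain ⟨F, ⟨-, hF⟩, -⟩ := cov.existsUnique_continuousMap_lifts_of_range_le (f := ⟨ψ, hψ⟩) (a₀ := y)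
    (e₀ := e) he (by
      rintro _ ⟨l, rfl⟩
      induction l using Path.Homotopic.Quotient.ind with
      | _ l =>
      have h1 : cov.monodromy (Path.Homotopic.Quotient.mk (l.map hψ)) ⟨e, he⟩ = ⟨e, he⟩ :=
        congrArg (fun f : Equiv.Perm (p ⁻¹' {ψ y}) => f ⟨e, he⟩) (h l)
      have h2 := cov.map_liftPathQuotient (Path.Homotopic.Quotient.mk (l.map hψ)) ⟨e, he⟩
      refine ⟨FundamentalGroup.fromPath ((cov.liftPathQuotient
        (Path.Homotopic.Quotient.mk (l.map hψ)) ⟨e, he⟩).cast rfl (congrArg Subtype.val h1).symm), ?_⟩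
      refine (FundamentalGroup.mapOfEq_apply ..).trans ?_
      change (Path.Homotopic.Quotient.map (Path.Homotopic.Quotient.cast _ _ _) _).cast _ _ = _
      rw [Path.Homotopic.Quotient.map_cast, h2]
      rfl)
  exact ⟨F, F.continuous, fun y => congrFun hF y⟩

end Monodromy

/-! ### Trivial monodromy of a double cover along the frames of one fibre. -/

section LoopsOfFrames

open Module unitInterval

variable {W : Type*} [NormedAddCommGroup W] [NormedSpace ℝ W] [FiniteDimensional ℝ W]

theorem isUnit_of_mem_GLPos {T : W →L[ℝ] W} (hT : T ∈ GLPos W) : IsUnit T := by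
  have h : IsUnit (T : W →ₗ[ℝ] W).det := isUnit_iff_ne_zero.2 (ne_of_gt hT)
  have h1 := (LinearMap.isUnit_iff_isUnit_det _).2 h
  exact h1.map (Module.End.toContinuousLinearMap W)

instance : Group (GLPos W) where
  inv T := ⟨Ring.inverse T.1, by
    have h := congrArg ContinuousLinearMap.det
      (Ring.mul_inverse_cancel T.1 (isUnit_of_mem_GLPos T.2))
    rw [continuousLinearMap_det_mul, show (1 : W →L[ℝ] W).det = 1 by
      simp [ContinuousLinearMap.det]] at h
    exact (pos_iff_pos_of_mul_pos (h ▸ one_pos)).1 T.2⟩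
  inv_mul_cancel T := Subtype.ext (Ring.inverse_mul_cancel T.1 (isUnit_of_mem_GLPos T.2))

instance : IsTopologicalGroup (GLPos W) where
  continuous_inv := by
    refine Continuous.subtype_mk (continuous_iff_continuousAt.2 fun T => ?_) _
    obtain ⟨u, hu⟩ := isUnit_of_mem_GLPos T.2
    have := NormedRing.inverse_continuousAt u
    rw [hu] at this
    exact this.comp continuous_subtype_val.continuousAt

theorem GLPos.exists_path (T : GLPos W) : Nonempty (Path 1 T) := by
  obtain ⟨κ, hκ, h0, h1, hpos⟩ := exists_path_of_det_pos T.2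
  exact ⟨⟨⟨fun t => ⟨κ t, hpos t t.2⟩, (hκ.continuous.comp continuous_subtype_val).subtype_mk _⟩,
    Subtype.ext (by simpa using h0), Subtype.ext (by simpa using h1)⟩⟩

instance : PathConnectedSpace (GLPos W) where
  nonempty := ⟨1⟩
  joined S T := by
    obtain ⟨p⟩ := GLPos.exists_path S
    obtain ⟨q⟩ := GLPos.exists_path T
    exact ⟨p.symm.trans q⟩

instance : LocallyPathConnectedSpace (GLPos W) :=
  IsOpen.locallyPathConnectedSpace
    (isOpen_lt continuous_const continuous_det_clm : IsOpen {T : W →L[ℝ] W | 0 < T.det})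

/-- The loop of rotations in the plane of `J`, as a line. -/
def rotLine (J : W →L[ℝ] W) (hJ : J * J * J = -J) : C(ℝ, GLPos W) :=
  ⟨fun t => ⟨rot J (2 * Real.pi * t), det_rot_pos hJ _⟩,
    ((continuous_rot J).comp (by fun_prop)).subtype_mk _⟩

theorem fromPath_rotLoop {J : W →L[ℝ] W} (hJ : J * J * J = -J) (k : ℤ) :
    FundamentalGroup.fromPath (Path.Homotopic.Quotient.mk (rotLoop J hJ k)) =
      FundamentalGroup.fromPath (Path.Homotopic.Quotient.mk (rotLoop J hJ 1)) ^ k := by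
  have hR : ∀ (t : ℝ) (k : ℤ), rotLine J hJ (t + k) = rotLine J hJ t := fun t k => by
    apply Subtype.ext
    change rot _ _ = rot _ _
    rw [mul_add, rot_add hJ, mul_comm (2 * Real.pi) (k : ℝ), mul_comm (k : ℝ), rot_two_pi_mul_int,
      mul_one]
  have h0 : rotLine J hJ 0 = 1 := Subtype.ext (by change rot _ _ = 1; simp)
  have hk : ∀ k : ℤ, rotLine J hJ k = 1 := fun k => by
    have := hR 0 k
    rwa [zero_add, h0] at this
  have e : ∀ k : ℤ, rotLoop J hJ k = windLoop (rotLine J hJ) 1 ⟨fun t => k * t, by fun_prop⟩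
      (by change rotLine J hJ (k * 0) = 1; rw [mul_zero, h0])
      (by change rotLine J hJ (k * 1) = 1; rw [mul_one, hk]) := fun k => by
    refine Path.ext (funext fun t => Subtype.ext ?_)
    rw [coe_rotLoop]
    change _ = rot J (2 * Real.pi * (k * t))
    rw [mul_assoc _ (k : ℝ)]
  rw [e, e]
  exact fromPath_windLoop (rotLine J hJ) hR 1 h0 k _ (by simp) (by simp) _ _ _ (by simp) (by simp)
    _ _

/-- Every loop is homotopic to a power of one rotation loop, so trivial monodromy of its inverse
already suffices. -/
theorem IsCoveringMap.exists_lift_of_loopPerm_rotLoop {P B : Type*} [TopologicalSpace P]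
    [TopologicalSpace B] {p : P → B} (cov : IsCoveringMap p) {ψ : GLPos W → B} (hψ : Continuous ψ)
    (hne : (p ⁻¹' {ψ 1}).Nonempty) {J : W →L[ℝ] W} (hJ : J * J * J = -J)
    (hgen : ∀ M : Path (1 : GLPos W) 1, ∃ k : ℤ, M.Homotopic (rotLoop J hJ k))
    (h : cov.loopPerm ((rotLoop J hJ (-1)).map hψ) = 1) :
    ∃ F : GLPos W → P, Continuous F ∧ ∀ g, p (F g) = ψ g := by
  let ρ : FundamentalGroup (GLPos W) 1 →* Equiv.Perm (p ⁻¹' {ψ 1}) :=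
    (cov.monodromyPerm (ψ 1)).comp (FundamentalGroup.map ⟨ψ, hψ⟩ 1)
  have hρ : ∀ l : Path (1 : GLPos W) 1, cov.loopPerm (l.map hψ) =
      ρ (FundamentalGroup.fromPath (Path.Homotopic.Quotient.mk l)) := fun l => rfl
  rw [hρ, fromPath_rotLoop, map_zpow, zpow_neg_one, inv_eq_one] at h
  refine cov.exists_lift_of_loopPerm hψ 1 hne fun l => ?_
  obtain ⟨k, hk⟩ := hgen l
  rw [cov.loopPerm_congr (hk.map ⟨ψ, hψ⟩)]
  refine (hρ _).trans ?_
  rw [fromPath_rotLoop, map_zpow, h, one_zpow]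

/-- The pullback of a double cover to the torus of frames of a flat bundle with commuting
holonomies, whose joint negative subspace has odd dimension, is trivial over the frames at a
point. -/
theorem IsCoveringMap.exists_lift_of_commute {P B : Type*} [TopologicalSpace P]
    [TopologicalSpace B] {p : P → B} (cov : IsCoveringMap p) (h2 : ∀ w, (p ⁻¹' {w}).ncard = 2)
    {A C : GLPos W} (hAC : Commute A C)
    (hodd : Odd (finrank ℝ ↥(negativeSubspace (A.1 : End ℝ W) ⊓ negativeSubspace (C.1 : End ℝ W))))
    {Φ : ℝ × ℝ × GLPos W → B} (hΦ : Continuous Φ)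
    (hA : ∀ s t g, Φ (s + 1, t, A * g) = Φ (s, t, g))
    (hC : ∀ s t g, Φ (s, t + 1, C * g) = Φ (s, t, g)) :
    ∃ F : GLPos W → P, Continuous F ∧ ∀ g, p (F g) = Φ (0, 0, g) := by
  obtain ⟨a, c, J, K, -, haa, hcc, hcomA, hcomC, hsA, hsC, hJ, haJ, hcJ, haK, hJK, hKJ, hK, hc, -⟩ :=
    exists_normal_form_clm (congrArg Subtype.val hAC : A.1 * C.1 = C.1 * A.1) A.2 C.2 hodd
  obtain ⟨hJ3, hgen⟩ := hJ.generatesLoops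
  have hJK3 : (J + K) * (J + K) * (J + K) = -(J + K) := by
    have h1 : K * K * J = 0 := by rw [mul_assoc, hKJ, mul_zero]
    have h2 : J * J * K = 0 := by rw [mul_assoc, hJK, mul_zero]
    simp only [mul_add, add_mul, hJK, hKJ, hJ3, hK, h1, h2, add_zero, zero_add, neg_add]
  have hAc : Commute A.1 c := hcomC _ (congrArg Subtype.val hAC)
  have hca : Commute c a := hcomA _ hAc.symm
  have hCc : Commute C.1 c := hcomC _ (Commute.refl _)
  have hApos : ∀ {T D : W →L[ℝ] W}, 0 < D.det → 0 < (T * D).det → 0 < T.det := fun h1 h2 => by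
    rw [continuousLinearMap_det_mul] at h2
    exact (pos_iff_pos_of_mul_pos h2).2 h1
  let a' : GLPos W := ⟨a, hApos A.2 (by simpa using hsA 1 (by simp))⟩
  let c' : GLPos W := ⟨c, hApos C.2 (by simpa using hsC 1 (by simp))⟩
  -- μ joins the involution a to A through maps commuting with c; ζ joins 1 to c C through maps
  -- commuting with A.
  let μ : I → GLPos W := fun r => a' * ⟨(1 - (r : ℝ)) • 1 + (r : ℝ) • (a * A.1), hsA r r.2⟩
  let ζ : I → GLPos W := fun r => ⟨(1 - (r : ℝ)) • 1 + (r : ℝ) • (c * C.1), hsC r r.2⟩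
  let η : ℝ → GLPos W := fun t => ⟨rot (J + K) (Real.pi * t), det_rot_pos hJK3 _⟩
  have hμ : Continuous μ :=
    continuous_const.mul (Continuous.subtype_mk (by fun_prop) _)
  have hζ : Continuous ζ := Continuous.subtype_mk (by fun_prop) _
  have hη : Continuous η := ((continuous_rot (J + K)).comp (by fun_prop)).subtype_mk _
  have haa' : a' * a' = 1 := Subtype.ext haa
  have hμ0 : μ 0 = a' := Subtype.ext (by simp [μ, a'])
  have hμ1 : μ 1 = A := Subtype.ext (by simp [μ, a', ← mul_assoc, haa])
  have hζ0 : ζ 0 = 1 := Subtype.ext (by simp [ζ])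
  have hζ1 : ζ 1 = c' * C := Subtype.ext (by simp [ζ, c'])
  have hη0 : η 0 = 1 := Subtype.ext (by simp [η])
  have hη1 : η 1 = c' := Subtype.ext (by simp [η, c', hc])
  have hcμ : ∀ r, Commute c' (μ r) := fun r => by
    refine Commute.mul_right (Subtype.ext hca) (Subtype.ext ?_)
    exact (((Commute.one_right c).smul_right _).add_right ((hca.mul_right hAc.symm).smul_right _)).eq
  have hAζ : ∀ r, Commute A (ζ r) := fun r => Subtype.ext
    (((Commute.one_right A.1).smul_right _).add_right
      ((hAc.mul_right (congrArg Subtype.val hAC : A.1 * C.1 = C.1 * A.1)).smul_right _)).eq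
  have hCc' : C * c' = c' * C := Subtype.ext hCc
  have hcc' : c' * c' = 1 := Subtype.ext hcc
  obtain ⟨lam⟩ := GLPos.exists_path A
  -- Any path from 1 to C would define ε; this one passes through the rotation path η from 1 to c,
  -- which makes its commutator with A computable.
  let γ : Path 1 C := ⟨⟨fun t => ζ t * η t, by fun_prop⟩, by simp [hζ0, hη0], by
    simp [hζ1, hη1, mul_assoc, hCc', ← mul_assoc c' c', hcc']⟩
  -- At r = 1 this is ε, since A commutes with ζ. At r = 0 it is the commutator of a with the
  -- rotations η, a full turn backwards in the plane of J. The loops stay closed because η ends at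
  -- c, which commutes with every μ r.
  let H : I → I → GLPos W := fun r t =>
    ζ (r * t) * ((μ r)⁻¹ * η t * μ r * (η t)⁻¹) * (ζ (r * t))⁻¹
  have hH0 : ∀ r, H r 0 = 1 := fun r => by simp [H, hζ0, hη0]
  have hH1 : ∀ r, H r 1 = 1 := fun r => by
    simp only [H, Icc.coe_one, hη1, mul_assoc]
    rw [← mul_assoc c', (hcμ r).eq]
    simp [mul_assoc]
  let ε : Path (1 : GLPos W) 1 := ⟨⟨fun t => H 1 t, by fun_prop⟩, hH0 1, hH1 1⟩
  have hε : ∀ t, ε t = A⁻¹ * γ t * A * (γ t)⁻¹ := fun t => by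
    change H 1 t = A⁻¹ * (ζ t * η t) * A * (ζ t * η t)⁻¹
    simp only [H, hμ1, one_mul, mul_inv_rev, mul_assoc]
    rw [← mul_assoc A⁻¹ (ζ t), ((hAζ t).inv_left).eq, mul_assoc]
  have hhom : (rotLoop J hJ3 (-1)).Homotopic ε := by
    refine ⟨⟨⟨⟨fun q => H q.1 q.2, by fun_prop⟩, fun t => ?_, fun t => rfl⟩, ?_⟩⟩
    · refine Subtype.ext ?_
      have h1 : (η t)⁻¹ = ⟨rot (J + K) (-(Real.pi * t)), det_rot_pos hJK3 _⟩ :=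
        inv_eq_of_mul_eq_one_right (Subtype.ext (rot_mul_rot_neg hJK3 _))
      have h2 : H 0 t = a' * η t * a' * ⟨rot (J + K) (-(Real.pi * t)), det_rot_pos hJK3 _⟩ := by
        simp only [H, zero_mul, hζ0, hμ0, inv_eq_of_mul_eq_one_right haa', h1, one_mul, inv_one,
          mul_one]
      have h3 := conj_rot_mul_rot haa haJ haK hJK hKJ hJ3 hK (-(Real.pi * t))
      rw [neg_neg] at h3
      refine (congrArg Subtype.val h2).trans (h3.trans (congrArg (rot J) ?_))
      push_cast
      ring
    · rintro r t (rfl | rfl)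
      · simp [hH0]
      · simp [hH1]
  have key := cov.loopPerm_commutator h2 hΦ hA hC lam γ ε hε
  refine cov.exists_lift_of_loopPerm_rotLoop (ψ := fun g => Φ (0, 0, g)) (by fun_prop)
    (Set.nonempty_of_ncard_ne_zero (by rw [h2]; simp)) hJ3 hgen ?_
  rw [← key]
  exact cov.loopPerm_congr (hhom.map ⟨fun g => Φ (0, 0, g), by fun_prop⟩)

end LoopsOfFrames

/-! ### Local diffeomorphisms from the model space and their Jacobian signs. -/

section FramesOfLocalDiffeomorphisms

open Module

variable {W : Type} [NormedAddCommGroup W] [NormedSpace ℝ W]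
  {M : Type u} [TopologicalSpace M] [ChartedSpace W M]

/-- The differential of a parametrisation of a manifold by its model space. -/
def paramDerivative (m : W → M) (p : W) : W →L[ℝ] W := mfderiv 𝓘(ℝ, W) 𝓘(ℝ, W) m p

theorem paramDerivative_of_comp {m : W → M} (hm : ContMDiff 𝓘(ℝ, W) 𝓘(ℝ, W) ∞ m) {p q : W}
    {f : W → W} {D : W →L[ℝ] W} (hf : HasFDerivAt f D p) (hq : f p = q)
    (h : ∀ᶠ z in 𝓝 p, m (f z) = m z) : paramDerivative m q ∘L D = paramDerivative m p := by
  subst hq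
  have h1 := ((hm.mdifferentiableAt (x := f p) (by simp)).hasMFDerivAt).comp p hf.hasMFDerivAt
  exact ((h1.congr_of_eventuallyEq (h.mono fun z hz => hz.symm)).mfderiv).symm

/-- The differential of a chart. -/
def chartDerivative (χ : OpenPartialHomeomorph M W) (y : M) : W →L[ℝ] W :=
  mfderiv 𝓘(ℝ, W) 𝓘(ℝ, W) χ y

variable {o : OrientedAtlas W M} {m : W → M}

theorem exists_equiv_paramDerivative (hm : IsLocalDiffeomorph 𝓘(ℝ, W) 𝓘(ℝ, W) ∞ m) (p : W) :
    ∃ e : W ≃L[ℝ] W, (e : W →L[ℝ] W) = paramDerivative m p :=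
  ⟨(hm p).mfderivToContinuousLinearEquiv (by simp), (hm p).mfderivToContinuousLinearEquiv_coe (by simp)⟩

theorem det_continuousLinearEquiv_ne_zero (e : W ≃L[ℝ] W) : (e : W →L[ℝ] W).det ≠ 0 :=
  e.toLinearEquiv.isUnit_det'.ne_zero

variable [IsManifold 𝓘(ℝ, W) ∞ M]

theorem fderiv_chart_comp (hm : ContMDiff 𝓘(ℝ, W) 𝓘(ℝ, W) ∞ m) {χ : OpenPartialHomeomorph M W}
    (hχ : χ ∈ IsManifold.maximalAtlas 𝓘(ℝ, W) ∞ M) {p : W} (hp : m p ∈ χ.source) :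
    HasFDerivAt (χ ∘ m) (chartDerivative χ (m p) ∘L paramDerivative m p) p :=
  hasMFDerivAt_iff_hasFDerivAt.1 ((((contMDiffAt_of_mem_maximalAtlas hχ hp).mdifferentiableAt
    (by simp)).hasMFDerivAt).comp p ((hm.mdifferentiableAt (by simp)).hasMFDerivAt))

theorem det_chartDerivative_ne_zero {χ : OpenPartialHomeomorph M W}
    (hχ : χ ∈ IsManifold.maximalAtlas 𝓘(ℝ, W) ∞ M) {y : M} (hy : y ∈ χ.source) :
    (chartDerivative χ y).det ≠ 0 := by
  have he : χ.MDifferentiable 𝓘(ℝ, W) 𝓘(ℝ, W) :=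
    ⟨(contMDiffOn_of_mem_maximalAtlas hχ).mdifferentiableOn (by simp),
      (contMDiffOn_symm_of_mem_maximalAtlas hχ).mdifferentiableOn (by simp)⟩
  let e : W ≃L[ℝ] W := he.mfderiv hy
  exact det_continuousLinearEquiv_ne_zero e

variable [FiniteDimensional ℝ W]

/-- The Jacobian determinants of a parametrisation in oriented charts have a constant sign. -/
theorem exists_sign_det (hm : IsLocalDiffeomorph 𝓘(ℝ, W) 𝓘(ℝ, W) ∞ m) :
    ∃ r : ℝ, r ≠ 0 ∧ ∀ p, ∀ χ ∈ o.charts, m p ∈ χ.source →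
      0 < r * (chartDerivative χ (m p) ∘L paramDerivative m p).det := by
  have hms := hm.contMDiff
  let d : OpenPartialHomeomorph M W → W → ℝ := fun χ p => (fderiv ℝ (χ ∘ m) p).det
  have hd : ∀ p, ∀ χ ∈ o.charts, m p ∈ χ.source →
      (chartDerivative χ (m p) ∘L paramDerivative m p).det = d χ p :=
    fun p χ hχ hp => by
      simp only [d]
      rw [(fderiv_chart_comp hms (o.charts_subset hχ) hp).fderiv]
  have hcont : ∀ p, ∀ χ ∈ o.charts, m p ∈ χ.source → ContinuousAt (d χ) p := by
    intro p χ hχ hp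
    have h1 : ContDiffAt ℝ ∞ (χ ∘ m) p := ((contMDiffAt_of_mem_maximalAtlas
      (o.charts_subset hχ) hp).comp p (hms p)).contDiffAt
    exact (continuous_det_clm (V := W)).continuousAt.comp
      (h1.fderiv_right (m := 0) (by simp)).continuousAt
  have hmul : ∀ p, ∀ χ ∈ o.charts, ∀ χ' ∈ o.charts, m p ∈ χ.source → m p ∈ χ'.source →
      ∃ s > 0, d χ' p = s * d χ p := by
    intro p χ hχ χ' hχ' hp hp'
    refine ⟨_, o.compatible χ hχ χ' hχ' (m p) ⟨hp, hp'⟩, ?_⟩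
    have h1 : DifferentiableAt ℝ (χ' ∘ χ.symm) (χ (m p)) := by
      refine ((contMDiffAt_of_mem_maximalAtlas (o.charts_subset hχ') ?_).comp (χ (m p))
        (contMDiffAt_symm_of_mem_maximalAtlas (o.charts_subset hχ)
          (χ.map_source hp))).contDiffAt.differentiableAt (by simp)
      rwa [χ.left_inv hp]
    have h2 := (fderiv_chart_comp hms (o.charts_subset hχ) hp).differentiableAt
    have h3 : χ' ∘ m =ᶠ[𝓝 p] (χ' ∘ χ.symm) ∘ (χ ∘ m) := by
      filter_upwards [hms.continuous.continuousAt.preimage_mem_nhds (χ.open_source.mem_nhds hp)]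
        with z hz
      simp only [Function.comp_apply, χ.left_inv hz]
    simp only [d]
    rw [h3.fderiv_eq, fderiv_comp p h1 h2]
    exact continuousLinearMap_det_mul _ _
  have hne : ∀ p, ∀ χ ∈ o.charts, m p ∈ χ.source → d χ p ≠ 0 := by
    intro p χ hχ hp
    rw [← hd p χ hχ hp]
    obtain ⟨e, he⟩ := exists_equiv_paramDerivative hm p
    rw [← he]
    refine (continuousLinearMap_det_mul _ _).trans_ne (mul_ne_zero
      (det_chartDerivative_ne_zero (o.charts_subset hχ) hp) (det_continuousLinearEquiv_ne_zero e))
  -- The sign is locally constant and independent of the oriented chart, and the model space is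
  -- connected.
  let U : Set W := {p | ∃ χ ∈ o.charts, m p ∈ χ.source ∧ 0 < d χ p}
  have hU : IsOpen U := by
    refine isOpen_iff_mem_nhds.2 ?_
    rintro p ⟨χ, hχ, hp, h⟩
    filter_upwards [hms.continuous.continuousAt.preimage_mem_nhds (χ.open_source.mem_nhds hp),
      (hcont p χ hχ hp).eventually (lt_mem_nhds h)] with z hz hz'
    exact ⟨χ, hχ, hz, hz'⟩
  have hUc : IsOpen Uᶜ := by
    refine isOpen_iff_mem_nhds.2 fun p hpU => ?_
    obtain ⟨χ, hχ, hp⟩ := o.covers (m p)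
    have h : d χ p < 0 :=
      lt_of_le_of_ne (not_lt.1 fun h => hpU ⟨χ, hχ, hp, h⟩) (hne p χ hχ hp)
    filter_upwards [hms.continuous.continuousAt.preimage_mem_nhds (χ.open_source.mem_nhds hp),
      (hcont p χ hχ hp).eventually (gt_mem_nhds h)] with z hz hz'
    rintro ⟨χ', hχ', hz1, hz2⟩
    obtain ⟨s, hs, h⟩ := hmul z χ hχ χ' hχ' hz hz1
    nlinarith
  rcases isClopen_iff.1 (⟨isOpen_compl_iff.1 hUc, hU⟩ : IsClopen U) with h | h
  · refine ⟨-1, by simp, fun p χ hχ hp => ?_⟩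
    rw [hd p χ hχ hp]
    have h1 : ¬ 0 < d χ p := fun h0 => by
      have : p ∈ U := ⟨χ, hχ, hp, h0⟩
      rw [h] at this
      exact this
    have := lt_of_le_of_ne (not_lt.1 h1) (hne p χ hχ hp)
    linarith
  · refine ⟨1, by simp, fun p χ hχ hp => ?_⟩
    rw [hd p χ hχ hp, one_mul]
    obtain ⟨χ', hχ', hp', h0⟩ : p ∈ U := h ▸ mem_univ p
    obtain ⟨s, hs, h1⟩ := hmul p χ' hχ' χ hχ hp' hp
    rw [h1]
    exact mul_pos hs h0

end FramesOfLocalDiffeomorphisms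

/-! ### Oriented frames along a parametrisation, and the obstruction to spin structures. -/

section FrameBundle

open Module

variable {W : Type} [NormedAddCommGroup W] [NormedSpace ℝ W] [FiniteDimensional ℝ W]
  {M : Type u} [TopologicalSpace M] [ChartedSpace W M] [IsManifold 𝓘(ℝ, W) ∞ M]
  {o : OrientedAtlas W M} {m : W → M}

theorem finBasis_det_clm (T : W →L[ℝ] W) (v : Fin (finrank ℝ W) → W) :
    (finBasis ℝ W).det (fun i => T (v i)) = T.det * (finBasis ℝ W).det v :=
  (finBasis ℝ W).det_comp (T : W →ₗ[ℝ] W) v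

theorem finBasis_det_apply_self (T : W →L[ℝ] W) :
    (finBasis ℝ W).det (fun i => T (finBasis ℝ W i)) = T.det := by
  rw [finBasis_det_clm T, (finBasis ℝ W).det_self, mul_one]

/-- The frame with the given columns at a point of a parametrised manifold. -/
def paramFrame (m : W → M) (p : W) (T : W →L[ℝ] W) (i : Fin (finrank ℝ W)) :
    TangentBundle 𝓘(ℝ, W) M := ⟨m p, paramDerivative m p (T (finBasis ℝ W i))⟩

theorem continuous_paramFrame (hm : ContMDiff 𝓘(ℝ, W) 𝓘(ℝ, W) ∞ m) :
    Continuous fun q : W × (W →L[ℝ] W) => paramFrame m q.1 q.2 := by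
  refine continuous_pi fun i => ?_
  have h1 : Continuous (tangentMap 𝓘(ℝ, W) 𝓘(ℝ, W) m) := hm.continuous_tangentMap (by simp)
  have h2 : Continuous fun q : W × (W →L[ℝ] W) =>
      ((tangentBundleModelSpaceHomeomorph 𝓘(ℝ, W)).symm (q.1, q.2 (finBasis ℝ W i))) :=
    (Homeomorph.continuous _).comp (by
      refine Continuous.prodMk (f := fun q : W × (W →L[ℝ] W) => q.1) continuous_fst ?_
      exact continuous_snd.clm_apply continuous_const)
  exact h1.comp h2

/-- Composition with R on the right compensates for a parametrisation that may reverse the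
orientation. -/
theorem paramFrame_mem {R : W →L[ℝ] W} {p : W} (hR : ∀ χ ∈ o.charts, m p ∈ χ.source →
      0 < R.det * (chartDerivative χ (m p) ∘L paramDerivative m p).det) (g : GLPos W) :
    paramFrame m p (g.1 * R) ∈ OrientedFrameBundle o := by
  refine ⟨m p, _, fun i => rfl, fun χ hχ hp => ?_⟩
  have h1 := finBasis_det_apply_self ((chartDerivative χ (m p) ∘L paramDerivative m p) * (g.1 * R))
  refine lt_of_lt_of_eq ?_ h1.symm
  rw [continuousLinearMap_det_mul, continuousLinearMap_det_mul]
  have := mul_pos g.2 (hR χ hχ hp)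
  nlinarith

/-- The oriented frames at a point of a parametrised manifold depend continuously on a linear
map. -/
theorem exists_continuous_section [Nontrivial W] {R : W →L[ℝ] W} {p : W} {e : W ≃L[ℝ] W}
    (he : (e : W →L[ℝ] W) = paramDerivative m p) (hRR : R * R = 1)
    (hR : ∀ χ ∈ o.charts, m p ∈ χ.source →
      0 < R.det * (chartDerivative χ (m p) ∘L paramDerivative m p).det) :
    ∃ κ : {w : OrientedFrameBundle o // ∀ i, (w.1 i).proj = m p} → GLPos W,
      Continuous κ ∧ ∀ w, paramFrame m p ((κ w).1 * R) = w.1.1 := by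
  let vec : {w : OrientedFrameBundle o // ∀ i, (w.1 i).proj = m p} → Fin (finrank ℝ W) → W :=
    fun w i => (w.1.1 i).2
  have hvec : ∀ w i, (⟨m p, vec w i⟩ : TangentBundle 𝓘(ℝ, W) M) = w.1.1 i := by
    intro w i
    have h : ∀ (q : TangentBundle 𝓘(ℝ, W) M), q.proj = m p →
        (⟨m p, (q.2 : W)⟩ : TangentBundle 𝓘(ℝ, W) M) = q := by
      rintro ⟨y, v⟩ rfl
      rfl
    exact h _ (w.2 i)
  have hc : Continuous vec := by
    refine continuous_pi fun i => ?_
    refine (FiberBundle.totalSpaceMk_isInducing W (TangentSpace 𝓘(ℝ, W) : M → Type _)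
      (m p)).continuous_iff.2 ?_
    have : Continuous fun w : {w : OrientedFrameBundle o // ∀ i, (w.1 i).proj = m p} => w.1.1 i :=
      (continuous_apply i).comp (continuous_subtype_val.comp continuous_subtype_val)
    exact this.congr fun w => (hvec w i).symm
  let lin : (Fin (finrank ℝ W) → W) →ₗ[ℝ] (W →L[ℝ] W) :=
    (LinearMap.toContinuousLinearMap (𝕜 := ℝ) (E := W) (F' := W)).toLinearMap ∘ₗ
      ((finBasis ℝ W).constr ℝ).toLinearMap
  have hlin : ∀ v i, lin v (finBasis ℝ W i) = v i := fun v i => (finBasis ℝ W).constr_basis ℝ v i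
  have hclin : Continuous lin := LinearMap.continuous_of_finiteDimensional _
  let E' : W →L[ℝ] W := e.symm
  have hE' : ∀ v, paramDerivative m p (E' v) = v := fun v => by
    rw [← he]; exact e.apply_symm_apply v
  have hpos : ∀ w, E' * lin (vec w) * R ∈ GLPos W := by
    intro w
    obtain ⟨y, v, hw, hpos⟩ := w.1.2
    have hv : ∀ i, vec w i = v i := fun i =>
      congrArg (fun q : TangentBundle 𝓘(ℝ, W) M => (show W from q.2)) (hw i)
    have hy : m p = y := by
      have h := w.2 ⟨0, finrank_pos⟩
      rw [hw] at h
      exact h.symm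
    subst hy
    obtain ⟨χ, hχ, hp⟩ := o.covers (m p)
    have h1 := hpos χ hχ hp
    have h2 := finBasis_det_apply_self (chartDerivative χ (m p) * lin (vec w))
    rw [continuousLinearMap_det_mul] at h2
    replace h1 : 0 < (chartDerivative χ (m p)).det * (lin (vec w)).det := by
      refine lt_of_lt_of_eq h1 (Eq.trans ?_ h2)
      refine congrArg (finBasis ℝ W).det (funext fun i => ?_)
      change _ = chartDerivative χ (m p) (lin (vec w) (finBasis ℝ W i))
      rw [hlin, hv]
      rfl
    have h3 := hR χ hχ hp
    have h4 : E'.det * (paramDerivative m p).det = 1 := by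
      rw [← continuousLinearMap_det_mul, ← he]
      have : E' * (e : W →L[ℝ] W) = 1 := ContinuousLinearMap.ext e.symm_apply_apply
      rw [this]
      simp [ContinuousLinearMap.det]
    rw [show (chartDerivative χ (m p) ∘L paramDerivative m p).det =
      (chartDerivative χ (m p)).det * (paramDerivative m p).det from
      continuousLinearMap_det_mul _ _] at h3
    rw [mem_GLPos, continuousLinearMap_det_mul, continuousLinearMap_det_mul]
    -- Signs are known only for products with the chart and parameter determinants; multiplying by
    -- the square of these lets both facts be combined.
    have h5 : 0 < E'.det * (lin (vec w)).det * R.det *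
        ((chartDerivative χ (m p)).det * (paramDerivative m p).det) ^ 2 := by
      refine lt_of_lt_of_eq (mul_pos h1 h3) ?_
      linear_combination (-(chartDerivative χ (m p)).det ^ 2 * (lin (vec w)).det * R.det *
        (paramDerivative m p).det) * h4
    exact (pos_iff_pos_of_mul_pos h5).2 (sq_pos_of_ne_zero (right_ne_zero_of_mul h3.ne'))
  refine ⟨fun w => ⟨_, hpos w⟩, Continuous.subtype_mk ((continuous_const.mul
    (hclin.comp hc)).mul continuous_const) _, fun w => ?_⟩
  funext i
  rw [← hvec, paramFrame]
  congr 1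
  change paramDerivative m p (E' (lin (vec w) ((R * R) (finBasis ℝ W i)))) = vec w i
  rw [hE', hRR, one_apply_eq_self, hlin]

/-- A manifold which contains the flat bundle of frames over a torus, with commuting holonomies
whose joint negative subspace has odd dimension, has no spin structure. -/
theorem not_hasSpinStructure_of_holonomy [Nontrivial W] (hm : IsLocalDiffeomorph 𝓘(ℝ, W) 𝓘(ℝ, W) ∞ m)
    {R : W →L[ℝ] W} (hRR : R * R = 1) (hdet : R.det = -1) {q : ℝ × ℝ → W} (hq : Continuous q)
    {A C : GLPos W} (hAC : Commute A C)
    (hodd : Odd (finrank ℝ ↥(negativeSubspace (A.1 : End ℝ W) ⊓ negativeSubspace (C.1 : End ℝ W))))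
    (hmA : ∀ s t, m (q (s + 1, t)) = m (q (s, t)))
    (hA : ∀ s t, paramDerivative m (q (s + 1, t)) ∘L A.1 = paramDerivative m (q (s, t)))
    (hmC : ∀ s t, m (q (s, t + 1)) = m (q (s, t)))
    (hC : ∀ s t, paramDerivative m (q (s, t + 1)) ∘L C.1 = paramDerivative m (q (s, t))) :
    ¬ HasSpinStructure o := by
  rintro ⟨P, _, p, cov, h2, hsec⟩
  -- R is the identity or a reflection, according to the constant sign of the parametrisation
  -- relative to the orientation under test.
  obtain ⟨R, hRR, hR⟩ : ∃ R : W →L[ℝ] W, R * R = 1 ∧ ∀ z, ∀ χ ∈ o.charts, m z ∈ χ.source →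
      0 < R.det * (chartDerivative χ (m z) ∘L paramDerivative m z).det := by
    obtain ⟨r, hr0, hr⟩ := exists_sign_det (o := o) hm
    rcases lt_or_gt_of_ne hr0 with h | h
    · refine ⟨R, hRR, fun z χ hχ hz => ?_⟩
      rw [hdet]
      nlinarith [hr z χ hχ hz]
    · refine ⟨1, one_mul 1, fun z χ hχ hz => ?_⟩
      rw [show (1 : W →L[ℝ] W).det = 1 by simp [ContinuousLinearMap.det], one_mul]
      exact (pos_iff_pos_of_mul_pos (hr z χ hχ hz)).1 h
  -- The pulled back frame bundle over the plane; the holonomies act by multiplication on the left,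
  -- which R on the right does not disturb.
  let Φ : ℝ × ℝ × GLPos W → OrientedFrameBundle o := fun z =>
    ⟨paramFrame m (q (z.1, z.2.1)) (z.2.2.1 * R), paramFrame_mem (hR _) _⟩
  have hΦ : Continuous Φ := by
    refine Continuous.subtype_mk ((continuous_paramFrame hm.contMDiff).comp
      (f := fun z : ℝ × ℝ × GLPos W => (q (z.1, z.2.1), z.2.2.1 * R)) ?_) _
    fun_prop
  have hΦeq : ∀ {z z' : W} {T : W →L[ℝ] W} (g : W →L[ℝ] W), m z' = m z →
      paramDerivative m z' ∘L T = paramDerivative m z →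
      paramFrame m z' (T * g * R) = paramFrame m z (g * R) := by
    intro z z' T g h1 h2
    funext i
    simp only [paramFrame, ← h2]
    have h : ∀ {y y' : M} (v : W), y' = y →
        (⟨y', v⟩ : TangentBundle 𝓘(ℝ, W) M) = ⟨y, v⟩ := by
      rintro y _ v rfl
      rfl
    exact h _ h1
  obtain ⟨F, hF, hpF⟩ := cov.exists_lift_of_commute h2 hAC hodd hΦ
    (fun s t g => Subtype.ext (hΦeq g.1 (hmA s t) (hA s t)))
    (fun s t g => Subtype.ext (hΦeq g.1 (hmC s t) (hC s t)))
  obtain ⟨e, he⟩ := exists_equiv_paramDerivative hm (q (0, 0))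
  obtain ⟨κ, hκ, hκ'⟩ := exists_continuous_section (o := o) he hRR (hR _)
  exact hsec (m (q (0, 0))) ⟨fun w => F (κ w), hF.comp hκ, fun w => by
    rw [hpF]
    exact Subtype.ext (hκ' w)⟩

end FrameBundle

/-! ### Stabilized holonomies and differentials of the gluing maps. -/

section Holonomy

open Module

section Algebra

variable {V U : Type*} [AddCommGroup V] [Module ℝ V] [AddCommGroup U] [Module ℝ U]

/-- On the identity factor, A - r acts by 1 - r, which is not zero for negative r. -/
theorem negativeSubspace_prodMap_id (A : End ℝ V) :
    negativeSubspace (LinearMap.prodMap LinearMap.id A : End ℝ (U × V)) =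
      (negativeSubspace A).map (LinearMap.inr ℝ U V) := by
  rw [negativeSubspace, negativeSubspace, Submodule.map_iSup]
  refine iSup_congr fun r => ?_
  have hpow : ∀ (k : ℕ) (w : U × V),
      (((LinearMap.prodMap LinearMap.id A : End ℝ (U × V)) - (r : ℝ) • (1 : End ℝ (U × V))) ^ k) w =
        ((1 - (r : ℝ)) ^ k • w.1, ((A - (r : ℝ) • (1 : End ℝ V)) ^ k) w.2) := by
    intro k
    induction k with
    | zero => simp
    | succ k ih =>
      intro w
      rw [pow_succ, Module.End.mul_apply, ih, pow_succ, pow_succ, Module.End.mul_apply]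
      refine Prod.ext ?_ rfl
      simp [mul_smul, sub_smul]
  ext w
  simp only [Module.End.mem_maxGenEigenspace, Submodule.mem_map, hpow]
  constructor
  · rintro ⟨k, hk⟩
    have h1 := (smul_eq_zero.1 (congrArg Prod.fst hk)).resolve_left
      (pow_ne_zero _ (by have := r.2.out; linarith))
    exact ⟨w.2, ⟨k, congrArg Prod.snd hk⟩, Prod.ext h1.symm rfl⟩
  · rintro ⟨v, ⟨k, hk⟩, rfl⟩
    exact ⟨k, by simp [hk]⟩

theorem finrank_negativeSubspace_prodMap_id (A C : End ℝ V) :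
    finrank ℝ ↥(negativeSubspace (LinearMap.prodMap LinearMap.id A : End ℝ (U × V)) ⊓
      negativeSubspace (LinearMap.prodMap LinearMap.id C : End ℝ (U × V))) =
    finrank ℝ ↥(negativeSubspace A ⊓ negativeSubspace C) := by
  rw [negativeSubspace_prodMap_id, negativeSubspace_prodMap_id,
    ← Submodule.map_inf _ LinearMap.inr_injective]
  exact (Submodule.equivMapOfInjective _ LinearMap.inr_injective _).finrank_eq.symm

end Algebra

local notation:max "𝔼" n:max => EuclideanSpace ℝ (Fin n)

variable {n : ℕ}

/-- The extension of an endomorphism by the identity of two lines. -/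
def torusHolonomy (A : 𝔼 n →L[ℝ] 𝔼 n) : (ℝ × ℝ × 𝔼 n) →L[ℝ] (ℝ × ℝ × 𝔼 n) :=
  (ContinuousLinearMap.id ℝ ℝ).prodMap ((ContinuousLinearMap.id ℝ ℝ).prodMap A)

theorem det_torusHolonomy (A : 𝔼 n →L[ℝ] 𝔼 n) : (torusHolonomy A).det = A.det := by
  refine (LinearMap.det_prodMap (LinearMap.id : End ℝ ℝ) (LinearMap.prodMap LinearMap.id
    (A : End ℝ (𝔼 n)) : End ℝ (ℝ × 𝔼 n))).trans ?_
  rw [LinearMap.det_prodMap, LinearMap.det_id, one_mul, one_mul]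

theorem finrank_negativeSubspace_torusHolonomy (A C : 𝔼 n →L[ℝ] 𝔼 n) :
    finrank ℝ ↥(negativeSubspace (torusHolonomy A : End ℝ (ℝ × ℝ × 𝔼 n)) ⊓
      negativeSubspace (torusHolonomy C : End ℝ (ℝ × ℝ × 𝔼 n))) =
    finrank ℝ ↥(negativeSubspace (A : End ℝ (𝔼 n)) ⊓ negativeSubspace (C : End ℝ (𝔼 n))) := by
  have h : ∀ A : 𝔼 n →L[ℝ] 𝔼 n, (torusHolonomy A : End ℝ (ℝ × ℝ × 𝔼 n)) =
      LinearMap.prodMap LinearMap.id (LinearMap.prodMap LinearMap.id (A : End ℝ (𝔼 n)) :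
        End ℝ (ℝ × 𝔼 n)) := fun A => rfl
  rw [h, h, finrank_negativeSubspace_prodMap_id, finrank_negativeSubspace_prodMap_id]

/-- The reflection in the first coordinate. -/
theorem exists_reflection : ∃ R : (ℝ × ℝ × 𝔼 n) →L[ℝ] (ℝ × ℝ × 𝔼 n), R * R = 1 ∧ R.det = -1 := by
  refine ⟨(-ContinuousLinearMap.id ℝ ℝ).prodMap (ContinuousLinearMap.id ℝ _), ?_, ?_⟩
  · ext w <;> simp
  · refine (LinearMap.det_prodMap (-LinearMap.id : End ℝ ℝ) LinearMap.id).trans ?_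
    rw [LinearMap.det_id, mul_one, ← neg_one_smul ℝ, LinearMap.det_smul]
    simp

variable {X : Type u} [TopologicalSpace X] [ChartedSpace (𝔼 n) X] [IsManifold (𝓡 n) ∞ X]
  {φ : OpenPartialHomeomorph X (𝔼 n)}

theorem exists_centered_chart (x : X) :
    ∃ ψ ∈ IsManifold.maximalAtlas (𝓡 n) ∞ X, ψ.target = univ ∧ ψ.symm 0 = x ∧ x ∈ ψ.source ∧
      ψ x = 0 := by
  obtain ⟨ψ, hmax, hψ, hx⟩ := exists_chart_target_eq_univ (n := n) x
  have huniv : ∀ u, u ∈ ψ.target := fun u => hψ ▸ mem_univ u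
  let τ : 𝔼 n ≃ₜ 𝔼 n := Homeomorph.subRight (ψ x)
  have hs : (ψ.trans τ.toOpenPartialHomeomorph).source = ψ.source := by
    simp
  refine ⟨ψ.trans τ.toOpenPartialHomeomorph, (IsManifold.mem_maximalAtlas_iff_contMDiffOn _).2
    ⟨?_, ?_⟩, ?_, ?_, ?_, ?_⟩
  · rw [hs]
    exact (contDiff_id.sub contDiff_const).contMDiff.comp_contMDiffOn
      (contMDiffOn_of_mem_maximalAtlas hmax)
  · exact (contMDiffOn_symm_of_mem_maximalAtlas hmax).comp
      (contDiff_id.add contDiff_const).contMDiff.contMDiffOn fun u _ => huniv _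
  · simp [hψ]
  · simp [τ, ψ.left_inv hx]
  · rwa [hs]
  · simp [τ]

/-- The differentials at a common fixed point in coordinates centered there. -/
theorem exists_hasChartDeriv (hmax : φ ∈ IsManifold.maximalAtlas (𝓡 n) ∞ X)
    (hφ : φ.target = univ) {x : X} (hx : φ.symm 0 = x) (hxs : x ∈ φ.source) (hx0 : φ x = 0) :
    ∃ e : 𝔼 n ≃L[ℝ] 𝔼 n, ∀ f : X ≃ₘ⟮𝓡 n, 𝓡 n⟯ X, f x = x → HasChartDeriv φ f.toEquiv
      ((e : 𝔼 n →L[ℝ] 𝔼 n) ∘L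
        (differentialAtFixedPoint n f x : 𝔼 n →L[ℝ] 𝔼 n) ∘L (e.symm : 𝔼 n →L[ℝ] 𝔼 n)) := by
  obtain ⟨e, he⟩ := exists_chart_differential hmax hxs
  refine ⟨e, fun f hfx => ?_⟩
  have h2 := he f f.contMDiff hfx
  rw [hx0] at h2
  have hsymm : ContMDiff 𝓘(ℝ, 𝔼 n) (𝓡 n) ∞ φ.symm := by
    rw [← contMDiffOn_univ, ← hφ]; exact contMDiffOn_symm_of_mem_maximalAtlas hmax
  exact ⟨by rw [hx]; exact hfx, (f.continuous.comp hsymm.continuous).continuousAt.eventually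
    (φ.open_source.mem_nhds (by
      change f (φ.symm 0) ∈ _
      rwa [hx, hfx])), h2⟩

/-- The isotopy contributes trivial differentials, and conjugation by powers of g is invisible
because A and C commute. The holonomy in the first direction is thus constant. -/
theorem HasChartDeriv.gluingPath (hmax : φ ∈ IsManifold.maximalAtlas (𝓡 n) ∞ X)
    (hφ : φ.target = univ) {f g : Equiv.Perm X} {β : ℝ → Equiv.Perm X} {A C : 𝔼 n →L[ℝ] 𝔼 n}
    (hAC : Commute A C) (hf : HasChartDeriv φ f A) (hg : HasChartDeriv φ g C)
    (hgs : (fun _ => g) ∈ SmoothPaths n X) (hβ : ∀ t, HasChartDeriv φ (β t) 1) (t : ℝ) :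
    HasChartDeriv φ (gluingPath f g β t) A := by
  have hC := hg.isUnit hφ hmax hgs
  have hg' := hg.inverse hφ hmax hgs
  have h1 : C * A * Ring.inverse C = A := by
    rw [← hAC.eq, mul_assoc, Ring.mul_inverse_cancel _ hC, mul_one]
  have h2 : Ring.inverse C * A * C = A := by
    rw [mul_assoc, hAC.eq, ← mul_assoc, Ring.inverse_mul_cancel _ hC, one_mul]
  have hconj : ∀ {p : Equiv.Perm X}, HasChartDeriv φ p A → ∀ k : ℤ,
      HasChartDeriv φ (g ^ k * p * g ^ (-k)) A := by
    intro p hp k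
    induction k with
    | zero => simpa using hp
    | succ k ih =>
      have h := (hg.mul hφ ih).mul hφ hg'
      rw [h1] at h
      convert h using 1
      group
    | pred k ih =>
      have h := (hg'.mul hφ ih).mul hφ hg
      rw [h2] at h
      convert h using 1
      group
  refine hconj ?_ _
  have h := (hβ (Int.fract t)).mul hφ ((hg.mul hφ hf).mul hφ hg')
  rwa [h1, one_mul] at h

end Holonomy

/-! ### The mapping torus is not spin. -/

section NotSpin

open Module

local notation:max "𝔼" n:max => EuclideanSpace ℝ (Fin n)

variable {n : ℕ} {X : Type u} [TopologicalSpace X] [ChartedSpace (𝔼 n) X] [IsManifold (𝓡 n) ∞ X]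
  {φ : OpenPartialHomeomorph X (𝔼 n)}

/-- The derivative of a deck transformation at a fixed point of the fibre maps. -/
theorem hasFDerivAt_deck (hmax : φ ∈ IsManifold.maximalAtlas (𝓡 n) ∞ X) (hφ : φ.target = univ)
    {h : ℝ → Equiv.Perm X} (hh : h ∈ SmoothPaths n X) {A : 𝔼 n →L[ℝ] 𝔼 n}
    (hA : ∀ t, HasChartDeriv φ (h t) A) (k l s t : ℝ) :
    HasFDerivAt (fun z : ℝ × ℝ × 𝔼 n => (z.1 + k, z.2.1 + l, φ (h z.2.1 (φ.symm z.2.2))))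
      (torusHolonomy A) (s, t, 0) := by
  have h0 : φ (φ.symm 0) = 0 := φ.right_inv (hφ ▸ mem_univ _)
  have hsymm : ContMDiff 𝓘(ℝ, 𝔼 n) (𝓡 n) ∞ φ.symm := by
    rw [← contMDiffOn_univ, ← hφ]; exact contMDiffOn_symm_of_mem_maximalAtlas hmax
  let G : ℝ × 𝔼 n → 𝔼 n := fun q => φ (h q.1 (φ.symm q.2))
  have hG : ContDiffAt ℝ ∞ G (t, 0) := by
    refine ContMDiffAt.contDiffAt ?_
    have h1 : ContMDiff 𝓘(ℝ, ℝ × 𝔼 n) (𝓡 n) ∞ fun q : ℝ × 𝔼 n => h q.1 (φ.symm q.2) :=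
      hh.1.comp (contDiff_fst.contMDiff.prodMk (hsymm.comp contDiff_snd.contMDiff))
    refine ContMDiffAt.comp (t, (0 : 𝔼 n)) (contMDiffAt_of_mem_maximalAtlas hmax ?_) (h1 _)
    simp only [(hA t).fixes]
    exact φ.map_target (hφ ▸ mem_univ _)
  have hG' := (hG.differentiableAt (by simp)).hasFDerivAt
  set D := fderiv ℝ G (t, 0)
  -- The centre is fixed at all times, so there is no derivative in the direction of time.
  have h1 : D ∘L ContinuousLinearMap.inl ℝ ℝ (𝔼 n) = 0 := by
    refine (HasFDerivAt.comp t hG' (hasFDerivAt_prodMk_left t (0 : 𝔼 n))).unique ?_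
    refine (hasFDerivAt_const (0 : 𝔼 n) t).congr_of_eventuallyEq (Filter.Eventually.of_forall
      fun r => ?_)
    simp [G, (hA r).fixes, h0]
  have h2 : D ∘L ContinuousLinearMap.inr ℝ ℝ (𝔼 n) = A :=
    (HasFDerivAt.comp (0 : 𝔼 n) hG' (hasFDerivAt_prodMk_right t (0 : 𝔼 n))).unique
      (hA t).hasFDerivAt
  have hD : ∀ v, D v = A v.2 := fun v => by
    have e1 := congrArg (fun T : ℝ →L[ℝ] 𝔼 n => T v.1) h1
    have e2 := congrArg (fun T : 𝔼 n →L[ℝ] 𝔼 n => T v.2) h2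
    simp only [ContinuousLinearMap.comp_apply, ContinuousLinearMap.inl_apply,
      ContinuousLinearMap.inr_apply, zero_apply] at e1 e2
    rw [← e2, ← zero_add (D (0, v.2)), ← e1, ← map_add]
    simp
  have hs : HasFDerivAt (fun z : ℝ × ℝ × 𝔼 n => z.2) (ContinuousLinearMap.snd ℝ ℝ (ℝ × 𝔼 n))
    (s, t, 0) := hasFDerivAt_snd
  have h3 : HasFDerivAt (fun z : ℝ × ℝ × 𝔼 n => G z.2)
      (D ∘L ContinuousLinearMap.snd ℝ ℝ (ℝ × 𝔼 n)) (s, t, 0) :=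
    HasFDerivAt.comp (g := G) (s, t, (0 : 𝔼 n)) hG' hs
  have h4 := (hasFDerivAt_fst (𝕜 := ℝ) (p := (s, t, (0 : 𝔼 n)))).add_const k
  have h5 := (HasFDerivAt.comp (g := Prod.fst) (s, t, (0 : 𝔼 n))
    (hasFDerivAt_fst (𝕜 := ℝ) (p := (t, (0 : 𝔼 n)))) hs).add_const l
  have h6 := h4.prodMk (h5.prodMk h3)
  refine h6.congr_fderiv (ContinuousLinearMap.ext fun v => ?_)
  exact Prod.ext rfl (Prod.ext rfl (hD v.2))

variable {a c : X ≃ₘ⟮𝓡 n, 𝓡 n⟯ X} {b : ℝ → X ≃ₘ⟮𝓡 n, 𝓡 n⟯ X} {x : X}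

/-- The parametrisation of a neighbourhood of a flat torus in the mapping torus. -/
def MappingTorus.param (a c : X ≃ₘ⟮𝓡 n, 𝓡 n⟯ X) (b : ℝ → X ≃ₘ⟮𝓡 n, 𝓡 n⟯ X)
    (φ : OpenPartialHomeomorph X (𝔼 n)) (z : ℝ × ℝ × 𝔼 n) : MappingTorus a c b :=
  MappingTorus.mk a c b (z.1, z.2.1, φ.symm z.2.2)

theorem isLocalDiffeomorph_prodMap_symm (hmax : φ ∈ IsManifold.maximalAtlas (𝓡 n) ∞ X)
    (hφ : φ.target = univ) :
    IsLocalDiffeomorph 𝓘(ℝ, ℝ × ℝ × 𝔼 n) (𝓘(ℝ, ℝ).prod (𝓘(ℝ, ℝ).prod (𝓡 n))) ∞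
      fun z : ℝ × ℝ × 𝔼 n => (z.1, z.2.1, φ.symm z.2.2) := by
  have hsymm : ContMDiff 𝓘(ℝ, 𝔼 n) (𝓡 n) ∞ φ.symm := by
    rw [← contMDiffOn_univ, ← hφ]; exact contMDiffOn_symm_of_mem_maximalAtlas hmax
  let Ψ : PartialDiffeomorph 𝓘(ℝ, ℝ × ℝ × 𝔼 n) (𝓘(ℝ, ℝ).prod (𝓘(ℝ, ℝ).prod (𝓡 n)))
      (ℝ × ℝ × 𝔼 n) (ℝ × ℝ × X) ∞ :=
    { toFun := fun z => (z.1, z.2.1, φ.symm z.2.2)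
      invFun := fun z => (z.1, z.2.1, φ z.2.2)
      source := univ
      target := univ ×ˢ univ ×ˢ φ.source
      map_source' := fun z _ => ⟨mem_univ _, mem_univ _, φ.map_target (hφ ▸ mem_univ _)⟩
      map_target' := fun z _ => mem_univ _
      left_inv' := fun z _ => by simp [φ.right_inv (show z.2.2 ∈ φ.target from hφ ▸ mem_univ _)]
      right_inv' := fun z hz => by simp [φ.left_inv hz.2.2]
      open_source := isOpen_univ
      open_target := isOpen_univ.prod (isOpen_univ.prod φ.open_source)
      contMDiffOn_toFun := (contDiff_fst.contMDiff.prodMk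
        ((contDiff_fst.comp contDiff_snd).contMDiff.prodMk
          (hsymm.comp (contDiff_snd.comp contDiff_snd).contMDiff))).contMDiffOn
      contMDiffOn_invFun := contMDiffOn_fst.prodMk_space
        ((contMDiff_fst.comp contMDiff_snd).contMDiffOn.prodMk_space
          ((contMDiffOn_of_mem_maximalAtlas hmax).comp
            (contMDiff_snd.comp contMDiff_snd).contMDiffOn fun z hz => hz.2.2)) }
  exact fun z => ⟨Ψ, mem_univ _, fun _ _ => rfl⟩

/-- The fixed point traces out a torus in the total space. The coordinates around it are glued by
deck transformations whose differentials there are those of a and c stabilized by two trivial lines,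
so the joint negative subspace keeps its odd dimension. -/
theorem MappingTorus.not_isSpin (o : OrientedAtlas (𝔼 n) X)
    (ha : IsOrientationPreserving o a) (hc : IsOrientationPreserving o c)
    (hax : a x = x) (hcx : c x = x) (hb : IsCommutatorIsotopy a c x b)
    (hodd : Odd (Module.finrank ℝ (jointNegativeSubspace
      (differentialAtFixedPoint n a x).toLinearMap (differentialAtFixedPoint n c x).toLinearMap)))
    [ChartedSpace (ℝ × ℝ × 𝔼 n) (MappingTorus a c b)]
    [IsManifold 𝓘(ℝ, ℝ × ℝ × 𝔼 n) ∞ (MappingTorus a c b)]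
    (hmk : IsLocalDiffeomorph (𝓘(ℝ, ℝ).prod (𝓘(ℝ, ℝ).prod (𝓡 n))) 𝓘(ℝ, ℝ × ℝ × 𝔼 n) ∞
      (MappingTorus.mk a c b)) :
    ¬ IsSpin (ℝ × ℝ × 𝔼 n) (MappingTorus a c b) := by
  rintro ⟨o', ho'⟩
  obtain ⟨φ, hmax, hφ, hφx, hxs, hx0⟩ := exists_centered_chart (n := n) x
  obtain ⟨e, he⟩ := exists_hasChartDeriv hmax hφ hφx hxs hx0
  let δ : (X → X) → 𝔼 n →L[ℝ] 𝔼 n := fun f => (e : 𝔼 n →L[ℝ] 𝔼 n) ∘L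
    (differentialAtFixedPoint n f x : 𝔼 n →L[ℝ] 𝔼 n) ∘L (e.symm : 𝔼 n →L[ℝ] 𝔼 n)
  have hA : HasChartDeriv φ a.toEquiv (δ a) := he a hax
  have hC : HasChartDeriv φ c.toEquiv (δ c) := he c hcx
  have hβ : ∀ t, HasChartDeriv φ (gluingFamily b t) 1 := fun t => by
    have ht : Real.smoothTransition (3 * t - 1) ∈ Icc (0 : ℝ) 1 :=
      ⟨Real.smoothTransition.nonneg _, Real.smoothTransition.le_one _⟩
    have h := he _ (hb.fixes _ ht)
    rw [hb.differential _ ht] at h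
    have h1 : (1 : 𝔼 n →L[ℝ] 𝔼 n) = (e : 𝔼 n →L[ℝ] 𝔼 n) ∘L
        ContinuousLinearMap.id ℝ (𝔼 n) ∘L (e.symm : 𝔼 n →L[ℝ] 𝔼 n) :=
      ContinuousLinearMap.ext fun v => (e.apply_symm_apply v).symm
    rw [h1]
    exact h
  have hg := isGluingFamily hb
  -- At time 0 the gluing family is the commutator, and its differential is trivial.
  have hAC : Commute (δ a) (δ c) := by
    have h1 := (hβ 0).mul hφ (hC.mul hφ hA)
    rw [hg.eq_of_le 0 (by norm_num), one_mul, show a.toEquiv * c.toEquiv * a.toEquiv⁻¹ *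
      c.toEquiv⁻¹ * (c.toEquiv * a.toEquiv) = a.toEquiv * c.toEquiv by group] at h1
    exact (hA.mul hφ hC).unique h1
  have hSa := SmoothPaths.const_of_contMDiff (g := a.toEquiv) a.contMDiff a.symm.contMDiff
  have hSc := SmoothPaths.const_of_contMDiff (g := c.toEquiv) c.contMDiff c.symm.contMDiff
  have hF := hg.gluingPath_mem hSa hSc (gluingFamily_mem hb)
  have hFD := hA.gluingPath hmax hφ hAC hC hSc hβ
  have hm : IsLocalDiffeomorph 𝓘(ℝ, ℝ × ℝ × 𝔼 n) 𝓘(ℝ, ℝ × ℝ × 𝔼 n) ∞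
      (MappingTorus.param a c b φ) := fun z =>
    (isLocalDiffeomorph_prodMap_symm hmax hφ z).comp _ _ (hmk _)
  have hdetA : 0 < (torusHolonomy (δ a)).det :=
    ((ha.det_differential_pos a.contMDiff hax).trans_eq (det_conj_clm e _).symm).trans_eq
      (det_torusHolonomy _).symm
  have hdetC : 0 < (torusHolonomy (δ c)).det :=
    ((hc.det_differential_pos c.contMDiff hcx).trans_eq (det_conj_clm e _).symm).trans_eq
      (det_torusHolonomy _).symm
  obtain ⟨R, hRR, hR⟩ := exists_reflection (n := n)
  -- Serves for both generators: the deck transformation preserves the parametrisation near the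
  -- torus, so differentiating the identity yields the transition rule for frames.
  have hmeq : ∀ {h : ℝ → Equiv.Perm X} (_ : h ∈ SmoothPaths n X) {A : 𝔼 n →L[ℝ] 𝔼 n}
      (_ : ∀ t, HasChartDeriv φ (h t) A) (k l : ℝ) (_ : ∀ s t y,
        MappingTorus.mk a c b (s + k, t + l, h t y) = MappingTorus.mk a c b (s, t, y)) (s t : ℝ),
      MappingTorus.param a c b φ (s + k, t + l, 0) = MappingTorus.param a c b φ (s, t, 0) ∧
      paramDerivative (MappingTorus.param a c b φ) (s + k, t + l, 0) ∘L torusHolonomy A =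
        paramDerivative (MappingTorus.param a c b φ) (s, t, 0) := by
    intro h hh A hA k l hmk s t
    refine ⟨?_, paramDerivative_of_comp hm.contMDiff (hasFDerivAt_deck hmax hφ hh hA k l s t) ?_ ?_⟩
    · have h1 := hmk s t (φ.symm 0)
      rwa [(hA t).fixes] at h1
    · have h1 := (hA t).fixes
      rw [hφx] at h1
      simp [hφx, h1, hx0]
    · have h1 : Continuous fun z : ℝ × ℝ × 𝔼 n => h z.2.1 (φ.symm z.2.2) := by
        have hsymm : ContMDiff 𝓘(ℝ, 𝔼 n) (𝓡 n) ∞ φ.symm := by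
          rw [← contMDiffOn_univ, ← hφ]; exact contMDiffOn_symm_of_mem_maximalAtlas hmax
        have h2 := hsymm.continuous
        have h3 := SmoothPaths.continuous hh
        exact h3.comp (f := fun z : ℝ × ℝ × 𝔼 n => (z.2.1, φ.symm z.2.2)) (by fun_prop)
      filter_upwards [h1.continuousAt.preimage_mem_nhds (φ.open_source.mem_nhds (by
        change h t (φ.symm 0) ∈ φ.source
        rwa [(hA t).fixes, hφx]))] with z hz
      simp only [MappingTorus.param, φ.left_inv hz]
      exact hmk _ _ _
  have hmA := hmeq hF hFD 1 0 fun s t y => ((MappingTorus.mk_eq_mk_iff hb).2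
    ⟨1, 0, by simp [torusDeck, deck]⟩).symm
  have hmC := hmeq hSc (fun _ => hC) 0 1 fun s t y => ((MappingTorus.mk_eq_mk_iff hb).2
    ⟨0, 1, by simp [torusDeck, deck]⟩).symm
  simp only [add_zero] at hmA hmC
  refine not_hasSpinStructure_of_holonomy (o := o') (q := fun r => (r.1, r.2, 0)) hm hRR hR
    (by fun_prop) (A := ⟨torusHolonomy (δ a), hdetA⟩) (C := ⟨torusHolonomy (δ c), hdetC⟩)
    (Subtype.ext (congrArg torusHolonomy hAC)) ?_ (fun s t => (hmA s t).1) (fun s t => (hmA s t).2)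
    (fun s t => (hmC s t).1) (fun s t => (hmC s t).2) ho'
  exact (congrArg Odd ((finrank_negativeSubspace_torusHolonomy _ _).trans
    (finrank_negativeSubspace_conj e _ _))).mpr hodd

end NotSpin

theorem mainTheorem2 {n : ℕ} {X : Type u} [TopologicalSpace X] [T2Space X] [CompactSpace X]
    [ChartedSpace (EuclideanSpace ℝ (Fin n)) X] [IsManifold (𝓡 n) ∞ X]
    (o : OrientedAtlas (EuclideanSpace ℝ (Fin n)) X)
    (a c : X ≃ₘ⟮𝓡 n, 𝓡 n⟯ X)
    (ha : IsOrientationPreserving o a) (hc : IsOrientationPreserving o c)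
    (x : X) (hax : a x = x) (hcx : c x = x)
    (b : ℝ → X ≃ₘ⟮𝓡 n, 𝓡 n⟯ X) (hb : IsCommutatorIsotopy a c x b)
    (hodd : Odd (Module.finrank ℝ (jointNegativeSubspace
      (differentialAtFixedPoint n a x).toLinearMap (differentialAtFixedPoint n c x).toLinearMap))) :
    (∀ φ ∈ IsManifold.maximalAtlas (𝓡 n) ∞ X, φ.target = univ →
      φ.symm 0 ∈ connectedComponent x →
      ∃ a' c' : Equiv.Perm (punctured φ),
        IsDiffRelBoundary o φ a' ∧ IsDiffRelBoundary o φ c' ∧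
        ∃ τ : Equiv.Perm (punctured φ), IsBoundaryDehnTwist φ τ ∧
          IsotopicRelBoundary o φ (a' * c' * a'⁻¹ * c'⁻¹) τ) ∧
    (T2Space (MappingTorus a c b) ∧ CompactSpace (MappingTorus a c b) ∧
      ∃ (_ : ChartedSpace (ℝ × ℝ × EuclideanSpace ℝ (Fin n)) (MappingTorus a c b))
        (_ : IsManifold 𝓘(ℝ, ℝ × ℝ × EuclideanSpace ℝ (Fin n)) ∞ (MappingTorus a c b)),
        IsLocalDiffeomorph (𝓘(ℝ, ℝ).prod (𝓘(ℝ, ℝ).prod (𝓡 n)))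
          𝓘(ℝ, ℝ × ℝ × EuclideanSpace ℝ (Fin n)) ∞ (MappingTorus.mk a c b) ∧
        IsOrientableSmoothBundle o ((𝓡 1).prod (𝓡 1))
          𝓘(ℝ, ℝ × ℝ × EuclideanSpace ℝ (Fin n)) (MappingTorus.proj a c b) ∧
        ¬ IsSpin (ℝ × ℝ × EuclideanSpace ℝ (Fin n)) (MappingTorus a c b)) := by
  refine ⟨fun φ hmax hφ hφx =>
    commutator_factorization o a c ha hc hax hcx b hb hodd hmax hφ hφx,
    MappingTorus.t2Space hb, MappingTorus.compactSpace hb, ?_⟩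
  obtain ⟨h1, h2, hmk⟩ := MappingTorus.exists_isManifold hb
  exact ⟨h1, h2, hmk, MappingTorus.isOrientableSmoothBundle_proj hb ha hc hmk,
    MappingTorus.not_isSpin o ha hc hax hcx hb hodd hmk⟩

end
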